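/- Let $G$ be a finite group and let $M$ be a nonsingular complex affine $G$-variety with coordinate ring $\mathcal O(M)$, on which $G$ acts by $(g f)(x)=f(g^{-1}x)$. Let $m\in M$, let $G_m$ be its isotropy group, and let $T_mM$ and $T_m^*M=I_m/I_m^2$ be the tangent and cotangent space at $m$, where $I_m=\{f\in\mathcal O(M): f(m)=0\}$, with their natural $G_m$-actions. For a finite-dimensional complex $G_m$-representation $V$ let $V_m$ be the $\mathcal O(M)\rtimes G_m$-module $V$ on which $f\in\mathcal O(M)$ acts as the scalar $f(m)$, and put $\mathrm{Ind}_mV=(\mathcal O(M)\rtimes G)\otimes_{\mathcal O(M)\rtimes G_m}V_m$. Let $\mathbb C_m$ be the one-dimensional $\mathcal O(M)$-module with character $m$. (a) For all finite-dimensional $G_m$-representations $V,V'$ and all $n\ge 0$ there are isomorphisms of complex vector spaces $$\mathrm{Ext}^n_{\mathcal O(M)\rtimes G}(\mathrm{Ind}_mV,\mathrm{Ind}_mV')\;\cong\;\mathrm{Hom}_{G_m}\big(V\otimes\textstyle\bigwedge^nT_m^*M,\,V'\big)\;\cong\;\big(\mathrm{Hom}_{\mathbb C}(V,V')\otimes\textstyle\bigwedge^nT_mM\big)^{G_m}.$$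 (b) The isomorphisms $\Phi$ of $\mathrm{Ext}^n_{\mathcal O(M)\rtimes G}(\mathrm{Ind}_mV,\mathrm{Ind}_mV')$ with $(\mathrm{Hom}_{\mathbb C}(V,V')\otimes\bigwedge^nT_mM)^{G_m}$ can be chosen, for all $V,V',n$ together, such that $\Phi(\beta\circ\alpha)=\Phi(\beta)\,\Phi(\alpha)$ for all $\alpha\in\mathrm{Ext}^p(\mathrm{Ind}_mV,\mathrm{Ind}_mV')$ and $\beta\in\mathrm{Ext}^q(\mathrm{Ind}_mV',\mathrm{Ind}_mV'')$, where $\circ$ is the Yoneda product and $(\psi\otimes\lambda)(\psi'\otimes\lambda')=\psi\psi'\otimes\lambda\wedge\lambda'$. In particular, for $V=V'=V''$, the Yoneda product on $\mathrm{Ext}^*(\mathrm{Ind}_mV,\mathrm{Ind}_mV)$ agrees with the usual product on $(\mathrm{End}_{\mathbb C}(V)\otimes\bigwedge^*T_mM)^{G_m}$. (c) For the regular representation $V=\mathbb C[G_m]$ one has $\mathrm{Ind}_mV\cong\mathrm{Ind}_{\mathcal O(M)}^{\mathcal O(M)\rtimes G}\mathbb C_m:=(\mathcal O(M)\rtimes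 G)\otimes_{\mathcal O(M)}\mathbb C_m$, and, as graded $\mathbb C$-algebras with $G_m$ in degree $0$, $$\mathrm{Ext}^*_{\mathcal O(M)\rtimes G}\big(\mathrm{Ind}_{\mathcal O(M)}^{\mathcal O(M)\rtimes G}\mathbb C_m,\mathrm{Ind}_{\mathcal O(M)}^{\mathcal O(M)\rtimes G}\mathbb C_m\big)\;\cong\;\textstyle\bigwedge^*T_mM\rtimes G_m .$$ (d) Let $\mathcal F_{Gm}$ be the completion of $\mathcal O(M)$ with respect to the powers of the ideal $I_{Gm}=\{f\in\mathcal O(M): f(gm)=0\ \forall g\in G\}$, with the Fréchet topology of power series (the inverse limit topology of the finite-dimensional spaces $\mathcal O(M)/I_{Gm}^n$). Replace $\mathcal O(M)$ by $\mathcal F_{Gm}$ and $f(m)$ by the value at $m$ of $f\in\mathcal F_{Gm}$ in the definitions of $\mathrm{Ind}_mV$ and $\mathrm{Ind}\,\mathbb C_m$. Then (a), (b) and (c) remain valid if the category of $\mathcal O(M)\rtimes G$-modules is replaced by any of the following: the category of all $\mathcal F_{Gm}\rtimes G$-modules; the exact category of Fréchet $\mathcal F_{Gm}\rtimes G$-modules,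 whose admissible short exact sequences are those that split as sequences of Fréchet spaces; the exact category of complete bornological $\mathcal F_{Gm}\rtimes G$-modules (where $\mathcal F_{Gm}\rtimes G$ has the precompact bornology), whose admissible short exact sequences are those that split as sequences of bornological vector spaces. In the last two categories the finite-dimensional modules $\mathrm{Ind}_mV$ and $\mathrm{Ind}\,\mathbb C_m$ carry their unique Hausdorff vector space topology, respectively its precompact bornology, and $\mathrm{Ext}$ consists of the Yoneda Ext-groups: equivalence classes of admissible $n$-fold extensions, with Baer sum and splicing. -/

import Mathlib

open CategoryTheory TensorProduct

universe w v u

noncomputable section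

namespace YonedaCrossed

/-! ### Yoneda extensions in an exact category -/

/-- A distinguished class of conflations `Y → E → Z` in a category
(the admissible short exact sequences of an exact category). -/
class HasConflations (C : Type u) [Category.{v} C] where
  IsConflation : ∀ {Y E Z : C}, (Y ⟶ E) → (E ⟶ Z) → Prop

open HasConflations

section Yoneda

variable {C : Type u} [Category.{v} C] [HasConflations C]

/-- Yoneda `n`-fold extensions of `X` by `Y`. For `n = 0` this is a morphism `X ⟶ Y`; for `n ≥ 1`
it is an admissible exact sequence `0 → Y → Eₙ → ⋯ → E₁ → X → 0`, cut into conflations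
`Y → Eₙ → Zₙ₋₁`, `Zₙ₋₁ → Eₙ₋₁ → Zₙ₋₂`, …, `Z₁ → E₁ → X`. -/
inductive NExt (X : C) : C → ℕ → Type (max u v)
  | hom {Y : C} (f : X ⟶ Y) : NExt X Y 0
  | conf {Y E : C} (i : Y ⟶ E) (p : E ⟶ X) (h : IsConflation i p) : NExt X Y 1
  | cons {Y E Z : C} {n : ℕ} (i : Y ⟶ E) (p : E ⟶ Z) (h : IsConflation i p)
      (e : NExt X Z (n + 1)) : NExt X Y (n + 2)

/-- `Morph e e' a b`: there is a morphism of `n`-fold extensions `e → e'` (a commutative ladder)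
which is `a : Y ⟶ Y'` at the left end and `b : X ⟶ X'` at the right end.
For `n = 0` it says that the square of `f`, `f'`, `a`, `b` commutes. -/
inductive Morph : ∀ {X Y X' Y' : C} {n : ℕ},
    NExt X Y n → NExt X' Y' n → (Y ⟶ Y') → (X ⟶ X') → Prop
  | hom {X Y X' Y' : C} (f : X ⟶ Y) (f' : X' ⟶ Y') (a : Y ⟶ Y') (b : X ⟶ X')
      (w : f ≫ a = b ≫ f') : Morph (NExt.hom f) (NExt.hom f') a b
  | conf {X Y E X' Y' E' : C} {i : Y ⟶ E} {p : E ⟶ X} {h : IsConflation i p}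
      {i' : Y' ⟶ E'} {p' : E' ⟶ X'} {h' : IsConflation i' p'}
      (a : Y ⟶ Y') (b : X ⟶ X') (t : E ⟶ E') (w₁ : i ≫ t = a ≫ i') (w₂ : p ≫ b = t ≫ p') :
      Morph (NExt.conf i p h) (NExt.conf i' p' h') a b
  | cons {X Y E Z X' Y' E' Z' : C} {n : ℕ} {i : Y ⟶ E} {p : E ⟶ Z} {h : IsConflation i p}
      {i' : Y' ⟶ E'} {p' : E' ⟶ Z'} {h' : IsConflation i' p'}
      {e : NExt X Z (n + 1)} {e' : NExt X' Z' (n + 1)}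
      (a : Y ⟶ Y') (z : Z ⟶ Z') (b : X ⟶ X') (t : E ⟶ E')
      (w₁ : i ≫ t = a ≫ i') (w₂ : p ≫ z = t ≫ p') (r : Morph e e' z b) :
      Morph (NExt.cons i p h e) (NExt.cons i' p' h' e') a b

/-- Yoneda's `Extⁿ(X, Y)`: classes of `n`-fold extensions for the equivalence relation generated
by the morphisms of extensions which are the identity at both ends. -/
def YExt (X Y : C) (n : ℕ) : Type (max u v) :=
  Quot (fun e e' : NExt X Y n => Morph e e' (𝟙 Y) (𝟙 X))

/-- `HasMorph x x' a b`: some representatives of the classes `x`, `x'` are related by a morphism of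
extensions with ends `a` and `b`. It says that `a_* x = b^* x'`; in particular
`HasMorph x x' a (𝟙 X)` says that `x'` is the pushout `a_* x`, and `HasMorph x x' (𝟙 Y) b`
says that `x` is the pullback `b^* x'`. -/
def HasMorph {X Y X' Y' : C} {n : ℕ} (x : YExt X Y n) (x' : YExt X' Y' n)
    (a : Y ⟶ Y') (b : X ⟶ X') : Prop :=
  ∃ (e : NExt X Y n) (e' : NExt X' Y' n), Quot.mk _ e = x ∧ Quot.mk _ e' = x' ∧ Morph e e' a b

/-- Yoneda product of representatives: composition with a morphism is pushout or pullback, and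
extensions of positive length are spliced. -/
inductive IsProductRep : ∀ {W X Y : C} {p q r : ℕ},
    NExt X Y p → NExt W X q → NExt W Y r → Prop
  | pushout {W X Y : C} {q : ℕ} (f : X ⟶ Y) (d : NExt W X q) (c : NExt W Y q)
      (h : Morph d c f (𝟙 W)) : IsProductRep (NExt.hom f) d c
  | pullback {W X Y : C} {p : ℕ} (e : NExt X Y p) (g : W ⟶ X) (c : NExt W Y p)
      (h : Morph c e (𝟙 Y) g) : IsProductRep e (NExt.hom g) c
  | conf {W X Y E : C} {q : ℕ} (i : Y ⟶ E) (s : E ⟶ X) (h : IsConflation i s)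
      (d : NExt W X (q + 1)) : IsProductRep (NExt.conf i s h) d (NExt.cons i s h d)
  | cons {W X Y E Z : C} {p q r : ℕ} (i : Y ⟶ E) (s : E ⟶ Z) (h : IsConflation i s)
      (e : NExt X Z (p + 1)) (d : NExt W X q) (c : NExt W Z (r + 1)) (hc : IsProductRep e d c) :
      IsProductRep (NExt.cons i s h e) d (NExt.cons i s h c)

/-- `IsProduct x y z`: the class `z` is the Yoneda product `x ∘ y`. -/
def IsProduct {W X Y : C} {p q r : ℕ} (x : YExt X Y p) (y : YExt W X q) (z : YExt W Y r) : Prop :=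
  ∃ (e : NExt X Y p) (d : NExt W X q) (c : NExt W Y r),
    Quot.mk _ e = x ∧ Quot.mk _ d = y ∧ Quot.mk _ c = z ∧ IsProductRep e d c

variable [Preadditive C]

/-- `IsBaerSum x y z`: the class `z` is the Baer sum `x + y`. If `w` is the extension of `X ⊕ X`
by `Y` whose pullbacks along the two inclusions are `x` and `y` (that is, the pushout of `x ⊕ y`
along the codiagonal of `Y`), then `z` is the pullback of `w` along the diagonal of `X`. -/
def IsBaerSum {X Y : C} {n : ℕ} (x y z : YExt X Y n) : Prop :=
  ∃ (b : Limits.BinaryBicone X X) (_ : b.IsBilimit) (w : YExt b.pt Y n),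
    HasMorph x w (𝟙 Y) b.inl ∧ HasMorph y w (𝟙 Y) b.inr ∧ HasMorph z w (𝟙 Y) (b.inl + b.inr)

/-- `IsScalarMultiple c x z`: the class `z` is the pushout of `x` along `c • 𝟙 Y`. -/
def IsScalarMultiple [Linear ℂ C] {X Y : C} {n : ℕ} (c : ℂ) (x z : YExt X Y n) : Prop :=
  HasMorph x z (c • 𝟙 Y) (𝟙 X)

end Yoneda

/-! ### Fréchet modules -/

section Frechet

variable (R : Type u) [Ring R] [Algebra ℂ R] [TopologicalSpace R]

/-- Fréchet modules over a topological `ℂ`-algebra `R`: complete metrizable locally convex spaces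
with a jointly continuous (unital) action of `R`. -/
structure FrechetMod where
  carrier : Type u
  [addCommGroup : AddCommGroup carrier]
  [moduleC : Module ℂ carrier]
  [moduleR : Module R carrier]
  [tower : IsScalarTower ℂ R carrier]
  [uniformSpace : UniformSpace carrier]
  [uniformAddGroup : IsUniformAddGroup carrier]
  [continuousSMulC : ContinuousSMul ℂ carrier]
  [continuousSMulR : ContinuousSMul R carrier]
  [locallyConvex : LocallyConvexSpace ℝ carrier]
  [separated : T0Space carrier]
  [complete : CompleteSpace carrier]
  [metrizable : (uniformity carrier).IsCountablyGenerated]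

namespace FrechetMod

attribute [instance] addCommGroup moduleC moduleR tower uniformSpace uniformAddGroup
  continuousSMulC continuousSMulR locallyConvex separated complete metrizable

variable {R}

instance : Category (FrechetMod R) where
  Hom X Y := X.carrier →L[R] Y.carrier
  id X := ContinuousLinearMap.id R X.carrier
  comp f g := ContinuousLinearMap.comp g f

instance : Preadditive (FrechetMod R) where
  homGroup X Y := inferInstanceAs (AddCommGroup (X.carrier →L[R] Y.carrier))
  add_comp _ _ _ f f' g := by
    apply ContinuousLinearMap.ext
    intro x
    exact map_add (show _ →L[R] _ from g) _ _
  comp_add _ _ _ _ _ _ := rfl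

instance : Linear ℂ (FrechetMod R) where
  homModule X Y := inferInstanceAs (Module ℂ (X.carrier →L[R] Y.carrier))
  smul_comp _ _ _ c f g := by
    apply ContinuousLinearMap.ext
    intro x
    exact ((show _ →L[R] _ from g).toLinearMap.restrictScalars ℂ).map_smul c _
  comp_smul _ _ _ _ _ _ := rfl

/-- The underlying continuous linear map. -/
def toCLM {X Y : FrechetMod R} (f : X ⟶ Y) : X.carrier →L[R] Y.carrier := f

/-- Conflations: sequences of Fréchet modules which are split exact as
sequences of Fréchet spaces. -/
instance : HasConflations (FrechetMod R) where
  IsConflation {Y E Z} i p :=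
    ∃ (s : Z.carrier →L[ℂ] E.carrier) (r : E.carrier →L[ℂ] Y.carrier),
      (∀ y, r (toCLM i y) = y) ∧ (∀ z, toCLM p (s z) = z) ∧ (∀ y, toCLM p (toCLM i y) = 0) ∧
        ∀ x, toCLM i (r x) + s (toCLM p x) = x

end FrechetMod

end Frechet

/-! ### Complete bornological modules -/

section Bornological

/-- A bounded disk whose span is a Banach space for the gauge of the disk, spelled out: `T` is
absolutely convex, contains no complex line, and every sequence that is
Cauchy for the gauge of `T` converges for the gauge of `T`. -/
structure IsCompleteDisk {E : Type u} [AddCommGroup E] [Module ℂ E] (T : Set E) : Prop where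
  nonempty : T.Nonempty
  balanced : Balanced ℂ T
  convex : Convex ℝ T
  separated : ∀ x : E, (∀ ε : ℝ, 0 < ε → ∃ t ∈ T, x = ε • t) → x = 0
  complete : ∀ s : ℕ → E,
    (∀ ε : ℝ, 0 < ε → ∃ N, ∀ j ≥ N, ∀ k ≥ N, ∃ t ∈ T, s j - s k = ε • t) →
      ∃ x, ∀ ε : ℝ, 0 < ε → ∃ N, ∀ j ≥ N, ∃ t ∈ T, s j - x = ε • t

variable (R : Type u) [Ring R] [Algebra ℂ R] [TopologicalSpace R]

/-- Complete (convex) bornological modules over a Fréchet algebra `R` with its precompact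
bornology (the bounded sets of `R` are the subsets of compact sets). The space is a complete
bornological vector space: every bounded set lies in a bounded complete disk. The
action `R × V → V` is bounded. -/
structure BornMod where
  carrier : Type u
  [addCommGroup : AddCommGroup carrier]
  [moduleC : Module ℂ carrier]
  [moduleR : Module R carrier]
  [tower : IsScalarTower ℂ R carrier]
  [bornology : Bornology carrier]
  bounded_add : ∀ S T : Set carrier, Bornology.IsBounded S → Bornology.IsBounded T →
    Bornology.IsBounded (Set.image2 (fun x y => x + y) S T)
  bounded_smul : ∀ (c : ℂ) (S : Set carrier), Bornology.IsBounded S →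
    Bornology.IsBounded ((fun x => c • x) '' S)
  complete : ∀ S : Set carrier, Bornology.IsBounded S →
    ∃ T : Set carrier, S ⊆ T ∧ Bornology.IsBounded T ∧ IsCompleteDisk T
  bounded_action : ∀ (K : Set R) (S : Set carrier), IsCompact K → Bornology.IsBounded S →
    Bornology.IsBounded (Set.image2 (fun r x => r • x) K S)

namespace BornMod

attribute [instance] addCommGroup moduleC moduleR tower bornology

variable {R}

/-- Bounded `R`-linear maps. -/
def boundedHom (X Y : BornMod R) : Submodule ℂ (X.carrier →ₗ[R] Y.carrier) where
  carrier := {f | ∀ S : Set X.carrier, Bornology.IsBounded S → Bornology.IsBounded (f '' S)}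
  zero_mem' := by
    intro S _
    refine (Bornology.isBounded_singleton (x := (0 : Y.carrier))).subset ?_
    rintro _ ⟨x, _, rfl⟩
    simp
  add_mem' := by
    intro f g hf hg S hS
    refine (Y.bounded_add _ _ (hf S hS) (hg S hS)).subset ?_
    rintro _ ⟨x, hx, rfl⟩
    exact ⟨f x, ⟨x, hx, rfl⟩, g x, ⟨x, hx, rfl⟩, rfl⟩
  smul_mem' := by
    intro c f hf S hS
    refine (Y.bounded_smul c _ (hf S hS)).subset ?_
    rintro _ ⟨x, hx, rfl⟩
    exact ⟨f x, ⟨x, hx, rfl⟩, rfl⟩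

instance : Category (BornMod R) where
  Hom X Y := boundedHom X Y
  id X := ⟨LinearMap.id, fun S hS => by simpa using hS⟩
  comp f g := ⟨g.1.comp f.1, fun S hS => by
    have := g.2 _ (f.2 S hS)
    rw [← Set.image_comp] at this
    exact this⟩

/-- The underlying linear map. -/
def toLin {X Y : BornMod R} (f : X ⟶ Y) : X.carrier →ₗ[R] Y.carrier :=
  Subtype.val (p := fun f => f ∈ boundedHom X Y) f

theorem hom_ext {X Y : BornMod R} {f g : X ⟶ Y} (h : ∀ x, toLin f x = toLin g x) : f = g :=
  Subtype.ext (LinearMap.ext h)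

instance : Preadditive (BornMod R) where
  homGroup X Y := inferInstanceAs (AddCommGroup (boundedHom X Y))
  add_comp _ _ _ _ _ g := hom_ext fun _ => (toLin g).map_add _ _
  comp_add _ _ _ _ _ _ := rfl

instance : Linear ℂ (BornMod R) where
  homModule X Y := inferInstanceAs (Module ℂ (boundedHom X Y))
  smul_comp _ _ _ c _ g := hom_ext fun _ => ((toLin g).restrictScalars ℂ).map_smul c _
  comp_smul _ _ _ _ _ _ := rfl

/-- Conflations: sequences of bornological modules which are split exact as
sequences of bornological vector spaces. -/
instance : HasConflations (BornMod R) where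
  IsConflation {Y E Z} i p :=
    ∃ (s : Z.carrier →ₗ[ℂ] E.carrier) (r : E.carrier →ₗ[ℂ] Y.carrier),
      (∀ S, Bornology.IsBounded S → Bornology.IsBounded (s '' S)) ∧
      (∀ S, Bornology.IsBounded S → Bornology.IsBounded (r '' S)) ∧
      (∀ y, r (toLin i y) = y) ∧ (∀ z, toLin p (s z) = z) ∧ (∀ y, toLin p (toLin i y) = 0) ∧
        ∀ x, toLin i (r x) + s (toLin p x) = x

end BornMod

end Bornological

/-! ### The precompact bornology of a Fréchet module -/

section Precompact

variable {R : Type u} [Ring R] [Algebra ℂ R] [TopologicalSpace R]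

theorem isCompleteDisk_of_isCompact {E : Type u} [AddCommGroup E] [Module ℂ E] [UniformSpace E]
    [IsUniformAddGroup E] [ContinuousSMul ℂ E] [T0Space E] [CompleteSpace E]
    {T : Set E} (hT : IsCompact T) (h0 : T.Nonempty) (hb : Balanced ℂ T) (hc : Convex ℝ T) :
    IsCompleteDisk T := by
  have : ContinuousSMul ℝ E := IsScalarTower.continuousSMul ℂ
  have hbdd : ∀ U ∈ nhds (0 : E), ∃ ε : ℝ, 0 < ε ∧ ∀ t ∈ T, ε • t ∈ U := by
    intro U hU
    have hv : Bornology.IsVonNBounded ℝ T := hT.totallyBounded.isVonNBounded ℝ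
    obtain ⟨r, hr, h⟩ := (hv hU).exists_pos
    refine ⟨r⁻¹, inv_pos.2 hr, fun t ht => ?_⟩
    obtain ⟨y, hy, hyt⟩ := h r (by rw [Real.norm_of_nonneg hr.le]) ht
    rw [← hyt]
    simpa [smul_smul, inv_mul_cancel₀ hr.ne'] using hy
  have hmono : ∀ ε δ : ℝ, 0 < ε → ε ≤ δ → ∀ t ∈ T, ∃ t' ∈ T, ε • t = δ • t' := by
    intro ε δ hε hεδ t ht
    have hδ : 0 < δ := hε.trans_le hεδ
    refine ⟨((ε / δ : ℝ) : ℂ) • t, hb _ ?_ (Set.smul_mem_smul_set ht), ?_⟩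
    · rw [Complex.norm_real, Real.norm_of_nonneg (by positivity)]
      exact (div_le_one hδ).2 hεδ
    · rw [← Complex.coe_smul, ← Complex.coe_smul, smul_smul, ← Complex.ofReal_mul,
        mul_div_cancel₀ _ hδ.ne']
  refine ⟨h0, hb, hc, ?_, ?_⟩
  · intro x hx
    by_contra hne
    have : ({x}ᶜ : Set E) ∈ nhds (0 : E) := isOpen_compl_singleton.mem_nhds (Ne.symm hne)
    obtain ⟨ε, hε, h⟩ := hbdd _ this
    obtain ⟨t, ht, hxt⟩ := hx ε hε
    exact h t ht hxt.symm
  · intro s hs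
    have hcau : CauchySeq s := by
      rw [cauchySeq_iff_tendsto, uniformity_eq_comap_nhds_zero, Filter.tendsto_comap_iff]
      intro U hU
      obtain ⟨ε, hε, h⟩ := hbdd U hU
      obtain ⟨N, hN⟩ := hs ε hε
      refine Filter.mem_map.2 (Filter.mem_atTop_sets.2 ⟨(N, N), ?_⟩)
      rintro ⟨j, k⟩ ⟨hj, hk⟩
      obtain ⟨t, ht, hjk⟩ := hN k hk j hj
      change s k - s j ∈ U
      rw [hjk]
      exact h t ht
    obtain ⟨x, hx⟩ := cauchySeq_tendsto_of_complete hcau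
    refine ⟨x, fun ε hε => ?_⟩
    obtain ⟨N, hN⟩ := hs ε hε
    refine ⟨N, fun j hj => ?_⟩
    have hclosed : IsClosed ((fun t => ε • t) '' T) :=
      (hT.image (continuous_const_smul ε)).isClosed
    have hlim : Filter.Tendsto (fun k => s j - s k) Filter.atTop (nhds (s j - x)) :=
      tendsto_const_nhds.sub hx
    obtain ⟨t, ht, h⟩ := hclosed.mem_of_tendsto hlim (Filter.eventually_atTop.2 ⟨N, fun k hk => by
      obtain ⟨t, ht, h⟩ := hN j hj k hk
      exact ⟨t, ht, h.symm⟩⟩)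
    exact ⟨t, ht, h.symm⟩

theorem exists_compact_disk {E : Type u} [AddCommGroup E] [Module ℂ E] [UniformSpace E]
    [IsUniformAddGroup E] [ContinuousSMul ℂ E] [T0Space E] [CompleteSpace E]
    [LocallyConvexSpace ℝ E] {K : Set E} (hK : IsCompact K) :
    ∃ T, K ⊆ T ∧ IsCompact T ∧ T.Nonempty ∧ Balanced ℂ T ∧ Convex ℝ T := by
  have : ContinuousSMul ℝ E := IsScalarTower.continuousSMul ℂ
  let B : Set E := insert 0 ((fun q : ℂ × E => q.1 • q.2) '' (Metric.closedBall (0 : ℂ) 1 ×ˢ K))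
  have hB : IsCompact B :=
    (((isCompact_closedBall (0 : ℂ) 1).prod hK).image continuous_smul).insert 0
  have hBb : Balanced ℂ B := by
    rintro a ha _ ⟨_, (rfl | ⟨⟨c, x⟩, ⟨hc, hx⟩, rfl⟩), rfl⟩
    · exact Or.inl (smul_zero a)
    · refine Or.inr ⟨(a * c, x), ⟨?_, hx⟩, mul_smul a c x⟩
      rw [mem_closedBall_zero_iff] at hc ⊢
      rw [norm_mul]
      exact mul_le_one₀ ha (norm_nonneg _) hc
  have hconv : Balanced ℂ (convexHull ℝ B) := by
    intro a ha
    have h1 : (fun x => a • x) '' convexHull ℝ B = convexHull ℝ ((fun x => a • x) '' B) :=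
      ((LinearMap.lsmul ℂ E a).restrictScalars ℝ).image_convexHull B
    change (fun x => a • x) '' convexHull ℝ B ⊆ _
    rw [h1]
    exact convexHull_mono (hBb a ha)
  refine ⟨closure (convexHull ℝ B), ?_, ?_, ?_, hconv.closure, (convex_convexHull ℝ B).closure⟩
  · intro x hx
    exact subset_closure (subset_convexHull ℝ B
      (Or.inr ⟨(1, x), ⟨by simp, hx⟩, one_smul ℂ x⟩))
  · exact hB.totallyBounded.convexHull.closure.isCompact_of_isClosed isClosed_closure
  · exact ⟨0, subset_closure (subset_convexHull ℝ B (Or.inl rfl))⟩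

theorem isBounded_inCompact_iff {E : Type u} [TopologicalSpace E] {S : Set E} :
    @Bornology.IsBounded E (Bornology.inCompact E) S ↔ ∃ K, IsCompact K ∧ S ⊆ K :=
  Bornology.inCompact.isBounded_iff

/-- A Fréchet module with its precompact bornology: the bounded sets are the
subsets of compact sets. -/
def FrechetMod.toBorn (X : FrechetMod R) : BornMod R :=
  letI : Bornology X.carrier := Bornology.inCompact X.carrier
  { carrier := X.carrier
    bounded_add := by
      intro S T hS hT
      obtain ⟨K, hK, hSK⟩ := isBounded_inCompact_iff.1 hS
      obtain ⟨L, hL, hTL⟩ := isBounded_inCompact_iff.1 hT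
      refine isBounded_inCompact_iff.2 ⟨_, (hK.prod hL).image continuous_add, ?_⟩
      rintro _ ⟨x, hx, y, hy, rfl⟩
      exact ⟨(x, y), ⟨hSK hx, hTL hy⟩, rfl⟩
    bounded_smul := by
      intro c S hS
      obtain ⟨K, hK, hSK⟩ := isBounded_inCompact_iff.1 hS
      exact isBounded_inCompact_iff.2 ⟨_, hK.image (continuous_const_smul c),
        Set.image_mono hSK⟩
    complete := by
      intro S hS
      obtain ⟨K, hK, hSK⟩ := isBounded_inCompact_iff.1 hS
      obtain ⟨T, hKT, hT, h0, hb, hc⟩ := exists_compact_disk hK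
      exact ⟨T, hSK.trans hKT, isBounded_inCompact_iff.2 ⟨T, hT, subset_rfl⟩,
        isCompleteDisk_of_isCompact hT h0 hb hc⟩
    bounded_action := by
      intro K S hK hS
      obtain ⟨L, hL, hSL⟩ := isBounded_inCompact_iff.1 hS
      refine isBounded_inCompact_iff.2 ⟨_, (hK.prod hL).image continuous_smul, ?_⟩
      rintro _ ⟨r, hr, x, hx, rfl⟩
      exact ⟨(r, x), ⟨hr, hSL hx⟩, rfl⟩ }

end Precompact

/-! ### Finite-dimensional Fréchet modules -/

section FiniteDimensional

variable {R : Type u} [Ring R] [Algebra ℂ R] [TopologicalSpace R]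

/-- A finite-dimensional `R`-module `W` with its unique Hausdorff vector space topology
(coordinates in a basis), as a Fréchet module. The action of `R` is required to be continuous,
in the form that all its matrix coefficients are. -/
def FrechetMod.ofFiniteDimensional (W : Type u) [AddCommGroup W] [Module ℂ W] [Module R W]
    [IsScalarTower ℂ R W] [FiniteDimensional ℂ W]
    (hW : ∀ (w : W) (l : Module.Dual ℂ W), Continuous fun r : R => l (r • w)) : FrechetMod R :=
  let e : W ≃ₗ[ℂ] (Fin (Module.finrank ℂ W) → ℂ) := (Module.finBasis ℂ W).equivFun
  letI : UniformSpace W := UniformSpace.comap e inferInstance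
  have he : IsUniformInducing e := ⟨rfl⟩
  haveI : IsUniformAddGroup W := IsUniformAddGroup.comap e.toLinearMap
  haveI : ContinuousSMul ℂ W := he.isInducing.continuousSMul continuous_id (by intros; simp)
  { carrier := W
    continuousSMulR := by
      constructor
      rw [he.isInducing.continuous_iff, continuous_pi_iff]
      intro j
      have h : ∀ q : R × W, (e (q.1 • q.2)) j =
          ∑ i, e q.2 i * (LinearMap.proj j ∘ₗ e.toLinearMap) (q.1 • Module.finBasis ℂ W i) := by
        intro q
        conv_lhs => rw [← (Module.finBasis ℂ W).sum_equivFun q.2]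
        rw [Finset.smul_sum, map_sum, Finset.sum_apply]
        refine Finset.sum_congr rfl fun i _ => ?_
        rw [← smul_comm, map_smul]
        rfl
      have h' : (fun q : R × W => (e (q.1 • q.2)) j) = _ := funext h
      change Continuous fun q : R × W => (e (q.1 • q.2)) j
      rw [h']
      refine continuous_finsetSum _ fun i _ => Continuous.mul ?_ ?_
      · exact (continuous_apply i).comp (he.uniformContinuous.continuous.comp continuous_snd)
      · exact (hW _ _).comp continuous_fst
    locallyConvex := LocallyConvexSpace.induced (𝕜 := ℝ) (e.toLinearMap.restrictScalars ℝ)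
    separated := ⟨fun x y h => e.injective (by
      have := h.map he.uniformContinuous.continuous
      exact this.eq)⟩
    complete := (completeSpace_congr (e := e.toEquiv) ⟨he, e.injective⟩).2 inferInstance
    metrizable := Filter.comap.isCountablyGenerated _ _ }

end FiniteDimensional

/-! ### Points, tangent spaces and isotropy groups -/

section Geometry

variable (G : Type u) [Group G] {A : Type u} [CommRing A] [Algebra ℂ A] [MulSemiringAction G A]

/-- The isotropy group of a point `m` of the affine variety with coordinate ring `A`. Points are
characters `A → ℂ`, and `(g • m) f = m (g⁻¹ • f)`. -/
def isotropy (m : A →ₐ[ℂ] ℂ) : Subgroup G where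
  carrier := {g | ∀ f : A, m (g • f) = m f}
  one_mem' f := by rw [one_smul]
  mul_mem' {a b} ha hb f := by rw [mul_smul, ha, hb]
  inv_mem' {a} ha f := by rw [← ha (a⁻¹ • f), smul_inv_smul]

/-- The cotangent space at `m`: `I_m / I_m²`. -/
abbrev Cotan (m : A →ₐ[ℂ] ℂ) : Type u := (RingHom.ker m).Cotangent

/-- The tangent space at `m`. -/
abbrev Tan (m : A →ₐ[ℂ] ℂ) : Type u := Module.Dual ℂ (Cotan m)

variable [SMulCommClass G ℂ A]

theorem ker_le_comap (m : A →ₐ[ℂ] ℂ) (g : isotropy G m) :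
    RingHom.ker m ≤ (RingHom.ker m).comap (MulSemiringAction.toAlgHom ℂ A (g : G)) := by
  intro f hf
  rw [Ideal.mem_comap, RingHom.mem_ker]
  exact (g.2 f).trans hf

/-- The action of the isotropy group on the cotangent space. -/
def cotanRep (m : A →ₐ[ℂ] ℂ) : Representation ℂ (isotropy G m) (Cotan m) where
  toFun g := (RingHom.ker m).mapCotangent (RingHom.ker m)
    (MulSemiringAction.toAlgHom ℂ A (g : G)) (ker_le_comap G m g)
  map_one' := by
    ext x
    obtain ⟨x, rfl⟩ := (RingHom.ker m).toCotangent_surjective x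
    rw [Ideal.mapCotangent_toCotangent]
    exact congrArg (RingHom.ker m).toCotangent (Subtype.ext (one_smul G (x : A)))
  map_mul' g h := by
    ext x
    obtain ⟨x, rfl⟩ := (RingHom.ker m).toCotangent_surjective x
    rw [Module.End.mul_apply, Ideal.mapCotangent_toCotangent, Ideal.mapCotangent_toCotangent,
      Ideal.mapCotangent_toCotangent]
    exact congrArg (RingHom.ker m).toCotangent (Subtype.ext (mul_smul (g : G) (h : G) (x : A)))

/-- The action of the isotropy group on the tangent space. -/
def tanRep (m : A →ₐ[ℂ] ℂ) : Representation ℂ (isotropy G m) (Tan m) := (cotanRep G m).dual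

/-- The exterior powers of a representation. -/
def extPowerRep {H : Type u} [Group H] {W : Type u} [AddCommGroup W] [Module ℂ W]
    (τ : Representation ℂ H W) (n : ℕ) : Representation ℂ H (⋀[ℂ]^n W) where
  toFun h := exteriorPower.map n (τ h)
  map_one' := by rw [map_one]; exact exteriorPower.map_id
  map_mul' g h := by rw [map_mul]; exact exteriorPower.map_comp (τ h) (τ g)

/-- The isotropy group acts on `⋀ T_m M` by algebra automorphisms. -/
instance (m : A →ₐ[ℂ] ℂ) : MulSemiringAction (isotropy G m) (ExteriorAlgebra ℂ (Tan m)) where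
  smul g x := ExteriorAlgebra.map (tanRep G m g) x
  one_smul x := by
    change ExteriorAlgebra.map (tanRep G m 1) x = x
    rw [map_one]
    exact DFunLike.congr_fun ExteriorAlgebra.map_id x
  mul_smul g h x := by
    change ExteriorAlgebra.map (tanRep G m (g * h)) x =
      ExteriorAlgebra.map (tanRep G m g) (ExteriorAlgebra.map (tanRep G m h) x)
    rw [map_mul]
    exact (DFunLike.congr_fun (ExteriorAlgebra.map_comp_map (tanRep G m h) (tanRep G m g)) x).symm
  smul_zero g := map_zero (ExteriorAlgebra.map (tanRep G m g))
  smul_add g := map_add (ExteriorAlgebra.map (tanRep G m g))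
  smul_one g := map_one (ExteriorAlgebra.map (tanRep G m g))
  smul_mul g := map_mul (ExteriorAlgebra.map (tanRep G m g))

/-- The degree `n` part of the graded algebra `⋀ T_m M ⋊ G_m` (where `G_m` has degree zero). -/
def extCrossedDegree (m : A →ₐ[ℂ] ℂ) (n : ℕ) :
    Submodule ℂ (SkewMonoidAlgebra (ExteriorAlgebra ℂ (Tan m)) (isotropy G m)) where
  carrier := {x | ∀ g, x.coeff g ∈ ⋀[ℂ]^n (Tan m)}
  zero_mem' g := by
    rw [SkewMonoidAlgebra.coeff_zero]; exact Submodule.zero_mem _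
  add_mem' {x y} hx hy g := by
    rw [SkewMonoidAlgebra.coeff_add]; exact Submodule.add_mem _ (hx g) (hy g)
  smul_mem' c x hx g := by
    rw [SkewMonoidAlgebra.coeff_smul]; exact Submodule.smul_mem _ c (hx g)

end Geometry

/-! ### Formal completion along an orbit -/

section Completion

variable (G : Type u) [Group G] {A : Type u} [CommRing A] [Algebra ℂ A] [MulSemiringAction G A]

/-- The ideal of functions vanishing on the orbit `G m`. -/
def orbitIdeal (m : A →ₐ[ℂ] ℂ) : Ideal A where
  carrier := {f | ∀ g : G, m (g • f) = 0}
  zero_mem' g := by rw [smul_zero, map_zero]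
  add_mem' {a b} ha hb g := by rw [smul_add, map_add, ha, hb, add_zero]
  smul_mem' c f hf g := by rw [smul_eq_mul, smul_mul', map_mul, hf, mul_zero]

theorem orbitIdeal_le (m : A →ₐ[ℂ] ℂ) : orbitIdeal G m ≤ RingHom.ker m := by
  intro f hf
  have := hf 1
  rwa [one_smul] at this

theorem orbitIdeal_pow_le_comap (m : A →ₐ[ℂ] ℂ) (g : G) (n : ℕ) :
    orbitIdeal G m ^ n ≤ (orbitIdeal G m ^ n).comap (MulSemiringAction.toRingHom G A g) := by
  have h : orbitIdeal G m ≤ (orbitIdeal G m).comap (MulSemiringAction.toRingHom G A g) := by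
    intro f hf k
    change m (k • g • f) = 0
    rw [smul_smul]
    exact hf _
  exact (Ideal.pow_right_mono h n).trans (Ideal.le_comap_pow _ n)

/-- The completion of `A = 𝒪(M)` with respect to the powers of the ideal of the orbit `G m`. -/
def OrbitCompletion (m : A →ₐ[ℂ] ℂ) : Type u := AdicCompletion (orbitIdeal G m) A

namespace OrbitCompletion

variable (m : A →ₐ[ℂ] ℂ)

instance : CommRing (OrbitCompletion G m) :=
  inferInstanceAs (CommRing (AdicCompletion (orbitIdeal G m) A))

instance : Algebra ℂ (OrbitCompletion G m) :=
  inferInstanceAs (Algebra ℂ (AdicCompletion (orbitIdeal G m) A))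

/-- The projection to the quotient by the `n`-th power of the ideal. -/
def proj (n : ℕ) : OrbitCompletion G m →ₐ[ℂ] A ⧸ orbitIdeal G m ^ n :=
  (AdicCompletion.evalₐ (orbitIdeal G m) n).restrictScalars ℂ

variable {G m} in
theorem ext {x y : OrbitCompletion G m} (h : ∀ n, proj G m n x = proj G m n y) : x = y :=
  AdicCompletion.ext_evalₐ h

/-- The action of `g` on the quotient by the `n`-th power of the ideal. -/
def quotAct (g : G) (n : ℕ) : A ⧸ orbitIdeal G m ^ n →+* A ⧸ orbitIdeal G m ^ n :=
  Ideal.quotientMap _ (MulSemiringAction.toRingHom G A g) (orbitIdeal_pow_le_comap G m g n)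

theorem quotAct_compat (g : G) {k n : ℕ} (hkn : k ≤ n) (x : OrbitCompletion G m) :
    Ideal.Quotient.factorPow (orbitIdeal G m) hkn (quotAct G m g n (proj G m n x)) =
      quotAct G m g k (proj G m k x) := by
  obtain ⟨y, hy⟩ := AdicCompletion.mk_surjective (orbitIdeal G m) A x
  have h : ∀ j, proj G m j x = Ideal.Quotient.mk (orbitIdeal G m ^ j) (y.val j) := by
    intro j
    rw [← hy]
    exact AdicCompletion.evalₐ_mk (orbitIdeal G m) j y
  have h2 : Ideal.Quotient.mk (orbitIdeal G m ^ k) (y.val n) =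
      Ideal.Quotient.mk (orbitIdeal G m ^ k) (y.val k) :=
    AdicCompletion.Ideal.mk_eq_mk (orbitIdeal G m) hkn y
  rw [h, h, ← h2]
  rfl

/-- The action of `g` on the completion, induced by its action on `A`. -/
def act (g : G) : OrbitCompletion G m →+* OrbitCompletion G m :=
  AdicCompletion.liftRingHom (orbitIdeal G m)
    (fun n => (quotAct G m g n).comp (proj G m n : OrbitCompletion G m →+* _))
    (fun hkn => RingHom.ext fun x => quotAct_compat G m g hkn x)

theorem proj_act (g : G) (n : ℕ) (x : OrbitCompletion G m) :
    proj G m n (act G m g x) = quotAct G m g n (proj G m n x) := by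
  have h : proj G m n (act G m g x) =
    AdicCompletion.evalₐ (orbitIdeal G m) n (AdicCompletion.liftRingHom (orbitIdeal G m)
      (fun n => (quotAct G m g n).comp (proj G m n : OrbitCompletion G m →+* _))
      (fun hkn => RingHom.ext fun x => quotAct_compat G m g hkn x) x) := rfl
  rw [h, AdicCompletion.evalₐ_liftRingHom]
  rfl

instance : MulSemiringAction G (OrbitCompletion G m) where
  smul g := act G m g
  one_smul x := ext fun n => by
    change proj G m n (act G m 1 x) = _
    rw [proj_act]
    obtain ⟨a, ha⟩ := Ideal.Quotient.mk_surjective (proj G m n x)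
    rw [← ha]
    exact congrArg _ (one_smul G a)
  mul_smul g h x := ext fun n => by
    change proj G m n (act G m (g * h) x) = proj G m n (act G m g (act G m h x))
    rw [proj_act, proj_act, proj_act]
    obtain ⟨a, ha⟩ := Ideal.Quotient.mk_surjective (proj G m n x)
    rw [← ha]
    exact congrArg _ (mul_smul g h a)
  smul_zero g := map_zero (act G m g)
  smul_add g := map_add (act G m g)
  smul_one g := map_one (act G m g)
  smul_mul g := map_mul (act G m g)

theorem proj_smul (g : G) (n : ℕ) (x : OrbitCompletion G m) :
    proj G m n (g • x) = quotAct G m g n (proj G m n x) := proj_act G m g n x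

instance [SMulCommClass G ℂ A] : SMulCommClass G ℂ (OrbitCompletion G m) where
  smul_comm g c x := ext fun n => by
    rw [proj_smul, map_smul (proj G m n), map_smul (proj G m n), proj_smul]
    obtain ⟨a, ha⟩ := Ideal.Quotient.mk_surjective (proj G m n x)
    rw [← ha]
    exact congrArg (Ideal.Quotient.mk _) (smul_comm g c a)

/-- The Fréchet topology of the completion: the inverse limit of the canonical topologies of the
finite-dimensional spaces `A / I_{Gm}ⁿ`, that is coefficientwise convergence of power series. -/
instance : TopologicalSpace (OrbitCompletion G m) :=
  ⨅ n : ℕ, TopologicalSpace.induced (proj G m n) (moduleTopology ℂ (A ⧸ orbitIdeal G m ^ n))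

/-- Evaluation at `m` on the quotient by the ideal of the orbit. -/
def evalQuot : A ⧸ orbitIdeal G m ^ 1 →ₐ[ℂ] ℂ :=
  Ideal.Quotient.liftₐ (orbitIdeal G m ^ 1) m (by
    intro a ha
    rw [pow_one] at ha
    exact orbitIdeal_le G m ha)

/-- Evaluation of an element of the completion at the point `m`. -/
def evalPoint : OrbitCompletion G m →ₐ[ℂ] ℂ := (evalQuot G m).comp (proj G m 1)

theorem evalPoint_smul (h : isotropy G m) (x : OrbitCompletion G m) :
    evalPoint G m (h • x) = evalPoint G m x := by
  change evalQuot G m (proj G m 1 ((h : G) • x)) = evalQuot G m (proj G m 1 x)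
  rw [proj_smul]
  obtain ⟨a, ha⟩ := Ideal.Quotient.mk_surjective (proj G m 1 x)
  rw [← ha]
  exact h.2 a

theorem continuous_evalPoint_smul [SMulCommClass G ℂ A] (g : G) :
    Continuous fun x : OrbitCompletion G m => evalPoint G m (g • x) := by
  let l : (A ⧸ orbitIdeal G m ^ 1) →ₗ[ℂ] ℂ :=
    { toFun := fun a => evalQuot G m (quotAct G m g 1 a)
      map_add' := fun a b => by rw [map_add, map_add]
      map_smul' := fun c a => by
        obtain ⟨a, rfl⟩ := Ideal.Quotient.mk_surjective a
        change m (g • c • a) = c • m (g • a)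
        rw [smul_comm, map_smul] }
  let _ : TopologicalSpace (A ⧸ orbitIdeal G m ^ 1) := moduleTopology ℂ _
  have : IsModuleTopology ℂ (A ⧸ orbitIdeal G m ^ 1) := ⟨rfl⟩
  have hl : Continuous l := IsModuleTopology.continuous_of_linearMap l
  have hp : Continuous (proj G m 1) :=
    continuous_iff_le_induced.2 (iInf_le _ 1)
  have h : (fun x : OrbitCompletion G m => evalPoint G m (g • x)) = l ∘ proj G m 1 := by
    funext x
    change evalQuot G m (proj G m 1 (g • x)) = evalQuot G m (quotAct G m g 1 (proj G m 1 x))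
    rw [proj_smul]
  rw [h]
  exact hl.comp hp

end OrbitCompletion

end Completion

/-! ### Induced modules over crossed products -/

section Induction

/-- Finite-dimensional complex representations of a group. -/
structure FinDimRep (H : Type u) [Group H] where
  carrier : Type u
  [addCommGroup : AddCommGroup carrier]
  [module : Module ℂ carrier]
  [finite : FiniteDimensional ℂ carrier]
  ρ : Representation ℂ H carrier

attribute [instance] FinDimRep.addCommGroup FinDimRep.module FinDimRep.finite

/-- The regular representation `ℂ[H]` of a finite group. -/
def regularRep (H : Type u) [Group H] [Finite H] : FinDimRep H where
  carrier := MonoidAlgebra ℂ H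
  finite := inferInstanceAs (FiniteDimensional ℂ (MonoidAlgebra ℂ H))
  ρ := Representation.ofMulAction ℂ H H

/-- The submodule of `R ⊗ V` whose quotient is the balanced tensor product `R ⊗_S V`. -/
def balancedRelations {S R : Type u} {V : Type w} [Ring S] [Algebra ℂ S] [Ring R] [Algebra ℂ R]
    [AddCommGroup V] [Module ℂ V] (φ : S →ₐ[ℂ] R) (σ : S →ₐ[ℂ] Module.End ℂ V) :
    Submodule R (R ⊗[ℂ] V) :=
  Submodule.span R {x | ∃ (r : R) (s : S) (v : V), x = (r * φ s) ⊗ₜ[ℂ] v - r ⊗ₜ[ℂ] (σ s v)}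

/-- Induction `R ⊗_S V` of an `S`-module `V` along `S → R`. -/
abbrev Induced {S R : Type u} {V : Type w} [Ring S] [Algebra ℂ S] [Ring R] [Algebra ℂ R]
    [AddCommGroup V] [Module ℂ V] (φ : S →ₐ[ℂ] R) (σ : S →ₐ[ℂ] Module.End ℂ V) :
    Type (max u w) :=
  (R ⊗[ℂ] V) ⧸ balancedRelations φ σ

variable {G : Type u} [Group G] (H : Subgroup G) {B : Type u} [CommRing B] [Algebra ℂ B]
  [MulSemiringAction G B] [SMulCommClass G ℂ B]

/-- The inclusion `B ⋊ H → B ⋊ G`. -/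
def crossedInclusion : SkewMonoidAlgebra B H →ₐ[ℂ] SkewMonoidAlgebra B G :=
  SkewMonoidAlgebra.mapDomainAlgHom ℂ B (f := H.subtype) (fun _ _ => rfl)

/-- The inclusion `B → B ⋊ G`. -/
def coeffInclusion (G : Type u) [Group G] (B : Type u) [CommRing B] [Algebra ℂ B]
    [MulSemiringAction G B] [SMulCommClass G ℂ B] : B →ₐ[ℂ] SkewMonoidAlgebra B G where
  toRingHom := SkewMonoidAlgebra.singleOneRingHom
  commutes' _ := rfl

variable {H} (χ : B →ₐ[ℂ] ℂ) (hχ : ∀ (h : H) (b : B), χ (h • b) = χ b)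

/-- The `B`-module structure on `V` through the character `χ`. -/
def charAction (V : Type w) [AddCommGroup V] [Module ℂ V] : B →ₐ[ℂ] Module.End ℂ V :=
  (Algebra.ofId ℂ (Module.End ℂ V)).comp χ

/-- The `B ⋊ H`-module `V_χ`: the representation `V` of `H` on which `B` acts through the
`H`-invariant character `χ`. -/
def crossedAction (V : FinDimRep H) : SkewMonoidAlgebra B H →ₐ[ℂ] Module.End ℂ V.carrier :=
  SkewMonoidAlgebra.liftNCAlgHom (charAction χ V.carrier) V.ρ (by
    intro x y
    ext v
    simp [charAction, Algebra.ofId_apply, hχ])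

/-- `Ind_{B ⋊ H}^{B ⋊ G} V_χ`. -/
abbrev IndRep (V : FinDimRep H) : Type u :=
  Induced (crossedInclusion (B := B) H) (crossedAction χ hχ V)

/-- `Ind_B^{B ⋊ G} ℂ_χ`, where `ℂ_χ` is `ℂ` with `B` acting through `χ`. -/
abbrev IndChar (G : Type u) [Group G] {B : Type u} [CommRing B] [Algebra ℂ B]
    [MulSemiringAction G B] [SMulCommClass G ℂ B] (χ : B →ₐ[ℂ] ℂ) : Type u :=
  Induced (coeffInclusion G B) (charAction χ ℂ)

/-! ### Finite-dimensionality and continuity of induced modules -/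

/-- The product topology on `B ⋊ G ≅ B^G`. -/
instance [Finite G] [TopologicalSpace B] : TopologicalSpace (SkewMonoidAlgebra B G) :=
  ⨅ g : G, TopologicalSpace.induced (fun x => x.coeff g) inferInstance

/-- The map `v ↦ 1 ⊗ v` from `V` to an induced module. -/
def toInduced {S R : Type u} {V : Type w} [Ring S] [Algebra ℂ S] [Ring R] [Algebra ℂ R]
    [AddCommGroup V] [Module ℂ V] (φ : S →ₐ[ℂ] R) (σ : S →ₐ[ℂ] Module.End ℂ V) :
    V →ₗ[ℂ] Induced φ σ :=
  ((balancedRelations φ σ).mkQ.restrictScalars ℂ) ∘ₗ (TensorProduct.mk ℂ R V 1)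

theorem smul_toInduced {S R : Type u} {V : Type w} [Ring S] [Algebra ℂ S] [Ring R] [Algebra ℂ R]
    [AddCommGroup V] [Module ℂ V] (φ : S →ₐ[ℂ] R) (σ : S →ₐ[ℂ] Module.End ℂ V) (s : S) (v : V) :
    φ s • toInduced φ σ v = toInduced φ σ (σ s v) := by
  change φ s • (balancedRelations φ σ).mkQ (1 ⊗ₜ v) = (balancedRelations φ σ).mkQ (1 ⊗ₜ (σ s v))
  rw [← map_smul, ← sub_eq_zero, ← map_sub, ← LinearMap.mem_ker, Submodule.ker_mkQ]
  refine Submodule.subset_span ⟨1, s, v, ?_⟩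
  rw [TensorProduct.smul_tmul', smul_eq_mul, mul_one, one_mul]

theorem span_toInduced {S R : Type u} {V : Type w} [Ring S] [Algebra ℂ S] [Ring R] [Algebra ℂ R]
    [AddCommGroup V] [Module ℂ V] (φ : S →ₐ[ℂ] R) (σ : S →ₐ[ℂ] Module.End ℂ V) :
    Submodule.span R (Set.range (toInduced φ σ)) = ⊤ := by
  rw [eq_top_iff]
  rintro x -
  obtain ⟨x, rfl⟩ := (balancedRelations φ σ).mkQ_surjective x
  induction x with
  | zero => rw [map_zero]; exact Submodule.zero_mem _
  | add x y hx hy => rw [map_add]; exact Submodule.add_mem _ hx hy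
  | tmul r v =>
    have h : (balancedRelations φ σ).mkQ (r ⊗ₜ v) = r • toInduced φ σ v := by
      change _ = r • (balancedRelations φ σ).mkQ (1 ⊗ₜ v)
      rw [← map_smul, TensorProduct.smul_tmul', smul_eq_mul, mul_one]
    rw [h]
    exact Submodule.smul_mem _ _ (Submodule.subset_span ⟨v, rfl⟩)

section Generation

variable {V : Type w} [AddCommGroup V] [Module ℂ V]
  {W : Type u} [AddCommGroup W] [Module ℂ W] [Module (SkewMonoidAlgebra B G) W]
  [IsScalarTower ℂ (SkewMonoidAlgebra B G) W] (ι : V →ₗ[ℂ] W)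

/-- The map `v ↦ g • ι v`. -/
def translate (g : G) : V →ₗ[ℂ] W :=
  (Algebra.lsmul ℂ ℂ W (SkewMonoidAlgebra.single g (1 : B))) ∘ₗ ι

theorem single_smul_translate
    (hι : ∀ b v, SkewMonoidAlgebra.single (1 : G) (b : B) • ι v = χ b • ι v) (h g : G) (b : B)
    (v : V) : SkewMonoidAlgebra.single h b • translate (B := B) ι g v =
      χ ((h * g)⁻¹ • b) • translate (B := B) ι (h * g) v := by
  have e : SkewMonoidAlgebra.single h b * SkewMonoidAlgebra.single g (1 : B) =
      SkewMonoidAlgebra.single (h * g) 1 * SkewMonoidAlgebra.single 1 ((h * g)⁻¹ • b) := by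
    rw [SkewMonoidAlgebra.single_mul_single, SkewMonoidAlgebra.single_mul_single, smul_one,
      mul_one, mul_one, one_mul, smul_inv_smul]
  change SkewMonoidAlgebra.single h b • SkewMonoidAlgebra.single g (1 : B) • ι v =
    _ • SkewMonoidAlgebra.single (h * g) (1 : B) • ι v
  rw [smul_smul, e, mul_smul, hι, smul_comm]

theorem iSup_translate [Finite G]
    (hι : ∀ b v, SkewMonoidAlgebra.single (1 : G) (b : B) • ι v = χ b • ι v)
    (hspan : Submodule.span (SkewMonoidAlgebra B G) (Set.range ι) = ⊤) :
    ⨆ g : G, LinearMap.range (translate (B := B) ι g) = ⊤ := by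
  rw [eq_top_iff]
  rintro x -
  have hx : x ∈ Submodule.span (SkewMonoidAlgebra B G) (Set.range ι) := hspan ▸ trivial
  have key : ∀ (r : SkewMonoidAlgebra B G) (g : G) (v : V),
      r • translate (B := B) ι g v ∈ ⨆ g : G, LinearMap.range (translate (B := B) ι g) := by
    intro r g v
    induction r with
    | single h b =>
      rw [single_smul_translate χ ι hι]
      exact Submodule.smul_mem _ _ (Submodule.mem_iSup_of_mem (h * g) ⟨v, rfl⟩)
    | add a b ha hb => rw [add_smul]; exact Submodule.add_mem _ ha hb
  have one : ∀ v, translate (B := B) ι (1 : G) v = ι v := fun v => one_smul _ _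
  induction hx using Submodule.span_induction with
  | mem x h => obtain ⟨v, rfl⟩ := h; rw [← one]; exact Submodule.mem_iSup_of_mem 1 ⟨v, rfl⟩
  | zero => exact Submodule.zero_mem _
  | add x y _ _ hx hy => exact Submodule.add_mem _ hx hy
  | smul r x hx' hx =>
    clear hx'
    induction hx using Submodule.iSup_induction' with
    | mem g x h => obtain ⟨v, rfl⟩ := h; exact key r g v
    | zero => rw [smul_zero]; exact Submodule.zero_mem _
    | add x y _ _ hx hy => rw [smul_add]; exact Submodule.add_mem _ hx hy

theorem finiteDimensional_of_generated [Finite G] [FiniteDimensional ℂ V]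
    (hι : ∀ b v, SkewMonoidAlgebra.single (1 : G) (b : B) • ι v = χ b • ι v)
    (hspan : Submodule.span (SkewMonoidAlgebra B G) (Set.range ι) = ⊤) :
    FiniteDimensional ℂ W := by
  have h := iSup_translate χ ι hι hspan
  have : FiniteDimensional ℂ (⨆ g : G, LinearMap.range (translate (B := B) ι g) :
    Submodule ℂ W) := inferInstance
  rw [h] at this
  exact Module.finite_def.2 ((Submodule.fg_top _).1 (Module.finite_def.1 this))

theorem continuous_of_generated [Finite G] [TopologicalSpace B]
    (hcont : ∀ g : G, Continuous fun b : B => χ (g • b))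
    (hι : ∀ b v, SkewMonoidAlgebra.single (1 : G) (b : B) • ι v = χ b • ι v)
    (hspan : Submodule.span (SkewMonoidAlgebra B G) (Set.range ι) = ⊤)
    (x : W) (l : Module.Dual ℂ W) :
    Continuous fun r : SkewMonoidAlgebra B G => l (r • x) := by
  have : Fintype G := Fintype.ofFinite G
  have hx : x ∈ ⨆ g : G, LinearMap.range (translate (B := B) ι g) :=
    iSup_translate χ ι hι hspan ▸ trivial
  induction hx using Submodule.iSup_induction' with
  | mem g x h =>
    obtain ⟨v, rfl⟩ := h
    have e : ∀ r : SkewMonoidAlgebra B G, l (r • translate (B := B) ι g v) =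
        ∑ h : G, χ ((h * g)⁻¹ • r.coeff h) * l (translate (B := B) ι (h * g) v) := by
      intro r
      induction r with
      | single k b =>
        rw [single_smul_translate χ ι hι, map_smul, Finset.sum_eq_single k]
        · rw [SkewMonoidAlgebra.coeff_single, Finsupp.single_eq_same, smul_eq_mul]
        · intro h _ hne
          rw [SkewMonoidAlgebra.coeff_single, Finsupp.single_eq_of_ne hne, smul_zero,
            map_zero, zero_mul]
        · intro h; exact absurd (Finset.mem_univ _) h
      | add a b ha hb =>
        rw [add_smul, map_add, ha, hb, ← Finset.sum_add_distrib]
        refine Finset.sum_congr rfl fun h _ => ?_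
        rw [SkewMonoidAlgebra.coeff_add, Finsupp.add_apply, smul_add, map_add, add_mul]
    simp_rw [e]
    refine continuous_finsetSum _ fun h _ => Continuous.mul ?_ continuous_const
    exact (hcont _).comp (continuous_iff_le_induced.2 (iInf_le _ h))
  | zero => simpa using continuous_const
  | add x y _ _ hx hy => simp_rw [smul_add, map_add]; exact hx.add hy

end Generation

theorem indRep_generator (V : FinDimRep H) (b : B) (v : V.carrier) :
    SkewMonoidAlgebra.single (1 : G) b •
        toInduced (crossedInclusion (B := B) H) (crossedAction χ hχ V) v =
      χ b • toInduced (crossedInclusion (B := B) H) (crossedAction χ hχ V) v := by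
  have h := smul_toInduced (crossedInclusion (B := B) H) (crossedAction χ hχ V)
    (SkewMonoidAlgebra.single 1 b) v
  have h1 : crossedInclusion (B := B) H (SkewMonoidAlgebra.single 1 b) =
      SkewMonoidAlgebra.single (1 : G) b := by
    exact (SkewMonoidAlgebra.mapDomain_single (f := H.subtype)).trans (by rw [map_one])
  have h2 : crossedAction χ hχ V (SkewMonoidAlgebra.single 1 b) v = χ b • v := by
    simp [crossedAction, SkewMonoidAlgebra.liftNCAlgHom, SkewMonoidAlgebra.liftNCRingHom,
      charAction, Algebra.ofId_apply]
  rw [h1, h2, map_smul] at h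
  exact h

theorem indChar_generator (b : B) (v : ℂ) :
    SkewMonoidAlgebra.single (1 : G) b •
        toInduced (coeffInclusion G B) (charAction χ ℂ) v =
      χ b • toInduced (coeffInclusion G B) (charAction χ ℂ) v := by
  have h := smul_toInduced (coeffInclusion G B) (charAction χ ℂ) b v
  have h2 : charAction χ ℂ b v = χ b • v := by
    simp [charAction, Algebra.ofId_apply]
  rw [h2, map_smul] at h
  exact h

end Induction

/-! ### Induced modules as Fréchet modules over the completed crossed product -/

section Objects

variable {G : Type u} [Group G] [Finite G] {A : Type u} [CommRing A] [Algebra ℂ A]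
  [MulSemiringAction G A] [SMulCommClass G ℂ A] (m : A →ₐ[ℂ] ℂ)

variable (G) in
/-- `Ind_m V` for the crossed product `𝒪(M) ⋊ G`. -/
abbrev IndAlg (V : FinDimRep (isotropy G m)) : Type u :=
  IndRep (H := isotropy G m) m (fun (h : isotropy G m) b => h.2 b) V

/-- `Ind_m V` for the completed crossed product. -/
abbrev IndFormal (V : FinDimRep (isotropy G m)) : Type u :=
  IndRep (OrbitCompletion.evalPoint G m) (OrbitCompletion.evalPoint_smul G m) V

variable (G) in
/-- `Ind ℂ_m` for the completed crossed product. -/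
abbrev IndCharFormal : Type u := IndChar G (OrbitCompletion.evalPoint G m)

instance (V : FinDimRep (isotropy G m)) : FiniteDimensional ℂ (IndFormal m V) :=
  finiteDimensional_of_generated (OrbitCompletion.evalPoint G m) (toInduced _ _)
    (indRep_generator _ _ V) (span_toInduced _ _)

instance : FiniteDimensional ℂ (IndCharFormal G m) :=
  finiteDimensional_of_generated (OrbitCompletion.evalPoint G m) (toInduced _ _)
    (indChar_generator _) (span_toInduced _ _)

/-- `Ind_m V` as a Fréchet module over the completed crossed product. -/
def indFrechet (V : FinDimRep (isotropy G m)) :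
    FrechetMod (SkewMonoidAlgebra (OrbitCompletion G m) G) :=
  FrechetMod.ofFiniteDimensional (IndFormal m V)
    (continuous_of_generated (OrbitCompletion.evalPoint G m) (toInduced _ _)
      (OrbitCompletion.continuous_evalPoint_smul G m) (indRep_generator _ _ V)
      (span_toInduced _ _))

variable (G) in
/-- `Ind ℂ_m` as a Fréchet module over the completed crossed product. -/
def indCharFrechet : FrechetMod (SkewMonoidAlgebra (OrbitCompletion G m) G) :=
  FrechetMod.ofFiniteDimensional (IndCharFormal G m)
    (continuous_of_generated (OrbitCompletion.evalPoint G m) (toInduced _ _)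
      (OrbitCompletion.continuous_evalPoint_smul G m) (indChar_generator _)
      (span_toInduced _ _))

end Objects

/-! ### The assertions about Ext -/

section Assertions

variable {G : Type u} [Group G] {A : Type u} [CommRing A] [Algebra ℂ A]
  [MulSemiringAction G A] [SMulCommClass G ℂ A] (m : A →ₐ[ℂ] ℂ)

/-- `Hom_{G_m}(V ⊗ ⋀ⁿ T*_m M, V')`. -/
abbrev cotangentHom (V V' : FinDimRep (isotropy G m)) (n : ℕ) : Type u :=
  (V.ρ.tprod (extPowerRep (cotanRep G m) n)).IntertwiningMap V'.ρ

/-- `(Hom(V, V') ⊗ ⋀ⁿ T_m M)^{G_m}`. -/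
abbrev tangentHom (V V' : FinDimRep (isotropy G m)) (n : ℕ) :
    Submodule ℂ ((V.carrier →ₗ[ℂ] V'.carrier) ⊗[ℂ] ⋀[ℂ]^n (Tan m)) :=
  ((V.ρ.linHom V'.ρ).tprod (extPowerRep (tanRep G m) n)).invariants

/-- The inclusion of `(Hom(V, V') ⊗ ⋀ⁿ T_m M)^{G_m}` in `Hom(V, V') ⊗ ⋀ T_m M`. -/
def toTotal {V V' : FinDimRep (isotropy G m)} {n : ℕ} (x : tangentHom m V V' n) :
    (V.carrier →ₗ[ℂ] V'.carrier) ⊗[ℂ] ExteriorAlgebra ℂ (Tan m) :=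
  LinearMap.lTensor (V.carrier →ₗ[ℂ] V'.carrier) (⋀[ℂ]^n (Tan m)).subtype x.1

/-- The product `(ψ ⊗ λ)(ψ' ⊗ λ') = (ψ ∘ ψ') ⊗ (λ ∧ λ')`. -/
def wedgeProduct {V V' V'' : Type u} [AddCommGroup V] [Module ℂ V] [AddCommGroup V']
    [Module ℂ V'] [AddCommGroup V''] [Module ℂ V''] :
    (V' →ₗ[ℂ] V'') ⊗[ℂ] ExteriorAlgebra ℂ (Tan m) →ₗ[ℂ]
      (V →ₗ[ℂ] V') ⊗[ℂ] ExteriorAlgebra ℂ (Tan m) →ₗ[ℂ]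
        (V →ₗ[ℂ] V'') ⊗[ℂ] ExteriorAlgebra ℂ (Tan m) :=
  TensorProduct.map₂ (LinearMap.llcomp ℂ V V' V'') (LinearMap.mul ℂ (ExteriorAlgebra ℂ (Tan m)))

/-- The assertions about Ext-groups in the abelian category of all modules over `R`, for a
construction `ind` of induced modules and a module `indPt` (the induction of the one-dimensional
module of the point). -/
structure ModuleExtAssertion [Finite G] (R : Type u) [Ring R] [Algebra ℂ R]
    (ind : FinDimRep (isotropy G m) → ModuleCat.{u} R) (indPt : ModuleCat.{u} R) : Prop where
  /-- `Extⁿ(Ind V, Ind V') ≅ Hom_{G_m}(V ⊗ ⋀ⁿ T*_m M, V')` -/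
  ext_cotangent : ∀ (V V' : FinDimRep (isotropy G m)) (n : ℕ),
    Nonempty (Abelian.Ext (ind V) (ind V') n ≃ₗ[ℂ] cotangentHom m V V' n)
  /-- `Extⁿ(Ind V, Ind V') ≅ (Hom(V, V') ⊗ ⋀ⁿ T_m M)^{G_m}`, by isomorphisms that match the Yoneda
  product `β ∘ α` with the product of the `ψ ⊗ λ`. -/
  ext_tangent : ∃ Φ : ∀ (V V' : FinDimRep (isotropy G m)) (n : ℕ),
      Abelian.Ext (ind V) (ind V') n ≃ₗ[ℂ] tangentHom m V V' n,
    ∀ (V V' V'' : FinDimRep (isotropy G m)) (p q n : ℕ) (h : p + q = n)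
      (α : Abelian.Ext (ind V) (ind V') p) (β : Abelian.Ext (ind V') (ind V'') q),
      toTotal m (Φ V V'' n (α.comp β h)) =
        wedgeProduct m (toTotal m (Φ V' V'' q β)) (toTotal m (Φ V V' p α))
  /-- Inducing the regular representation gives the induction from `𝒪(M)` of the point. -/
  ind_regular : Nonempty (ind (regularRep (isotropy G m)) ≅ indPt)
  /-- The Ext-algebra of `indPt` is `⋀ T_m M ⋊ G_m`, as a graded algebra. -/
  ext_algebra : ∃ Ψ : ∀ n : ℕ, Abelian.Ext indPt indPt n ≃ₗ[ℂ] extCrossedDegree G m n,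
    (Ψ 0 (Abelian.Ext.mk₀ (𝟙 indPt))).1 = 1 ∧
    ∀ (p q n : ℕ) (h : p + q = n) (α : Abelian.Ext indPt indPt p) (β : Abelian.Ext indPt indPt q),
      (Ψ n (α.comp β h)).1 = (Ψ q β).1 * (Ψ p α).1

/-- A bijection of a Yoneda Ext-set with a complex vector space is linear: it transports Baer sums
and scalar multiples to sums and scalar multiples. -/
def IsLinearOnExt {C : Type (u + 1)} [Category.{u} C] [Preadditive C] [Linear ℂ C]
    [HasConflations C] {X Y : C} {n : ℕ} {W : Type u} [AddCommGroup W] [Module ℂ W]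
    (f : YExt X Y n ≃ W) : Prop :=
  (∀ x y z, IsBaerSum x y z ↔ f z = f x + f y) ∧
    ∀ (c : ℂ) (x z), IsScalarMultiple c x z ↔ f z = c • f x

/-- The same assertions about Yoneda Ext-groups in an exact category. -/
structure ExactExtAssertion [Finite G] (C : Type (u + 1)) [Category.{u} C] [Preadditive C]
    [Linear ℂ C] [HasConflations C] (ind : FinDimRep (isotropy G m) → C) (indPt : C) : Prop where
  /-- `Extⁿ(Ind V, Ind V') ≅ Hom_{G_m}(V ⊗ ⋀ⁿ T*_m M, V')` -/
  ext_cotangent : ∀ (V V' : FinDimRep (isotropy G m)) (n : ℕ),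
    ∃ f : YExt (ind V) (ind V') n ≃ cotangentHom m V V' n, IsLinearOnExt f
  /-- `Extⁿ(Ind V, Ind V') ≅ (Hom(V, V') ⊗ ⋀ⁿ T_m M)^{G_m}`, by isomorphisms that match the Yoneda
  product `β ∘ α` with the product of the `ψ ⊗ λ`. -/
  ext_tangent : ∃ Φ : ∀ (V V' : FinDimRep (isotropy G m)) (n : ℕ),
      YExt (ind V) (ind V') n ≃ tangentHom m V V' n,
    (∀ V V' n, IsLinearOnExt (Φ V V' n)) ∧
    ∀ (V V' V'' : FinDimRep (isotropy G m)) (p q : ℕ)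
      (α : YExt (ind V) (ind V') p) (β : YExt (ind V') (ind V'') q)
      (γ : YExt (ind V) (ind V'') (q + p)),
      IsProduct β α γ ↔ toTotal m (Φ V V'' (q + p) γ) =
        wedgeProduct m (toTotal m (Φ V' V'' q β)) (toTotal m (Φ V V' p α))
  /-- Inducing the regular representation gives the induction from `𝒪(M)` of the point. -/
  ind_regular : Nonempty (ind (regularRep (isotropy G m)) ≅ indPt)
  /-- The Ext-algebra of `indPt` is `⋀ T_m M ⋊ G_m`, as a graded algebra. -/
  ext_algebra : ∃ Ψ : ∀ n : ℕ, YExt indPt indPt n ≃ extCrossedDegree G m n,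
    (∀ n, IsLinearOnExt (Ψ n)) ∧
    (Ψ 0 (Quot.mk _ (NExt.hom (𝟙 indPt)))).1 = 1 ∧
    ∀ (p q : ℕ) (α : YExt indPt indPt p) (β : YExt indPt indPt q)
      (γ : YExt indPt indPt (q + p)),
      IsProduct β α γ ↔ (Ψ (q + p) γ).1 = (Ψ q β).1 * (Ψ p α).1

end Assertions

end YonedaCrossed

end

open YonedaCrossed

set_option linter.unusedSectionVars false

noncomputable section

namespace YonedaCrossed

open HasConflations

/-- A chain of composable short sequences `Ω (k + 1) → P k → Ω k`, that is, a resolution of `Ω 0`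
together with its syzygies. -/
structure Resn (C : Type u) [Category.{v} C] where
  Ω : ℕ → C
  P : ℕ → C
  i : ∀ k, Ω (k + 1) ⟶ P k
  p : ∀ k, P k ⟶ Ω k

namespace Resn

variable {C : Type u} [Category.{v} C]

/-- The resolution of the `q`-th syzygy obtained by truncation. -/
def shift (R : Resn C) (q : ℕ) : Resn C where
  Ω k := R.Ω (q + k)
  P k := R.P (q + k)
  i k := R.i (q + k)
  p k := R.p (q + k)

/-- Morphisms of resolutions with their syzygies. -/
structure Hom (R S : Resn C) where
  l : ∀ k, R.Ω k ⟶ S.Ω k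
  t : ∀ k, R.P k ⟶ S.P k
  comm_i : ∀ k, R.i k ≫ t k = l (k + 1) ≫ S.i k
  comm_p : ∀ k, R.p k ≫ l k = t k ≫ S.p k

end Resn

/-- The properties of an exact category that are needed to compute Yoneda Ext-sets with
projective resolutions. -/
class ExactLike (C : Type u) [Category.{v} C] [Preadditive C] [HasConflations C] : Prop where
  zero : ∀ {Y E Z : C} {i : Y ⟶ E} {p : E ⟶ Z}, IsConflation i p → i ≫ p = 0
  mono : ∀ {Y E Z : C} {i : Y ⟶ E} {p : E ⟶ Z}, IsConflation i p → Mono i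
  epi : ∀ {Y E Z : C} {i : Y ⟶ E} {p : E ⟶ Z}, IsConflation i p → Epi p
  lift : ∀ {Y E Z : C} {i : Y ⟶ E} {p : E ⟶ Z}, IsConflation i p →
    ∀ {W : C} (f : W ⟶ E), f ≫ p = 0 → ∃ g : W ⟶ Y, g ≫ i = f
  desc : ∀ {Y E Z : C} {i : Y ⟶ E} {p : E ⟶ Z}, IsConflation i p →
    ∀ {W : C} (f : E ⟶ W), i ≫ f = 0 → ∃ g : Z ⟶ W, p ≫ g = f
  pushout : ∀ {Y E Z Y' : C} {i : Y ⟶ E} {p : E ⟶ Z} (_ : IsConflation i p) (f : Y ⟶ Y'),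
    ∃ (E' : C) (i' : Y' ⟶ E') (p' : E' ⟶ Z) (t : E ⟶ E'), IsConflation i' p' ∧
      i ≫ t = f ≫ i' ∧ t ≫ p' = p ∧
      (∀ {W : C} (a : Y' ⟶ W) (b : E ⟶ W), i ≫ b = f ≫ a → ∃ c : E' ⟶ W, i' ≫ c = a ∧ t ≫ c = b) ∧
      ∀ {W : C} (c c' : E' ⟶ W), i' ≫ c = i' ≫ c' → t ≫ c = t ≫ c' → c = c'

/-- An object is projective relative to the conflations. -/
def RelProjective {C : Type u} [Category.{v} C] [HasConflations C] (P : C) : Prop :=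
  ∀ {Y E Z : C} {i : Y ⟶ E} {p : E ⟶ Z}, IsConflation i p → ∀ f : P ⟶ Z, ∃ g : P ⟶ E, g ≫ p = f

section Morph

variable {C : Type u} [Category.{v} C] [HasConflations C]

theorem Morph.refl {X Y : C} {n : ℕ} (e : NExt X Y n) : Morph e e (𝟙 Y) (𝟙 X) := by
  induction e with
  | hom f => exact .hom _ _ _ _ (by simp)
  | conf i p hc => exact .conf _ _ (𝟙 _) (by simp) (by simp)
  | cons i p hc e ih => exact .cons _ (𝟙 _) _ (𝟙 _) (by simp) (by simp) ih

theorem Morph.trans {X Y X' Y' X'' Y'' : C} {n : ℕ} {e : NExt X Y n} {e' : NExt X' Y' n}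
    {e'' : NExt X'' Y'' n} {a : Y ⟶ Y'} {b : X ⟶ X'} {a' : Y' ⟶ Y''} {b' : X' ⟶ X''}
    (h : Morph e e' a b) (h' : Morph e' e'' a' b') : Morph e e'' (a ≫ a') (b ≫ b') := by
  induction h generalizing Y'' with
  | hom f f' a b w =>
    cases h' with
    | hom _ f'' a' b' w' =>
      exact .hom _ _ _ _ (by rw [← Category.assoc, w, Category.assoc, w', Category.assoc])
  | conf a b t w₁ w₂ =>
    cases h' with
    | conf a' b' t' w₁' w₂' =>
      exact .conf _ _ (t ≫ t')
        (by rw [← Category.assoc, w₁, Category.assoc, w₁', Category.assoc])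
        (by rw [← Category.assoc, w₂, Category.assoc, w₂', Category.assoc])
  | cons a z b t w₁ w₂ r ih =>
    cases h' with
    | cons a' z' b' t' w₁' w₂' r' =>
      exact .cons _ (z ≫ z') _ (t ≫ t')
        (by rw [← Category.assoc, w₁, Category.assoc, w₁', Category.assoc])
        (by rw [← Category.assoc, w₂, Category.assoc, w₂', Category.assoc]) (ih r')

variable [Preadditive C]

theorem Morph.add {X Y X' Y' : C} {n : ℕ} {e : NExt X Y n} {e' : NExt X' Y' n}
    {a a' : Y ⟶ Y'} {b b' : X ⟶ X'}
    (h : Morph e e' a b) (h' : Morph e e' a' b') : Morph e e' (a + a') (b + b') := by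
  induction h with
  | hom f f' a b w =>
    cases h' with
    | hom _ _ _ _ w' => exact .hom _ _ _ _ (by simp [w, w'])
  | conf a b t w₁ w₂ =>
    cases h' with
    | conf a' b' t' w₁' w₂' => exact .conf _ _ (t + t') (by simp [w₁, w₁']) (by simp [w₂, w₂'])
  | cons a z b t w₁ w₂ r ih =>
    cases h' with
    | cons a' z' b' t' w₁' w₂' r' =>
      exact .cons _ (z + z') _ (t + t') (by simp [w₁, w₁']) (by simp [w₂, w₂']) (ih r')

theorem Morph.neg {X Y X' Y' : C} {n : ℕ} {e : NExt X Y n} {e' : NExt X' Y' n}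
    {a : Y ⟶ Y'} {b : X ⟶ X'} (h : Morph e e' a b) : Morph e e' (-a) (-b) := by
  induction h with
  | hom f f' a b w => exact .hom _ _ _ _ (by simp [w])
  | conf a b t w₁ w₂ => exact .conf _ _ (-t) (by simp [w₁]) (by simp [w₂])
  | cons a z b t w₁ w₂ r ih => exact .cons _ (-z) _ (-t) (by simp [w₁]) (by simp [w₂]) ih

end Morph

namespace Resn

variable {C : Type u} [Category.{v} C] [HasConflations C]

/-- A resolution by relatively projective objects. -/
structure IsProjective (R : Resn C) : Prop where
  conf : ∀ k, IsConflation (R.i k) (R.p k)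
  proj : ∀ k, RelProjective (R.P k)

theorem IsProjective.shift {R : Resn C} (h : R.IsProjective) (q : ℕ) :
    (R.shift q).IsProjective :=
  ⟨fun _ => h.conf _, fun _ => h.proj _⟩

/-- The `n`-fold extension of `Ω 0` by `Ω n` given by a resolution. -/
def res (R : Resn C) (h : R.IsProjective) : ∀ n, NExt (R.Ω 0) (R.Ω n) n
  | 0 => .hom (𝟙 _)
  | 1 => .conf (R.i 0) (R.p 0) (h.conf 0)
  | n + 2 => .cons (R.i (n + 1)) (R.p (n + 1)) (h.conf _) (res R h (n + 1))

variable [Preadditive C] [ExactLike C] {R : Resn C} (h : R.IsProjective)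

theorem exists_ladder_step {Y E Z : C} {i : Y ⟶ E} {p : E ⟶ Z} (hc : IsConflation i p) {k : ℕ}
    (h : R.IsProjective) (z : R.Ω k ⟶ Z) :
    ∃ (t : R.P k ⟶ E) (f : R.Ω (k + 1) ⟶ Y), R.i k ≫ t = f ≫ i ∧ R.p k ≫ z = t ≫ p := by
  obtain ⟨t, ht⟩ := h.proj k hc (R.p k ≫ z)
  obtain ⟨f, hf⟩ := ExactLike.lift hc (R.i k ≫ t) (by
    rw [Category.assoc, ht, ← Category.assoc, ExactLike.zero (h.conf k), Limits.zero_comp])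
  exact ⟨t, f, hf.symm, ht.symm⟩

theorem exists_morph {X Y : C} {n : ℕ} (e : NExt X Y n) (b : R.Ω 0 ⟶ X) :
    ∃ f : R.Ω n ⟶ Y, Morph (R.res h n) e f b := by
  induction e with
  | hom f => exact ⟨b ≫ f, .hom _ _ _ _ (by simp)⟩
  | conf i p hc =>
    obtain ⟨t, f, h1, h2⟩ := exists_ladder_step hc h b
    exact ⟨f, .conf _ _ t h1 h2⟩
  | cons i p hc e ih =>
    obtain ⟨z, hz⟩ := ih
    obtain ⟨t, f, h1, h2⟩ := exists_ladder_step hc h z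
    exact ⟨f, .cons _ z _ t h1 h2 hz⟩

theorem step_eq_of_null {Y E Z : C} {i : Y ⟶ E} {p : E ⟶ Z} (hc : IsConflation i p) {k : ℕ}
    {t : R.P k ⟶ E} {f : R.Ω (k + 1) ⟶ Y} (h1 : R.i k ≫ t = f ≫ i) (h2 : t ≫ p = 0) :
    ∃ s : R.P k ⟶ Y, f = R.i k ≫ s := by
  obtain ⟨s, hs⟩ := ExactLike.lift hc t h2
  have := ExactLike.mono hc
  exact ⟨s, by rw [← cancel_mono i, ← h1, ← hs, Category.assoc]⟩

theorem eq_of_morph_zero {X Y : C} : ∀ {n : ℕ} {e : NExt X Y (n + 1)} {f : R.Ω (n + 1) ⟶ Y},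
    Morph (R.res h (n + 1)) e f 0 → ∃ s : R.P n ⟶ Y, f = R.i n ≫ s := by
  intro n
  induction n generalizing Y with
  | zero =>
    intro e f hm
    cases hm with
    | conf _ _ t w₁ w₂ =>
      rename_i hc _
      exact step_eq_of_null hc w₁ (by rw [← w₂, Limits.comp_zero])
  | succ n ih =>
    intro e f hm
    cases hm with
    | cons _ z _ t w₁ w₂ r =>
      rename_i hc _ _
      obtain ⟨s, rfl⟩ := ih r
      obtain ⟨s', hs'⟩ := h.proj n hc s
      refine step_eq_of_null (t := t - R.p (n + 1) ≫ R.i n ≫ s') hc ?_ ?_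
      · rw [Preadditive.comp_sub, w₁, ← Category.assoc (R.i (n + 1)),
          ExactLike.zero (h.conf (n + 1)), Limits.zero_comp, sub_zero]
      · rw [Preadditive.sub_comp, ← w₂]; simp [hs']

theorem morph_add_null {X Y : C} {n : ℕ} {e : NExt X Y (n + 1)} {f : R.Ω (n + 1) ⟶ Y}
    {b : R.Ω 0 ⟶ X} (hm : Morph (R.res h (n + 1)) e f b) (s : R.P n ⟶ Y) :
    Morph (R.res h (n + 1)) e (f + R.i n ≫ s) b := by
  cases n with
  | zero =>
    cases hm with
    | conf _ _ t w₁ w₂ =>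
      rename_i p' i' hc _
      exact .conf _ _ (t + s ≫ i') (by simp [w₁]) (by simp [w₂, ExactLike.zero hc])
  | succ n =>
    cases hm with
    | cons _ z _ t w₁ w₂ r =>
      rename_i p' i' hc _ _
      exact .cons _ z _ (t + s ≫ i') (by simp [w₁]) (by simp [w₂, ExactLike.zero hc]) r

theorem morph_unique_add {X Y : C} {n : ℕ} {e : NExt X Y (n + 1)} {f f' : R.Ω (n + 1) ⟶ Y}
    {b : R.Ω 0 ⟶ X} (hm : Morph (R.res h (n + 1)) e f b) (hm' : Morph (R.res h (n + 1)) e f' b) :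
    ∃ s : R.P n ⟶ Y, f' = f + R.i n ≫ s := by
  obtain ⟨s, hs⟩ := eq_of_morph_zero h (f := f' - f) (e := e) (by
    simpa [sub_eq_add_neg] using hm'.add hm.neg)
  exact ⟨s, by rw [← hs]; abel⟩

theorem morph_unique {X Y : C} (hmin : ∀ k (f : R.P k ⟶ Y), R.i k ≫ f = 0) {n : ℕ}
    {e : NExt X Y n} {f f' : R.Ω n ⟶ Y}
    {b : R.Ω 0 ⟶ X} (hm : Morph (R.res h n) e f b) (hm' : Morph (R.res h n) e f' b) : f = f' := by
  cases n with
  | zero =>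
    cases hm with
    | hom _ _ _ _ w =>
      cases hm' with
      | hom _ _ _ _ w' => rw [Category.id_comp] at w w'; rw [w, w']
  | succ n =>
    obtain ⟨s, hs⟩ := morph_unique_add h hm hm'
    rw [hs, hmin, add_zero]

/-- Pushing out a resolution along `f : Ω n ⟶ Y` gives an extension with the universal property
of a pushout for ladders. -/
theorem exists_pushout {Y : C} : ∀ {n : ℕ} (f : R.Ω n ⟶ Y), ∃ e : NExt (R.Ω 0) Y n,
    Morph (R.res h n) e f (𝟙 _) ∧ ∀ {X' Y' : C} (e' : NExt X' Y' n) (a : Y ⟶ Y') (b : R.Ω 0 ⟶ X'),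
      Morph (R.res h n) e' (f ≫ a) b → Morph e e' a b
  | 0, f => ⟨.hom f, .hom _ _ _ _ (by simp), fun e' a b hm => by
      cases hm with
      | hom _ _ _ _ w => exact .hom _ _ _ _ (by simpa using w)⟩
  | 1, f => by
    obtain ⟨E, i, p, t, hc, h1, h2, hu, hj⟩ := ExactLike.pushout (h.conf 0) f
    refine ⟨.conf i p hc, .conf _ _ t h1 (by rw [Category.comp_id, h2]), fun e' a b hm => ?_⟩
    cases hm with
    | conf _ _ t' w₁ w₂ =>
      obtain ⟨c, hc1, hc2⟩ := hu (a ≫ _) t' (by rw [w₁, Category.assoc])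
      refine .conf _ _ c hc1 (hj _ _ ?_ ?_)
      · rename_i hc' _
        rw [← Category.assoc, ExactLike.zero hc, ← Category.assoc, hc1, Category.assoc,
          ExactLike.zero hc', Limits.zero_comp, Limits.comp_zero]
      · rw [← Category.assoc, h2, w₂, ← Category.assoc, hc2]
  | n + 2, f => by
    obtain ⟨E, i, p, t, hc, h1, h2, hu, hj⟩ := ExactLike.pushout (h.conf (n + 1)) f
    refine ⟨.cons i p hc (R.res h (n + 1)), .cons _ (𝟙 _) _ t h1 (by rw [Category.comp_id, h2])
        (Morph.refl _),
      fun e' a b hm => ?_⟩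
    cases hm with
    | cons _ z _ t' w₁ w₂ r =>
      obtain ⟨c, hc1, hc2⟩ := hu (a ≫ _) t' (by rw [w₁, Category.assoc])
      refine .cons _ z _ c hc1 (hj _ _ ?_ ?_) r
      · rename_i hc' _ _
        rw [← Category.assoc, ExactLike.zero hc, ← Category.assoc, hc1, Category.assoc,
          ExactLike.zero hc', Limits.zero_comp, Limits.comp_zero]
      · rw [← Category.assoc, h2, w₂, ← Category.assoc, hc2]

omit [Preadditive C] [ExactLike C] in
theorem isProductRep_add {W X Y : C} {p q r : ℕ} {e : NExt X Y p} {d : NExt W X q}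
    {c : NExt W Y r} (hp : IsProductRep e d c) : r = q + p := by
  induction hp with
  | pushout => rfl
  | pullback => simp
  | conf => rfl
  | cons _ _ _ _ _ _ _ ih => omega

omit [HasConflations C] [Preadditive C] [ExactLike C] in
theorem shift_zero (R : Resn C) : R.shift 0 = R := by
  have key : ∀ (s : ℕ → ℕ) (_ : s = id) (e : ∀ k, s (k + 1) = s k + 1),
      (⟨fun k => R.Ω (s k), fun k => R.P (s k), fun k => eqToHom (congrArg R.Ω (e k)) ≫ R.i (s k),
        fun k => R.p (s k)⟩ : Resn C) = R := by
    rintro _ rfl e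
    simp
  refine Eq.trans ?_ (key (fun k => 0 + k) (funext Nat.zero_add) (fun _ => rfl))
  simp [shift]

omit [Preadditive C] [ExactLike C] in
theorem morph_congr {X Y : C} {S : Resn C} (hS : S.IsProjective) (hSR : S = R) {p n : ℕ}
    (hn : p = n) {c : NExt X Y p} {f : S.Ω p ⟶ Y} {f' : R.Ω n ⟶ Y} (hf : HEq f f')
    {b : S.Ω 0 ⟶ X} {b' : R.Ω 0 ⟶ X} (hb : HEq b b') (hm : Morph (S.res hS p) c f b) :
    Morph (R.res h n) (hn ▸ c) f' b' := by
  subst hSR hn hf hb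
  exact hm

theorem morph_of_isProductRep {W X Y : C} {p q r : ℕ} {e : NExt X Y p} {d : NExt W X q}
    {c : NExt W Y r} (hp : IsProductRep e d c) (b : R.Ω 0 ⟶ W) (g : R.Ω q ⟶ X)
    (hd : Morph (R.res h q) d g b) (hr : r = q + p) (f : R.Ω (q + p) ⟶ Y)
    (he : Morph ((R.shift q).res (h.shift q) p) e f g) :
    Morph (R.res h (q + p)) (hr ▸ c) f b := by
  induction hp with
  | pushout f₀ d c hm =>
    cases he with
    | hom _ _ _ _ w =>
      obtain rfl : f = g ≫ f₀ := (Category.id_comp _).symm.trans w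
      have := hd.trans hm
      rwa [Category.comp_id] at this
  | pullback e g₀ c hm =>
    cases hd with
    | hom _ _ _ _ w =>
      obtain rfl : g = b ≫ g₀ := (Category.id_comp _).symm.trans w
      refine morph_congr h (h.shift 0) R.shift_zero hr HEq.rfl (b := b) HEq.rfl ?_
      obtain ⟨f', hf'⟩ := exists_morph (h.shift 0) c b
      have h2 := hf'.trans hm
      rw [Category.comp_id] at h2
      rename_i p
      cases p with
      | zero =>
        cases h2 with
        | hom _ _ _ _ w =>
          cases he with
          | hom _ _ _ _ w' =>
            obtain rfl : f' = f := by
              refine (Category.id_comp _).symm.trans ((w.trans w'.symm).trans (Category.id_comp _))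
            exact hf'
      | succ p =>
        obtain ⟨s, rfl⟩ := morph_unique_add (h.shift 0) h2 he
        exact morph_add_null (h.shift 0) hf' s
  | conf i s hc d =>
    cases he with
    | conf _ _ t w₁ w₂ => exact .cons _ g _ t w₁ w₂ hd
  | cons i s hc e d c hp ih =>
    cases he with
    | cons _ z _ t w₁ w₂ r =>
      obtain rfl := Nat.succ_injective (isProductRep_add hp)
      exact .cons _ z _ t w₁ w₂ (ih g hd rfl z r)

end Resn

section Splice

/-- The class of an extension. -/
def YExt.mk {C : Type u} [Category.{v} C] [HasConflations C] {X Y : C} {n : ℕ}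
    (e : NExt X Y n) : YExt X Y n := Quot.mk _ e

theorem YExt.exists_rep {C : Type u} [Category.{v} C] [HasConflations C] {X Y : C} {n : ℕ}
    (x : YExt X Y n) : ∃ e, YExt.mk e = x := Quot.exists_rep x

variable {C : Type u} [Category.{v} C] [HasConflations C]

theorem Morph.trans_id {X Y X' Y' Y'' : C} {n : ℕ} {e : NExt X Y n} {e' : NExt X' Y' n}
    {e'' : NExt X' Y'' n} {a : Y ⟶ Y'} {b : X ⟶ X'} {a' : Y' ⟶ Y''}
    (h : Morph e e' a b) (h' : Morph e' e'' a' (𝟙 _)) : Morph e e'' (a ≫ a') b := by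
  have := h.trans h'
  rwa [Category.comp_id] at this

theorem exists_splice {W X : C} {q : ℕ} (d : NExt W X (q + 1)) :
    ∀ {p : ℕ} {Y : C} (e : NExt X Y (p + 1)),
      ∃ (r : ℕ) (c : NExt W Y (r + 1)), IsProductRep e d c := by
  intro p
  induction p with
  | zero =>
    rintro Y (_ | ⟨i, p, h⟩)
    exact ⟨_, _, .conf i p h d⟩
  | succ p ih =>
    intro Y e
    cases e with
    | cons i p h e =>
      obtain ⟨r, c, hc⟩ := ih e
      exact ⟨_, _, .cons i p h e d c hc⟩

end Splice

namespace Resn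

variable {C : Type u} [Category.{v} C] [HasConflations C] [Preadditive C] [ExactLike C]
  {R : Resn C} (h : R.IsProjective) {Y : C} (hmin : ∀ k (f : R.P k ⟶ Y), R.i k ≫ f = 0)

/-- The characteristic map of the pullback along `b` of a Yoneda extension. -/
def clsAt {X : C} (b : R.Ω 0 ⟶ X) {n : ℕ} : YExt X Y n → (R.Ω n ⟶ Y) :=
  Quot.lift (fun e => (exists_morph h e b).choose) (by
    intro e e' hm
    have h1 := ((exists_morph h e b).choose_spec.trans hm)
    rw [Category.comp_id, Category.comp_id] at h1
    exact morph_unique h hmin h1 (exists_morph h e' b).choose_spec)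

theorem morph_clsAt {X : C} (b : R.Ω 0 ⟶ X) {n : ℕ} (e : NExt X Y n) :
    Morph (R.res h n) e (clsAt h hmin b (YExt.mk e)) b :=
  (exists_morph h e b).choose_spec

theorem clsAt_eq {X : C} {b : R.Ω 0 ⟶ X} {n : ℕ} {e : NExt X Y n} {f : R.Ω n ⟶ Y}
    (hm : Morph (R.res h n) e f b) : clsAt h hmin b (YExt.mk e) = f :=
  morph_unique h hmin (morph_clsAt h hmin b e) hm

theorem clsAt_add {X : C} (b b' : R.Ω 0 ⟶ X) {n : ℕ} (x : YExt X Y n) :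
    clsAt h hmin (b + b') x = clsAt h hmin b x + clsAt h hmin b' x := by
  obtain ⟨e, rfl⟩ := YExt.exists_rep x
  exact clsAt_eq h hmin ((morph_clsAt h hmin b e).add (morph_clsAt h hmin b' e))

include hmin in
theorem exists_rep_pushout {n : ℕ} (x : YExt (R.Ω 0) Y n) :
    ∃ e : NExt (R.Ω 0) Y n, YExt.mk e = x ∧
      ∀ {X' Y' : C} (e' : NExt X' Y' n) (a : Y ⟶ Y') (b : R.Ω 0 ⟶ X'),
      Morph (R.res h n) e' (clsAt h hmin (𝟙 _) x ≫ a) b → Morph e e' a b := by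
  obtain ⟨e, he, hu⟩ := exists_pushout h (clsAt h hmin (𝟙 _) x)
  obtain ⟨e₀, rfl⟩ := YExt.exists_rep x
  refine ⟨e, Quot.sound (hu e₀ (𝟙 _) (𝟙 _) ?_), hu⟩
  rw [Category.comp_id]
  exact morph_clsAt h hmin (𝟙 _) e₀

theorem hasMorph_iff {X' Y' : C} (hmin' : ∀ k (f : R.P k ⟶ Y'), R.i k ≫ f = 0) {n : ℕ}
    (x : YExt (R.Ω 0) Y n) (x' : YExt X' Y' n) (a : Y ⟶ Y') (b : R.Ω 0 ⟶ X') :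
    HasMorph x x' a b ↔ clsAt h hmin (𝟙 _) x ≫ a = clsAt h hmin' b x' := by
  constructor
  · rintro ⟨e, e', rfl, rfl, hm⟩
    have := (morph_clsAt h hmin (𝟙 _) e).trans hm
    rw [Category.id_comp] at this
    exact (clsAt_eq h hmin' this).symm
  · intro heq
    obtain ⟨e, he, hu⟩ := exists_rep_pushout h hmin x
    obtain ⟨e', rfl⟩ := YExt.exists_rep x'
    exact ⟨e, e', he, rfl, hu e' a b (heq ▸ morph_clsAt h hmin' b e')⟩

theorem clsAt_id_bijective {n : ℕ} :
    Function.Bijective (clsAt h hmin (𝟙 (R.Ω 0)) (n := n)) := by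
  constructor
  · intro x y hxy
    have : HasMorph x y (𝟙 _) (𝟙 _) := by
      rw [hasMorph_iff h hmin hmin, Category.comp_id, hxy]
    obtain ⟨e, e', rfl, rfl, hm⟩ := this
    exact Quot.sound hm
  · intro f
    obtain ⟨e, he, -⟩ := exists_pushout h f
    exact ⟨YExt.mk e, clsAt_eq h hmin he⟩

omit [Preadditive C] [ExactLike C] in
/-- A morphism of resolutions is a ladder of the extensions given by them. -/
theorem Hom.morph {S : Resn C} (hS : S.IsProjective) (F : R.Hom S) :
    ∀ n, Morph (R.res h n) (S.res hS n) (F.l n) (F.l 0)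
  | 0 => .hom _ _ _ _ (by simp)
  | 1 => .conf _ _ (F.t 0) (F.comm_i 0) (F.comm_p 0)
  | n + 2 => .cons _ (F.l (n + 1)) _ (F.t (n + 1)) (F.comm_i _) (F.comm_p _)
      (Hom.morph hS F (n + 1))

end Resn

/-- Minimal resolutions of a family of objects, together with a description of the
morphisms from their syzygies to these objects and lifts of these morphisms. -/
structure MinimalSystem (C : Type u) [Category.{v} C] [Preadditive C] [Linear ℂ C]
    (I : Type*) (T : I → I → ℕ → Type w) [∀ i j n, AddCommGroup (T i j n)]
    [∀ i j n, Module ℂ (T i j n)] where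
  R : I → Resn C
  φ : ∀ {i j n}, T i j n ≃ₗ[ℂ] ((R i).Ω n ⟶ (R j).Ω 0)
  lift : ∀ {i j p}, T i j p → Resn.Hom ((R i).shift p) (R j)
  lift_zero : ∀ {i j p} (α : T i j p), (lift α).l 0 = φ α
  minimal : ∀ {i j k} (f : (R i).P k ⟶ (R j).Ω 0), (R i).i k ≫ f = 0

namespace MinimalSystem

variable {C : Type u} [Category.{v} C] [Preadditive C] [Linear ℂ C]
  {I : Type*} {T : I → I → ℕ → Type w} [∀ i j n, AddCommGroup (T i j n)]
  [∀ i j n, Module ℂ (T i j n)] (D : MinimalSystem C I T)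

/-- The product defined by lifting morphisms to the resolutions. -/
def mul {i j k : I} {p q n : ℕ} (h : p + q = n) (α : T i j p) (β : T j k q) : T i k n :=
  h ▸ D.φ.symm ((D.lift α).l q ≫ D.φ β)

variable [HasConflations C] [ExactLike C] (hD : ∀ i, (D.R i).IsProjective)

/-- The identification of the Yoneda Ext-sets with the graded pieces of the system. -/
def equivYExt (i j : I) (n : ℕ) : YExt ((D.R i).Ω 0) ((D.R j).Ω 0) n ≃ T i j n :=
  (Equiv.ofBijective _ (Resn.clsAt_id_bijective (hD i) (fun _ => D.minimal))).trans
    D.φ.symm.toEquiv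

theorem φ_equivYExt {i j : I} {n : ℕ} (x : YExt ((D.R i).Ω 0) ((D.R j).Ω 0) n) :
    D.φ (D.equivYExt hD i j n x) = Resn.clsAt (hD i) (fun _ => D.minimal) (𝟙 _) x :=
  D.φ.apply_symm_apply _

theorem equivYExt_hom {i j : I} (f : (D.R i).Ω 0 ⟶ (D.R j).Ω 0) :
    D.φ (D.equivYExt hD i j 0 (YExt.mk (NExt.hom f))) = f := by
  rw [φ_equivYExt]
  exact Resn.clsAt_eq (hD i) _ (.hom _ _ _ _ (by simp))

theorem equivYExt_smul {i j : I} {n : ℕ} (c : ℂ) (x z : YExt ((D.R i).Ω 0) ((D.R j).Ω 0) n) :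
    IsScalarMultiple c x z ↔ D.equivYExt hD i j n z = c • D.equivYExt hD i j n x := by
  rw [IsScalarMultiple, Resn.hasMorph_iff (hD i) (fun _ => D.minimal) (fun _ => D.minimal),
    ← φ_equivYExt, ← φ_equivYExt, Linear.comp_smul, Category.comp_id, ← map_smul,
    D.φ.injective.eq_iff, eq_comm]

theorem equivYExt_baer (hsum : ∀ i, ∃ i' : I,
      ∃ b : Limits.BinaryBicone ((D.R i).Ω 0) ((D.R i).Ω 0), ∃ (_ : b.IsBilimit),
        b.pt = (D.R i').Ω 0)
    {i j : I} {n : ℕ} (x y z : YExt ((D.R i).Ω 0) ((D.R j).Ω 0) n) :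
    IsBaerSum x y z ↔
      D.equivYExt hD i j n z = D.equivYExt hD i j n x + D.equivYExt hD i j n y := by
  have hc {Y' : C} (hY' : ∀ k (f : (D.R i).P k ⟶ Y'), (D.R i).i k ≫ f = 0)
      {i' : C} (x : YExt ((D.R i).Ω 0) Y' n) (w : YExt i' Y' n) (b : (D.R i).Ω 0 ⟶ i') :
      HasMorph x w (𝟙 _) b ↔ Resn.clsAt (hD i) hY' (𝟙 _) x = Resn.clsAt (hD i) hY' b w := by
    rw [Resn.hasMorph_iff (hD i) hY' hY', Category.comp_id]
  rw [← D.φ.injective.eq_iff, map_add, φ_equivYExt, φ_equivYExt, φ_equivYExt]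
  constructor
  · rintro ⟨b, hb, w, hx, hy, hz⟩
    rw [hc (fun _ => D.minimal)] at hx hy hz
    rw [hx, hy, hz, Resn.clsAt_add]
  · intro hz
    obtain ⟨i', b, hb, hpt⟩ := hsum i
    obtain ⟨P, fst, snd, inl, inr, h1, h2, h3, h4⟩ := b
    obtain rfl : P = (D.R i').Ω 0 := hpt
    have lifts : ∀ (a a' : I) (g : (D.R a).Ω 0 ⟶ (D.R a').Ω 0),
        ∃ l, Morph ((D.R a).res (hD a) n) ((D.R a').res (hD a') n) l g := fun a a' g =>
      Resn.exists_morph (hD a) _ g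
    obtain ⟨l1, hl1⟩ := lifts _ _ fst
    obtain ⟨l2, hl2⟩ := lifts _ _ snd
    obtain ⟨x, rfl⟩ := YExt.exists_rep x
    obtain ⟨y, rfl⟩ := YExt.exists_rep y
    have mx := Resn.morph_clsAt (hD i) (fun _ => D.minimal) (𝟙 _) x
    have my := Resn.morph_clsAt (hD i) (fun _ => D.minimal) (𝟙 _) y
    set fx := Resn.clsAt (hD i) (fun _ => D.minimal) (𝟙 _) (YExt.mk x)
    set fy := Resn.clsAt (hD i) (fun _ => D.minimal) (𝟙 _) (YExt.mk y)
    obtain ⟨w, hw, -⟩ := Resn.exists_pushout (hD i') (l1 ≫ fx + l2 ≫ fy)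
    have val : ∀ (g : (D.R i).Ω 0 ⟶ (D.R i').Ω 0) (f : (D.R i).Ω n ⟶ (D.R j).Ω 0),
        (∀ l, Morph ((D.R i).res (hD i) n) ((D.R i').res (hD i') n) l g →
          l ≫ (l1 ≫ fx + l2 ≫ fy) = f) →
        Resn.clsAt (hD i) (fun _ => D.minimal) g (YExt.mk w) = f := by
      intro g f hgf
      obtain ⟨l, hl⟩ := lifts _ _ g
      have := hl.trans hw
      rw [hgf l hl, Category.comp_id] at this
      exact Resn.clsAt_eq (hD i) (fun _ => D.minimal) this
    have comp_val : ∀ (e : NExt ((D.R i).Ω 0) ((D.R j).Ω 0) n) (f : (D.R i).Ω n ⟶ (D.R j).Ω 0)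
        (c : (D.R i).Ω 0 ⟶ (D.R i).Ω 0) (l : (D.R i).Ω n ⟶ (D.R i).Ω n),
        Morph ((D.R i).res (hD i) n) ((D.R i).res (hD i) n) l c →
        Morph ((D.R i).res (hD i) n) e f (𝟙 _) →
        Morph ((D.R i).res (hD i) n) e (l ≫ f) c := by
      intro e f c l h1 h2
      have := h1.trans h2
      rwa [Category.comp_id] at this
    have inl_val : Resn.clsAt (hD i) (fun _ => D.minimal) inl (YExt.mk w) = fx := by
      refine val _ _ fun l hl => ?_
      have e1 := comp_val x fx _ _ (hl.trans hl1) mx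
      have e2 := comp_val y fy _ _ (hl.trans hl2) my
      rw [h1] at e1
      rw [h2] at e2
      have e3 : Morph ((D.R i).res (hD i) n) y 0 0 := by
        simpa using my.add my.neg
      rw [Preadditive.comp_add, ← Category.assoc, ← Category.assoc,
        Resn.morph_unique (hD i) (fun _ => D.minimal) e1 mx,
        Resn.morph_unique (hD i) (fun _ => D.minimal) e2 e3, add_zero]
    have inr_val : Resn.clsAt (hD i) (fun _ => D.minimal) inr (YExt.mk w) = fy := by
      refine val _ _ fun l hl => ?_
      have e1 := comp_val x fx _ _ (hl.trans hl1) mx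
      have e2 := comp_val y fy _ _ (hl.trans hl2) my
      rw [h3] at e1
      rw [h4] at e2
      have e3 : Morph ((D.R i).res (hD i) n) x 0 0 := by
        simpa using mx.add mx.neg
      rw [Preadditive.comp_add, ← Category.assoc, ← Category.assoc,
        Resn.morph_unique (hD i) (fun _ => D.minimal) e1 e3,
        Resn.morph_unique (hD i) (fun _ => D.minimal) e2 my, zero_add]
    refine ⟨⟨_, fst, snd, inl, inr, h1, h2, h3, h4⟩, hb, YExt.mk w,
      (hc (fun _ => D.minimal) _ _ inl).2 inl_val.symm,
      (hc (fun _ => D.minimal) _ _ inr).2 inr_val.symm,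
      (hc (fun _ => D.minimal) _ _ (inl + inr)).2 ?_⟩
    rw [Resn.clsAt_add, inl_val, inr_val]
    exact hz

theorem equivYExt_product {i j k : I} {p q r : ℕ} (hr : p + q = r)
    (α : YExt ((D.R i).Ω 0) ((D.R j).Ω 0) p) (β : YExt ((D.R j).Ω 0) ((D.R k).Ω 0) q)
    (γ : YExt ((D.R i).Ω 0) ((D.R k).Ω 0) r) :
    IsProduct β α γ ↔ D.equivYExt hD i k r γ =
      D.mul hr (D.equivYExt hD i j p α) (D.equivYExt hD j k q β) := by
  have key : ∀ (e : NExt ((D.R j).Ω 0) ((D.R k).Ω 0) q) (d : NExt ((D.R i).Ω 0) ((D.R j).Ω 0) p)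
      (c : NExt ((D.R i).Ω 0) ((D.R k).Ω 0) r), IsProductRep e d c →
      D.equivYExt hD i k r (YExt.mk c) = D.mul hr (D.equivYExt hD i j p (YExt.mk d))
        (D.equivYExt hD j k q (YExt.mk e)) := by
    intro e d c hp
    subst hr
    have hd := Resn.morph_clsAt (hD i) (fun _ => D.minimal) (𝟙 _) d
    have he := Resn.morph_clsAt (hD j) (fun _ => D.minimal) (𝟙 _) e
    rw [← φ_equivYExt] at hd he
    have hl := (D.lift (D.equivYExt hD i j p (YExt.mk d))).morph ((hD i).shift p) (hD j) q
    rw [D.lift_zero] at hl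
    have h1 := hl.trans_id he
    have h2 := Resn.morph_of_isProductRep (hD i) hp _ _ hd rfl _ h1
    rw [← D.φ.injective.eq_iff, φ_equivYExt]
    exact (Resn.clsAt_eq (hD i) _ h2).trans (D.φ.apply_symm_apply _).symm
  constructor
  · rintro ⟨e, d, c, rfl, rfl, rfl, hp⟩
    exact key e d c hp
  · intro hγ
    obtain ⟨e, rfl⟩ := YExt.exists_rep β
    obtain ⟨d, rfl⟩ := YExt.exists_rep α
    suffices h : ∃ (e' : NExt ((D.R j).Ω 0) ((D.R k).Ω 0) q)
        (d' : NExt ((D.R i).Ω 0) ((D.R j).Ω 0) p) (r' : ℕ)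
        (c : NExt ((D.R i).Ω 0) ((D.R k).Ω 0) r'), YExt.mk e' = YExt.mk e ∧
          YExt.mk d' = YExt.mk d ∧ IsProductRep e' d' c by
      obtain ⟨e', d', r', c, he, hd, hp⟩ := h
      obtain rfl : r' = r := by rw [Resn.isProductRep_add hp, hr]
      refine ⟨e', d', c, he, hd, (D.equivYExt hD i k _).injective ?_, hp⟩
      refine (key e' d' c hp).trans ?_
      rw [hγ, he, hd]
    cases e with
    | hom f =>
      obtain ⟨d', hd', hu⟩ := Resn.exists_rep_pushout (hD i) (fun _ => D.minimal)
        (YExt.mk d)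
      obtain ⟨c, hc, -⟩ := Resn.exists_pushout (hD i)
        (Resn.clsAt (hD i) (fun _ => D.minimal) (𝟙 _) (YExt.mk d) ≫ f)
      exact ⟨_, d', p, c, rfl, hd', .pushout f d' c (hu c f (𝟙 _) hc)⟩
    | @conf _ E ie pe he =>
      cases d with
      | hom g =>
        obtain ⟨x, hx⟩ := (Resn.clsAt_id_bijective (hD i) (fun _ => D.minimal)).2
          (Resn.clsAt (hD i) (fun _ => D.minimal) g (YExt.mk (NExt.conf ie pe he)))
        obtain ⟨c, hc, hu⟩ := Resn.exists_rep_pushout (hD i) (fun _ => D.minimal) x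
        refine ⟨_, _, _, c, rfl, rfl, .pullback _ g c (hu _ (𝟙 _) g ?_)⟩
        rw [Category.comp_id, hx]
        exact Resn.morph_clsAt (hD i) (fun _ => D.minimal) g _
      | conf => exact ⟨_, _, _, _, rfl, rfl, .conf _ _ _ _⟩
      | cons => exact ⟨_, _, _, _, rfl, rfl, .conf _ _ _ _⟩
    | @cons _ E Z q ie pe he e =>
      cases d with
      | hom g =>
        obtain ⟨x, hx⟩ := (Resn.clsAt_id_bijective (hD i) (fun _ => D.minimal)).2
          (Resn.clsAt (hD i) (fun _ => D.minimal) g (YExt.mk (NExt.cons ie pe he e)))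
        obtain ⟨c, hc, hu⟩ := Resn.exists_rep_pushout (hD i) (fun _ => D.minimal) x
        refine ⟨_, _, _, c, rfl, rfl, .pullback _ g c (hu _ (𝟙 _) g ?_)⟩
        rw [Category.comp_id, hx]
        exact Resn.morph_clsAt (hD i) (fun _ => D.minimal) g _
      | conf id pd hd =>
        obtain ⟨r', c, hc⟩ := exists_splice (.conf id pd hd) e
        exact ⟨_, _, _, _, rfl, rfl, .cons _ _ _ _ _ _ hc⟩
      | cons id pd hd d =>
        obtain ⟨r', c, hc⟩ := exists_splice (.cons id pd hd d) e
        exact ⟨_, _, _, _, rfl, rfl, .cons _ _ _ _ _ _ hc⟩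

end MinimalSystem

end YonedaCrossed

namespace YonedaCrossed

namespace Resn

open Abelian

variable {C : Type u} [Category.{v} C] [Abelian C]

/-- A resolution whose constituents are short exact sequences of an abelian category. -/
structure IsExact (R : Resn C) : Prop where
  zero : ∀ k, R.i k ≫ R.p k = 0
  exact : ∀ k, (ShortComplex.mk (R.i k) (R.p k) (zero k)).ShortExact

theorem IsExact.shift {R : Resn C} (h : R.IsExact) (q : ℕ) : (R.shift q).IsExact :=
  ⟨fun _ => h.zero _, fun _ => h.exact _⟩

variable [HasExt.{w} C] {R : Resn C} (h : R.IsExact)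

/-- The Ext-class of the `n`-fold extension given by a resolution. -/
def extCls : ∀ n, Ext.{w} (R.Ω 0) (R.Ω n) n
  | 0 => Ext.mk₀ (𝟙 _)
  | n + 1 => (extCls n).comp (h.exact n).extClass rfl

theorem extCls_add (p : ℕ) : ∀ q, extCls h (p + q) =
    (extCls h p).comp (extCls (h.shift p) q) rfl
  | 0 => (Ext.comp_mk₀_id _).symm
  | q + 1 => by
    change (extCls h (p + q)).comp _ _ = (extCls h p).comp ((extCls (h.shift p) q).comp _ _) _
    rw [extCls_add p q]
    exact Ext.comp_assoc _ _ _ _ _ (add_assoc p q 1)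

theorem extCls_naturality {S : Resn C} (hS : S.IsExact) (F : R.Hom S) :
    ∀ n, (extCls h n).comp (Ext.mk₀ (F.l n)) (add_zero n) =
      (Ext.mk₀ (F.l 0)).comp (extCls hS n) (zero_add n)
  | 0 => by
    change (Ext.mk₀ (𝟙 _)).comp _ _ = Ext.comp _ (Ext.mk₀ (𝟙 _)) _
    rw [Ext.mk₀_id_comp, Ext.comp_mk₀_id]
  | n + 1 => by
    have h1 := ShortComplex.ShortExact.extClass_naturality (h.exact n) (hS.exact n)
      { τ₁ := F.l (n + 1), τ₂ := F.t n, τ₃ := F.l n, comm₁₂ := (F.comm_i n).symm,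
        comm₂₃ := (F.comm_p n).symm }
    change ((extCls h n).comp _ _).comp _ _ = Ext.comp _ ((extCls hS n).comp _ _) _
    rw [Ext.comp_assoc_of_third_deg_zero, h1, ← Ext.comp_assoc_of_second_deg_zero,
      extCls_naturality hS F n, Ext.comp_assoc (a₂₃ := n + 1) _ _ _ (zero_add n) rfl (by omega)]

variable {Y : C} (hac : ∀ k n (e : Ext.{w} (R.P k) Y (n + 1)), e = 0)

include hac in
theorem exists_extCls_comp : ∀ {n m r : ℕ} (hr : n + m = r) (x : Ext.{w} (R.Ω 0) Y r),
    ∃ y : Ext.{w} (R.Ω n) Y m, (extCls h n).comp y hr = x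
  | 0, m, r, hr, x => by
    obtain rfl : m = r := by omega
    exact ⟨x, Ext.mk₀_id_comp x⟩
  | n + 1, m, r, hr, x => by
    obtain ⟨y, rfl⟩ := exists_extCls_comp (n := n) (m := m + 1) (by omega) x
    obtain ⟨z, rfl⟩ := Ext.contravariant_sequence_exact₃ (h.exact n) Y y (hac _ _ _)
      (add_comm 1 m)
    refine ⟨z, ?_⟩
    exact Ext.comp_assoc _ _ _ _ _ (by omega)

variable (hmin : ∀ k (f : R.P k ⟶ Y), R.i k ≫ f = 0)

include hac hmin in
theorem eq_zero_of_extCls_comp : ∀ {n m r : ℕ} (hr : n + m = r) (y : Ext.{w} (R.Ω n) Y m),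
    (extCls h n).comp y hr = 0 → y = 0
  | 0, m, r, hr, y, hy => by
    obtain rfl : m = r := by omega
    rwa [extCls, Ext.mk₀_id_comp] at hy
  | n + 1, m, r, hr, y, hy => by
    have h1 : (h.exact n).extClass.comp y (add_comm 1 m) = 0 := by
      refine eq_zero_of_extCls_comp (n := n) (m := m + 1) (r := r) (by omega) _ ?_
      rw [← hy]
      exact (Ext.comp_assoc _ _ _ _ _ (by omega)).symm
    obtain ⟨z, rfl⟩ := Ext.contravariant_sequence_exact₁ (h.exact n) Y y (add_comm 1 m) h1
    cases m with
    | zero =>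
      obtain ⟨f, rfl⟩ := Ext.mk₀_bijective _ _ |>.2 z
      rw [Ext.mk₀_comp_mk₀]
      change Ext.mk₀ (R.i n ≫ f) = 0
      rw [hmin, Ext.mk₀_zero]
    | succ m => rw [hac _ _ z, Ext.comp_zero]

theorem extCls_comp_mk₀_bijective (hac : ∀ k n (e : Ext.{w} (R.P k) Y (n + 1)), e = 0)
    (hmin : ∀ k (f : R.P k ⟶ Y), R.i k ≫ f = 0) (n : ℕ) :
    Function.Bijective fun f : R.Ω n ⟶ Y => (extCls h n).comp (Ext.mk₀ f) (add_zero n) := by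
  constructor
  · intro f g hfg
    have h1 : (extCls h n).comp (Ext.mk₀ (f + -g)) (add_zero n) = 0 := by
      rw [Ext.mk₀_add, Ext.comp_add, Ext.mk₀_neg, Ext.comp_neg]
      exact add_neg_eq_zero.2 hfg
    have := eq_zero_of_extCls_comp h hac hmin (add_zero n) _ h1
    rw [Ext.mk₀_eq_zero_iff] at this
    exact add_neg_eq_zero.1 this
  · intro x
    obtain ⟨y, rfl⟩ := exists_extCls_comp h hac (add_zero n) x
    obtain ⟨f, rfl⟩ := Ext.mk₀_bijective _ _ |>.2 y
    exact ⟨f, rfl⟩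

end Resn

namespace MinimalSystem

open Abelian

variable {C : Type u} [Category.{v} C] [Abelian C] [HasExt.{w} C] [Linear ℂ C]
  {I : Type*} {T : I → I → ℕ → Type w} [∀ i j n, AddCommGroup (T i j n)]
  [∀ i j n, Module ℂ (T i j n)] (D : MinimalSystem C I T) (hD : ∀ i, (D.R i).IsExact)
  (hac : ∀ i j k n (e : Ext.{w} ((D.R i).P k) ((D.R j).Ω 0) (n + 1)), e = 0)

/-- The identification of the graded pieces of the system with the Ext-groups. -/
def equivExt (i j : I) (n : ℕ) : Ext.{w} ((D.R i).Ω 0) ((D.R j).Ω 0) n ≃ₗ[ℂ] T i j n :=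
  (D.φ.trans (LinearEquiv.ofBijective
    { toFun := fun f : (D.R i).Ω n ⟶ (D.R j).Ω 0 =>
        (Resn.extCls (hD i) n).comp (Ext.mk₀ f) (add_zero n)
      map_add' := fun f g => by rw [Ext.mk₀_add, Ext.comp_add]
      map_smul' := fun c f => by rw [Ext.mk₀_smul, Ext.comp_smul]; rfl }
    (Resn.extCls_comp_mk₀_bijective (hD i) (hac i j) (fun _ => D.minimal) n))).symm

theorem extCls_comp_equivExt {i j : I} {n : ℕ} (x : Ext.{w} ((D.R i).Ω 0) ((D.R j).Ω 0) n) :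
    (Resn.extCls (hD i) n).comp (Ext.mk₀ (D.φ (D.equivExt hD hac i j n x))) (add_zero n) = x :=
  (D.equivExt hD hac i j n).symm_apply_apply x

theorem equivExt_eq {i j : I} {n : ℕ} (x : Ext.{w} ((D.R i).Ω 0) ((D.R j).Ω 0) n) (t : T i j n)
    (h : (Resn.extCls (hD i) n).comp (Ext.mk₀ (D.φ t)) (add_zero n) = x) :
    D.equivExt hD hac i j n x = t := by
  rw [← h]
  exact (D.equivExt hD hac i j n).apply_symm_apply t

theorem equivExt_mk₀ {i j : I} (f : (D.R i).Ω 0 ⟶ (D.R j).Ω 0) :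
    D.φ (D.equivExt hD hac i j 0 (Ext.mk₀ f)) = f := by
  rw [D.equivExt_eq hD hac (Ext.mk₀ f) (D.φ.symm f), LinearEquiv.apply_symm_apply]
  rw [LinearEquiv.apply_symm_apply]
  exact Ext.mk₀_id_comp _

theorem equivExt_comp {i j k : I} {p q r : ℕ} (hr : p + q = r)
    (α : Ext.{w} ((D.R i).Ω 0) ((D.R j).Ω 0) p) (β : Ext.{w} ((D.R j).Ω 0) ((D.R k).Ω 0) q) :
    D.equivExt hD hac i k r (α.comp β hr) =
      D.mul hr (D.equivExt hD hac i j p α) (D.equivExt hD hac j k q β) := by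
  subst hr
  apply D.equivExt_eq hD hac
  have ha := D.extCls_comp_equivExt hD hac α
  have hb := D.extCls_comp_equivExt hD hac β
  set a := D.equivExt hD hac i j p α
  set b := D.equivExt hD hac j k q β
  have h2 := Resn.extCls_naturality ((hD i).shift p) (hD j) (D.lift a) q
  rw [D.lift_zero] at h2
  have h3 := Resn.extCls_add (hD i) p q
  have h1 : D.φ (D.mul rfl a b) = (D.lift a).l q ≫ D.φ b := D.φ.apply_symm_apply _
  generalize (D.lift a).l q = L at h1 h2
  generalize Resn.extCls ((hD i).shift p) q = u at h2 h3
  change (D.R i).Ω (p + q) ⟶ _ at L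
  change Ext ((D.R i).Ω p) ((D.R i).Ω (p + q)) q at u
  change D.φ (D.mul rfl a b) = L ≫ D.φ b at h1
  change Ext.comp u (Ext.mk₀ L) (add_zero q) = _ at h2
  change Resn.extCls (hD i) (p + q) = Ext.comp _ u rfl at h3
  rw [h1, ← Ext.mk₀_comp_mk₀, h3, ← ha, ← hb, ← Ext.comp_assoc_of_third_deg_zero,
    Ext.comp_assoc_of_third_deg_zero (Resn.extCls (hD i) p), h2,
    Ext.comp_assoc_of_second_deg_zero (Resn.extCls (hD i) p),
    ← Ext.comp_assoc_of_third_deg_zero (Ext.mk₀ (D.φ a)),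
    ← Ext.comp_assoc_of_third_deg_zero (Resn.extCls (hD i) p)]
  rfl

end MinimalSystem

/-! ### Contractions on exterior algebras -/

section Contraction

open CliffordAlgebra (contractLeft contractRight)

variable {W : Type u} [AddCommGroup W] [Module ℂ W]

variable (W) in
/-- The action of `⋀ W*` on `⋀ W` by iterated left contractions. -/
def contrAlg : ExteriorAlgebra ℂ (Module.Dual ℂ W) →ₐ[ℂ] Module.End ℂ (ExteriorAlgebra ℂ W) :=
  ExteriorAlgebra.lift ℂ ⟨contractLeft (Q := (0 : QuadraticForm ℂ W)), fun ξ =>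
    LinearMap.ext fun x => CliffordAlgebra.contractLeft_contractLeft ξ x⟩

theorem contrAlg_ι (ξ : Module.Dual ℂ W) (x : ExteriorAlgebra ℂ W) :
    contrAlg W (ExteriorAlgebra.ι ℂ ξ) x = contractLeft (Q := (0 : QuadraticForm ℂ W)) ξ x := by
  rw [contrAlg, ExteriorAlgebra.lift_ι_apply]

theorem contrAlg_mul (a b : ExteriorAlgebra ℂ (Module.Dual ℂ W)) (x : ExteriorAlgebra ℂ W) :
    contrAlg W (a * b) x = contrAlg W a (contrAlg W b x) := by
  rw [map_mul]; rfl

theorem extPow_induction_left {n : ℕ} (p : ExteriorAlgebra ℂ W → Prop)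
    (hm : ∀ w, ∀ y ∈ ⋀[ℂ]^n W, p (ExteriorAlgebra.ι ℂ w * y))
    (ha : ∀ x y, p x → p y → p (x + y)) {x : ExteriorAlgebra ℂ W} (hx : x ∈ ⋀[ℂ]^(n + 1) W) :
    p x := by
  rw [ExteriorAlgebra.exteriorPower, pow_succ'] at hx
  refine Submodule.mul_induction_on hx ?_ ha
  rintro _ ⟨w, rfl⟩ y hy
  exact hm w y hy

theorem extPow_induction_right {n : ℕ} (p : ExteriorAlgebra ℂ W → Prop)
    (hm : ∀ w, ∀ y ∈ ⋀[ℂ]^n W, p (y * ExteriorAlgebra.ι ℂ w))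
    (ha : ∀ x y, p x → p y → p (x + y)) {x : ExteriorAlgebra ℂ W} (hx : x ∈ ⋀[ℂ]^(n + 1) W) :
    p x := by
  rw [ExteriorAlgebra.exteriorPower, pow_succ] at hx
  refine Submodule.mul_induction_on hx ?_ ha
  rintro y hy _ ⟨w, rfl⟩
  exact hm w y hy

theorem ι_mul_mem {n : ℕ} (w : W) {y : ExteriorAlgebra ℂ W} (hy : y ∈ ⋀[ℂ]^n W) :
    ExteriorAlgebra.ι ℂ w * y ∈ ⋀[ℂ]^(n + 1) W := by
  rw [ExteriorAlgebra.exteriorPower, pow_succ']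
  exact Submodule.mul_mem_mul ⟨w, rfl⟩ hy

theorem mul_ι_mem {n : ℕ} (w : W) {y : ExteriorAlgebra ℂ W} (hy : y ∈ ⋀[ℂ]^n W) :
    y * ExteriorAlgebra.ι ℂ w ∈ ⋀[ℂ]^(n + 1) W := by
  rw [ExteriorAlgebra.exteriorPower, pow_succ]
  exact Submodule.mul_mem_mul hy ⟨w, rfl⟩

theorem exists_of_mem_extPow_zero {y : ExteriorAlgebra ℂ W} (hy : y ∈ ⋀[ℂ]^0 W) :
    ∃ c : ℂ, algebraMap ℂ _ c = y := by
  rw [ExteriorAlgebra.exteriorPower, pow_zero] at hy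
  exact Submodule.mem_one.1 hy

theorem contractLeft_of_mem_zero (ξ : Module.Dual ℂ W) {y : ExteriorAlgebra ℂ W}
    (hy : y ∈ ⋀[ℂ]^0 W) : contractLeft (Q := (0 : QuadraticForm ℂ W)) ξ y = 0 := by
  obtain ⟨c, rfl⟩ := exists_of_mem_extPow_zero hy
  exact CliffordAlgebra.contractLeft_algebraMap (Q := (0 : QuadraticForm ℂ W)) ξ c

theorem contractRight_of_mem_zero (ξ : Module.Dual ℂ W) {y : ExteriorAlgebra ℂ W}
    (hy : y ∈ ⋀[ℂ]^0 W) : contractRight (Q := (0 : QuadraticForm ℂ W)) y ξ = 0 := by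
  obtain ⟨c, rfl⟩ := exists_of_mem_extPow_zero hy
  exact CliffordAlgebra.contractRight_algebraMap (Q := (0 : QuadraticForm ℂ W)) ξ c

theorem contractLeft_mem (ξ : Module.Dual ℂ W) : ∀ {n : ℕ} {x : ExteriorAlgebra ℂ W},
    x ∈ ⋀[ℂ]^(n + 1) W → contractLeft (Q := (0 : QuadraticForm ℂ W)) ξ x ∈ ⋀[ℂ]^n W := by
  intro n
  induction n with
  | zero =>
    intro x hx
    refine extPow_induction_left (fun x => contractLeft (Q := (0 : QuadraticForm ℂ W)) ξ x ∈ ⋀[ℂ]^0 W)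
      (fun w y hy => ?_) (fun x y hx hy => ?_) hx
    · refine (congrArg (· ∈ ⋀[ℂ]^0 W)
        (CliffordAlgebra.contractLeft_ι_mul (Q := (0 : QuadraticForm ℂ W)) ξ w y)).mpr ?_
      rw [contractLeft_of_mem_zero ξ hy, mul_zero, sub_zero]
      exact Submodule.smul_mem _ _ hy
    · rw [map_add]; exact Submodule.add_mem _ hx hy
  | succ n ih =>
    intro x hx
    refine extPow_induction_left (fun x => contractLeft (Q := (0 : QuadraticForm ℂ W)) ξ x ∈ ⋀[ℂ]^(n + 1) W)
      (fun w y hy => ?_) (fun x y hx hy => ?_) hx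
    · refine (congrArg (· ∈ ⋀[ℂ]^(n + 1) W)
        (CliffordAlgebra.contractLeft_ι_mul (Q := (0 : QuadraticForm ℂ W)) ξ w y)).mpr ?_
      exact Submodule.sub_mem _ (Submodule.smul_mem _ _ hy) (ι_mul_mem w (ih hy))
    · rw [map_add]; exact Submodule.add_mem _ hx hy

theorem contractRight_mem (ξ : Module.Dual ℂ W) : ∀ {n : ℕ} {x : ExteriorAlgebra ℂ W},
    x ∈ ⋀[ℂ]^(n + 1) W → contractRight (Q := (0 : QuadraticForm ℂ W)) x ξ ∈ ⋀[ℂ]^n W := by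
  intro n
  induction n with
  | zero =>
    intro x hx
    refine extPow_induction_right (fun x => contractRight (Q := (0 : QuadraticForm ℂ W)) x ξ ∈ ⋀[ℂ]^0 W)
      (fun w y hy => ?_) (fun x y hx hy => ?_) hx
    · refine (congrArg (· ∈ ⋀[ℂ]^0 W)
        (CliffordAlgebra.contractRight_mul_ι (Q := (0 : QuadraticForm ℂ W)) ξ w y)).mpr ?_
      rw [contractRight_of_mem_zero ξ hy, zero_mul, sub_zero]
      exact Submodule.smul_mem _ _ hy
    · rw [map_add, LinearMap.add_apply]; exact Submodule.add_mem _ hx hy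
  | succ n ih =>
    intro x hx
    refine extPow_induction_right (fun x => contractRight (Q := (0 : QuadraticForm ℂ W)) x ξ ∈ ⋀[ℂ]^(n + 1) W)
      (fun w y hy => ?_) (fun x y hx hy => ?_) hx
    · refine (congrArg (· ∈ ⋀[ℂ]^(n + 1) W)
        (CliffordAlgebra.contractRight_mul_ι (Q := (0 : QuadraticForm ℂ W)) ξ w y)).mpr ?_
      exact Submodule.sub_mem _ (Submodule.smul_mem _ _ hy) (mul_ι_mem w (ih hy))
    · rw [map_add, LinearMap.add_apply]; exact Submodule.add_mem _ hx hy

theorem contrAlg_mem : ∀ {p k : ℕ} {a : ExteriorAlgebra ℂ (Module.Dual ℂ W)}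
    {x : ExteriorAlgebra ℂ W}, a ∈ ⋀[ℂ]^p (Module.Dual ℂ W) → x ∈ ⋀[ℂ]^(p + k) W →
      contrAlg W a x ∈ ⋀[ℂ]^k W := by
  intro p
  induction p with
  | zero =>
    intro k a x ha hx
    obtain ⟨c, rfl⟩ := exists_of_mem_extPow_zero ha
    rw [AlgHom.commutes, Module.algebraMap_end_apply]
    rw [zero_add] at hx
    exact Submodule.smul_mem _ _ hx
  | succ p ih =>
    intro k a x ha hx
    refine extPow_induction_left (fun a => contrAlg W a x ∈ ⋀[ℂ]^k W)
      (fun ξ y hy => ?_) (fun a b ha hb => ?_) ha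
    · rw [contrAlg_mul, contrAlg_ι]
      refine contractLeft_mem ξ (ih hy ?_)
      rwa [show p + (k + 1) = p + 1 + k by omega]
    · rw [map_add, LinearMap.add_apply]; exact Submodule.add_mem _ ha hb

theorem contractLeft_involute (ξ : Module.Dual ℂ W) (x : CliffordAlgebra (0 : QuadraticForm ℂ W)) :
    contractLeft ξ (CliffordAlgebra.involute x) = -CliffordAlgebra.involute (contractLeft ξ x) := by
  induction x using CliffordAlgebra.left_induction with
  | algebraMap c =>
    rw [AlgHom.commutes, CliffordAlgebra.contractLeft_algebraMap, map_zero, neg_zero]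
  | add x y hx hy => rw [map_add, map_add, hx, hy, map_add, map_add, neg_add]
  | ι_mul x w hx =>
    rw [map_mul, CliffordAlgebra.involute_ι, neg_mul, map_neg, CliffordAlgebra.contractLeft_ι_mul,
      CliffordAlgebra.contractLeft_ι_mul, hx, map_sub, map_smul, map_mul,
      CliffordAlgebra.involute_ι, neg_mul, mul_neg]

theorem contractRight_ι_mul (η : Module.Dual ℂ W) (w : W)
    (x : CliffordAlgebra (0 : QuadraticForm ℂ W)) :
    contractRight (CliffordAlgebra.ι 0 w * x) η =
      CliffordAlgebra.ι 0 w * contractRight x η + η w • CliffordAlgebra.involute x := by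
  induction x using CliffordAlgebra.right_induction with
  | algebraMap c =>
    rw [AlgHom.commutes, CliffordAlgebra.contractRight_algebraMap,
      CliffordAlgebra.contractRight_mul_algebraMap, CliffordAlgebra.contractRight_ι, mul_zero,
      zero_add, Algebra.smul_def, Algebra.commutes]
  | add x y hx hy =>
    rw [mul_add, map_add, LinearMap.add_apply, hx, hy, map_add, LinearMap.add_apply, map_add,
      mul_add, smul_add]
    abel
  | mul_ι v x hx =>
    rw [← mul_assoc, CliffordAlgebra.contractRight_mul_ι, hx, CliffordAlgebra.contractRight_mul_ι,
      map_mul, CliffordAlgebra.involute_ι, mul_sub, add_mul, smul_mul_assoc, mul_neg, smul_neg,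
      mul_smul_comm, mul_assoc]
    abel

theorem contractRight_contractLeft (ξ η : Module.Dual ℂ W)
    (x : CliffordAlgebra (0 : QuadraticForm ℂ W)) :
    contractRight (contractLeft ξ x) η = contractLeft ξ (contractRight x η) := by
  induction x using CliffordAlgebra.left_induction with
  | algebraMap c =>
    rw [CliffordAlgebra.contractLeft_algebraMap, CliffordAlgebra.contractRight_algebraMap,
      map_zero, map_zero, LinearMap.zero_apply]
  | add x y hx hy => simp only [map_add, LinearMap.add_apply, hx, hy]
  | ι_mul x w hx =>
    rw [CliffordAlgebra.contractLeft_ι_mul, contractRight_ι_mul, map_add,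
      CliffordAlgebra.contractLeft_ι_mul, map_smul, contractLeft_involute, map_sub, map_smul,
      LinearMap.sub_apply, LinearMap.smul_apply, contractRight_ι_mul, hx, smul_neg]
    abel

theorem contrAlg_contractRight (a : ExteriorAlgebra ℂ (Module.Dual ℂ W)) (ξ : Module.Dual ℂ W)
    (x : ExteriorAlgebra ℂ W) :
    contrAlg W a (contractRight (Q := (0 : QuadraticForm ℂ W)) x ξ) =
      contractRight (Q := (0 : QuadraticForm ℂ W)) (contrAlg W a x) ξ := by
  induction a using ExteriorAlgebra.induction generalizing x with
  | algebraMap c =>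
    rw [AlgHom.commutes, Module.algebraMap_end_apply, Module.algebraMap_end_apply, map_smul]
    rfl
  | ι η =>
    rw [contrAlg_ι, contrAlg_ι]
    exact (contractRight_contractLeft η ξ x).symm
  | mul a b ha hb => rw [contrAlg_mul, contrAlg_mul, hb, ha]
  | add a b ha hb =>
    rw [map_add, LinearMap.add_apply, LinearMap.add_apply, ha, hb, map_add, LinearMap.add_apply]

theorem coe_exteriorPower_map {W' : Type u} [AddCommGroup W'] [Module ℂ W'] (f : W →ₗ[ℂ] W')
    {n : ℕ} (x : ⋀[ℂ]^n W) :
    (exteriorPower.map n f x : ExteriorAlgebra ℂ W') = ExteriorAlgebra.map f x := by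
  have : (⋀[ℂ]^n W').subtype ∘ₗ exteriorPower.map n f =
      (ExteriorAlgebra.map f).toLinearMap ∘ₗ (⋀[ℂ]^n W).subtype := by
    apply exteriorPower.linearMap_ext
    ext v
    simp [ExteriorAlgebra.ιMulti_apply, map_list_prod, List.map_ofFn, Function.comp_def]
  exact LinearMap.congr_fun this x

theorem contractLeft_map (f : W →ₗ[ℂ] W) {ξ ξ' : Module.Dual ℂ W} (h : ξ' ∘ₗ f = ξ)
    (x : ExteriorAlgebra ℂ W) :
    contractLeft (Q := (0 : QuadraticForm ℂ W)) ξ' (ExteriorAlgebra.map f x) =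
      ExteriorAlgebra.map f (contractLeft (Q := (0 : QuadraticForm ℂ W)) ξ x) := by
  induction x using CliffordAlgebra.left_induction with
  | algebraMap c =>
    rw [CliffordAlgebra.contractLeft_algebraMap, map_zero]
    erw [AlgHom.commutes]
    exact CliffordAlgebra.contractLeft_algebraMap (Q := (0 : QuadraticForm ℂ W)) ξ' c
  | add x y hx hy => rw [map_add, map_add, hx, hy, map_add, map_add]
  | ι_mul x w hx =>
    have h1 : ExteriorAlgebra.map f (CliffordAlgebra.ι 0 w * x) =
      ExteriorAlgebra.ι ℂ (f w) * ExteriorAlgebra.map f x := by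
      rw [map_mul]; exact congrArg (· * _) (ExteriorAlgebra.map_apply_ι f w)
    rw [h1]
    refine (CliffordAlgebra.contractLeft_ι_mul (Q := (0 : QuadraticForm ℂ W)) ξ' (f w) _).trans ?_
    rw [hx, CliffordAlgebra.contractLeft_ι_mul, map_sub, map_smul, map_mul]
    congr 1
    · rw [← h]; rfl
    · exact congrArg (· * _) (ExteriorAlgebra.map_apply_ι f w).symm

theorem contractRight_map (f : W →ₗ[ℂ] W) {ξ ξ' : Module.Dual ℂ W} (h : ξ' ∘ₗ f = ξ)
    (x : ExteriorAlgebra ℂ W) :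
    contractRight (Q := (0 : QuadraticForm ℂ W)) (ExteriorAlgebra.map f x) ξ' =
      ExteriorAlgebra.map f (contractRight (Q := (0 : QuadraticForm ℂ W)) x ξ) := by
  induction x using CliffordAlgebra.right_induction with
  | algebraMap c =>
    rw [CliffordAlgebra.contractRight_algebraMap, map_zero]
    erw [AlgHom.commutes]
    exact CliffordAlgebra.contractRight_algebraMap (Q := (0 : QuadraticForm ℂ W)) ξ' c
  | add x y hx hy =>
    rw [map_add, map_add, LinearMap.add_apply, hx, hy, map_add, LinearMap.add_apply, map_add]
  | mul_ι w x hx =>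
    have h1 : ExteriorAlgebra.map f (x * CliffordAlgebra.ι 0 w) =
      ExteriorAlgebra.map f x * ExteriorAlgebra.ι ℂ (f w) := by
      rw [map_mul]; exact congrArg (_ * ·) (ExteriorAlgebra.map_apply_ι f w)
    rw [h1]
    refine (CliffordAlgebra.contractRight_mul_ι (Q := (0 : QuadraticForm ℂ W)) ξ' (f w) _).trans ?_
    rw [hx, CliffordAlgebra.contractRight_mul_ι, map_sub, map_smul, map_mul]
    congr 1
    · rw [← h]; rfl
    · exact congrArg (_ * ·) (ExteriorAlgebra.map_apply_ι f w).symm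

theorem contrAlg_map (f : W →ₗ[ℂ] W) (f' : Module.Dual ℂ W →ₗ[ℂ] Module.Dual ℂ W)
    (h : ∀ ξ, f' ξ ∘ₗ f = ξ) (a : ExteriorAlgebra ℂ (Module.Dual ℂ W)) (x : ExteriorAlgebra ℂ W) :
    contrAlg W (ExteriorAlgebra.map f' a) (ExteriorAlgebra.map f x) =
      ExteriorAlgebra.map f (contrAlg W a x) := by
  induction a using ExteriorAlgebra.induction generalizing x with
  | algebraMap c =>
    rw [AlgHom.commutes, AlgHom.commutes, Module.algebraMap_end_apply,
      Module.algebraMap_end_apply, map_smul]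
  | ι η => rw [ExteriorAlgebra.map_apply_ι, contrAlg_ι, contrAlg_ι, contractLeft_map f (h η)]
  | mul a b ha hb => rw [map_mul, contrAlg_mul, contrAlg_mul, hb, ha]
  | add a b ha hb =>
    rw [map_add, map_add, LinearMap.add_apply, map_add, LinearMap.add_apply, ha, hb, map_add]

section Basis

variable {κ : Type*} [Fintype κ] (b : Module.Basis κ ℂ W)

theorem sum_ι_mul_contractLeft {n : ℕ} {x : ExteriorAlgebra ℂ W} (hx : x ∈ ⋀[ℂ]^n W) :
    ∑ i, ExteriorAlgebra.ι ℂ (b i) * contractLeft (Q := (0 : QuadraticForm ℂ W)) (b.coord i) x =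
      (n : ℂ) • x := by
  induction n generalizing x with
  | zero =>
    rw [Nat.cast_zero, zero_smul]
    exact Finset.sum_eq_zero fun i _ => by rw [contractLeft_of_mem_zero _ hx, mul_zero]
  | succ n ih =>
    refine extPow_induction_left (fun x => ∑ i, ExteriorAlgebra.ι ℂ (b i) *
      contractLeft (Q := (0 : QuadraticForm ℂ W)) (b.coord i) x = ((n + 1 : ℕ) : ℂ) • x)
      (fun w y hy => ?_) (fun a b ha hb => ?_) hx
    · have h1 : ∀ i, ExteriorAlgebra.ι ℂ (b i) *
          contractLeft (Q := (0 : QuadraticForm ℂ W)) (b.coord i) (ExteriorAlgebra.ι ℂ w * y) =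
          ExteriorAlgebra.ι ℂ (b.coord i w • b i) * y + ExteriorAlgebra.ι ℂ w *
            (ExteriorAlgebra.ι ℂ (b i) *
              contractLeft (Q := (0 : QuadraticForm ℂ W)) (b.coord i) y) := by
        intro i
        refine (congrArg (_ * ·) (CliffordAlgebra.contractLeft_ι_mul
          (Q := (0 : QuadraticForm ℂ W)) (b.coord i) w y)).trans ?_
        rw [mul_sub, ← mul_assoc, ← mul_assoc]
        have h2 : ExteriorAlgebra.ι ℂ (b i) * ExteriorAlgebra.ι ℂ w =
            - (ExteriorAlgebra.ι ℂ w * ExteriorAlgebra.ι ℂ (b i)) :=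
          eq_neg_of_add_eq_zero_left (ExteriorAlgebra.ι_add_mul_swap (R := ℂ) (b i) w)
        refine (congrArg (_ - · * _) h2).trans ?_
        rw [neg_mul, sub_neg_eq_add, map_smul, mul_smul_comm, smul_mul_assoc]
      rw [Finset.sum_congr rfl fun i _ => h1 i, Finset.sum_add_distrib, ← Finset.mul_sum, ih hy,
        ← Finset.sum_mul, ← map_sum]
      simp only [Module.Basis.coord_apply]
      rw [b.sum_repr, mul_smul_comm, Nat.cast_succ, add_smul, one_smul, add_comm]
    · simp only [map_add, mul_add, Finset.sum_add_distrib, ha, hb, smul_add]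

theorem sum_contractRight_mul_ι {n : ℕ} {x : ExteriorAlgebra ℂ W} (hx : x ∈ ⋀[ℂ]^n W) :
    ∑ i, contractRight (Q := (0 : QuadraticForm ℂ W)) x (b.coord i) * ExteriorAlgebra.ι ℂ (b i) =
      (n : ℂ) • x := by
  induction n generalizing x with
  | zero =>
    rw [Nat.cast_zero, zero_smul]
    exact Finset.sum_eq_zero fun i _ => by rw [contractRight_of_mem_zero _ hx, zero_mul]
  | succ n ih =>
    refine extPow_induction_right (fun x => ∑ i, contractRight (Q := (0 : QuadraticForm ℂ W)) x (b.coord i) *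
      ExteriorAlgebra.ι ℂ (b i) = ((n + 1 : ℕ) : ℂ) • x)
      (fun w y hy => ?_) (fun a b ha hb => ?_) hx
    · have h1 : ∀ i, 
          contractRight (Q := (0 : QuadraticForm ℂ W)) (y * ExteriorAlgebra.ι ℂ w) (b.coord i) *
            ExteriorAlgebra.ι ℂ (b i) =
          y * ExteriorAlgebra.ι ℂ (b.coord i w • b i) + 
            (contractRight (Q := (0 : QuadraticForm ℂ W)) y (b.coord i) *
              ExteriorAlgebra.ι ℂ (b i)) * ExteriorAlgebra.ι ℂ w := by
        intro i
        refine (congrArg (· * _) (CliffordAlgebra.contractRight_mul_ι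
          (Q := (0 : QuadraticForm ℂ W)) (b.coord i) w y)).trans ?_
        rw [sub_mul, mul_assoc, mul_assoc]
        have h2 : ExteriorAlgebra.ι ℂ w * ExteriorAlgebra.ι ℂ (b i) =
            - (ExteriorAlgebra.ι ℂ (b i) * ExteriorAlgebra.ι ℂ w) :=
          eq_neg_of_add_eq_zero_left (ExteriorAlgebra.ι_add_mul_swap (R := ℂ) w (b i))
        refine (congrArg (_ - _ * ·) h2).trans ?_
        rw [mul_neg, sub_neg_eq_add, map_smul, mul_smul_comm, smul_mul_assoc]
      rw [Finset.sum_congr rfl fun i _ => h1 i, Finset.sum_add_distrib, ← Finset.sum_mul, ih hy,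
        ← Finset.mul_sum, ← map_sum]
      simp only [Module.Basis.coord_apply]
      rw [b.sum_repr, smul_mul_assoc, Nat.cast_succ, add_smul, one_smul, add_comm]
    · simp only [map_add, LinearMap.add_apply, add_mul, Finset.sum_add_distrib, ha, hb, smul_add]

end Basis

end Contraction

section GradedContraction

open CliffordAlgebra (contractLeft contractRight)

variable (W : Type u) [AddCommGroup W] [Module ℂ W]

/-- The contraction `⋀ᵖ W* × ⋀ⁿ W → ⋀ᵏ W` for `n = p + k`. -/
def contrDeg (p k n : ℕ) (h : p + k = n) :
    ⋀[ℂ]^p (Module.Dual ℂ W) →ₗ[ℂ] ⋀[ℂ]^n W →ₗ[ℂ] ⋀[ℂ]^k W :=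
  LinearMap.mk₂ ℂ (fun a x => ⟨contrAlg W a x, contrAlg_mem a.2 (h ▸ x.2)⟩)
    (fun a b x => Subtype.ext (by simp)) (fun c a x => Subtype.ext (by simp))
    (fun a x y => Subtype.ext (by simp)) (fun c a x => Subtype.ext (by simp))

theorem coe_contrDeg {p k n : ℕ} (h : p + k = n) (a : ⋀[ℂ]^p (Module.Dual ℂ W))
    (x : ⋀[ℂ]^n W) : (contrDeg W p k n h a x : ExteriorAlgebra ℂ W) = contrAlg W a x := rfl

/-- The product of `⋀ W` in given degrees. -/
def mulDeg (q p r : ℕ) (h : p + q = r) : ⋀[ℂ]^q W →ₗ[ℂ] ⋀[ℂ]^p W →ₗ[ℂ] ⋀[ℂ]^r W :=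
  LinearMap.mk₂ ℂ (fun a x => ⟨(a : ExteriorAlgebra ℂ W) * x, by
      have := SetLike.mul_mem_graded a.2 x.2
      rwa [add_comm, h] at this⟩)
    (fun a b x => Subtype.ext (by simp [add_mul])) (fun c a x => Subtype.ext (by simp))
    (fun a x y => Subtype.ext (by simp [mul_add])) (fun c a x => Subtype.ext (by simp))

theorem coe_mulDeg {q p r : ℕ} (h : p + q = r) (a : ⋀[ℂ]^q W) (x : ⋀[ℂ]^p W) :
    (mulDeg W q p r h a x : ExteriorAlgebra ℂ W) = a * x := rfl

variable {W}

/-- Right contraction with `ξ` in degree `k + 1`. -/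
def rightContr (ξ : Module.Dual ℂ W) (k : ℕ) : ⋀[ℂ]^(k + 1) W →ₗ[ℂ] ⋀[ℂ]^k W :=
  (((contractRight (Q := (0 : QuadraticForm ℂ W))).flip ξ).comp
    (⋀[ℂ]^(k + 1) W).subtype).codRestrict _ fun x => contractRight_mem ξ x.2

/-- Right multiplication by `w` in degree `k`. -/
def rightMul (w : W) (k : ℕ) : ⋀[ℂ]^k W →ₗ[ℂ] ⋀[ℂ]^(k + 1) W :=
  ((LinearMap.mulRight ℂ (ExteriorAlgebra.ι ℂ w)).comp
    (⋀[ℂ]^k W).subtype).codRestrict _ fun x => mul_ι_mem w x.2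

theorem coe_rightContr (ξ : Module.Dual ℂ W) {k : ℕ} (x : ⋀[ℂ]^(k + 1) W) :
    (rightContr ξ k x : ExteriorAlgebra ℂ W) =
      contractRight (Q := (0 : QuadraticForm ℂ W)) x.1 ξ := rfl

theorem rightContr_rightMul_zero (ξ : Module.Dual ℂ W) (w : W) :
    rightContr ξ 0 ∘ₗ rightMul w 0 = ξ w • LinearMap.id := by
  refine LinearMap.ext fun x => Subtype.ext ?_
  refine (CliffordAlgebra.contractRight_mul_ι (Q := (0 : QuadraticForm ℂ W)) ξ w x.1).trans ?_
  rw [contractRight_of_mem_zero ξ x.2, zero_mul, sub_zero]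
  rfl

theorem rightContr_rightMul_succ (ξ : Module.Dual ℂ W) (w : W) (k : ℕ) :
    rightContr ξ (k + 1) ∘ₗ rightMul w (k + 1) =
      ξ w • LinearMap.id - rightMul w k ∘ₗ rightContr ξ k :=
  LinearMap.ext fun x => Subtype.ext
    (CliffordAlgebra.contractRight_mul_ι (Q := (0 : QuadraticForm ℂ W)) ξ w x.1)

theorem rightContr_rightContr (ξ η : Module.Dual ℂ W) (k : ℕ) :
    rightContr ξ k ∘ₗ rightContr η (k + 1) = -(rightContr η k ∘ₗ rightContr ξ (k + 1)) :=
  LinearMap.ext fun x => Subtype.ext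
    (CliffordAlgebra.contractRight_comm (Q := (0 : QuadraticForm ℂ W)) (d := η) (d' := ξ) x.1)

theorem sum_rightMul_rightContr {κ : Type*} [Fintype κ] (b : Module.Basis κ ℂ W) (k : ℕ) :
    ∑ i, rightMul (b i) k ∘ₗ rightContr (b.coord i) k =
      ((k + 1 : ℕ) : ℂ) • (LinearMap.id : ⋀[ℂ]^(k + 1) W →ₗ[ℂ] ⋀[ℂ]^(k + 1) W) := by
  refine LinearMap.ext fun x => Subtype.ext ?_
  have := sum_contractRight_mul_ι b x.2
  rw [LinearMap.sum_apply, AddSubmonoidClass.coe_finsetSum]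
  exact this

theorem contrDeg_comp_rightContr {p k n : ℕ} (h : p + k = n) (h' : p + (k + 1) = n + 1)
    (a : ⋀[ℂ]^p (Module.Dual ℂ W)) (ξ : Module.Dual ℂ W) :
    contrDeg W p k n h a ∘ₗ rightContr ξ n =
      rightContr ξ k ∘ₗ contrDeg W p (k + 1) (n + 1) h' a :=
  LinearMap.ext fun x => Subtype.ext (contrAlg_contractRight a.1 ξ x.1)

theorem contrDeg_mulDeg {p q r k m n : ℕ} (hr : p + q = r) (h : r + k = n) (h' : q + k = m)
    (h'' : p + m = n) (a : ⋀[ℂ]^q (Module.Dual ℂ W)) (b : ⋀[ℂ]^p (Module.Dual ℂ W)) :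
    contrDeg W r k n h (mulDeg _ q p r hr a b) = contrDeg W q k m h' a ∘ₗ contrDeg W p m n h'' b :=
  LinearMap.ext fun x => Subtype.ext (contrAlg_mul a.1 b.1 x.1)

variable {H : Type u} [Group H] (τ : Representation ℂ H W)

theorem coe_extPowerRep (g : H) {n : ℕ} (x : ⋀[ℂ]^n W) :
    (extPowerRep τ n g x : ExteriorAlgebra ℂ W) = ExteriorAlgebra.map (τ g) x :=
  coe_exteriorPower_map _ _

theorem dual_apply_comp (g : H) (ξ : Module.Dual ℂ W) : τ.dual g ξ ∘ₗ τ g = ξ := by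
  refine LinearMap.ext fun x => ?_
  rw [Representation.dual_apply]
  change ξ (τ g⁻¹ (τ g x)) = ξ x
  rw [← Module.End.mul_apply, ← map_mul, inv_mul_cancel, map_one, Module.End.one_apply]

theorem extPowerRep_rightContr (g : H) (ξ : Module.Dual ℂ W) (k : ℕ) :
    extPowerRep τ k g ∘ₗ rightContr ξ k = rightContr (τ.dual g ξ) k ∘ₗ extPowerRep τ (k + 1) g := by
  refine LinearMap.ext fun x => Subtype.ext ?_
  rw [LinearMap.comp_apply, LinearMap.comp_apply, coe_extPowerRep, coe_rightContr, coe_rightContr,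
    coe_extPowerRep, contractRight_map (τ g) (dual_apply_comp τ g ξ)]

theorem extPowerRep_contrDeg (g : H) {p k n : ℕ} (h : p + k = n)
    (a : ⋀[ℂ]^p (Module.Dual ℂ W)) :
    extPowerRep τ k g ∘ₗ contrDeg W p k n h a =
      contrDeg W p k n h (extPowerRep τ.dual p g a) ∘ₗ extPowerRep τ n g := by
  refine LinearMap.ext fun x => Subtype.ext ?_
  rw [LinearMap.comp_apply, LinearMap.comp_apply, coe_extPowerRep, coe_contrDeg, coe_contrDeg,
    coe_extPowerRep, coe_extPowerRep, contrAlg_map (τ g) (τ.dual g) (dual_apply_comp τ g)]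

/-! ### The perfect pairing -/

theorem eq_zero_of_contrDeg [FiniteDimensional ℂ W] : ∀ {n : ℕ} (x : ⋀[ℂ]^n W),
    (∀ a, contrDeg W n 0 n rfl a x = 0) → x = 0 := by
  intro n
  induction n with
  | zero =>
    intro x hx
    have h1 := congrArg Subtype.val (hx ⟨1, ?_⟩)
    · rw [coe_contrDeg, map_one] at h1
      exact Subtype.ext h1
    · rw [ExteriorAlgebra.exteriorPower, pow_zero]; exact Submodule.mem_one.2 ⟨1, map_one _⟩
  | succ n ih =>
    intro x hx
    have h1 : ∀ ξ : Module.Dual ℂ W, contractLeft (Q := (0 : QuadraticForm ℂ W)) ξ x.1 = 0 := by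
      intro ξ
      refine congrArg Subtype.val (ih ⟨_, contractLeft_mem ξ x.2⟩ fun a => Subtype.ext ?_)
      have h2 := congrArg Subtype.val (hx ⟨a.1 * ExteriorAlgebra.ι ℂ ξ, mul_ι_mem ξ a.2⟩)
      rw [coe_contrDeg, contrAlg_mul, contrAlg_ι] at h2
      exact h2
    have h2 := sum_ι_mul_contractLeft (Module.finBasis ℂ W) x.2
    simp only [h1, mul_zero, Finset.sum_const_zero] at h2
    exact Subtype.ext ((smul_eq_zero.1 h2.symm).resolve_left (Nat.cast_ne_zero.2 n.succ_ne_zero))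

variable (W) in
/-- The pairing of `⋀ⁿ W*` with `⋀ⁿ W`. -/
def extPairing (n : ℕ) : ⋀[ℂ]^n (Module.Dual ℂ W) →ₗ[ℂ] Module.Dual ℂ (⋀[ℂ]^n W) :=
  (LinearMap.llcomp ℂ _ _ _ (exteriorPower.zeroEquiv ℂ W).toLinearMap) ∘ₗ contrDeg W n 0 n rfl

theorem extPairing_bijective [FiniteDimensional ℂ W] (n : ℕ) :
    Function.Bijective (extPairing W n) := by
  have h1 : Function.Injective (extPairing W n).flip := by
    rw [injective_iff_map_eq_zero]
    intro x hx
    refine eq_zero_of_contrDeg x fun a => ?_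
    have := LinearMap.congr_fun hx a
    exact (exteriorPower.zeroEquiv ℂ W).map_eq_zero_iff.1 this
  have h2 : Module.finrank ℂ (⋀[ℂ]^n W) = Module.finrank ℂ (⋀[ℂ]^n (Module.Dual ℂ W)) := by
    rw [exteriorPower.finrank_eq, exteriorPower.finrank_eq, Subspace.dual_finrank_eq]
  have h4 : Function.Injective (extPairing W n) := by
    rw [injective_iff_map_eq_zero]
    intro a ha
    have h5 : Function.Surjective (extPairing W n).flip :=
      (LinearMap.injective_iff_surjective_of_finrank_eq_finrank
        (by rw [Subspace.dual_finrank_eq, h2])).1 h1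
    refine (Module.forall_dual_apply_eq_zero_iff ℂ a).1 fun φ => ?_
    obtain ⟨x, rfl⟩ := h5 φ
    exact LinearMap.congr_fun ha x
  exact ⟨h4, (LinearMap.injective_iff_surjective_of_finrank_eq_finrank
        (by rw [Subspace.dual_finrank_eq, h2])).1 h4⟩

end GradedContraction

/-! ### The action of `Hom(V, V') ⊗ ⋀ W*` on `V ⊗ ⋀ W` -/

section Act

variable {W : Type u} [AddCommGroup W] [Module ℂ W]
  (V V' V'' : Type u) [AddCommGroup V] [Module ℂ V] [AddCommGroup V'] [Module ℂ V']
  [AddCommGroup V''] [Module ℂ V'']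

variable (W) in
/-- The action `V ⊗ ⋀ⁿ W → V' ⊗ ⋀ᵏ W` of the elements of `Hom(V, V') ⊗ ⋀ᵖ W*`. -/
def actDeg (p k n : ℕ) (h : p + k = n) :
    (V →ₗ[ℂ] V') ⊗[ℂ] ⋀[ℂ]^p (Module.Dual ℂ W) →ₗ[ℂ]
      V ⊗[ℂ] ⋀[ℂ]^n W →ₗ[ℂ] V' ⊗[ℂ] ⋀[ℂ]^k W :=
  TensorProduct.homTensorHomMap (.id ℂ) V (⋀[ℂ]^n W) V' (⋀[ℂ]^k W) ∘ₗ
    LinearMap.lTensor _ (contrDeg W p k n h)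

theorem actDeg_tmul {p k n : ℕ} (h : p + k = n) (ψ : V →ₗ[ℂ] V')
    (a : ⋀[ℂ]^p (Module.Dual ℂ W)) :
    actDeg W V V' p k n h (ψ ⊗ₜ a) = TensorProduct.map ψ (contrDeg W p k n h a) := rfl

variable (W) in
/-- The product of `Hom(V', V'') ⊗ ⋀ W` and `Hom(V, V') ⊗ ⋀ W` in given degrees. -/
def gradedMul (q p r : ℕ) (h : p + q = r) :
    (V' →ₗ[ℂ] V'') ⊗[ℂ] ⋀[ℂ]^q W →ₗ[ℂ] (V →ₗ[ℂ] V') ⊗[ℂ] ⋀[ℂ]^p W →ₗ[ℂ]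
      (V →ₗ[ℂ] V'') ⊗[ℂ] ⋀[ℂ]^r W :=
  TensorProduct.map₂ (LinearMap.llcomp ℂ V V' V'') (mulDeg W q p r h)

variable {V V' V''}

theorem actDeg_gradedMul {p q r k m n : ℕ} (hr : p + q = r) (h : r + k = n) (h' : q + k = m)
    (h'' : p + m = n) (y : (V' →ₗ[ℂ] V'') ⊗[ℂ] ⋀[ℂ]^q (Module.Dual ℂ W))
    (x : (V →ₗ[ℂ] V') ⊗[ℂ] ⋀[ℂ]^p (Module.Dual ℂ W)) :
    actDeg W V V'' r k n h (gradedMul _ V V' V'' q p r hr y x) =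
      actDeg W V' V'' q k m h' y ∘ₗ actDeg W V V' p m n h'' x := by
  induction y with
  | zero => simp
  | add y y' hy hy' => simp only [map_add, LinearMap.add_apply, LinearMap.add_comp, hy, hy']
  | tmul ψ a =>
    induction x with
    | zero => simp
    | add x x' hx hx' => simp only [map_add, LinearMap.comp_add, hx, hx']
    | tmul φ b =>
      rw [actDeg_tmul, actDeg_tmul, ← TensorProduct.map_comp, ← contrDeg_mulDeg hr h h' h'']
      rfl

theorem actDeg_lTensor_rightContr {p k n : ℕ} (h : p + k = n) (h' : p + (k + 1) = n + 1)
    (x : (V →ₗ[ℂ] V') ⊗[ℂ] ⋀[ℂ]^p (Module.Dual ℂ W)) (ξ : Module.Dual ℂ W) :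
    actDeg W V V' p k n h x ∘ₗ LinearMap.lTensor V (rightContr ξ n) =
      LinearMap.lTensor V' (rightContr ξ k) ∘ₗ actDeg W V V' p (k + 1) (n + 1) h' x := by
  induction x with
  | zero => simp
  | add x x' hx hx' => simp only [map_add, LinearMap.comp_add, LinearMap.add_comp, hx, hx']
  | tmul φ b =>
    rw [actDeg_tmul, actDeg_tmul, LinearMap.lTensor, LinearMap.lTensor, ← TensorProduct.map_comp,
      ← TensorProduct.map_comp, contrDeg_comp_rightContr h h', LinearMap.comp_id,
      LinearMap.id_comp]

theorem actDeg_equivariant {H : Type u} [Group H] (τ : Representation ℂ H W)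
    (ρ : Representation ℂ H V) (ρ' : Representation ℂ H V') {p k n : ℕ} (h : p + k = n)
    (x : (V →ₗ[ℂ] V') ⊗[ℂ] ⋀[ℂ]^p (Module.Dual ℂ W)) (g : H) :
    ρ'.tprod (extPowerRep τ k) g ∘ₗ actDeg W V V' p k n h x =
      actDeg W V V' p k n h ((ρ.linHom ρ').tprod (extPowerRep τ.dual p) g x) ∘ₗ
        ρ.tprod (extPowerRep τ n) g := by
  induction x with
  | zero => simp
  | add x x' hx hx' => simp only [map_add, LinearMap.comp_add, LinearMap.add_comp, hx, hx']
  | tmul φ b =>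
    have h1 : (ρ.linHom ρ').tprod (extPowerRep τ.dual p) g (φ ⊗ₜ b) =
      (ρ.linHom ρ' g φ) ⊗ₜ (extPowerRep τ.dual p g b) := rfl
    have h2 : ρ.linHom ρ' g φ ∘ₗ ρ g = ρ' g ∘ₗ φ := by
      refine LinearMap.ext fun v => ?_
      rw [Representation.linHom_apply]
      change ρ' g (φ (ρ g⁻¹ (ρ g v))) = _
      rw [← Module.End.mul_apply, ← map_mul, inv_mul_cancel, map_one]
      rfl
    rw [h1, actDeg_tmul, actDeg_tmul, Representation.tprod_apply, Representation.tprod_apply,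
      ← TensorProduct.map_comp, ← TensorProduct.map_comp, extPowerRep_contrDeg, h2]

variable (W) in
/-- The identification of `V' ⊗ ⋀⁰ W` with `V'`. -/
def evZero (V' : Type u) [AddCommGroup V'] [Module ℂ V'] : V' ⊗[ℂ] ⋀[ℂ]^0 W ≃ₗ[ℂ] V' :=
  (TensorProduct.congr (LinearEquiv.refl ℂ V') (exteriorPower.zeroEquiv ℂ W)).trans
    (TensorProduct.rid ℂ V')

theorem evZero_equivariant {H : Type u} [Group H] (τ : Representation ℂ H W)
    (ρ' : Representation ℂ H V') (g : H) (x : V' ⊗[ℂ] ⋀[ℂ]^0 W) :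
    evZero W V' (ρ'.tprod (extPowerRep τ 0) g x) = ρ' g (evZero W V' x) := by
  induction x with
  | zero => simp
  | add x y hx hy => simp only [map_add, hx, hy]
  | tmul v a =>
    have h1 : exteriorPower.zeroEquiv ℂ W (extPowerRep τ 0 g a) = exteriorPower.zeroEquiv ℂ W a :=
      LinearMap.congr_fun (exteriorPower.zeroEquiv_naturality (τ g)) a
    change exteriorPower.zeroEquiv ℂ W (extPowerRep τ 0 g a) • ρ' g v =
      ρ' g (exteriorPower.zeroEquiv ℂ W a • v)
    rw [h1, map_smul]

variable (W V V') in
/-- `Hom(V, V') ⊗ ⋀ⁿ W* ≅ Hom(V ⊗ ⋀ⁿ W, V')`. -/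
def actZero (n : ℕ) : (V →ₗ[ℂ] V') ⊗[ℂ] ⋀[ℂ]^n (Module.Dual ℂ W) →ₗ[ℂ]
      V ⊗[ℂ] ⋀[ℂ]^n W →ₗ[ℂ] V' :=
  LinearMap.llcomp ℂ _ _ _ (evZero W V').toLinearMap ∘ₗ actDeg W V V' n 0 n rfl

theorem actZero_bijective [FiniteDimensional ℂ W] [FiniteDimensional ℂ V] (n : ℕ) :
    Function.Bijective (actZero W V V' n) := by
  let e : (V →ₗ[ℂ] V') ⊗[ℂ] ⋀[ℂ]^n (Module.Dual ℂ W) ≃ₗ[ℂ] (V ⊗[ℂ] ⋀[ℂ]^n W →ₗ[ℂ] V') :=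
    (TensorProduct.congr (LinearEquiv.refl ℂ _)
      (LinearEquiv.ofBijective _ (extPairing_bijective (W := W) n))).trans
    ((homTensorHomEquiv ℂ V (⋀[ℂ]^n W) V' ℂ).trans
      (LinearEquiv.congrRight (TensorProduct.rid ℂ V')))
  have he : actZero W V V' n = e.toLinearMap := by
    refine TensorProduct.ext' fun φ a => TensorProduct.ext' fun v x => ?_
    change _ = TensorProduct.rid ℂ V' (homTensorHomEquiv ℂ V (⋀[ℂ]^n W) V' ℂ
      (φ ⊗ₜ extPairing W n a) (v ⊗ₜ x))
    rw [homTensorHomEquiv_apply]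
    rfl
  rw [he]
  exact e.bijective

end Act

/-! ### Invariants and intertwining maps -/

section Invariants

variable {G : Type u} [Group G] {A : Type u} [CommRing A] [Algebra ℂ A]
  [MulSemiringAction G A] [SMulCommClass G ℂ A] (m : A →ₐ[ℂ] ℂ)

theorem actZero_equivariant {H W V V' : Type u} [Group H] [AddCommGroup W] [Module ℂ W]
    [AddCommGroup V] [Module ℂ V] [AddCommGroup V'] [Module ℂ V'] (τ : Representation ℂ H W)
    (ρ : Representation ℂ H V) (ρ' : Representation ℂ H V') {n : ℕ}
    (x : (V →ₗ[ℂ] V') ⊗[ℂ] ⋀[ℂ]^n (Module.Dual ℂ W)) (g : H) :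
    ρ' g ∘ₗ actZero W V V' n x =
      actZero W V V' n ((ρ.linHom ρ').tprod (extPowerRep τ.dual n) g x) ∘ₗ
        ρ.tprod (extPowerRep τ n) g := by
  refine LinearMap.ext fun y => ?_
  have := LinearMap.congr_fun (actDeg_equivariant τ ρ ρ' (rfl : n + 0 = n) x g) y
  change ρ' g (evZero W V' _) = evZero W V' (actDeg W V V' n 0 n rfl _ _)
  rw [← evZero_equivariant τ]
  exact congrArg _ this

theorem mem_invariants_iff_actZero {H W V V' : Type u} [Group H] [AddCommGroup W] [Module ℂ W]
    [AddCommGroup V] [Module ℂ V] [AddCommGroup V'] [Module ℂ V'] [FiniteDimensional ℂ W]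
    [FiniteDimensional ℂ V] (τ : Representation ℂ H W)
    (ρ : Representation ℂ H V) (ρ' : Representation ℂ H V') {n : ℕ}
    (x : (V →ₗ[ℂ] V') ⊗[ℂ] ⋀[ℂ]^n (Module.Dual ℂ W)) :
    x ∈ ((ρ.linHom ρ').tprod (extPowerRep τ.dual n)).invariants ↔
      ∀ g, actZero W V V' n x ∘ₗ ρ.tprod (extPowerRep τ n) g = ρ' g ∘ₗ actZero W V V' n x := by
  rw [Representation.mem_invariants]
  refine forall_congr' fun g => ?_
  rw [actZero_equivariant τ ρ ρ' x g]
  refine ⟨fun h => by rw [h], fun h => (actZero_bijective n).1 (LinearMap.ext fun y => ?_)⟩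
  have h3 := LinearMap.congr_fun h ((ρ.tprod (extPowerRep τ n)) g⁻¹ y)
  simp only [LinearMap.comp_apply] at h3
  rw [← Module.End.mul_apply, ← map_mul, mul_inv_cancel, map_one] at h3
  exact h3.symm

/-- `(Hom(V, V') ⊗ ⋀ⁿ T_m M)^{G_m} → Hom_{G_m}(V ⊗ ⋀ⁿ T*_m M, V')`. -/
def tangentToCotangent [FiniteDimensional ℂ (Cotan m)] (V V' : FinDimRep (isotropy G m)) (n : ℕ) :
    tangentHom m V V' n →ₗ[ℂ] cotangentHom m V V' n where
  toFun x := ⟨actZero (Cotan m) V.carrier V'.carrier n x.1,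
    (mem_invariants_iff_actZero (cotanRep G m) V.ρ V'.ρ x.1).1 x.2⟩
  map_add' x y := Representation.IntertwiningMap.ext (map_add _ x.1 y.1)
  map_smul' c x := Representation.IntertwiningMap.ext (map_smul _ c x.1)

theorem tangentToCotangent_bijective [FiniteDimensional ℂ (Cotan m)]
    (V V' : FinDimRep (isotropy G m)) (n : ℕ) :
    Function.Bijective (tangentToCotangent m V V' n) := by
  have hb := actZero_bijective (W := Cotan m) (V := V.carrier) (V' := V'.carrier) n
  refine ⟨fun x y hxy => Subtype.ext (hb.1
    (congrArg Representation.IntertwiningMap.toLinearMap hxy)), fun f => ?_⟩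
  obtain ⟨x, hx⟩ := hb.2 f.toLinearMap
  refine ⟨⟨x, (mem_invariants_iff_actZero (cotanRep G m) V.ρ V'.ρ x).2 ?_⟩,
    Representation.IntertwiningMap.ext hx⟩
  rw [hx]
  exact f.isIntertwining'

/-- `(Hom(V, V') ⊗ ⋀ⁿ T_m M)^{G_m} ≅ Hom_{G_m}(V ⊗ ⋀ⁿ T*_m M, V')`. -/
def tangentCotangent [FiniteDimensional ℂ (Cotan m)] (V V' : FinDimRep (isotropy G m)) (n : ℕ) :
    tangentHom m V V' n ≃ₗ[ℂ] cotangentHom m V V' n :=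
  LinearEquiv.ofBijective (tangentToCotangent m V V' n) (tangentToCotangent_bijective m V V' n)

theorem lTensor_gradedMul {V V' V'' : Type u} [AddCommGroup V] [Module ℂ V] [AddCommGroup V']
    [Module ℂ V'] [AddCommGroup V''] [Module ℂ V''] {p q r : ℕ} (h : p + q = r)
    (y : (V' →ₗ[ℂ] V'') ⊗[ℂ] ⋀[ℂ]^q (Tan m)) (x : (V →ₗ[ℂ] V') ⊗[ℂ] ⋀[ℂ]^p (Tan m)) :
    LinearMap.lTensor (V →ₗ[ℂ] V'') (⋀[ℂ]^r (Tan m)).subtype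
        (gradedMul (Tan m) V V' V'' q p r h y x) =
      wedgeProduct m (LinearMap.lTensor (V' →ₗ[ℂ] V'') (⋀[ℂ]^q (Tan m)).subtype y)
        (LinearMap.lTensor (V →ₗ[ℂ] V') (⋀[ℂ]^p (Tan m)).subtype x) := by
  induction y with
  | zero => simp
  | add y y' hy hy' => simp only [map_add, LinearMap.add_apply, hy, hy']
  | tmul ψ a =>
    induction x with
    | zero => simp
    | add x x' hx hx' => simp only [map_add, hx, hx']
    | tmul φ b => rfl

theorem toTotal_eq_wedgeProduct_iff {V V' V'' : FinDimRep (isotropy G m)} {p q r : ℕ}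
    (h : p + q = r) (z : tangentHom m V V'' r) (y : tangentHom m V' V'' q)
    (x : tangentHom m V V' p) :
    toTotal m z = wedgeProduct m (toTotal m y) (toTotal m x) ↔
      z.1 = gradedMul (Tan m) V.carrier V'.carrier V''.carrier q p r h y.1 x.1 := by
  rw [toTotal, toTotal, toTotal, ← lTensor_gradedMul m h]
  exact (Module.Flat.lTensor_preserves_injective_linearMap
    (M := V.carrier →ₗ[ℂ] V''.carrier) _ (⋀[ℂ]^r (Tan m)).injective_subtype).eq_iff

end Invariants

/-! ### Quasi-regularity of coordinates at a nonsingular point -/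

section QuasiRegular

open IsLocalRing

theorem height_maximalIdeal_le_card {L : Type*} [CommRing L] [IsLocalRing L] [IsNoetherianRing L]
    (s : Finset L) (hs : ∀ y ∈ s, y ∈ maximalIdeal L) (t b : L) (ht : t ∈ maximalIdeal L)
    (hm : maximalIdeal L ≤ Ideal.span (s : Set L) ⊔ Ideal.span {t}) (n : ℕ)
    (h : t ^ n * (1 - t * b) ∈ Ideal.span (s : Set L)) :
    (maximalIdeal L).height ≤ s.card := by
  apply Ideal.height_le_card_of_mem_minimalPrimes_span_finset
  refine ⟨⟨inferInstance, Ideal.span_le.2 hs⟩, fun q ⟨hq, hsq⟩ hqm => ?_⟩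
  have h1 : 1 - t * b ∉ q := fun h2 => by
    have h3 := Ideal.add_mem _ (hqm h2) (Ideal.mul_mem_right b _ ht)
    rw [sub_add_cancel] at h3
    exact (Ideal.ne_top_iff_one _).1 (maximalIdeal.isMaximal L).ne_top h3
  have h2 : t ∈ q := hq.mem_of_pow_mem n ((hq.mem_or_mem (hsq h)).resolve_right h1)
  exact hm.trans (sup_le hsq ((Ideal.span_singleton_le_iff_mem _).2 h2))

variable {A : Type u} [CommRing A] [Algebra ℂ A] (m : A →ₐ[ℂ] ℂ)

instance ker_isMaximal : (RingHom.ker m).IsMaximal :=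
  RingHom.ker_isMaximal_of_surjective m fun c => ⟨algebraMap ℂ A c, m.commutes c⟩

theorem exists_eq_algebraMap_add (a : A) : ∃ z ∈ RingHom.ker m, a = algebraMap ℂ A (m a) + z :=
  ⟨a - algebraMap ℂ A (m a), by simp [RingHom.mem_ker], by ring⟩

theorem mem_sq_of_algebraMap_mem {z : A} (hz : z ∈ RingHom.ker m)
    (h : algebraMap A (Localization.AtPrime (RingHom.ker m)) z ∈
      maximalIdeal (Localization.AtPrime (RingHom.ker m)) ^ 2) : z ∈ RingHom.ker m ^ 2 := by
  rw [← Localization.AtPrime.map_eq_maximalIdeal, ← Ideal.map_pow,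
    IsLocalization.algebraMap_mem_map_algebraMap_iff (RingHom.ker m).primeCompl] at h
  obtain ⟨s, hs, h⟩ := h
  obtain ⟨y, hy, e⟩ := exists_eq_algebraMap_add m s
  have h0 : m s ≠ 0 := hs
  have h1 : m s • z = s * z - y * z := by
    conv_rhs => rw [e]
    rw [Algebra.smul_def]; ring
  have h2 : m s • z ∈ RingHom.ker m ^ 2 := by
    rw [h1]
    exact Ideal.sub_mem _ h (by rw [pow_two]; exact Ideal.mul_mem_mul hy hz)
  have h3 := Submodule.smul_of_tower_mem (RingHom.ker m ^ 2) (m s)⁻¹ h2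
  rwa [smul_smul, inv_mul_cancel₀ h0, one_smul] at h3

theorem exists_eq_algebraMap_add_localization (a : Localization.AtPrime (RingHom.ker m)) :
    ∃ c : ℂ, a - algebraMap A _ (algebraMap ℂ A c) ∈
      maximalIdeal (Localization.AtPrime (RingHom.ker m)) := by
  obtain ⟨a, s, rfl⟩ := IsLocalization.exists_mk'_eq (RingHom.ker m).primeCompl a
  have h0 : m s ≠ 0 := s.2
  refine ⟨m a / m s, ?_⟩
  rw [← Ideal.mul_unit_mem_iff_mem (maximalIdeal _)
      (IsLocalization.map_units (Localization.AtPrime (RingHom.ker m)) s), sub_mul, IsLocalization.mk'_spec, ← map_mul, ← map_sub,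
    IsLocalization.AtPrime.to_map_mem_maximal_iff _ (RingHom.ker m), RingHom.mem_ker]
  simp [h0]

variable {κ : Type*} [Fintype κ] {x : κ → A} 

theorem card_le_finrank_cotangentSpace [IsNoetherianRing A] (hx : ∀ i, x i ∈ RingHom.ker m)
    (hind : ∀ a : κ → ℂ, ∑ i, a i • x i ∈ RingHom.ker m ^ 2 → a = 0) :
    Fintype.card κ ≤ Module.finrank (ResidueField (Localization.AtPrime (RingHom.ker m)))
      (CotangentSpace (Localization.AtPrime (RingHom.ker m))) := by
  set L := Localization.AtPrime (RingHom.ker m)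
  have hx' : ∀ i, algebraMap A L (x i) ∈ maximalIdeal L := fun i =>
    (IsLocalization.AtPrime.to_map_mem_maximal_iff L (RingHom.ker m) _).2 (hx i)
  let v : κ → CotangentSpace L := fun i => (maximalIdeal L).toCotangent ⟨_, hx' i⟩
  have hv : LinearIndependent (ResidueField L) v := by
    rw [Fintype.linearIndependent_iff]
    intro g hg
    choose a ha using fun i => IsLocalRing.residue_surjective (R := L) (g i)
    choose c hc using fun i => exists_eq_algebraMap_add_localization m (a i)
    have h1 : ∑ i, a i • v i = 0 := by
      rw [← hg]
      refine Finset.sum_congr rfl fun i _ => ?_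
      rw [← ha]
      rfl
    have h2 : ∑ i, a i * algebraMap A L (x i) ∈ maximalIdeal L ^ 2 := by
      have h3 : ∑ i, a i • v i =
          (maximalIdeal L).toCotangent (∑ i, a i • ⟨_, hx' i⟩) := by
        rw [map_sum]
        exact Finset.sum_congr rfl fun i _ => (map_smul _ _ _).symm
      rw [h3, Ideal.toCotangent_eq_zero] at h1
      simpa using h1
    have h3 : algebraMap A L (∑ i, c i • x i) ∈ maximalIdeal L ^ 2 := by
      have h4 : algebraMap A L (∑ i, c i • x i) = ∑ i, a i * algebraMap A L (x i) -
          ∑ i, (a i - algebraMap A L (algebraMap ℂ A (c i))) * algebraMap A L (x i) := by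
        rw [← Finset.sum_sub_distrib, map_sum]
        refine Finset.sum_congr rfl fun i _ => ?_
        rw [Algebra.smul_def, map_mul]
        ring
      rw [h4]
      refine Ideal.sub_mem _ h2 (Ideal.sum_mem _ fun i _ => ?_)
      rw [pow_two]
      exact Ideal.mul_mem_mul (hc i) (hx' i)
    have h4 := hind c (mem_sq_of_algebraMap_mem m (Ideal.sum_mem _ fun i _ =>
      Submodule.smul_of_tower_mem _ _ (hx i)) h3)
    intro i
    have h5 := hc i
    rw [h4] at h5
    simp only [Pi.zero_apply, map_zero, sub_zero] at h5
    rw [← ha]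
    exact (IsLocalRing.residue_eq_zero_iff _).2 h5
  exact hv.fintype_card_le_finrank

theorem maximalIdeal_eq_span [IsNoetherianRing A]
    (hspan : RingHom.ker m ≤ Ideal.span (Set.range x) ⊔ RingHom.ker m ^ 2) :
    maximalIdeal (Localization.AtPrime (RingHom.ker m)) ≤
      Ideal.span (Set.range fun i => algebraMap A (Localization.AtPrime (RingHom.ker m)) (x i)) := by
  set L := Localization.AtPrime (RingHom.ker m)
  have h1 := Ideal.map_mono (f := algebraMap A L) hspan
  rw [Ideal.map_sup, Ideal.map_pow, Localization.AtPrime.map_eq_maximalIdeal, Ideal.map_span,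
    ← Set.range_comp] at h1
  refine Submodule.le_of_le_smul_of_le_jacobson_bot (I := maximalIdeal L)
    (IsNoetherian.noetherian _) ?_ ?_
  · exact (IsLocalRing.jacobson_eq_maximalIdeal ⊥ bot_ne_top).ge
  · rw [smul_eq_mul, ← pow_two]
    exact h1

theorem aeval_smul_of_isHomogeneous {B : Type*} [CommRing B] [Algebra ℂ B]
    {p : MvPolynomial κ ℂ} {n : ℕ} (hp : p.IsHomogeneous n) (c : κ → ℂ) (t : B) :
    MvPolynomial.aeval (fun i => c i • t) p = MvPolynomial.eval c p • t ^ n := by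
  rw [MvPolynomial.aeval_def, MvPolynomial.eval₂_eq', MvPolynomial.eval_eq', Finset.sum_smul]
  refine Finset.sum_congr rfl fun d hd => ?_
  have h1 : ∑ i, d i = n := by
    have := hp (MvPolynomial.mem_support_iff.1 hd)
    rw [Finsupp.weight_apply, Finsupp.sum_fintype _ _ (by simp)] at this
    simpa using this
  simp_rw [smul_pow]
  rw [← h1, Finset.prod_smul, Finset.prod_pow_eq_pow_sum, Algebra.smul_def, Algebra.smul_def,
    map_mul, mul_assoc]

theorem eq_zero_of_aeval_mem_pow [IsNoetherianRing A]
    [hreg : IsRegularLocalRing (Localization.AtPrime (RingHom.ker m))]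
    (hx : ∀ i, x i ∈ RingHom.ker m)
    (hspan : RingHom.ker m ≤ Ideal.span (Set.range x) ⊔ RingHom.ker m ^ 2)
    (hind : ∀ a : κ → ℂ, ∑ i, a i • x i ∈ RingHom.ker m ^ 2 → a = 0)
    {p : MvPolynomial κ ℂ} {n : ℕ} (hp : p.IsHomogeneous n)
    (h : MvPolynomial.aeval x p ∈ RingHom.ker m ^ (n + 1)) : p = 0 := by
  classical
  by_contra hne
  obtain ⟨c, hc⟩ : ∃ c, MvPolynomial.eval c p ≠ 0 := by
    by_contra! hc
    exact hne (MvPolynomial.funext fun c => by rw [hc, map_zero])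
  have hmx : ∀ q : MvPolynomial κ ℂ, m (MvPolynomial.aeval x q) = MvPolynomial.eval 0 q := by
    intro q
    rw [← AlgHom.comp_apply, MvPolynomial.comp_aeval, MvPolynomial.eval, MvPolynomial.aeval_def]
    congr 2
    funext i
    exact hx i
  by_cases hc0 : c = 0
  · have h1 := hmx p
    rw [Ideal.pow_le_self n.succ_ne_zero h, ← hc0] at h1
    exact hc h1.symm
  obtain ⟨i₀, hi⟩ := Function.ne_iff.1 hc0
  rw [Pi.zero_apply] at hi
  set L := Localization.AtPrime (RingHom.ker m)
  let f : A →ₐ[ℂ] L := IsScalarTower.toAlgHom ℂ A L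
  have hf : ∀ a, f a = algebraMap A L a := fun a => rfl
  let γ : κ → ℂ := fun i => c i / c i₀
  let y : κ → L := fun i => f (x i) - γ i • f (x i₀)
  let s : Finset L := (Finset.univ.erase i₀).image y
  have hfm : ∀ i, f (x i) ∈ maximalIdeal L := fun i =>
    (IsLocalization.AtPrime.to_map_mem_maximal_iff L (RingHom.ker m) _).2 (hx i)
  have hys : ∀ i, y i ∈ Ideal.span (s : Set L) := by
    intro i
    by_cases hii : i = i₀
    · have : y i = 0 := by simp [y, γ, hii, div_self hi]
      rw [this]; exact zero_mem _
    · exact Ideal.subset_span (Finset.mem_image_of_mem y (Finset.mem_erase.2 ⟨hii, Finset.mem_univ i⟩))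
  have hsm : ∀ z ∈ s, z ∈ maximalIdeal L := by
    intro z hz
    obtain ⟨i, -, rfl⟩ := Finset.mem_image.1 hz
    exact Ideal.sub_mem _ (hfm i) (Submodule.smul_of_tower_mem _ _ (hfm i₀))
  have hle : maximalIdeal L ≤ Ideal.span (s : Set L) ⊔ Ideal.span {f (x i₀)} := by
    refine (maximalIdeal_eq_span m hspan).trans (Ideal.span_le.2 ?_)
    rintro _ ⟨i, rfl⟩
    have : algebraMap A L (x i) = y i + γ i • f (x i₀) := by simp [y, hf]
    change algebraMap A L (x i) ∈ _
    rw [this]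
    exact Ideal.add_mem _ (Ideal.mem_sup_left (hys i))
      (Ideal.mem_sup_right (Submodule.smul_of_tower_mem _ _ (Ideal.mem_span_singleton_self _)))
  obtain ⟨b, hb⟩ : ∃ b, f (x i₀) ^ n * (1 - f (x i₀) * b) ∈ Ideal.span (s : Set L) := by
    let Q := L ⧸ Ideal.span (s : Set L)
    let g : L →ₐ[ℂ] Q := Ideal.Quotient.mkₐ ℂ _
    have hg0 : ∀ z, g z = 0 ↔ z ∈ Ideal.span (s : Set L) := fun z => Ideal.Quotient.eq_zero_iff_mem
    have h1 : g (f (MvPolynomial.aeval x p)) = MvPolynomial.eval γ p • g (f (x i₀)) ^ n := by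
      rw [← AlgHom.comp_apply, ← AlgHom.comp_apply, MvPolynomial.comp_aeval,
        ← aeval_smul_of_isHomogeneous hp]
      congr 2
      funext i
      have := (hg0 _).2 (hys i)
      rw [map_sub, map_smul, sub_eq_zero] at this
      exact this
    have h2 : MvPolynomial.eval γ p ≠ 0 := by
      have h3 := aeval_smul_of_isHomogeneous hp c ((c i₀)⁻¹)
      have h4 : MvPolynomial.aeval (fun i => c i • (c i₀)⁻¹) p = MvPolynomial.eval γ p := rfl
      rw [← h4, h3]
      exact mul_ne_zero hc (pow_ne_zero _ (inv_ne_zero hi))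
    have h3 : g (f (MvPolynomial.aeval x p)) ∈ Ideal.span {g (f (x i₀)) ^ (n + 1)} := by
      rw [← Ideal.span_singleton_pow]
      have h4 : (RingHom.ker m).map (g.comp f : A →+* Q) ≤ Ideal.span {g (f (x i₀))} := by
        have h5 : (maximalIdeal L).map (g : L →+* Q) ≤ Ideal.span {g (f (x i₀))} := by
          refine (Ideal.map_mono hle).trans ?_
          rw [Ideal.map_sup, Ideal.map_span _ {f (x i₀)}, Set.image_singleton]
          refine sup_le ?_ le_rfl
          rw [Ideal.map_le_iff_le_comap]
          intro z hz
          rw [Ideal.mem_comap]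
          have : g z = 0 := (hg0 z).2 hz
          exact this ▸ zero_mem _
        refine le_trans ?_ h5
        rw [Ideal.map_le_iff_le_comap]
        intro z hz
        exact Ideal.mem_map_of_mem _
          ((IsLocalization.AtPrime.to_map_mem_maximal_iff L (RingHom.ker m) z).2 hz)
      have h5 := Ideal.pow_right_mono h4 (n + 1)
      rw [← Ideal.map_pow] at h5
      exact h5 (Ideal.mem_map_of_mem (g.comp f : A →+* Q) h)
    obtain ⟨b, hb⟩ := Ideal.mem_span_singleton'.1 h3
    obtain ⟨b, rfl⟩ := Ideal.Quotient.mk_surjective b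
    change g b * _ = _ at hb
    refine ⟨(MvPolynomial.eval γ p)⁻¹ • b, (hg0 _).1 ?_⟩
    have h4 : g (f (x i₀)) ^ n = (MvPolynomial.eval γ p)⁻¹ • (g b * g (f (x i₀)) ^ (n + 1)) := by
      rw [hb, h1, smul_smul, inv_mul_cancel₀ h2, one_smul]
    rw [map_mul, map_pow, map_sub, map_mul, map_smul, map_one, mul_sub, mul_one, sub_eq_zero,
      mul_smul_comm, mul_smul_comm]
    refine h4.trans ?_
    congr 1
    ring
  have hht := height_maximalIdeal_le_card s hsm _ b (hfm i₀) hle n hb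
  have h1 : Fintype.card κ ≤ Module.finrank (ResidueField L) (CotangentSpace L) :=
    card_le_finrank_cotangentSpace m hx hind
  have h2 := IsLocalRing.maximalIdeal_height_eq_ringKrullDim (R := L)
  rw [← (IsRegularLocalRing.iff_finrank_cotangentSpace L).1 hreg] at h2
  have h3 : s.card < Fintype.card κ := by
    refine (Finset.card_image_le).trans_lt ?_
    rw [Finset.card_erase_of_mem (Finset.mem_univ _), Finset.card_univ]
    exact Nat.sub_lt (Fintype.card_pos_iff.2 ⟨i₀⟩) one_pos
  have h4 : (maximalIdeal L).height =
      (Module.finrank (ResidueField L) (CotangentSpace L) : ℕ∞) := by exact_mod_cast h2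
  rw [h4] at hht
  have h5 : Module.finrank (ResidueField L) (CotangentSpace L) ≤ s.card := by exact_mod_cast hht
  omega

end QuasiRegular

/-! ### Formal coordinates -/

namespace OrbitCompletion

variable (K : Type u) [Group K] {A : Type u} [CommRing A] [Algebra ℂ A] [MulSemiringAction K A]
  (m : A →ₐ[ℂ] ℂ)

/-- The canonical map to the completion. -/
def of : A →ₐ[ℂ] OrbitCompletion K m :=
  (IsScalarTower.toAlgHom ℂ A (AdicCompletion (orbitIdeal K m) A) :
    A →ₐ[ℂ] AdicCompletion (orbitIdeal K m) A)

variable {K m}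

theorem proj_of (n : ℕ) (a : A) : proj K m n (of K m a) = Ideal.Quotient.mk _ a :=
  (AdicCompletion.evalₐ (orbitIdeal K m) n).commutes a

theorem factorPow_proj {k n : ℕ} (h : k ≤ n) (x : OrbitCompletion K m) :
    Ideal.Quotient.factorPow (orbitIdeal K m) h (proj K m n x) = proj K m k x := by
  obtain ⟨y, hy⟩ := AdicCompletion.mk_surjective (orbitIdeal K m) A x
  have h1 : ∀ j, proj K m j x = Ideal.Quotient.mk (orbitIdeal K m ^ j) (y.val j) := by
    intro j
    rw [← hy]
    exact AdicCompletion.evalₐ_mk (orbitIdeal K m) j y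
  rw [h1, h1]
  exact AdicCompletion.Ideal.mk_eq_mk (orbitIdeal K m) h y

theorem smul_of (g : K) (a : A) : g • of K m a = of K m (g • a) :=
  ext fun n => by rw [proj_smul, proj_of, proj_of]; rfl

theorem evalPoint_of (a : A) : evalPoint K m (of K m a) = m a := by
  change evalQuot K m (proj K m 1 (of K m a)) = m a
  rw [proj_of]; rfl

/-- The lift of a compatible family of algebra homomorphisms to the completion. -/
def lift {B : Type*} [CommRing B] [Algebra ℂ B] (f : ∀ n, B →ₐ[ℂ] A ⧸ orbitIdeal K m ^ n)
    (hf : ∀ {k n : ℕ} (h : k ≤ n) (b : B),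
      Ideal.Quotient.factorPow (orbitIdeal K m) h (f n b) = f k b) : B →ₐ[ℂ] OrbitCompletion K m :=
  (AdicCompletion.liftAlgHom (R := ℂ) (orbitIdeal K m) f (fun h => AlgHom.ext fun b => hf h b) :
    B →ₐ[ℂ] AdicCompletion (orbitIdeal K m) A)

theorem proj_lift {B : Type*} [CommRing B] [Algebra ℂ B]
    (f : ∀ n, B →ₐ[ℂ] A ⧸ orbitIdeal K m ^ n)
    (hf : ∀ {k n : ℕ} (h : k ≤ n) (b : B),
      Ideal.Quotient.factorPow (orbitIdeal K m) h (f n b) = f k b) (n : ℕ) (b : B) :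
    proj K m n (lift f hf b) = f n b :=
  AdicCompletion.evalₐ_liftAlgHom (R := ℂ) (orbitIdeal K m) f
    (fun h => AlgHom.ext fun b => hf h b) n b

/-- The element of the completion with given compatible projections. -/
theorem exists_proj_eq (c : ∀ n, A ⧸ orbitIdeal K m ^ n)
    (hc : ∀ n, Ideal.Quotient.factorPow (orbitIdeal K m) n.le_succ (c (n + 1)) = c n) :
    ∃ x : OrbitCompletion K m, ∀ n, proj K m n x = c n := by
  choose a ha using fun n => Ideal.Quotient.mk_surjective (c n)
  have h1 : ∀ n, a n ≡ a (n + 1) [SMOD (orbitIdeal K m ^ n • ⊤ : Submodule A A)] := by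
    intro n
    rw [SModEq.sub_mem, smul_eq_mul, Ideal.mul_top, ← Ideal.Quotient.eq, ha, ← hc n, ← ha (n + 1)]
    rfl
  refine ⟨AdicCompletion.mk (orbitIdeal K m) A (AdicCompletion.AdicCauchySequence.mk _ _ a h1),
    fun n => ?_⟩
  rw [← ha]
  exact AdicCompletion.evalₐ_mk (orbitIdeal K m) n _

theorem continuous_proj (n : ℕ) :
    @Continuous _ _ _ (moduleTopology ℂ _) (proj K m n) :=
  continuous_iff_le_induced.2 (iInf_le _ n)

theorem continuous_iff {Y : Type*} [TopologicalSpace Y] {f : Y → OrbitCompletion K m} :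
    Continuous f ↔ ∀ n, @Continuous _ _ _ (moduleTopology ℂ _) fun y => proj K m n (f y) := by
  refine continuous_iInf_rng.trans (forall_congr' fun n => ?_)
  exact continuous_induced_rng

end OrbitCompletion

section Coordinates

open MvPowerSeries (truncTotal truncTotalAlgHom)
open MvPolynomial (idealOfVars)
open scoped MvPowerSeries.WithPiTopology

variable {K : Type u} [Group K] {A : Type u} [CommRing A] [Algebra ℂ A] [MulSemiringAction K A]
  {m : A →ₐ[ℂ] ℂ} (hK : orbitIdeal K m = RingHom.ker m)
  {κ : Type*} [Fintype κ] {x : κ → A} (hx : ∀ i, x i ∈ RingHom.ker m)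

include hK hx in
theorem idealOfVars_pow_le (n : ℕ) :
    idealOfVars κ ℂ ^ n ≤ (orbitIdeal K m ^ n).comap (MvPolynomial.aeval x) := by
  refine le_trans (Ideal.pow_right_mono ?_ n) (Ideal.le_comap_pow _ n)
  rw [Ideal.span_le]
  rintro _ ⟨i, rfl⟩
  rw [SetLike.mem_coe, Ideal.mem_comap, MvPolynomial.aeval_X, hK]
  exact hx i

/-- Truncated polynomials as functions modulo a power of the ideal. -/
def polyQuot (n : ℕ) : MvPolynomial κ ℂ ⧸ idealOfVars κ ℂ ^ n →ₐ[ℂ] A ⧸ orbitIdeal K m ^ n :=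
  Ideal.quotientMapₐ _ (MvPolynomial.aeval x) (idealOfVars_pow_le hK hx n)

theorem polyQuot_mk (n : ℕ) (p : MvPolynomial κ ℂ) :
    polyQuot hK hx n (Ideal.Quotient.mk _ p) = Ideal.Quotient.mk _ (MvPolynomial.aeval x p) := rfl

theorem polyQuot_injective [IsNoetherianRing A]
    (hreg : IsRegularLocalRing (Localization.AtPrime (RingHom.ker m)))
    (hspan : RingHom.ker m ≤ Ideal.span (Set.range x) ⊔ RingHom.ker m ^ 2)
    (hind : ∀ a : κ → ℂ, ∑ i, a i • x i ∈ RingHom.ker m ^ 2 → a = 0) (n : ℕ) :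
    Function.Injective (polyQuot hK hx n) := by
  rw [injective_iff_map_eq_zero]
  intro p hp
  obtain ⟨p, rfl⟩ := Ideal.Quotient.mk_surjective p
  rw [polyQuot_mk, Ideal.Quotient.eq_zero_iff_mem] at hp
  rw [Ideal.Quotient.eq_zero_iff_mem, MvPolynomial.mem_pow_idealOfVars_iff']
  have key : ∀ k ≤ n, p ∈ idealOfVars κ ℂ ^ k := by
    intro k
    induction k with
    | zero => intro _; rw [pow_zero, Ideal.one_eq_top]; trivial
    | succ k ih =>
      intro hk
      have h1 := ih (by omega)
      have h2 : p - MvPolynomial.homogeneousComponent k p ∈ idealOfVars κ ℂ ^ (k + 1) := by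
        rw [MvPolynomial.mem_pow_idealOfVars_iff'] at h1 ⊢
        intro d hd
        rw [MvPolynomial.coeff_sub, MvPolynomial.coeff_homogeneousComponent]
        split_ifs with h
        · rw [sub_self]
        · rw [h1 d (by omega), sub_zero]
      have h3 : MvPolynomial.homogeneousComponent k p = 0 := by
        refine eq_zero_of_aeval_mem_pow m hx hspan hind
          (MvPolynomial.homogeneousComponent_isHomogeneous k p) ?_
        have h4 := idealOfVars_pow_le hK hx (k + 1) h2
        rw [Ideal.mem_comap, map_sub] at h4
        have h5 := Ideal.sub_mem _ (Ideal.pow_le_pow_right hk hp) h4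
        rwa [sub_sub_cancel, hK] at h5
      rwa [h3, sub_zero] at h2
  exact (MvPolynomial.mem_pow_idealOfVars_iff' ..).1 (key n le_rfl)

theorem polyQuot_surjective
    (hspan : RingHom.ker m ≤ Ideal.span (Set.range x) ⊔ RingHom.ker m ^ 2) (n : ℕ) :
    Function.Surjective (polyQuot hK hx n) := by
  intro a
  obtain ⟨a, rfl⟩ := Ideal.Quotient.mk_surjective a
  suffices h : ∃ p : MvPolynomial κ ℂ, a - MvPolynomial.aeval x p ∈ orbitIdeal K m ^ n by
    obtain ⟨p, hp⟩ := h
    exact ⟨Ideal.Quotient.mk _ p, by rw [polyQuot_mk]; exact (Ideal.Quotient.eq.2 hp).symm⟩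
  rw [hK]
  have h0 : ∀ a : A, ∃ p : MvPolynomial κ ℂ, a - MvPolynomial.aeval x p ∈ RingHom.ker m :=
    fun a => ⟨MvPolynomial.C (m a), by simp [RingHom.mem_ker]⟩
  have h1 : ∀ k, ∀ a ∈ RingHom.ker m ^ k,
      ∃ p : MvPolynomial κ ℂ, a - MvPolynomial.aeval x p ∈ RingHom.ker m ^ (k + 1) := by
    intro k
    induction k with
    | zero => intro a _; rw [zero_add, pow_one]; exact h0 a
    | succ k ih =>
      intro a ha
      rw [pow_succ] at ha
      refine Submodule.mul_induction_on ha ?_ ?_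
      · intro b hb c hc
        obtain ⟨p, hp⟩ := ih b hb
        have h2 : ∀ c ∈ Ideal.span (Set.range x), ∃ q : MvPolynomial κ ℂ,
            c - MvPolynomial.aeval x q ∈ RingHom.ker m ^ 2 ∧
              MvPolynomial.aeval x q ∈ RingHom.ker m := by
          intro c hc
          induction hc using Submodule.span_induction with
          | mem c hc =>
            obtain ⟨i, rfl⟩ := hc
            refine ⟨MvPolynomial.X i, ?_, ?_⟩
            · rw [MvPolynomial.aeval_X, sub_self]; exact zero_mem _
            · rw [MvPolynomial.aeval_X]; exact hx i
          | zero => exact ⟨0, by simp, by simp⟩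
          | add c c' _ _ h h' =>
            obtain ⟨q, hq, hq'⟩ := h
            obtain ⟨r, hr, hr'⟩ := h'
            refine ⟨q + r, ?_, ?_⟩
            · rw [map_add, add_sub_add_comm]; exact Ideal.add_mem _ hq hr
            · rw [map_add]; exact Ideal.add_mem _ hq' hr'
          | smul s c _ h =>
            obtain ⟨q, hq, hq'⟩ := h
            refine ⟨MvPolynomial.C (m s) * q, ?_, ?_⟩
            · obtain ⟨z, hz, e⟩ := exists_eq_algebraMap_add m s
              have : s • c - MvPolynomial.aeval x (MvPolynomial.C (m s) * q) =
                  s * (c - MvPolynomial.aeval x q) + z * MvPolynomial.aeval x q := by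
                rw [map_mul, MvPolynomial.aeval_C, smul_eq_mul]
                conv_lhs => rw [e]
                conv_rhs => rw [e]
                simp only [map_add, AlgHom.commutes, Algebra.algebraMap_self, RingHom.id_apply,
                  (RingHom.mem_ker).1 hz, add_zero]
                ring
              rw [this]
              refine Ideal.add_mem _ (Ideal.mul_mem_left _ _ hq) ?_
              rw [pow_two]
              exact Ideal.mul_mem_mul hz hq'
            · rw [map_mul]; exact Ideal.mul_mem_left _ _ hq'
        obtain ⟨c₁, hc₁, c₂, hc₂, e⟩ := Submodule.mem_sup.1 (hspan hc)
        obtain ⟨q, hq, hq'⟩ := h2 c₁ hc₁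
        refine ⟨p * q, ?_⟩
        have h3 : c - MvPolynomial.aeval x q ∈ RingHom.ker m ^ 2 := by
          rw [← e, add_sub_right_comm]; exact Ideal.add_mem _ hq hc₂
        have h4 : b * c - MvPolynomial.aeval x (p * q) =
            b * (c - MvPolynomial.aeval x q) +
              (b - MvPolynomial.aeval x p) * MvPolynomial.aeval x q := by
          rw [map_mul]; ring
        rw [h4]
        refine Ideal.add_mem _ ?_ ?_
        · rw [show k + 1 + 1 = k + 2 by omega, pow_add]
          exact Ideal.mul_mem_mul hb h3
        · rw [pow_succ]
          exact Ideal.mul_mem_mul hp hq'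
      · rintro a b ⟨p, hp⟩ ⟨q, hq⟩
        exact ⟨p + q, by rw [map_add, add_sub_add_comm]; exact Ideal.add_mem _ hp hq⟩
  induction n with
  | zero => exact ⟨0, by rw [pow_zero, Ideal.one_eq_top]; trivial⟩
  | succ n ih =>
    obtain ⟨p, hp⟩ := ih
    obtain ⟨q, hq⟩ := h1 n _ hp
    exact ⟨p + q, by rwa [map_add, ← sub_sub]⟩

/-- Power series modulo a power of the ideal. -/
def seriesQuot (n : ℕ) : MvPowerSeries κ ℂ →ₐ[ℂ] A ⧸ orbitIdeal K m ^ n :=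
  (polyQuot hK hx n).comp ((truncTotalAlgHom κ ℂ n).restrictScalars ℂ)

theorem seriesQuot_apply (n : ℕ) (f : MvPowerSeries κ ℂ) :
    seriesQuot hK hx n f = Ideal.Quotient.mk _ (MvPolynomial.aeval x (truncTotal n f)) := rfl

theorem factorPow_seriesQuot {k n : ℕ} (h : k ≤ n) (f : MvPowerSeries κ ℂ) :
    Ideal.Quotient.factorPow (orbitIdeal K m) h (seriesQuot hK hx n f) =
      seriesQuot hK hx k f := by
  rw [seriesQuot_apply, seriesQuot_apply]
  change Ideal.Quotient.mk _ _ = _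
  rw [Ideal.Quotient.eq, ← map_sub]
  exact idealOfVars_pow_le hK hx k
    (MvPowerSeries.truncTotal_sub_truncTotal_mem_pow_idealOfVars h le_rfl f)

/-- The substitution of functions vanishing at the point in power series. -/
def seriesMap : MvPowerSeries κ ℂ →ₐ[ℂ] OrbitCompletion K m :=
  OrbitCompletion.lift (seriesQuot hK hx) (factorPow_seriesQuot hK hx)

theorem proj_seriesMap (n : ℕ) (f : MvPowerSeries κ ℂ) :
    OrbitCompletion.proj K m n (seriesMap hK hx f) =
      Ideal.Quotient.mk _ (MvPolynomial.aeval x (truncTotal n f)) :=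
  OrbitCompletion.proj_lift (seriesQuot hK hx) (factorPow_seriesQuot hK hx) n f

theorem seriesMap_coe (p : MvPolynomial κ ℂ) :
    seriesMap hK hx p = OrbitCompletion.of K m (MvPolynomial.aeval x p) :=
  OrbitCompletion.ext fun n => by
    rw [proj_seriesMap, OrbitCompletion.proj_of, Ideal.Quotient.eq, ← map_sub]
    refine idealOfVars_pow_le hK hx n ((MvPolynomial.mem_pow_idealOfVars_iff' ..).2 fun d hd => ?_)
    rw [MvPolynomial.coeff_sub, MvPowerSeries.coeff_truncTotal _ hd, MvPolynomial.coeff_coe,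
      sub_self]

theorem seriesMap_X (i : κ) :
    seriesMap hK hx (MvPowerSeries.X i) = OrbitCompletion.of K m (x i) := by
  rw [← MvPolynomial.coe_X, seriesMap_coe, MvPolynomial.aeval_X]

theorem evalPoint_seriesMap (f : MvPowerSeries κ ℂ) :
    OrbitCompletion.evalPoint K m (seriesMap hK hx f) = MvPowerSeries.constantCoeff f := by
  change OrbitCompletion.evalQuot K m (OrbitCompletion.proj K m 1 (seriesMap hK hx f)) = _
  rw [proj_seriesMap]
  change m (MvPolynomial.aeval x (truncTotal 1 f)) = _
  have h1 : truncTotal 1 f = MvPolynomial.C (MvPowerSeries.constantCoeff f) := by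
    classical
    ext d
    rw [MvPowerSeries.coeff_truncTotal_eq_ite, MvPolynomial.coeff_C]
    by_cases hd : d = 0
    · subst hd; simp
    · have : ¬ d.degree < 1 := by
        rw [Nat.lt_one_iff, Finsupp.degree_eq_zero_iff]; exact hd
      rw [if_neg this, if_neg (Ne.symm hd)]
  rw [h1, MvPolynomial.aeval_C, AlgHom.commutes]
  rfl

theorem seriesMap_bijective [IsNoetherianRing A]
    (hreg : IsRegularLocalRing (Localization.AtPrime (RingHom.ker m)))
    (hspan : RingHom.ker m ≤ Ideal.span (Set.range x) ⊔ RingHom.ker m ^ 2)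
    (hind : ∀ a : κ → ℂ, ∑ i, a i • x i ∈ RingHom.ker m ^ 2 → a = 0) :
    Function.Bijective (seriesMap (K := K) hK hx) := by
  have hi := polyQuot_injective hK hx hreg hspan hind
  constructor
  · rw [injective_iff_map_eq_zero]
    intro f hf
    ext d
    have h1 := congrArg (OrbitCompletion.proj K m (d.degree + 1)) hf
    rw [proj_seriesMap, map_zero, ← polyQuot_mk hK hx] at h1
    have h2 := (injective_iff_map_eq_zero _).1 (hi _) _ h1
    rw [Ideal.Quotient.eq_zero_iff_mem, MvPolynomial.mem_pow_idealOfVars_iff'] at h2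
    rw [← MvPowerSeries.coeff_truncTotal _ (Nat.lt_succ_self _), h2 d (Nat.lt_succ_self _)]
    simp
  · intro c
    choose q hq using fun n => polyQuot_surjective hK hx hspan n (OrbitCompletion.proj K m n c)
    choose p hp using fun n => Ideal.Quotient.mk_surjective (q n)
    have h1 : ∀ {k n : ℕ}, k ≤ n → p n - p k ∈ idealOfVars κ ℂ ^ k := by
      intro k n h
      rw [← Ideal.Quotient.eq]
      apply hi k
      rw [hp k, hq, polyQuot_mk, ← OrbitCompletion.factorPow_proj h, ← hq n, ← hp n, polyQuot_mk]
      rfl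
    let f : MvPowerSeries κ ℂ := fun d => (p (d.degree + 1)).coeff d
    refine ⟨f, OrbitCompletion.ext fun n => ?_⟩
    rw [proj_seriesMap, ← hq n, ← hp n, polyQuot_mk, Ideal.Quotient.eq, ← map_sub]
    refine idealOfVars_pow_le hK hx n ((MvPolynomial.mem_pow_idealOfVars_iff' ..).2 fun d hd => ?_)
    rw [MvPolynomial.coeff_sub, MvPowerSeries.coeff_truncTotal _ hd]
    have h2 := (MvPolynomial.mem_pow_idealOfVars_iff' ..).1 (h1 (Nat.succ_le_of_lt hd)) d
      (Nat.lt_succ_self _)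
    rw [MvPolynomial.coeff_sub, sub_eq_zero] at h2
    rw [h2]
    exact sub_self _

/-- The identification of the completion with a power series ring. -/
def seriesEquiv [IsNoetherianRing A]
    (hreg : IsRegularLocalRing (Localization.AtPrime (RingHom.ker m)))
    (hspan : RingHom.ker m ≤ Ideal.span (Set.range x) ⊔ RingHom.ker m ^ 2)
    (hind : ∀ a : κ → ℂ, ∑ i, a i • x i ∈ RingHom.ker m ^ 2 → a = 0) :
    MvPowerSeries κ ℂ ≃ₐ[ℂ] OrbitCompletion K m :=
  AlgEquiv.ofBijective _ (seriesMap_bijective hK hx hreg hspan hind)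

theorem continuous_seriesMap : Continuous (seriesMap (K := K) hK hx) := by
  rw [OrbitCompletion.continuous_iff]
  intro n
  let _ : TopologicalSpace (A ⧸ orbitIdeal K m ^ n) := moduleTopology ℂ _
  have : IsModuleTopology ℂ (A ⧸ orbitIdeal K m ^ n) := ⟨rfl⟩
  have : ContinuousAdd (A ⧸ orbitIdeal K m ^ n) := IsModuleTopology.toContinuousAdd ℂ _
  have : ContinuousSMul ℂ (A ⧸ orbitIdeal K m ^ n) := IsModuleTopology.toContinuousSMul ℂ _
  have h : ∀ f : MvPowerSeries κ ℂ, OrbitCompletion.proj K m n (seriesMap hK hx f) =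
      ∑ d ∈ (Finsupp.finite_of_degree_lt (σ := κ) n).toFinset, MvPowerSeries.coeff d f •
        Ideal.Quotient.mk (orbitIdeal K m ^ n)
          (MvPolynomial.aeval x (MvPolynomial.monomial d (1 : ℂ))) := by
    intro f
    rw [proj_seriesMap]
    change Ideal.Quotient.mkₐ ℂ _ (MvPolynomial.aeval x
      (∑ d ∈ (Finsupp.finite_of_degree_lt (σ := κ) n).toFinset,
        MvPolynomial.monomial d (MvPowerSeries.coeff d f))) = _
    rw [map_sum, map_sum]
    refine Finset.sum_congr rfl fun d _ => ?_
    rw [← mul_one (MvPowerSeries.coeff d f), ← smul_eq_mul, ← MvPolynomial.smul_monomial, map_smul,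
      map_smul, smul_eq_mul, mul_one]
    rfl
  simp_rw [h]
  refine continuous_finsetSum _ fun d _ => ?_
  have hc : Continuous fun f : MvPowerSeries κ ℂ => MvPowerSeries.coeff d f :=
    MvPowerSeries.WithPiTopology.continuous_coeff ℂ d
  exact hc.fun_smul continuous_const

theorem continuous_coeff_seriesEquiv_symm [IsNoetherianRing A]
    (hreg : IsRegularLocalRing (Localization.AtPrime (RingHom.ker m)))
    (hspan : RingHom.ker m ≤ Ideal.span (Set.range x) ⊔ RingHom.ker m ^ 2)
    (hind : ∀ a : κ → ℂ, ∑ i, a i • x i ∈ RingHom.ker m ^ 2 → a = 0) :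
    Continuous (seriesEquiv (K := K) hK hx hreg hspan hind).symm := by
  refine continuous_pi fun d => ?_
  let n := d.degree + 1
  let _ : TopologicalSpace (A ⧸ orbitIdeal K m ^ n) := moduleTopology ℂ _
  have : IsModuleTopology ℂ (A ⧸ orbitIdeal K m ^ n) := ⟨rfl⟩
  let e : (MvPolynomial κ ℂ ⧸ idealOfVars κ ℂ ^ n) ≃ₗ[ℂ] (A ⧸ orbitIdeal K m ^ n) :=
    LinearEquiv.ofBijective (polyQuot hK hx n).toLinearMap
      ⟨polyQuot_injective hK hx hreg hspan hind n, polyQuot_surjective hK hx hspan n⟩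
  let l : (MvPolynomial κ ℂ ⧸ idealOfVars κ ℂ ^ n) →ₗ[ℂ] ℂ :=
    ((idealOfVars κ ℂ ^ n).restrictScalars ℂ).liftQ (MvPolynomial.lcoeff ℂ d) fun p hp =>
      (MvPolynomial.mem_pow_idealOfVars_iff' ..).1 hp d (Nat.lt_succ_self _)
  have h : ∀ c, (seriesEquiv (K := K) hK hx hreg hspan hind).symm c d =
      (l ∘ₗ e.symm.toLinearMap) (OrbitCompletion.proj K m n c) := by
    intro c
    obtain ⟨f, rfl⟩ := (seriesEquiv (K := K) hK hx hreg hspan hind).surjective c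
    rw [AlgEquiv.symm_apply_apply]
    have h1 : OrbitCompletion.proj K m n (seriesEquiv (K := K) hK hx hreg hspan hind f) =
        e (Ideal.Quotient.mk _ (truncTotal n f)) := proj_seriesMap hK hx n f
    rw [h1, LinearMap.comp_apply, LinearEquiv.coe_coe, LinearEquiv.symm_apply_apply]
    exact (MvPowerSeries.coeff_truncTotal f (Nat.lt_succ_self _)).symm
  change Continuous fun c => (seriesEquiv (K := K) hK hx hreg hspan hind).symm c d
  simp_rw [h]
  exact (IsModuleTopology.continuous_of_linearMap (l ∘ₗ e.symm.toLinearMap)).comp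
    (OrbitCompletion.continuous_proj n)

end Coordinates

/-! ### Euler operators on power series -/

section Euler

open scoped MvPowerSeries.WithPiTopology

/-- Operators on a commutative algebra `C` with elements `X i` that contract the Koszul complex:
derivations `D i` dual to the `X i`, and inverses `Q k` of `k` plus the Euler operator. -/
structure EulerOps (C : Type*) [CommRing C] [Algebra ℂ C] (κ : Type*) [Fintype κ] [DecidableEq κ]
    (ε : C →ₐ[ℂ] ℂ) (X : κ → C) where
  D : κ → C →ₗ[ℂ] C
  Q : ℕ → C →ₗ[ℂ] C
  leibniz : ∀ i j f, D j (X i * f) = X i * D j f + if i = j then f else 0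
  euler_succ : ∀ k f, ∑ i, X i * D i (Q (k + 1) f) + ((k + 1 : ℕ) : ℂ) • Q (k + 1) f = f
  euler_zero : ∀ f, ∑ i, X i * D i (Q 0 f) + algebraMap ℂ C (ε f) = f
  shift : ∀ k i f, Q k (X i * f) = X i * Q (k + 1) f
  counit : ∀ i, ε (X i) = 0

namespace MvPowerSeries

variable {κ : Type*} [Fintype κ] [DecidableEq κ]

theorem coeff_X_mul_eq (i : κ) (f : MvPowerSeries κ ℂ) (d : κ →₀ ℕ) :
    MvPowerSeries.coeff d (MvPowerSeries.X i * f) =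
      if d i = 0 then 0 else MvPowerSeries.coeff (d - Finsupp.single i 1) f := by
  rw [MvPowerSeries.X, MvPowerSeries.coeff_monomial_mul, one_mul]
  have h : Finsupp.single i 1 ≤ d ↔ ¬ d i = 0 := by
    rw [Finsupp.single_le_iff, Nat.one_le_iff_ne_zero]
  by_cases hd : d i = 0
  · rw [if_pos hd, if_neg (by rwa [h, not_not])]
  · rw [if_neg hd, if_pos (h.2 hd)]

/-- Division of the homogeneous components of degree `n` by `n + k`. -/
def divDegree (k : ℕ) : MvPowerSeries κ ℂ →ₗ[ℂ] MvPowerSeries κ ℂ where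
  toFun f := fun d => ((d.degree + k : ℕ) : ℂ)⁻¹ * MvPowerSeries.coeff d f
  map_add' f g := by ext d; exact mul_add _ _ _
  map_smul' c f := by ext d; exact mul_left_comm _ _ _

theorem coeff_divDegree (k : ℕ) (f : MvPowerSeries κ ℂ) (d : κ →₀ ℕ) :
    MvPowerSeries.coeff d (divDegree k f) =
      ((d.degree + k : ℕ) : ℂ)⁻¹ * MvPowerSeries.coeff d f := rfl

theorem sum_X_mul_pderiv (f : MvPowerSeries κ ℂ) (d : κ →₀ ℕ) :
    MvPowerSeries.coeff d (∑ i, MvPowerSeries.X i * MvPowerSeries.pderiv ℂ i f) =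
      (d.degree : ℂ) * MvPowerSeries.coeff d f := by
  rw [map_sum]
  have h : ∀ i, MvPowerSeries.coeff d (MvPowerSeries.X i * MvPowerSeries.pderiv ℂ i f) =
      (d i : ℂ) * MvPowerSeries.coeff d f := by
    intro i
    rw [coeff_X_mul_eq]
    split_ifs with h
    · rw [h, Nat.cast_zero, zero_mul]
    · rw [MvPowerSeries.coeff_pderiv]
      have h1 : d - Finsupp.single i 1 + Finsupp.single i 1 = d :=
        tsub_add_cancel_of_le (Finsupp.single_le_iff.2 (Nat.one_le_iff_ne_zero.2 h))
      have h2 : (d - Finsupp.single i 1 : κ →₀ ℕ) i = d i - 1 := by simp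
      rw [h1, h2, mul_comm]
      congr 1
      rw [← Nat.cast_succ, Nat.succ_eq_add_one, Nat.sub_add_cancel (Nat.one_le_iff_ne_zero.2 h)]
  simp_rw [h]
  rw [← Finset.sum_mul, ← Nat.cast_sum, Finsupp.degree_eq_sum]

/-- The Euler operators of the power series ring. -/
def eulerOps : EulerOps (MvPowerSeries κ ℂ) κ
    { MvPowerSeries.constantCoeff with commutes' := fun c => MvPowerSeries.constantCoeff_C c }
    MvPowerSeries.X where
  D i := (MvPowerSeries.pderiv ℂ i).toLinearMap
  Q := divDegree
  leibniz i j f := by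
    change MvPowerSeries.pderiv ℂ j _ = _ * MvPowerSeries.pderiv ℂ j f + _
    rw [Derivation.leibniz, MvPowerSeries.pderiv_X, smul_eq_mul, smul_eq_mul]
    congr 1
    by_cases h : i = j
    · subst h; simp
    · rw [if_neg h, Pi.single_eq_of_ne (by tauto), mul_zero]
  euler_succ k f := by
    ext d
    rw [map_add, map_smul]
    refine (congrArg (· + _) (sum_X_mul_pderiv _ d)).trans ?_
    rw [smul_eq_mul, ← add_mul, coeff_divDegree, ← Nat.cast_add, ← mul_assoc,
      mul_inv_cancel₀ (Nat.cast_ne_zero.2 (by omega)), one_mul]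
  euler_zero f := by
    ext d
    rw [map_add]
    refine (congrArg (· + _) (sum_X_mul_pderiv _ d)).trans ?_
    change _ + MvPowerSeries.coeff d (MvPowerSeries.C (MvPowerSeries.constantCoeff f)) = _
    rw [coeff_divDegree, MvPowerSeries.coeff_C, add_zero, ← mul_assoc]
    by_cases h : d = 0
    · subst h; simp
    · rw [if_neg h, add_zero, mul_inv_cancel₀, one_mul]
      exact Nat.cast_ne_zero.2 (by rwa [ne_eq, Finsupp.degree_eq_zero_iff])
  shift k i f := by
    ext d
    rw [coeff_divDegree, coeff_X_mul_eq, coeff_X_mul_eq]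
    split_ifs with h
    · rw [mul_zero]
    · rw [coeff_divDegree]
      have h1 : d - Finsupp.single i 1 + Finsupp.single i 1 = d :=
        tsub_add_cancel_of_le (Finsupp.single_le_iff.2 (Nat.one_le_iff_ne_zero.2 h))
      have h2 : (d - Finsupp.single i 1).degree + 1 = d.degree := by
        conv_rhs => rw [← h1]
        rw [map_add, Finsupp.degree_single]
      rw [← h2]
      congr 3
      omega
  counit i := MvPowerSeries.constantCoeff_X i

theorem continuous_D (i : κ) : Continuous (eulerOps.D i : MvPowerSeries κ ℂ → _) := by
  refine continuous_pi fun d => ?_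
  have h : ∀ f : MvPowerSeries κ ℂ, (eulerOps.D i f : MvPowerSeries κ ℂ) d =
      MvPowerSeries.coeff (d + Finsupp.single i 1) f * (d i + 1) :=
    fun f => MvPowerSeries.coeff_pderiv f d
  simp_rw [h]
  exact (MvPowerSeries.WithPiTopology.continuous_coeff ℂ _).mul continuous_const

theorem continuous_Q (k : ℕ) : Continuous (eulerOps.Q k : MvPowerSeries κ ℂ → _) := by
  refine continuous_pi fun d => ?_
  exact continuous_const.mul (MvPowerSeries.WithPiTopology.continuous_coeff ℂ d)

end MvPowerSeries

/-- Transport of Euler operators along an isomorphism. -/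
def EulerOps.map {C C' : Type*} [CommRing C] [Algebra ℂ C] [CommRing C'] [Algebra ℂ C']
    {κ : Type*} [Fintype κ] [DecidableEq κ] {ε : C →ₐ[ℂ] ℂ} {X : κ → C} (E : EulerOps C κ ε X)
    (e : C ≃ₐ[ℂ] C') {ε' : C' →ₐ[ℂ] ℂ} {X' : κ → C'} (hε : ∀ f, ε' (e f) = ε f)
    (hX : ∀ i, e (X i) = X' i) : EulerOps C' κ ε' X' where
  D i := e.toLinearMap ∘ₗ E.D i ∘ₗ e.symm.toLinearMap
  Q k := e.toLinearMap ∘ₗ E.Q k ∘ₗ e.symm.toLinearMap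
  leibniz i j f := by
    obtain ⟨f, rfl⟩ := e.surjective f
    simp only [← hX, LinearMap.comp_apply, AlgEquiv.toLinearMap_apply, ← map_mul,
      AlgEquiv.symm_apply_apply, E.leibniz, map_add]
    split_ifs
    · rfl
    · rw [map_zero]
  euler_succ k f := by
    obtain ⟨f, rfl⟩ := e.surjective f
    simp only [← hX, LinearMap.comp_apply, AlgEquiv.toLinearMap_apply,
      AlgEquiv.symm_apply_apply]
    conv_rhs => rw [← E.euler_succ k f]
    simp only [map_add, map_sum, map_mul, map_smul]
  euler_zero f := by
    obtain ⟨f, rfl⟩ := e.surjective f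
    simp only [← hX, LinearMap.comp_apply, AlgEquiv.toLinearMap_apply,
      AlgEquiv.symm_apply_apply, hε]
    conv_rhs => rw [← E.euler_zero f]
    simp only [map_add, map_sum, map_mul, AlgEquiv.commutes]
  shift k i f := by
    obtain ⟨f, rfl⟩ := e.surjective f
    simp only [← hX, LinearMap.comp_apply, AlgEquiv.toLinearMap_apply, ← map_mul,
      AlgEquiv.symm_apply_apply, E.shift]
  counit i := by rw [← hX, hε, E.counit]

end Euler

/-! ### Equivariant coordinates at a point -/

section LocalCoordinates

open scoped MvPowerSeries.WithPiTopology

variable {A : Type u} [CommRing A] [Algebra ℂ A] (m : A →ₐ[ℂ] ℂ)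

theorem smul_cotan (a : A) (y : Cotan m) : a • y = m a • y := by
  obtain ⟨z, hz, e⟩ := exists_eq_algebraMap_add m a
  conv_lhs => rw [e]
  rw [add_smul, Ideal.Cotangent.smul_eq_zero_of_mem hz, add_zero, algebraMap_smul]

instance finiteDimensional_cotan [IsNoetherianRing A] : FiniteDimensional ℂ (Cotan m) := by
  have hfin : Module.Finite A (Cotan m) :=
    Module.Finite.of_surjective (RingHom.ker m).toCotangent (RingHom.ker m).toCotangent_surjective
  obtain ⟨s, hs⟩ := hfin.fg_top
  refine ⟨s, eq_top_iff.2 fun y _ => ?_⟩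
  have hy : y ∈ Submodule.span A (s : Set (Cotan m)) := hs ▸ trivial
  induction hy using Submodule.span_induction with
  | mem y h => exact Submodule.subset_span h
  | zero => exact zero_mem _
  | add y z _ _ h h' => exact Submodule.add_mem _ (h trivial) (h' trivial)
  | smul a y _ h => rw [smul_cotan]; exact Submodule.smul_mem _ _ (h trivial)

theorem exists_cotan_section : ∃ s : Cotan m →ₗ[ℂ] A, ∀ y, ∃ h : s y ∈ RingHom.ker m,
    (RingHom.ker m).toCotangent ⟨s y, h⟩ = y := by
  let q : (RingHom.ker m) →ₗ[ℂ] Cotan m := (RingHom.ker m).toCotangent.restrictScalars ℂ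
  obtain ⟨s, hs⟩ := q.exists_rightInverse_of_surjective
    (LinearMap.range_eq_top.2 (RingHom.ker m).toCotangent_surjective)
  exact ⟨((RingHom.ker m).subtype.restrictScalars ℂ) ∘ₗ s, fun y =>
    ⟨(s y).2, LinearMap.congr_fun hs y⟩⟩

variable (G : Type u) [Group G] [Finite G] [MulSemiringAction G A] [SMulCommClass G ℂ A]

theorem orbitIdeal_isotropy : orbitIdeal (isotropy G m) m = RingHom.ker m := by
  refine le_antisymm (orbitIdeal_le _ m) fun f hf h => ?_
  exact (h.2 f).trans hf

theorem exists_equivariant_section : ∃ s : Cotan m →ₗ[ℂ] A,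
    (∀ y, ∃ h : s y ∈ RingHom.ker m, (RingHom.ker m).toCotangent ⟨s y, h⟩ = y) ∧
      ∀ (h : isotropy G m) y, s (cotanRep G m h y) = h • s y := by
  have : Fintype (isotropy G m) := Fintype.ofFinite _
  obtain ⟨s₀, hs₀⟩ := exists_cotan_section m
  have hc : (Fintype.card (isotropy G m) : ℂ) ≠ 0 := Nat.cast_ne_zero.2 Fintype.card_ne_zero
  have hstab : ∀ (h : isotropy G m) (a : A), a ∈ RingHom.ker m → h • a ∈ RingHom.ker m :=
    fun h a ha => (h.2 a).trans ha
  have hmap : ∀ (h : isotropy G m) (a : A) (ha : a ∈ RingHom.ker m),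
      (RingHom.ker m).toCotangent ⟨h • a, hstab h a ha⟩ =
        cotanRep G m h ((RingHom.ker m).toCotangent ⟨a, ha⟩) := fun h a ha =>
    (Ideal.mapCotangent_toCotangent _ _ _ (ker_le_comap G m h) ⟨a, ha⟩).symm
  let s : Cotan m →ₗ[ℂ] A := (Fintype.card (isotropy G m) : ℂ)⁻¹ •
    ∑ h : isotropy G m, DistribMulAction.toModuleEnd ℂ A h ∘ₗ s₀ ∘ₗ cotanRep G m h⁻¹
  have hs : ∀ y, s y = (Fintype.card (isotropy G m) : ℂ)⁻¹ •
      ∑ h : isotropy G m, h • s₀ (cotanRep G m h⁻¹ y) := fun y => by simp [s]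
  refine ⟨s, fun y => ?_, fun k y => ?_⟩
  · have h1 : s y ∈ RingHom.ker m := by
      rw [hs]
      exact Submodule.smul_of_tower_mem _ _
        (Ideal.sum_mem _ fun h _ => hstab h _ (hs₀ _).choose)
    refine ⟨h1, ?_⟩
    have h2 : (⟨s y, h1⟩ : RingHom.ker m) = (Fintype.card (isotropy G m) : ℂ)⁻¹ •
        ∑ h : isotropy G m, ⟨h • s₀ (cotanRep G m h⁻¹ y), hstab h _ (hs₀ _).choose⟩ :=
      Subtype.ext ((hs y).trans (by simp))
    rw [h2]
    refine (((RingHom.ker m).toCotangent.restrictScalars ℂ).map_smul _ _).trans ?_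
    rw [LinearMap.restrictScalars_apply, map_sum]
    have h3 : ∀ h : isotropy G m, (RingHom.ker m).toCotangent
        ⟨h • s₀ (cotanRep G m h⁻¹ y), hstab h _ (hs₀ _).choose⟩ = y := by
      intro h
      rw [hmap h _ (hs₀ _).choose, (hs₀ _).choose_spec, ← Module.End.mul_apply, ← map_mul,
        mul_inv_cancel, map_one, Module.End.one_apply]
    rw [Finset.sum_congr rfl fun h _ => h3 h, Finset.sum_const, Finset.card_univ,
      ← Nat.cast_smul_eq_nsmul ℂ, smul_smul, inv_mul_cancel₀ hc, one_smul]
  · rw [hs, hs, smul_comm k]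
    congr 1
    rw [Finset.smul_sum]
    refine Fintype.sum_equiv (Equiv.mulLeft k⁻¹) _ _ fun h => ?_
    rw [Equiv.coe_mulLeft, smul_smul, mul_inv_cancel_left, mul_inv_rev, inv_inv, map_mul,
      Module.End.mul_apply]

/-- An equivariant system of functions vanishing at the point, with prescribed differentials. -/
def coordFun : Cotan m →ₗ[ℂ] A := (exists_equivariant_section m G).choose

theorem coordFun_mem (y : Cotan m) : coordFun m G y ∈ RingHom.ker m :=
  ((exists_equivariant_section m G).choose_spec.1 y).choose

theorem toCotangent_coordFun (y : Cotan m) :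
    (RingHom.ker m).toCotangent ⟨coordFun m G y, coordFun_mem m G y⟩ = y :=
  ((exists_equivariant_section m G).choose_spec.1 y).choose_spec

theorem coordFun_cotanRep (h : isotropy G m) (y : Cotan m) :
    coordFun m G (cotanRep G m h y) = h • coordFun m G y :=
  (exists_equivariant_section m G).choose_spec.2 h y

/-- The completion of the functions at the point itself. -/
abbrev LocalCompletion : Type u := OrbitCompletion (isotropy G m) m

variable [IsNoetherianRing A]

/-- The index set of a system of coordinates. -/
abbrev CoordIndex : Type := Fin (Module.finrank ℂ (Cotan m))

/-- A basis of the cotangent space. -/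
def cotanBasis : Module.Basis (CoordIndex m) ℂ (Cotan m) := Module.finBasis ℂ (Cotan m)

theorem ker_le_span_coordFun : RingHom.ker m ≤
    Ideal.span (Set.range fun i => coordFun m G (cotanBasis m i)) ⊔ RingHom.ker m ^ 2 := by
  intro z hz
  let y := (RingHom.ker m).toCotangent ⟨z, hz⟩
  have h1 : z - coordFun m G y ∈ RingHom.ker m ^ 2 :=
    ((RingHom.ker m).toCotangent_eq).1 (toCotangent_coordFun m G y).symm
  have h2 : coordFun m G y ∈ Ideal.span (Set.range fun i => coordFun m G (cotanBasis m i)) := by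
    rw [← (cotanBasis m).sum_repr y, map_sum]
    refine Ideal.sum_mem _ fun i _ => ?_
    rw [map_smul]
    exact Submodule.smul_of_tower_mem _ _ (Ideal.subset_span ⟨i, rfl⟩)
  rw [← sub_add_cancel z (coordFun m G y), add_comm]
  exact Submodule.add_mem_sup h2 h1

theorem eq_zero_of_sum_coordFun_mem (a : CoordIndex m → ℂ)
    (h : ∑ i, a i • coordFun m G (cotanBasis m i) ∈ RingHom.ker m ^ 2) : a = 0 := by
  have h1 : ∑ i, a i • coordFun m G (cotanBasis m i) =
      coordFun m G (∑ i, a i • cotanBasis m i) := by simp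
  rw [h1] at h
  have h2 := toCotangent_coordFun m G (∑ i, a i • cotanBasis m i)
  rw [(Ideal.toCotangent_eq_zero _ _).2 h] at h2
  exact funext (Fintype.linearIndependent_iff.1 (cotanBasis m).linearIndependent a h2.symm)

variable [hreg : IsRegularLocalRing (Localization.AtPrime (RingHom.ker m))]

/-- Formal coordinates at a nonsingular point. -/
def chart : MvPowerSeries (CoordIndex m) ℂ ≃ₐ[ℂ] LocalCompletion m G :=
  seriesEquiv (orbitIdeal_isotropy m G) (fun i => coordFun_mem m G (cotanBasis m i)) hreg
    (ker_le_span_coordFun m G) (eq_zero_of_sum_coordFun_mem m G)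

/-- The formal coordinates, as functions on the cotangent space. -/
def formalCoord : Cotan m →ₗ[ℂ] LocalCompletion m G :=
  (OrbitCompletion.of (isotropy G m) m).toLinearMap ∘ₗ coordFun m G

theorem chart_X (i : CoordIndex m) :
    chart m G (MvPowerSeries.X i) = formalCoord m G (cotanBasis m i) :=
  seriesMap_X (orbitIdeal_isotropy m G) (fun i => coordFun_mem m G (cotanBasis m i)) i

theorem formalCoord_cotanRep (h : isotropy G m) (y : Cotan m) :
    formalCoord m G (cotanRep G m h y) = h • formalCoord m G y := by
  change OrbitCompletion.of _ m (coordFun m G _) = h • OrbitCompletion.of _ m (coordFun m G _)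
  rw [OrbitCompletion.smul_of, coordFun_cotanRep]

theorem evalPoint_formalCoord (y : Cotan m) :
    OrbitCompletion.evalPoint (isotropy G m) m (formalCoord m G y) = 0 :=
  (OrbitCompletion.evalPoint_of _).trans (coordFun_mem m G y)

/-- The Euler operators of the completion at a nonsingular point. -/
def localEuler : EulerOps (LocalCompletion m G) (CoordIndex m)
    (OrbitCompletion.evalPoint (isotropy G m) m) (fun i => formalCoord m G (cotanBasis m i)) :=
  MvPowerSeries.eulerOps.map (chart m G)
    (evalPoint_seriesMap (orbitIdeal_isotropy m G) (fun i => coordFun_mem m G (cotanBasis m i)))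
    (chart_X m G)

theorem continuous_chart : Continuous (chart m G) :=
  continuous_seriesMap (orbitIdeal_isotropy m G) (fun i => coordFun_mem m G (cotanBasis m i))

theorem continuous_chart_symm : Continuous (chart m G).symm :=
  continuous_coeff_seriesEquiv_symm (orbitIdeal_isotropy m G)
    (fun i => coordFun_mem m G (cotanBasis m i)) hreg
    (ker_le_span_coordFun m G) (eq_zero_of_sum_coordFun_mem m G)

theorem isInducing_chart_symm : Topology.IsInducing (chart m G).symm :=
  Homeomorph.isInducing
    { toEquiv := (chart m G).symm.toEquiv
      continuous_toFun := continuous_chart_symm m G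
      continuous_invFun := continuous_chart m G }

theorem continuous_localEuler_D (i : CoordIndex m) : Continuous ((localEuler m G).D i) :=
  (continuous_chart m G).comp ((MvPowerSeries.continuous_D i).comp (continuous_chart_symm m G))

theorem continuous_localEuler_Q (k : ℕ) : Continuous ((localEuler m G).Q k) :=
  (continuous_chart m G).comp ((MvPowerSeries.continuous_Q k).comp (continuous_chart_symm m G))

theorem continuousAdd_local : ContinuousAdd (LocalCompletion m G) :=
  (isInducing_chart_symm m G).continuousAdd (chart m G).symm

theorem continuousMul_local : ContinuousMul (LocalCompletion m G) :=
  (isInducing_chart_symm m G).continuousMul (chart m G).symm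

theorem continuousSMul_local : ContinuousSMul ℂ (LocalCompletion m G) :=
  (isInducing_chart_symm m G).continuousSMul continuous_id (by intro c x; exact map_smul _ _ _)

theorem continuous_smul_completion {K : Type u} [Group K] [MulSemiringAction K A]
    [SMulCommClass K ℂ A] (h : K) :
    Continuous fun c : OrbitCompletion K m => h • c := by
  rw [OrbitCompletion.continuous_iff]
  intro n
  let _ : TopologicalSpace (A ⧸ orbitIdeal K m ^ n) := moduleTopology ℂ _
  have : IsModuleTopology ℂ (A ⧸ orbitIdeal K m ^ n) := ⟨rfl⟩
  let l : (A ⧸ orbitIdeal K m ^ n) →ₗ[ℂ] (A ⧸ orbitIdeal K m ^ n) :=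
    { OrbitCompletion.quotAct K m h n with
      map_smul' := fun c a => by
        obtain ⟨a, rfl⟩ := Ideal.Quotient.mk_surjective a
        exact congrArg (Ideal.Quotient.mk _) (smul_comm h c a) }
  simp_rw [OrbitCompletion.proj_smul]
  have : ContinuousAdd (A ⧸ orbitIdeal K m ^ n) := IsModuleTopology.toContinuousAdd ℂ _
  have : ContinuousSMul ℂ (A ⧸ orbitIdeal K m ^ n) := IsModuleTopology.toContinuousSMul ℂ _
  exact (IsModuleTopology.continuous_of_linearMap l).comp (OrbitCompletion.continuous_proj n)

end LocalCoordinates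

/-! ### Coefficient spaces -/

section Coef

/-- The space `U ⊗ C` of `C`-valued points of a finite-dimensional space `U`, realized as the linear
maps from the dual of `U` to `C`. -/
abbrev Coef (C : Type*) [AddCommGroup C] [Module ℂ C] (U : Type*) [AddCommGroup U] [Module ℂ U] :=
  Module.Dual ℂ U →ₗ[ℂ] C

variable {C C' C'' : Type*} [AddCommGroup C] [Module ℂ C] [AddCommGroup C'] [Module ℂ C']
  [AddCommGroup C''] [Module ℂ C'']
  {U U' U'' : Type*} [AddCommGroup U] [Module ℂ U] [AddCommGroup U'] [Module ℂ U']
  [AddCommGroup U''] [Module ℂ U'']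

/-- The map `α ⊗ T : U ⊗ C → U' ⊗ C'`. -/
def opMap : (C →ₗ[ℂ] C') →ₗ[ℂ] (U →ₗ[ℂ] U') →ₗ[ℂ] Coef C U →ₗ[ℂ] Coef C' U' :=
  LinearMap.mk₂ ℂ
    (fun T α =>
      { toFun := fun f => T ∘ₗ f ∘ₗ α.dualMap
        map_add' := fun f g => by rw [LinearMap.add_comp, LinearMap.comp_add]
        map_smul' := fun c f => by rw [LinearMap.smul_comp, LinearMap.comp_smul]; rfl })
    (fun _ _ _ => rfl) (fun _ _ _ => rfl)
    (fun T α β => LinearMap.ext fun f => LinearMap.ext fun ξ => by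
      change T (f (ξ ∘ₗ (α + β))) = T (f (ξ ∘ₗ α)) + T (f (ξ ∘ₗ β))
      rw [LinearMap.comp_add, map_add, map_add])
    (fun c T α => LinearMap.ext fun f => LinearMap.ext fun ξ => by
      change T (f (ξ ∘ₗ (c • α))) = c • T (f (ξ ∘ₗ α))
      rw [LinearMap.comp_smul, map_smul, map_smul])

theorem opMap_apply (T : C →ₗ[ℂ] C') (α : U →ₗ[ℂ] U') (f : Coef C U) (ξ : Module.Dual ℂ U') :
    opMap T α f ξ = T (f (ξ ∘ₗ α)) := rfl

theorem opMap_comp (T : C →ₗ[ℂ] C') (T' : C' →ₗ[ℂ] C'') (α : U →ₗ[ℂ] U') (α' : U' →ₗ[ℂ] U'') :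
    opMap T' α' ∘ₗ opMap T α = opMap (T' ∘ₗ T) (α' ∘ₗ α) := rfl

theorem opMap_id : opMap (LinearMap.id : C →ₗ[ℂ] C) (LinearMap.id : U →ₗ[ℂ] U) = LinearMap.id :=
  rfl

/-- The element `u ⊗ c`. -/
def Coef.pure (c : C) : U →ₗ[ℂ] Coef C U where
  toFun u := LinearMap.smulRight (Module.Dual.eval ℂ U u) c
  map_add' u u' := LinearMap.ext fun ξ => by simp [add_smul]
  map_smul' a u := LinearMap.ext fun ξ => by simp [mul_smul]

theorem Coef.pure_apply (c : C) (u : U) (ξ : Module.Dual ℂ U) : Coef.pure c u ξ = ξ u • c := rfl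

theorem opMap_pure (T : C →ₗ[ℂ] C') (α : U →ₗ[ℂ] U') (c : C) (u : U) :
    opMap T α (Coef.pure c u) = Coef.pure (T c) (α u) :=
  LinearMap.ext fun _ => map_smul T _ _

theorem Coef.sum_pure {κ : Type*} [Fintype κ] [DecidableEq κ] (b : Module.Basis κ ℂ U)
    (f : Coef C U) : ∑ i, Coef.pure (f (b.coord i)) (b i) = f := by
  refine LinearMap.ext fun ξ => ?_
  rw [LinearMap.sum_apply]
  simp_rw [Coef.pure_apply, ← map_smul, ← map_sum, b.sum_dual_apply_smul_coord]

/-- Evaluation of the coefficients. -/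
def coefEval [FiniteDimensional ℂ U] (ε : C →ₗ[ℂ] ℂ) : Coef C U →ₗ[ℂ] U :=
  (Module.evalEquiv ℂ U).symm.toLinearMap ∘ₗ opMap ε LinearMap.id

theorem dual_coefEval [FiniteDimensional ℂ U] (ε : C →ₗ[ℂ] ℂ) (f : Coef C U)
    (ξ : Module.Dual ℂ U) : ξ (coefEval ε f) = ε (f ξ) := by
  have h : Module.Dual.eval ℂ U (coefEval ε f) = opMap ε LinearMap.id f := by
    rw [← Module.evalEquiv_toLinearMap]
    exact (Module.evalEquiv ℂ U).apply_symm_apply _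
  exact LinearMap.congr_fun h ξ

theorem dual_ext [FiniteDimensional ℂ U] {u v : U} (h : ∀ ξ : Module.Dual ℂ U, ξ u = ξ v) :
    u = v :=
  (Module.evalEquiv ℂ U).injective (LinearMap.ext h)

theorem coefEval_pure [FiniteDimensional ℂ U] (ε : C →ₗ[ℂ] ℂ) (c : C) (u : U) :
    coefEval ε (Coef.pure c u) = ε c • u :=
  dual_ext fun ξ => by
    rw [dual_coefEval, Coef.pure_apply, map_smul, map_smul, smul_eq_mul, smul_eq_mul, mul_comm]

theorem coefEval_opMap [FiniteDimensional ℂ U] [FiniteDimensional ℂ U'] (ε : C →ₗ[ℂ] ℂ)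
    (ε' : C' →ₗ[ℂ] ℂ) (T : C →ₗ[ℂ] C') (h : ε' ∘ₗ T = ε) (α : U →ₗ[ℂ] U') (f : Coef C U) :
    coefEval ε' (opMap T α f) = α (coefEval ε f) :=
  dual_ext fun ξ => by
    rw [dual_coefEval, opMap_apply, ← LinearMap.comp_apply, h]
    exact (dual_coefEval ε f (ξ ∘ₗ α)).symm

end Coef

/-! ### The Koszul complex -/

section Koszul

section Sums

variable {ι ι' M N L : Type*} [Fintype ι] [Fintype ι'] [AddCommGroup M] [Module ℂ M]
  [AddCommGroup N] [Module ℂ N] [AddCommGroup L] [Module ℂ L]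

theorem sum_comp_linear (f : ι → N →ₗ[ℂ] L) (g : M →ₗ[ℂ] N) :
    (∑ i, f i) ∘ₗ g = ∑ i, f i ∘ₗ g :=
  map_sum (LinearMap.lcomp ℂ L g) f _

theorem comp_sum_linear (f : N →ₗ[ℂ] L) (g : ι → M →ₗ[ℂ] N) :
    f ∘ₗ (∑ i, g i) = ∑ i, f ∘ₗ g i :=
  map_sum (LinearMap.llcomp ℂ M N L f) g _

theorem sum_comp_sum_linear (f : ι → N →ₗ[ℂ] L) (g : ι' → M →ₗ[ℂ] N) :
    (∑ i, f i) ∘ₗ (∑ j, g j) = ∑ i, ∑ j, f i ∘ₗ g j := by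
  rw [sum_comp_linear]
  exact Finset.sum_congr rfl fun i _ => comp_sum_linear _ _

end Sums

/-- The right contraction as a linear function of the covector. -/
def rightContrHom (W : Type u) [AddCommGroup W] [Module ℂ W] (k : ℕ) :
    Module.Dual ℂ W →ₗ[ℂ] ⋀[ℂ]^(k + 1) W →ₗ[ℂ] ⋀[ℂ]^k W where
  toFun ξ := rightContr ξ k
  map_add' ξ η := LinearMap.ext fun x => Subtype.ext (map_add
    (CliffordAlgebra.contractRight (Q := (0 : QuadraticForm ℂ W)) x.1) ξ η)
  map_smul' c ξ := LinearMap.ext fun x => Subtype.ext (map_smul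
    (CliffordAlgebra.contractRight (Q := (0 : QuadraticForm ℂ W)) x.1) c ξ)

theorem sum_basis_coord_eq {W M : Type*} [AddCommGroup W] [Module ℂ W] [AddCommMonoid M]
    [Module ℂ M] {κ : Type*} [Fintype κ] [DecidableEq κ] (b b' : Module.Basis κ ℂ W)
    (B : W →ₗ[ℂ] Module.Dual ℂ W →ₗ[ℂ] M) :
    ∑ i, B (b i) (b.coord i) = ∑ i, B (b' i) (b'.coord i) := by
  have h : ∀ i, B (b' i) (b'.coord i) = ∑ j, b.coord j (b' i) • B (b j) (b'.coord i) := by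
    intro i
    conv_lhs => rw [← b.sum_repr (b' i)]
    rw [map_sum, LinearMap.sum_apply]
    exact Finset.sum_congr rfl fun j _ => by rw [map_smul]; rfl
  simp_rw [h]
  rw [Finset.sum_comm]
  refine Finset.sum_congr rfl fun j _ => ?_
  simp_rw [← map_smul, ← map_sum]
  rw [b'.sum_dual_apply_smul_coord]

theorem eq_zero_of_eq_neg {M : Type*} [AddCommGroup M] [Module ℂ M] {a : M} (h : a = -a) :
    a = 0 := by
  have h2 : (2 : ℂ) • a = 0 := by
    rw [two_smul]
    nth_rw 1 [h]
    exact neg_add_cancel a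
  exact (smul_eq_zero.1 h2).resolve_left two_ne_zero

section Abstract

variable {C : Type*} [CommRing C] [Algebra ℂ C] {κ : Type*} [Fintype κ]
  {U₀ U₁ U₂ : Type*} [AddCommGroup U₀] [Module ℂ U₀] [AddCommGroup U₁] [Module ℂ U₁]
  [AddCommGroup U₂] [Module ℂ U₂]

/-- The operator `∑ y i ⊗ c i`. -/
def mulSum (y : κ → C) (c : κ → U₁ →ₗ[ℂ] U₀) : Coef C U₁ →ₗ[ℂ] Coef C U₀ :=
  ∑ i, opMap (LinearMap.mulLeft ℂ (y i)) (c i)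

theorem mulSum_basis {W : Type*} [AddCommGroup W] [Module ℂ W] [DecidableEq κ] (x : W →ₗ[ℂ] C)
    (c : Module.Dual ℂ W →ₗ[ℂ] U₁ →ₗ[ℂ] U₀) (b b' : Module.Basis κ ℂ W) :
    mulSum (fun i => x (b i)) (fun i => c (b.coord i)) =
      mulSum (fun i => x (b' i)) fun i => c (b'.coord i) :=
  sum_basis_coord_eq b b' ((opMap ∘ₗ LinearMap.mul ℂ C ∘ₗ x).compl₂ c)

/-- The operator `∑ D i Q ⊗ c i`. -/
def diffSum (D : κ → C →ₗ[ℂ] C) (Q : C →ₗ[ℂ] C) (c : κ → U₁ →ₗ[ℂ] U₀) :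
    Coef C U₁ →ₗ[ℂ] Coef C U₀ :=
  ∑ i, opMap (D i ∘ₗ Q) (c i)

theorem mulSum_mulSum (y : κ → C) (c : κ → U₁ →ₗ[ℂ] U₀) (c' : κ → U₂ →ₗ[ℂ] U₁)
    (h : ∀ i j, c i ∘ₗ c' j = -(c j ∘ₗ c' i)) : mulSum y c ∘ₗ mulSum y c' = 0 := by
  refine LinearMap.ext fun f => LinearMap.ext fun ξ => eq_zero_of_eq_neg ?_
  have e : ∀ S : κ → κ → Coef C U₂ →ₗ[ℂ] Coef C U₀,
      (∑ i, ∑ j, S i j) f ξ = ∑ i, ∑ j, S i j f ξ := fun S => by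
    simp only [LinearMap.sum_apply]
  rw [mulSum, mulSum, sum_comp_sum_linear, e]
  conv_lhs => rw [Finset.sum_comm]
  rw [← Finset.sum_neg_distrib]
  refine Finset.sum_congr rfl fun i _ => ?_
  rw [← Finset.sum_neg_distrib]
  refine Finset.sum_congr rfl fun j _ => ?_
  rw [opMap_comp, opMap_comp, h, map_neg]
  change -(y j * (y i * _)) = -(y i * (y j * _))
  rw [mul_left_comm]

theorem mulSum_comp_opMap {U₀' U₁' : Type*} [AddCommGroup U₀'] [Module ℂ U₀'] [AddCommGroup U₁']
    [Module ℂ U₁'] (y y' : κ → C) (T : C →ₗ[ℂ] C) (hT : ∀ i c, y i * T c = T (y' i * c))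
    (r₁ : U₁' →ₗ[ℂ] U₁) (r₀ : U₀' →ₗ[ℂ] U₀) (c : κ → U₁ →ₗ[ℂ] U₀) (c' : κ → U₁' →ₗ[ℂ] U₀')
    (h : ∀ i, c i ∘ₗ r₁ = r₀ ∘ₗ c' i) :
    mulSum y c ∘ₗ opMap T r₁ = opMap T r₀ ∘ₗ mulSum y' c' := by
  rw [mulSum, mulSum, comp_sum_linear, sum_comp_linear]
  refine Finset.sum_congr rfl fun i _ => ?_
  rw [opMap_comp, opMap_comp, h]
  congr 2
  exact LinearMap.ext (hT i)

variable [DecidableEq κ] {y : κ → C} {ε : C →ₐ[ℂ] ℂ} (E : EulerOps C κ ε y)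

include E in
theorem mulSum_homotopy (k : ℕ) (c : κ → U₁ →ₗ[ℂ] U₀) (c' : κ → U₂ →ₗ[ℂ] U₁)
    (a : κ → U₀ →ₗ[ℂ] U₁) (a' : κ → U₁ →ₗ[ℂ] U₂)
    (h : ∀ i j, c' i ∘ₗ a' j = (if i = j then (1 : ℂ) else 0) • LinearMap.id - a j ∘ₗ c i)
    (hs : ∑ i, a i ∘ₗ c i = ((k + 1 : ℕ) : ℂ) • LinearMap.id) :
    mulSum y c' ∘ₗ diffSum E.D (E.Q (k + 1)) a' + diffSum E.D (E.Q k) a ∘ₗ mulSum y c =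
      LinearMap.id := by
  rw [mulSum, mulSum, diffSum, diffSum, sum_comp_sum_linear, sum_comp_sum_linear]
  refine (congrArg (_ + ·) Finset.sum_comm).trans ?_
  rw [← Finset.sum_add_distrib]
  have h1 : ∀ i j, opMap (LinearMap.mulLeft ℂ (y i)) (c' i) ∘ₗ
        opMap (E.D j ∘ₗ E.Q (k + 1)) (a' j) +
      opMap (E.D j ∘ₗ E.Q k) (a j) ∘ₗ opMap (LinearMap.mulLeft ℂ (y i)) (c i) =
      if i = j then opMap (LinearMap.mulLeft ℂ (y i) ∘ₗ E.D i ∘ₗ E.Q (k + 1)) LinearMap.id +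
        opMap (E.Q (k + 1)) (a i ∘ₗ c i)
      else 0 := by
    intro i j
    have e1 : (E.D j ∘ₗ E.Q k) ∘ₗ LinearMap.mulLeft ℂ (y i) =
        LinearMap.mulLeft ℂ (y i) ∘ₗ E.D j ∘ₗ E.Q (k + 1) +
          if i = j then E.Q (k + 1) else 0 := by
      refine LinearMap.ext fun f => ?_
      have h2 := E.leibniz i j (E.Q (k + 1) f)
      have h3 := E.shift k i f
      rw [LinearMap.add_apply]
      change E.D j (E.Q k (y i * f)) = y i * E.D j (E.Q (k + 1) f) + _
      rw [h3, h2]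
      split_ifs <;> rfl
    rw [opMap_comp, opMap_comp, e1, h, map_sub, map_add, LinearMap.add_apply, map_smul]
    split_ifs with hij
    · subst hij; rw [one_smul]; abel
    · rw [zero_smul, map_zero, LinearMap.zero_apply]; abel
  have h2 : ∀ i ∈ (Finset.univ : Finset κ), (∑ j, opMap (LinearMap.mulLeft ℂ (y i)) (c' i) ∘ₗ
        opMap (E.D j ∘ₗ E.Q (k + 1)) (a' j)) +
      ∑ j, opMap (E.D j ∘ₗ E.Q k) (a j) ∘ₗ opMap (LinearMap.mulLeft ℂ (y i)) (c i) =
      opMap (LinearMap.mulLeft ℂ (y i) ∘ₗ E.D i ∘ₗ E.Q (k + 1)) LinearMap.id +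
        opMap (E.Q (k + 1)) (a i ∘ₗ c i) := by
    intro i _
    rw [← Finset.sum_add_distrib, Finset.sum_congr rfl fun j _ => h1 i j, Finset.sum_ite_eq,
      if_pos (Finset.mem_univ _)]
  rw [Finset.sum_congr rfl h2, Finset.sum_add_distrib, ← map_sum, hs, ← LinearMap.sum_apply,
    ← map_sum, map_smul, ← LinearMap.smul_apply, ← map_smul, ← LinearMap.add_apply, ← map_add]
  refine Eq.trans (congrArg (fun T => opMap T LinearMap.id) (?_ : _ = LinearMap.id)) opMap_id
  refine LinearMap.ext fun f => ?_
  rw [LinearMap.add_apply, LinearMap.sum_apply]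
  exact E.euler_succ k f

include E in
theorem mulSum_homotopy_zero (c : κ → U₁ →ₗ[ℂ] U₀) (a : κ → U₀ →ₗ[ℂ] U₁)
    (h : ∀ i j, c i ∘ₗ a j = (if i = j then (1 : ℂ) else 0) • LinearMap.id) :
    mulSum y c ∘ₗ diffSum E.D (E.Q 0) a +
      opMap (Algebra.linearMap ℂ C ∘ₗ ε.toLinearMap) LinearMap.id = LinearMap.id := by
  rw [mulSum, diffSum, sum_comp_sum_linear]
  have h1 : ∀ i j, opMap (LinearMap.mulLeft ℂ (y i)) (c i) ∘ₗ opMap (E.D j ∘ₗ E.Q 0) (a j) =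
      if i = j then opMap (LinearMap.mulLeft ℂ (y i) ∘ₗ E.D i ∘ₗ E.Q 0) LinearMap.id
      else 0 := by
    intro i j
    rw [opMap_comp, h, map_smul]
    split_ifs with hij
    · subst hij; rw [one_smul]
    · rw [zero_smul]
  have h2 : ∀ i ∈ (Finset.univ : Finset κ), ∑ j, opMap (LinearMap.mulLeft ℂ (y i)) (c i) ∘ₗ
      opMap (E.D j ∘ₗ E.Q 0) (a j) =
      opMap (LinearMap.mulLeft ℂ (y i) ∘ₗ E.D i ∘ₗ E.Q 0) LinearMap.id := by
    intro i _
    rw [Finset.sum_congr rfl fun j _ => h1 i j, Finset.sum_ite_eq, if_pos (Finset.mem_univ _)]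
  rw [Finset.sum_congr rfl h2, ← LinearMap.sum_apply, ← map_sum, ← LinearMap.add_apply, ← map_add]
  refine Eq.trans (congrArg (fun T => opMap T LinearMap.id) (?_ : _ = LinearMap.id)) opMap_id
  refine LinearMap.ext fun f => ?_
  rw [LinearMap.add_apply, LinearMap.sum_apply]
  exact E.euler_zero f

end Abstract

variable {C : Type*} [CommRing C] [Algebra ℂ C] {W : Type u} [AddCommGroup W] [Module ℂ W]
  {κ : Type*} [Fintype κ] [DecidableEq κ] (t : Module.Basis κ ℂ W) (x : W →ₗ[ℂ] C)
  (V : Type u) [AddCommGroup V] [Module ℂ V]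

/-- The Koszul differential. -/
def koszulD (k : ℕ) : Coef C (V ⊗[ℂ] ⋀[ℂ]^(k + 1) W) →ₗ[ℂ] Coef C (V ⊗[ℂ] ⋀[ℂ]^k W) :=
  mulSum (fun i => x (t i)) fun i => LinearMap.lTensor V (rightContr (t.coord i) k)

theorem koszulD_comp (k : ℕ) : koszulD t x V k ∘ₗ koszulD t x V (k + 1) = 0 :=
  mulSum_mulSum _ _ _ fun i j => by
    rw [← LinearMap.lTensor_comp, ← LinearMap.lTensor_comp, rightContr_rightContr,
      LinearMap.lTensor_neg]

variable {x} {ε : C →ₐ[ℂ] ℂ} (E : EulerOps C κ ε (fun i => x (t i)))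

/-- The contracting homotopy of the Koszul complex. -/
def koszulS (k : ℕ) : Coef C (V ⊗[ℂ] ⋀[ℂ]^k W) →ₗ[ℂ] Coef C (V ⊗[ℂ] ⋀[ℂ]^(k + 1) W) :=
  diffSum E.D (E.Q k) fun j => LinearMap.lTensor V (rightMul (t j) k)

theorem coord_basis (i j : κ) : t.coord i (t j) = if i = j then 1 else 0 := by
  rw [Module.Basis.coord_apply, t.repr_self, Finsupp.single_apply]
  exact if_congr eq_comm rfl rfl

theorem koszul_homotopy (k : ℕ) :
    koszulD t x V (k + 1) ∘ₗ koszulS t V E (k + 1) + koszulS t V E k ∘ₗ koszulD t x V k =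
      LinearMap.id :=
  mulSum_homotopy E k _ _ _ _
    (fun i j => by
      rw [← LinearMap.lTensor_comp, rightContr_rightMul_succ, LinearMap.lTensor_sub,
        LinearMap.lTensor_smul, LinearMap.lTensor_id, LinearMap.lTensor_comp, coord_basis])
    (by
      have h := congrArg (LinearMap.lTensorHom V) (sum_rightMul_rightContr t k)
      rw [map_sum, map_smul] at h
      refine Eq.trans (Finset.sum_congr rfl fun i _ => ?_) (h.trans ?_)
      · exact (LinearMap.lTensor_comp V _ _).symm
      · exact congrArg (_ • ·) (LinearMap.lTensor_id V _))

theorem koszul_homotopy_zero :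
    koszulD t x V 0 ∘ₗ koszulS t V E 0 +
      opMap (Algebra.linearMap ℂ C ∘ₗ ε.toLinearMap) LinearMap.id = LinearMap.id :=
  mulSum_homotopy_zero E _ _ fun i j => by
    rw [← LinearMap.lTensor_comp, rightContr_rightMul_zero, LinearMap.lTensor_smul,
      LinearMap.lTensor_id, coord_basis]

variable (x) in
theorem koszulD_opMap_actDeg {V V' : Type u} [AddCommGroup V] [Module ℂ V] [AddCommGroup V']
    [Module ℂ V'] {p k n : ℕ} (h : p + k = n) (h' : p + (k + 1) = n + 1)
    (y : (V →ₗ[ℂ] V') ⊗[ℂ] ⋀[ℂ]^p (Module.Dual ℂ W)) :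
    koszulD t x V' k ∘ₗ opMap LinearMap.id (actDeg W V V' p (k + 1) (n + 1) h' y) =
      opMap LinearMap.id (actDeg W V V' p k n h y) ∘ₗ koszulD t x V n :=
  mulSum_comp_opMap _ _ _ (fun _ _ => rfl) _ _ _ _ fun i =>
    (actDeg_lTensor_rightContr h h' y (t.coord i)).symm

variable {H : Type u} [Group H] [MulSemiringAction H C] [SMulCommClass H ℂ C]

/-- The action of a group on the coefficient space of a representation. -/
def coefRep {U : Type*} [AddCommGroup U] [Module ℂ U] (C : Type*) [CommRing C] [Algebra ℂ C]
    [MulSemiringAction H C] [SMulCommClass H ℂ C] (ρ : Representation ℂ H U) :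
    Representation ℂ H (Coef C U) where
  toFun h := opMap (DistribMulAction.toModuleEnd ℂ C h) (ρ h)
  map_one' := by
    rw [map_one (DistribMulAction.toModuleEnd ℂ C), map_one ρ]; rfl
  map_mul' g h := by
    rw [map_mul (DistribMulAction.toModuleEnd ℂ C), map_mul ρ]; rfl

variable (x) in
theorem koszulD_equivariant (τ : Representation ℂ H W) (hx : ∀ h w, x (τ h w) = h • x w)
    {V : Type u} [AddCommGroup V] [Module ℂ V] (ρ : Representation ℂ H V) (k : ℕ) (h : H) :
    koszulD t x V k ∘ₗ coefRep C (ρ.tprod (extPowerRep τ (k + 1))) h =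
      coefRep C (ρ.tprod (extPowerRep τ k)) h ∘ₗ koszulD t x V k := by
  let e : W ≃ₗ[ℂ] W := LinearEquiv.ofLinearMap (τ h) (τ h⁻¹)
    (by rw [← Module.End.mul_eq_comp, ← map_mul, mul_inv_cancel, map_one]; rfl)
    (by rw [← Module.End.mul_eq_comp, ← map_mul, inv_mul_cancel, map_one]; rfl)
  have hD : ∀ b : Module.Basis κ ℂ W, koszulD t x V k = koszulD b x V k := by
    intro b
    exact mulSum_basis x (LinearMap.lTensorHom V ∘ₗ rightContrHom W k) t b
  rw [hD (t.map e)]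
  conv_rhs => rw [← hD (t.map e)]
  refine mulSum_comp_opMap _ _ _ (fun i c => ?_) _ _ _ _ fun i => ?_
  · change x (τ h (t i)) * h • c = h • (x (t i) * c)
    rw [hx, smul_mul']
  · have h3 := extPowerRep_rightContr τ h (t.coord i) k
    change TensorProduct.map _ _ ∘ₗ TensorProduct.map _ _ =
      TensorProduct.map _ _ ∘ₗ TensorProduct.map _ _
    rw [← TensorProduct.map_comp, ← TensorProduct.map_comp, h3]
    rfl

end Koszul

/-! ### Averaging -/

section Average

variable {H : Type*} [Group H] [Fintype H] {N N' : Type*} [AddCommGroup N] [Module ℂ N]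
  [AddCommGroup N'] [Module ℂ N'] (ρ : Representation ℂ H N) (ρ' : Representation ℂ H N')

/-- The average of a linear map between representations of a finite group. -/
def average (T : N →ₗ[ℂ] N') : N →ₗ[ℂ] N' :=
  (Fintype.card H : ℂ)⁻¹ • ∑ h, ρ' h ∘ₗ T ∘ₗ ρ h⁻¹

theorem average_equivariant (T : N →ₗ[ℂ] N') (k : H) :
    average ρ ρ' T ∘ₗ ρ k = ρ' k ∘ₗ average ρ ρ' T := by
  rw [average, LinearMap.smul_comp, LinearMap.comp_smul, sum_comp_linear, comp_sum_linear]
  congr 1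
  refine Fintype.sum_equiv (Equiv.mulLeft k⁻¹) _ _ fun h => ?_
  have h1 : ρ h⁻¹ ∘ₗ ρ k = ρ (k⁻¹ * h)⁻¹ := by
    rw [← Module.End.mul_eq_comp, ← map_mul, mul_inv_rev, inv_inv]
  have h2 : ρ' k ∘ₗ ρ' (k⁻¹ * h) = ρ' h := by
    rw [← Module.End.mul_eq_comp, ← map_mul, mul_inv_cancel_left]
  rw [Equiv.coe_mulLeft, LinearMap.comp_assoc, LinearMap.comp_assoc, h1,
    ← LinearMap.comp_assoc _ _ (ρ' k), h2]

theorem average_eq_self (T : N →ₗ[ℂ] N') (hT : ∀ k, T ∘ₗ ρ k = ρ' k ∘ₗ T) :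
    average ρ ρ' T = T := by
  have h : ∀ h, ρ' h ∘ₗ T ∘ₗ ρ h⁻¹ = T := fun h => by
    rw [hT, ← LinearMap.comp_assoc, ← Module.End.mul_eq_comp, ← map_mul, mul_inv_cancel, map_one]
    rfl
  rw [average, Finset.sum_congr rfl fun k _ => h k, Finset.sum_const, Finset.card_univ,
    ← Nat.cast_smul_eq_nsmul ℂ, smul_smul, inv_mul_cancel₀, one_smul]
  exact Nat.cast_ne_zero.2 Fintype.card_ne_zero

theorem average_add (T S : N →ₗ[ℂ] N') :
    average ρ ρ' (T + S) = average ρ ρ' T + average ρ ρ' S := by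
  rw [average, average, average, ← smul_add, ← Finset.sum_add_distrib]
  simp_rw [LinearMap.add_comp, LinearMap.comp_add]

variable {N'' : Type*} [AddCommGroup N''] [Module ℂ N''] (ρ'' : Representation ℂ H N'')

theorem comp_average (T : N →ₗ[ℂ] N') (S : N' →ₗ[ℂ] N'') (hS : ∀ k, S ∘ₗ ρ' k = ρ'' k ∘ₗ S) :
    S ∘ₗ average ρ ρ' T = average ρ ρ'' (S ∘ₗ T) := by
  rw [average, average, LinearMap.comp_smul, comp_sum_linear]
  congr 1
  refine Finset.sum_congr rfl fun h _ => ?_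
  rw [← LinearMap.comp_assoc, hS]; rfl

theorem average_comp (T : N' →ₗ[ℂ] N'') (S : N →ₗ[ℂ] N') (hS : ∀ k, S ∘ₗ ρ k = ρ' k ∘ₗ S) :
    average ρ' ρ'' T ∘ₗ S = average ρ ρ'' (T ∘ₗ S) := by
  rw [average, average, LinearMap.smul_comp, sum_comp_linear]
  congr 1
  refine Finset.sum_congr rfl fun h _ => ?_
  rw [LinearMap.comp_assoc, LinearMap.comp_assoc, ← hS]; rfl

end Average

/-! ### Coinduction from a subgroup -/

section Coinduction

variable {G : Type u} [Group G] {H : Subgroup G} {B : Type u} [CommRing B] [Algebra ℂ B]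
  [MulSemiringAction G B] [SMulCommClass G ℂ B]

variable (H B) in
/-- Modules over `B ⋊ H`, as representations of `H` with a compatible action of `B`. -/
structure CrossedMod where
  carrier : Type u
  [addCommGroup : AddCommGroup carrier]
  [module : Module ℂ carrier]
  ρ : Representation ℂ H carrier
  act : B →ₐ[ℂ] Module.End ℂ carrier
  compat : ∀ (h : H) (b : B) (x : carrier), ρ h (act b x) = act ((h : G) • b) (ρ h x)

attribute [instance] CrossedMod.addCommGroup CrossedMod.module

namespace CrossedMod

variable (N N' N'' : CrossedMod H B)

/-- The functions `φ` on `G` with `φ (g h) = h⁻¹ φ g`. -/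
def coindSub : Submodule ℂ (G → N.carrier) where
  carrier := {φ | ∀ (g : G) (h : H), φ (g * h) = N.ρ h⁻¹ (φ g)}
  zero_mem' g h := (map_zero _).symm
  add_mem' {a b} ha hb g h := by rw [Pi.add_apply, Pi.add_apply, ha, hb, map_add]
  smul_mem' c a ha g h := by rw [Pi.smul_apply, Pi.smul_apply, ha, map_smul]

/-- The coinduced module. -/
def Coind : Type u := N.coindSub

namespace Coind

variable {N N' N''}

instance : AddCommGroup (Coind N) := inferInstanceAs (AddCommGroup N.coindSub)

instance : Module ℂ (Coind N) := inferInstanceAs (Module ℂ N.coindSub)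

instance : FunLike (Coind N) G N.carrier := ⟨fun φ => φ.1, Subtype.coe_injective⟩

@[ext] theorem ext {φ ψ : Coind N} (h : ∀ g, φ g = ψ g) : φ = ψ := DFunLike.ext _ _ h

theorem apply_mul (φ : Coind N) (g : G) (h : H) : φ (g * h) = N.ρ h⁻¹ (φ g) := φ.2 g h

theorem add_apply (φ ψ : Coind N) (g : G) : (φ + ψ) g = φ g + ψ g := rfl

theorem smul_apply (c : ℂ) (φ : Coind N) (g : G) : (c • φ) g = c • φ g := rfl

/-- Evaluation at a group element. -/
def ev (g : G) : Coind N →ₗ[ℂ] N.carrier where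
  toFun φ := φ g
  map_add' _ _ := rfl
  map_smul' _ _ := rfl

theorem sum_apply {ι : Type*} (s : Finset ι) (f : ι → Coind N) (g : G) :
    (∑ i ∈ s, f i) g = ∑ i ∈ s, f i g := map_sum (ev g) f s

variable (N) in
/-- Left translation. -/
def trans : G →* Module.End ℂ (Coind N) where
  toFun k :=
    { toFun := fun φ => ⟨fun y => φ (k⁻¹ * y), fun g h => by
        change φ (k⁻¹ * (g * h)) = _
        rw [← mul_assoc]; exact φ.2 _ h⟩
      map_add' := fun _ _ => rfl
      map_smul' := fun _ _ => rfl }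
  map_one' := LinearMap.ext fun φ => ext fun y => by
    change φ (1⁻¹ * y) = φ y
    rw [inv_one, one_mul]
  map_mul' k l := LinearMap.ext fun φ => ext fun y => by
    change φ ((k * l)⁻¹ * y) = φ (l⁻¹ * (k⁻¹ * y))
    rw [mul_inv_rev, mul_assoc]

variable (N) in
/-- The action of the coefficients. -/
def coeffAct : B →ₐ[ℂ] Module.End ℂ (Coind N) where
  toFun b :=
    { toFun := fun φ => ⟨fun y => N.act (y⁻¹ • b) (φ y), fun g h => by
        change N.act ((g * h)⁻¹ • b) (φ (g * h)) = N.ρ h⁻¹ (N.act (g⁻¹ • b) (φ g))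
        rw [φ.apply_mul, N.compat, mul_inv_rev, mul_smul]; rfl⟩
      map_add' := fun φ ψ => ext fun y => map_add (N.act (y⁻¹ • b)) (φ y) (ψ y)
      map_smul' := fun c φ => ext fun y => map_smul (N.act (y⁻¹ • b)) c (φ y) }
  map_one' := LinearMap.ext fun φ => ext fun y => by
    change N.act (y⁻¹ • 1) (φ y) = φ y
    rw [smul_one, map_one]; rfl
  map_mul' b c := LinearMap.ext fun φ => ext fun y => by
    change N.act (y⁻¹ • (b * c)) (φ y) = N.act (y⁻¹ • b) (N.act (y⁻¹ • c) (φ y))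
    rw [smul_mul', map_mul]; rfl
  map_zero' := LinearMap.ext fun φ => ext fun y => by
    change N.act (y⁻¹ • 0) (φ y) = 0
    rw [smul_zero, map_zero]; rfl
  map_add' b c := LinearMap.ext fun φ => ext fun y => by
    change N.act (y⁻¹ • (b + c)) (φ y) = N.act (y⁻¹ • b) (φ y) + N.act (y⁻¹ • c) (φ y)
    rw [smul_add, map_add]; rfl
  commutes' a := LinearMap.ext fun φ => ext fun y => by
    change N.act (y⁻¹ • algebraMap ℂ B a) (φ y) = a • φ y
    rw [smul_algebraMap, AlgHom.commutes]; rfl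

theorem trans_apply (k : G) (φ : Coind N) (y : G) : trans N k φ y = φ (k⁻¹ * y) := rfl

theorem coeffAct_apply (b : B) (φ : Coind N) (y : G) :
    coeffAct N b φ y = N.act (y⁻¹ • b) (φ y) := rfl

variable (N) in
/-- The action of the crossed product. -/
def action : SkewMonoidAlgebra B G →ₐ[ℂ] Module.End ℂ (Coind N) :=
  SkewMonoidAlgebra.liftNCAlgHom (coeffAct N) (trans N) (by
    intro b k
    refine LinearMap.ext fun φ => ext fun y => ?_
    rw [Module.End.mul_apply, Module.End.mul_apply, coeffAct_apply, trans_apply, trans_apply,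
      coeffAct_apply, mul_inv_rev, inv_inv, mul_smul])

instance : Module (SkewMonoidAlgebra B G) (Coind N) :=
  Module.compHom _ (action N).toRingHom

theorem crossed_smul_def (r : SkewMonoidAlgebra B G) (φ : Coind N) : r • φ = action N r φ := rfl

instance : IsScalarTower ℂ (SkewMonoidAlgebra B G) (Coind N) where
  smul_assoc c r φ := by
    rw [crossed_smul_def, crossed_smul_def, map_smul]; rfl

theorem single_smul (k : G) (b : B) (φ : Coind N) (y : G) :
    (SkewMonoidAlgebra.single k b • φ) y = N.act (y⁻¹ • b) (φ (k⁻¹ * y)) := by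
  have h : action N (SkewMonoidAlgebra.single k b) = coeffAct N b * trans N k :=
    SkewMonoidAlgebra.liftNC_single _ _ _ _
  rw [crossed_smul_def, h, Module.End.mul_apply, coeffAct_apply, trans_apply]

theorem crossed_smul_apply [Fintype G] (r : SkewMonoidAlgebra B G) (φ : Coind N) (y : G) :
    (r • φ) y = ∑ k, N.act (y⁻¹ • r.coeff k) (φ (k⁻¹ * y)) := by
  induction r with
  | single k b =>
    rw [single_smul, Finset.sum_eq_single k]
    · rw [SkewMonoidAlgebra.coeff_single, Finsupp.single_eq_same]
    · intro h _ hne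
      rw [SkewMonoidAlgebra.coeff_single, Finsupp.single_eq_of_ne hne, smul_zero, map_zero]; rfl
    · intro h; exact absurd (Finset.mem_univ _) h
  | add a b ha hb =>
    rw [add_smul, add_apply, ha, hb, ← Finset.sum_add_distrib]
    refine Finset.sum_congr rfl fun h _ => ?_
    rw [SkewMonoidAlgebra.coeff_add, Finsupp.add_apply, smul_add, map_add]; rfl

/-- The functoriality of coinduction in equivariant linear maps. -/
def map (T : N.carrier →ₗ[ℂ] N'.carrier) (hT : ∀ h, T ∘ₗ N.ρ h = N'.ρ h ∘ₗ T) :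
    Coind N →ₗ[ℂ] Coind N' where
  toFun φ := ⟨fun y => T (φ y), fun g h => by
    change T (φ (g * h)) = _
    rw [φ.apply_mul]; exact LinearMap.congr_fun (hT h⁻¹) _⟩
  map_add' φ ψ := ext fun y => map_add T _ _
  map_smul' c φ := ext fun y => map_smul T c _

/-- The functoriality of coinduction in homomorphisms of modules. -/
def lmap (T : N.carrier →ₗ[ℂ] N'.carrier) (hT : ∀ h, T ∘ₗ N.ρ h = N'.ρ h ∘ₗ T)
    (hB : ∀ b x, T (N.act b x) = N'.act b (T x)) : Coind N →ₗ[SkewMonoidAlgebra B G] Coind N' where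
  toFun := map T hT
  map_add' := map_add _
  map_smul' r φ := by
    rw [RingHom.id_apply]
    induction r with
    | single k b =>
      refine ext fun y => ?_
      rw [single_smul]
      change T ((SkewMonoidAlgebra.single k b • φ) y) = N'.act (y⁻¹ • b) (T (φ (k⁻¹ * y)))
      rw [single_smul, hB]
    | add a b ha hb => rw [add_smul, map_add, ha, hb, add_smul]

theorem map_apply (T : N.carrier →ₗ[ℂ] N'.carrier) (hT : ∀ h, T ∘ₗ N.ρ h = N'.ρ h ∘ₗ T)
    (φ : Coind N) (y : G) : map T hT φ y = T (φ y) := rfl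

open Classical in
/-- The function supported on `H` with a given value at `1`. -/
def extend : N.carrier →ₗ[ℂ] Coind N where
  toFun n := ⟨fun y => if hy : y ∈ H then N.ρ (⟨y, hy⟩ : H)⁻¹ n else 0, fun g h => by
    change dite _ _ _ = N.ρ h⁻¹ (dite _ _ _)
    by_cases hg : g ∈ H
    · rw [dif_pos (H.mul_mem hg h.2), dif_pos hg, ← Module.End.mul_apply, ← map_mul, ← mul_inv_rev]
      rfl
    · rw [dif_neg (fun h' => hg ((H.mul_mem_cancel_right h.2).1 h')), dif_neg hg, map_zero]⟩
  map_add' n n' := ext fun y => by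
    change (if hy : y ∈ H then N.ρ (⟨y, hy⟩ : H)⁻¹ (n + n') else 0) =
      (if hy : y ∈ H then N.ρ (⟨y, hy⟩ : H)⁻¹ n else 0) +
        if hy : y ∈ H then N.ρ (⟨y, hy⟩ : H)⁻¹ n' else 0
    split_ifs
    · exact map_add _ _ _
    · rw [add_zero]
  map_smul' c n := ext fun y => by
    change (if hy : y ∈ H then N.ρ (⟨y, hy⟩ : H)⁻¹ (c • n) else 0) =
      c • if hy : y ∈ H then N.ρ (⟨y, hy⟩ : H)⁻¹ n else 0
    split_ifs
    · exact map_smul _ _ _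
    · rw [smul_zero]

theorem extend_apply_mem (n : N.carrier) (h : H) : extend n (h : G) = N.ρ h⁻¹ n :=
  dif_pos h.2

theorem extend_apply_notMem (n : N.carrier) {y : G} (hy : y ∉ H) : extend n y = 0 :=
  dif_neg hy

theorem extend_apply_one (n : N.carrier) : extend n (1 : G) = n := by
  have h := extend_apply_mem n (1 : H)
  rwa [inv_one, map_one] at h

theorem single_smul_extend (h : H) (n : N.carrier) :
    SkewMonoidAlgebra.single (h : G) (1 : B) • extend n = extend (N.ρ h n) := by
  refine ext fun y => ?_
  rw [single_smul, smul_one, map_one, Module.End.one_apply]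
  by_cases hy : y ∈ H
  · have h1 := extend_apply_mem n (h⁻¹ * ⟨y, hy⟩)
    have h2 := extend_apply_mem (N.ρ h n) ⟨y, hy⟩
    refine h1.trans (Eq.trans ?_ h2.symm)
    rw [← Module.End.mul_apply, ← map_mul, mul_inv_rev, inv_inv]
  · rw [extend_apply_notMem _ hy, extend_apply_notMem]
    intro h'
    exact hy ((H.mul_mem_cancel_left (H.inv_mem h.2)).1 h')

theorem single_one_smul_extend (b : B) (n : N.carrier) :
    SkewMonoidAlgebra.single (1 : G) b • extend n = extend (N.act b n) := by
  refine ext fun y => ?_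
  rw [single_smul, inv_one, one_mul]
  by_cases hy : y ∈ H
  · have h1 := extend_apply_mem n ⟨y, hy⟩
    have h2 := extend_apply_mem (N.act b n) ⟨y, hy⟩
    refine (congrArg (N.act (y⁻¹ • b)) h1).trans (Eq.trans ?_ h2.symm)
    rw [N.compat]; rfl
  · rw [extend_apply_notMem _ hy, extend_apply_notMem _ hy, map_zero]

theorem map_extend (T : N.carrier →ₗ[ℂ] N'.carrier) (hT : ∀ h, T ∘ₗ N.ρ h = N'.ρ h ∘ₗ T)
    (n : N.carrier) : map T hT (extend n) = extend (T n) := by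
  refine ext fun y => ?_
  rw [map_apply]
  by_cases hy : y ∈ H
  · have h1 := extend_apply_mem n ⟨y, hy⟩
    have h2 := extend_apply_mem (T n) ⟨y, hy⟩
    exact (congrArg T h1).trans ((LinearMap.congr_fun (hT _) n).trans h2.symm)
  · rw [extend_apply_notMem _ hy, extend_apply_notMem _ hy, map_zero]

variable [Finite G]

instance : Fintype H := Fintype.ofFinite H

theorem card_ne_zero : (Fintype.card H : ℂ) ≠ 0 := Nat.cast_ne_zero.2 Fintype.card_ne_zero

theorem eq_sum_extend [Fintype G] (φ : Coind N) :
    φ = (Fintype.card H : ℂ)⁻¹ • ∑ g : G, SkewMonoidAlgebra.single g (1 : B) • extend (φ g) := by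
  classical
  refine ext fun y => ?_
  rw [smul_apply, sum_apply, eq_inv_smul_iff₀ card_ne_zero]
  simp_rw [single_smul, smul_one, map_one, Module.End.one_apply]
  have h1 : ∑ g : G, extend (φ g) (g⁻¹ * y) = ∑ k : G, extend (φ (y * k⁻¹)) k :=
    Fintype.sum_equiv ((Equiv.inv G).trans (Equiv.mulRight y)) _ _ fun g => by
      simp
  rw [h1, ← Finset.sum_subset (Finset.subset_univ (Finset.univ.filter fun k => k ∈ H))]
  · have h2 : ∀ k ∈ Finset.univ.filter (fun k : G => k ∈ H), extend (φ (y * k⁻¹)) k = φ y := by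
      intro k hk
      have hk : k ∈ H := (Finset.mem_filter.1 hk).2
      have h3 := extend_apply_mem (φ (y * k⁻¹)) ⟨k, hk⟩
      have h4 := φ.apply_mul (y * k⁻¹) ⟨k, hk⟩
      rw [← h4] at h3
      refine h3.trans (congrArg φ.1 ?_)
      exact inv_mul_cancel_right y k
    rw [Finset.sum_congr rfl h2, Finset.sum_const, ← Nat.cast_smul_eq_nsmul ℂ]
    congr 2
    rw [Fintype.card_subtype]
  · intro k _ hk
    refine extend_apply_notMem _ fun h => hk (Finset.mem_filter.2 ⟨Finset.mem_univ _, h⟩)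

theorem linearMap_ext {X : Type*} [AddCommGroup X] [Module (SkewMonoidAlgebra B G) X]
    {f f' : Coind N →ₗ[SkewMonoidAlgebra B G] X} (h : ∀ n, f (extend n) = f' (extend n)) :
    f = f' := by
  have : Fintype G := Fintype.ofFinite G
  refine LinearMap.ext fun φ => ?_
  rw [eq_sum_extend φ, ← algebraMap_smul (SkewMonoidAlgebra B G), map_smul, map_smul, map_sum,
    map_sum]
  simp_rw [map_smul, h]

/-- A homomorphism of modules `N → B`, viewed as a homomorphism from the coinduced module to the
crossed product. -/
def coord (c : N.carrier →ₗ[ℂ] B) (hc : ∀ b n, c (N.act b n) = b * c n) :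
    Coind N →ₗ[SkewMonoidAlgebra B G] SkewMonoidAlgebra B G where
  toFun φ := letI := Fintype.ofFinite G
    ∑ g : G, SkewMonoidAlgebra.single g (g • c ((Fintype.card H : ℂ)⁻¹ • φ g))
  map_add' φ ψ := by
    rw [← Finset.sum_add_distrib]
    refine Finset.sum_congr rfl fun g _ => ?_
    rw [add_apply, smul_add, map_add, smul_add, SkewMonoidAlgebra.single_add]
  map_smul' r φ := by
    let _ := Fintype.ofFinite G
    rw [RingHom.id_apply]
    induction r with
    | single k b =>
      rw [Finset.smul_sum]
      symm
      refine Fintype.sum_equiv (Equiv.mulLeft k) _ _ fun g => ?_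
      rw [Equiv.coe_mulLeft, single_smul, smul_eq_mul, SkewMonoidAlgebra.single_mul_single,
        inv_mul_cancel_left, ← map_smul (N.act _), hc, smul_mul', smul_inv_smul, mul_smul k g]
    | add a b ha hb =>
      rw [add_smul, add_smul, ← ha, ← hb, ← Finset.sum_add_distrib]
      refine Finset.sum_congr rfl fun g _ => ?_
      rw [add_apply, smul_add, map_add, smul_add, SkewMonoidAlgebra.single_add]

theorem coeff_coord (c : N.carrier →ₗ[ℂ] B) (hc : ∀ b n, c (N.act b n) = b * c n) (φ : Coind N)
    (g : G) : (coord c hc φ).coeff g = g • c ((Fintype.card H : ℂ)⁻¹ • φ g) := by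
  let _ := Fintype.ofFinite G
  change (∑ g : G, SkewMonoidAlgebra.single g (g • c ((Fintype.card H : ℂ)⁻¹ • φ g))).coeff g = _
  have h : ∀ (s : Finset G) (f : G → SkewMonoidAlgebra B G),
      (∑ g ∈ s, f g).coeff g = ∑ k ∈ s, (f k).coeff g := fun s f =>
    map_sum ((Finsupp.applyAddHom g).comp
      (SkewMonoidAlgebra.coeffAddEquiv (k := B) (G := G)).toAddMonoidHom) f s
  rw [h, Finset.sum_eq_single g]
  · rw [SkewMonoidAlgebra.coeff_single, Finsupp.single_eq_same]
  · intro k _ hk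
    rw [SkewMonoidAlgebra.coeff_single, Finsupp.single_eq_of_ne hk.symm]
  · intro h; exact absurd (Finset.mem_univ _) h

theorem sum_coord_smul_extend {ι : Type*} [Fintype ι] (c : ι → N.carrier →ₗ[ℂ] B)
    (hc : ∀ i b n, c i (N.act b n) = b * c i n) (n : ι → N.carrier)
    (hn : ∀ x, ∑ i, N.act (c i x) (n i) = x) (φ : Coind N) :
    ∑ i, coord (c i) (hc i) φ • extend (n i) = φ := by
  let _ := Fintype.ofFinite G
  have h1 : ∀ i, coord (c i) (hc i) φ • extend (n i) = ∑ g : G,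
      SkewMonoidAlgebra.single g (1 : B) •
        extend (N.act (c i ((Fintype.card H : ℂ)⁻¹ • φ g)) (n i)) := by
    intro i
    change (∑ g : G, SkewMonoidAlgebra.single g _) • _ = _
    rw [Finset.sum_smul]
    refine Finset.sum_congr rfl fun g _ => ?_
    rw [← single_one_smul_extend, smul_smul, SkewMonoidAlgebra.single_mul_single, mul_one, one_mul]
  simp_rw [h1]
  rw [Finset.sum_comm]
  simp_rw [← Finset.smul_sum, ← map_sum, hn]
  conv_rhs => rw [eq_sum_extend φ]
  rw [Finset.smul_sum]
  refine Finset.sum_congr rfl fun g _ => ?_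
  rw [map_smul, smul_comm]

end Coind

end CrossedMod

/-! ### Induced modules as coinduced modules -/

section Induced

theorem Induced.lift_aux {S R : Type u} {V : Type w} [Ring S] [Algebra ℂ S] [Ring R] [Algebra ℂ R]
    [AddCommGroup V] [Module ℂ V] (φ : S →ₐ[ℂ] R) (σ : S →ₐ[ℂ] Module.End ℂ V) {X : Type*}
    [AddCommGroup X] [Module ℂ X] [Module R X] [IsScalarTower ℂ R X] (l : V →ₗ[ℂ] X)
    (hl : ∀ s v, l (σ s v) = φ s • l v) : ∃ f : Induced φ σ →ₗ[R] X, ∀ v,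
      f (toInduced φ σ v) = l v := by
  have : SMulCommClass ℂ R X := IsScalarTower.to_smulCommClass
  let f₀ : R ⊗[ℂ] V →ₗ[R] X :=
    TensorProduct.AlgebraTensorModule.lift (LinearMap.toSpanSingleton R (V →ₗ[ℂ] X) l)
  have h₀ : ∀ r v, f₀ (r ⊗ₜ v) = r • l v := fun r v => rfl
  refine ⟨(balancedRelations φ σ).liftQ f₀ (Submodule.span_le.2 ?_), fun v => ?_⟩
  · rintro _ ⟨r, s, v, rfl⟩
    rw [SetLike.mem_coe, LinearMap.mem_ker, map_sub, h₀, h₀, hl, mul_smul, sub_self]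
  · exact (h₀ 1 v).trans (one_smul R _)

theorem Induced.hom_ext {S R : Type u} {V : Type w} [Ring S] [Algebra ℂ S] [Ring R] [Algebra ℂ R]
    [AddCommGroup V] [Module ℂ V] (φ : S →ₐ[ℂ] R) (σ : S →ₐ[ℂ] Module.End ℂ V) {X : Type*}
    [AddCommGroup X] [Module R X] {f f' : Induced φ σ →ₗ[R] X}
    (h : ∀ v, f (toInduced φ σ v) = f' (toInduced φ σ v)) : f = f' := by
  refine LinearMap.ext_on (span_toInduced φ σ) ?_
  rintro _ ⟨v, rfl⟩
  exact h v

variable (χ : B →ₐ[ℂ] ℂ) (hχ : ∀ (h : H) (b : B), χ (h • b) = χ b)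

/-- The module `V_χ` over `B ⋊ H`. -/
abbrev charMod (V : FinDimRep H) : CrossedMod H B where
  carrier := V.carrier
  ρ := V.ρ
  act := charAction χ V.carrier
  compat h b x := by
    change V.ρ h (χ b • x) = χ ((h : G) • b) • V.ρ h x
    rw [map_smul]
    exact congrArg (· • _) (hχ h b).symm

theorem charMod_act (V : FinDimRep H) (b : B) (x : V.carrier) :
    (charMod χ hχ V).act b x = χ b • x := rfl

theorem crossedAction_single (V : FinDimRep H) (h : H) (b : B) (v : V.carrier) :
    crossedAction χ hχ V (SkewMonoidAlgebra.single h b) v = χ b • V.ρ h v := by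
  have e : crossedAction χ hχ V (SkewMonoidAlgebra.single h b) = charAction χ V.carrier b * V.ρ h :=
    SkewMonoidAlgebra.liftNC_single _ _ _ _
  rw [e]; rfl

theorem crossedInclusion_single (h : H) (b : B) :
    crossedInclusion (B := B) H (SkewMonoidAlgebra.single h b) =
      SkewMonoidAlgebra.single (h : G) b :=
  SkewMonoidAlgebra.mapDomain_single (f := H.subtype)

theorem single_smul_toInduced (V : FinDimRep H) (h : H) (v : V.carrier) :
    SkewMonoidAlgebra.single (h : G) (1 : B) •
        toInduced (crossedInclusion (B := B) H) (crossedAction χ hχ V) v =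
      toInduced (crossedInclusion (B := B) H) (crossedAction χ hχ V) (V.ρ h v) := by
  have e := smul_toInduced (crossedInclusion (B := B) H) (crossedAction χ hχ V)
    (SkewMonoidAlgebra.single h 1) v
  rwa [crossedInclusion_single, crossedAction_single, map_one, one_smul] at e

open CrossedMod in
theorem exists_indRep_equiv [Finite G] (V : FinDimRep H) :
    ∃ e : IndRep χ hχ V ≃ₗ[SkewMonoidAlgebra B G] Coind (charMod χ hχ V), ∀ v,
      e (toInduced (crossedInclusion (B := B) H) (crossedAction χ hχ V) v) =
        Coind.extend (N := charMod χ hχ V) v := by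
  let _ := Fintype.ofFinite G
  let ι := toInduced (crossedInclusion (B := B) H) (crossedAction χ hχ V)
  have hι : ∀ b v, SkewMonoidAlgebra.single (1 : G) (b : B) • ι v = χ b • ι v :=
    indRep_generator χ hχ V
  obtain ⟨f, hf⟩ := Induced.lift_aux (crossedInclusion (B := B) H) (crossedAction χ hχ V)
    (Coind.extend (N := charMod χ hχ V)) (by
      intro s v
      induction s with
      | single h b =>
        rw [crossedAction_single, crossedInclusion_single]
        have e : SkewMonoidAlgebra.single (h : G) b = SkewMonoidAlgebra.single (1 : G) b *
            SkewMonoidAlgebra.single (h : G) 1 := by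
          rw [SkewMonoidAlgebra.single_mul_single, one_mul, smul_one, mul_one]
        rw [e, mul_smul]
        exact ((congrArg (_ • ·) (Coind.single_smul_extend (N := charMod χ hχ V) h v)).trans
          (Coind.single_one_smul_extend b _)).symm
      | add a b ha hb => rw [map_add, LinearMap.add_apply, map_add, ha, hb, map_add, add_smul])
  let g₀ : Coind (charMod χ hχ V) →ₗ[ℂ] IndRep χ hχ V :=
    (Fintype.card H : ℂ)⁻¹ • ∑ g : G, translate (B := B) ι g ∘ₗ Coind.ev g
  have hg₀ : ∀ φ, g₀ φ = (Fintype.card H : ℂ)⁻¹ • ∑ g : G, translate (B := B) ι g (φ g) := by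
    intro φ
    simp only [g₀, LinearMap.smul_apply, LinearMap.sum_apply]
    rfl
  let g : Coind (charMod χ hχ V) →ₗ[SkewMonoidAlgebra B G] IndRep χ hχ V :=
    { g₀ with
      map_smul' := fun r φ => by
        change g₀ (r • φ) = r • g₀ φ
        induction r with
        | single k b =>
          rw [hg₀, hg₀, smul_comm (SkewMonoidAlgebra.single k b)]
          congr 1
          rw [Finset.smul_sum]
          symm
          refine Fintype.sum_equiv (Equiv.mulLeft k) _ _ fun g => ?_
          rw [Equiv.coe_mulLeft, Coind.single_smul, charMod_act, inv_mul_cancel_left, map_smul]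
          exact single_smul_translate χ ι hι k g b (φ g)
        | add a b ha hb => rw [add_smul, map_add, ha, hb, add_smul] }
  have hext : ∀ v, g (Coind.extend (N := charMod χ hχ V) v) = ι v := by
    intro v
    classical
    refine (hg₀ _).trans ?_
    rw [inv_smul_eq_iff₀ Coind.card_ne_zero,
      ← Finset.sum_subset (Finset.subset_univ (Finset.univ.filter fun k => k ∈ H))]
    · have h2 : ∀ k ∈ Finset.univ.filter (fun k : G => k ∈ H),
          translate (B := B) ι k (Coind.extend (N := charMod χ hχ V) v k) = ι v := by
        intro k hk
        have hk : k ∈ H := (Finset.mem_filter.1 hk).2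
        have h3 := Coind.extend_apply_mem (N := charMod χ hχ V) v ⟨k, hk⟩
        refine (congrArg (translate (B := B) ι k) h3).trans ?_
        refine (single_smul_toInduced χ hχ V ⟨k, hk⟩ _).trans ?_
        change ι (V.ρ _ (V.ρ _ v)) = _
        rw [← Module.End.mul_apply, ← map_mul, mul_inv_cancel, map_one]; rfl
      rw [Finset.sum_congr rfl h2, Finset.sum_const, ← Nat.cast_smul_eq_nsmul ℂ]
      congr 2
      rw [Fintype.card_subtype]
    · intro k _ hk
      rw [Coind.extend_apply_notMem _ fun h => hk (Finset.mem_filter.2 ⟨Finset.mem_univ _, h⟩),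
        map_zero]
  refine ⟨LinearEquiv.ofLinearMap f g ?_ ?_, hf⟩
  · refine Coind.linearMap_ext fun n => ?_
    rw [LinearMap.comp_apply, hext, hf]; rfl
  · refine Induced.hom_ext _ _ fun v => ?_
    rw [LinearMap.comp_apply, hf, hext]; rfl

variable (H) in
/-- The group elements, as a basis of the regular representation. -/
def regularBasis [Finite H] : Module.Basis H ℂ (regularRep H).carrier := MonoidAlgebra.basis H ℂ

theorem regularRep_basis [Finite H] (h k : H) :
    (regularRep H).ρ h (regularBasis H k) = regularBasis H (h * k) := by
  have e : ∀ k : H, (regularBasis H k : MonoidAlgebra ℂ H) = MonoidAlgebra.single k 1 := fun k =>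
    MonoidAlgebra.basis_apply ℂ k
  exact (congrArg _ (e k)).trans ((Representation.ofMulAction_single h k 1).trans (e (h * k)).symm)

theorem exists_indRegular_equiv [Finite G] :
    Nonempty (IndRep χ hχ (regularRep H) ≃ₗ[SkewMonoidAlgebra B G] IndChar G χ) := by
  let ι := toInduced (coeffInclusion G B) (charAction χ ℂ)
  let ι' := toInduced (crossedInclusion (B := B) H) (crossedAction χ hχ (regularRep H))
  have hι : ∀ b v, SkewMonoidAlgebra.single (1 : G) (b : B) • ι v = χ b • ι v :=
    indChar_generator χ
  have hι' : ∀ b v, SkewMonoidAlgebra.single (1 : G) (b : B) • ι' v = χ b • ι' v :=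
    indRep_generator χ hχ _
  obtain ⟨f, hf⟩ := Induced.lift_aux (coeffInclusion G B) (charAction χ ℂ)
    (ι' ∘ₗ LinearMap.toSpanSingleton ℂ (regularRep H).carrier (regularBasis H 1)) (by
      intro b c
      refine Eq.trans ?_ (hι' b _).symm
      exact map_smul (ι' ∘ₗ _) (χ b) c)
  let l : (regularRep H).carrier →ₗ[ℂ] IndChar G χ :=
    (regularBasis H).constr ℂ fun h : H => translate (B := B) ι (h : G) 1
  have hl : ∀ h : H, l (regularBasis H h) = translate (B := B) ι (h : G) 1 :=
    fun h => (regularBasis H).constr_basis ℂ _ h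
  obtain ⟨g, hg⟩ := Induced.lift_aux (crossedInclusion (B := B) H)
    (crossedAction χ hχ (regularRep H)) l (by
      intro s v
      induction s with
      | single h b =>
        rw [crossedAction_single, crossedInclusion_single]
        have e : χ b • (l ∘ₗ (regularRep H).ρ h) =
            (Algebra.lsmul ℂ ℂ (IndChar G χ) (SkewMonoidAlgebra.single (h : G) b)) ∘ₗ l := by
          refine (regularBasis H).ext fun k => ?_
          rw [LinearMap.smul_apply, LinearMap.comp_apply, LinearMap.comp_apply, regularRep_basis,
            hl, hl]
          refine Eq.trans ?_ (single_smul_translate χ ι hι h k b 1).symm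
          exact congrArg (· • _) (hχ (h * k)⁻¹ b).symm
        rw [map_smul]
        exact LinearMap.congr_fun e v
      | add a b ha hb => rw [map_add, LinearMap.add_apply, map_add, ha, hb, map_add, add_smul])
  refine ⟨(LinearEquiv.ofLinearMap f g ?_ ?_).symm⟩
  · refine Induced.hom_ext _ _ fun v => ?_
    rw [LinearMap.comp_apply, hg]
    have e : (f.restrictScalars ℂ) ∘ₗ l = ι' := by
      refine (regularBasis H).ext fun k => ?_
      rw [LinearMap.comp_apply, hl, LinearMap.restrictScalars_apply]
      change f (SkewMonoidAlgebra.single (k : G) (1 : B) • ι 1) = _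
      refine (map_smul f (SkewMonoidAlgebra.single (k : G) (1 : B)) _).trans ?_
      refine (congrArg (_ • ·) (hf 1)).trans ?_
      rw [LinearMap.comp_apply, LinearMap.toSpanSingleton_apply, one_smul]
      refine (single_smul_toInduced χ hχ _ k _).trans ?_
      rw [regularRep_basis, mul_one]
    exact LinearMap.congr_fun e v
  · refine Induced.hom_ext _ _ fun c => ?_
    rw [LinearMap.comp_apply, hf, LinearMap.comp_apply, hg, LinearMap.toSpanSingleton_apply,
      map_smul, hl]
    change c • SkewMonoidAlgebra.single ((1 : H) : G) (1 : B) • ι 1 = ι c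
    have h1 : SkewMonoidAlgebra.single ((1 : H) : G) (1 : B) = 1 := rfl
    rw [h1, one_smul, ← map_smul, smul_eq_mul, mul_one]

end Induced

end Coinduction

/-! ### The completion along an orbit and at a point -/

section Localization

variable {A : Type u} [CommRing A] [Algebra ℂ A] (m : A →ₐ[ℂ] ℂ)
  (G : Type u) [Group G] [MulSemiringAction G A]

theorem orbitIdeal_le_isotropy : orbitIdeal G m ≤ orbitIdeal (isotropy G m) m :=
  fun _ hf h => hf h

variable [SMulCommClass G ℂ A]

/-- The restriction modulo `n`-th powers. -/
def localQuot (n : ℕ) : A ⧸ orbitIdeal G m ^ n →ₐ[ℂ] A ⧸ orbitIdeal (isotropy G m) m ^ n :=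
  Ideal.Quotient.factorₐ ℂ (Ideal.pow_right_mono (orbitIdeal_le_isotropy m G) n)

theorem localQuot_mk (n : ℕ) (a : A) :
    localQuot m G n (Ideal.Quotient.mk _ a) = Ideal.Quotient.mk _ a := rfl

theorem factorPow_localQuot {k n : ℕ} (h : k ≤ n) (b : OrbitCompletion G m) :
    Ideal.Quotient.factorPow (orbitIdeal (isotropy G m) m) h
        (((localQuot m G n).comp (OrbitCompletion.proj G m n)) b) =
      ((localQuot m G k).comp (OrbitCompletion.proj G m k)) b := by
  rw [AlgHom.comp_apply, AlgHom.comp_apply, ← OrbitCompletion.factorPow_proj h]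
  obtain ⟨a, ha⟩ := Ideal.Quotient.mk_surjective (OrbitCompletion.proj G m n b)
  rw [← ha]
  rfl

/-- The restriction from the completion along the orbit to the completion at the point. -/
def toLocal : OrbitCompletion G m →ₐ[ℂ] LocalCompletion m G :=
  OrbitCompletion.lift (fun n => (localQuot m G n).comp (OrbitCompletion.proj G m n))
    (factorPow_localQuot m G)

theorem proj_toLocal_apply (n : ℕ) (b : OrbitCompletion G m) :
    OrbitCompletion.proj (isotropy G m) m n (toLocal m G b) =
      localQuot m G n (OrbitCompletion.proj G m n b) :=
  OrbitCompletion.proj_lift _ (factorPow_localQuot m G) n b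

variable {m G}

theorem proj_toLocal {n : ℕ} {b : OrbitCompletion G m} {a : A}
    (h : OrbitCompletion.proj G m n b = Ideal.Quotient.mk _ a) :
    OrbitCompletion.proj (isotropy G m) m n (toLocal m G b) = Ideal.Quotient.mk _ a := by
  rw [proj_toLocal_apply, h, localQuot_mk]

theorem toLocal_smul (h : isotropy G m) (b : OrbitCompletion G m) :
    toLocal m G ((h : G) • b) = h • toLocal m G b :=
  OrbitCompletion.ext fun n => by
    obtain ⟨a, ha⟩ := Ideal.Quotient.mk_surjective (OrbitCompletion.proj G m n b)
    have h1 : OrbitCompletion.proj G m n ((h : G) • b) = Ideal.Quotient.mk _ ((h : G) • a) := by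
      rw [OrbitCompletion.proj_smul, ← ha]; rfl
    rw [OrbitCompletion.proj_smul, proj_toLocal h1, proj_toLocal ha.symm]
    rfl

theorem evalPoint_toLocal (b : OrbitCompletion G m) :
    OrbitCompletion.evalPoint (isotropy G m) m (toLocal m G b) = OrbitCompletion.evalPoint G m b := by
  obtain ⟨a, ha⟩ := Ideal.Quotient.mk_surjective (OrbitCompletion.proj G m 1 b)
  change OrbitCompletion.evalQuot _ m (OrbitCompletion.proj _ m 1 (toLocal m G b)) =
    OrbitCompletion.evalQuot G m (OrbitCompletion.proj G m 1 b)
  have h1 : OrbitCompletion.evalQuot (isotropy G m) m (Ideal.Quotient.mk _ a) = m a := rfl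
  have h2 : OrbitCompletion.evalQuot G m (Ideal.Quotient.mk _ a) = m a := rfl
  rw [proj_toLocal ha.symm, ← ha, h1, h2]

theorem continuous_toLocal : Continuous (toLocal m G) := by
  rw [OrbitCompletion.continuous_iff]
  intro n
  let _ : TopologicalSpace (A ⧸ orbitIdeal (isotropy G m) m ^ n) := moduleTopology ℂ _
  have : IsModuleTopology ℂ (A ⧸ orbitIdeal (isotropy G m) m ^ n) := ⟨rfl⟩
  let _ : TopologicalSpace (A ⧸ orbitIdeal G m ^ n) := moduleTopology ℂ _
  have : IsModuleTopology ℂ (A ⧸ orbitIdeal G m ^ n) := ⟨rfl⟩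
  have : ContinuousAdd (A ⧸ orbitIdeal (isotropy G m) m ^ n) :=
    IsModuleTopology.toContinuousAdd ℂ _
  have : ContinuousSMul ℂ (A ⧸ orbitIdeal (isotropy G m) m ^ n) :=
    IsModuleTopology.toContinuousSMul ℂ _
  simp_rw [proj_toLocal_apply]
  exact (IsModuleTopology.continuous_of_linearMap (localQuot m G n).toLinearMap).comp
    (OrbitCompletion.continuous_proj n)

variable (m G)

/-- The functions that vanish at the other points of the orbit. -/
def awayIdeal : Ideal A where
  carrier := {f | ∀ g : G, g ∉ isotropy G m → m (g • f) = 0}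
  zero_mem' g _ := by rw [smul_zero, map_zero]
  add_mem' {a b} ha hb g hg := by rw [smul_add, map_add, ha g hg, hb g hg, add_zero]
  smul_mem' c f hf g hg := by rw [smul_eq_mul, smul_mul', map_mul, hf g hg, mul_zero]

variable {m G} in
theorem mul_awayIdeal_le : RingHom.ker m * awayIdeal m G ≤ orbitIdeal G m := by
  rw [Ideal.mul_le]
  intro a ha b hb g
  rw [smul_mul', map_mul]
  by_cases hg : g ∈ isotropy G m
  · rw [hg a, show m a = 0 from ha, zero_mul]
  · rw [hb g hg, mul_zero]

theorem exists_separating [Finite G] : ∃ a ∈ awayIdeal m G, m a = 1 := by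
  classical
  have := Fintype.ofFinite G
  let K : G → Ideal A := fun g =>
    RingHom.ker ((m : A →+* ℂ).comp (MulSemiringAction.toRingHom G A g))
  have h1 : ∏ g ∈ Finset.univ.filter (fun g => g ∉ isotropy G m), K g ≤ awayIdeal m G := by
    intro f hf g hg
    exact (Ideal.prod_le_inf.trans (Finset.inf_le
      (Finset.mem_filter.2 ⟨Finset.mem_univ g, hg⟩))) hf
  have hp : (RingHom.ker m).IsPrime := Ideal.IsMaximal.isPrime inferInstance
  have h2 : ¬ awayIdeal m G ≤ RingHom.ker m := by
    intro h
    obtain ⟨g, hg, hle⟩ := (hp.prod_le).1 (h1.trans h)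
    refine (Finset.mem_filter.1 hg).2 fun f => ?_
    have h3 : f - algebraMap ℂ A (m (g • f)) ∈ K g := by
      rw [RingHom.mem_ker]
      change m (g • (f - algebraMap ℂ A (m (g • f)))) = 0
      rw [smul_sub, smul_algebraMap, map_sub, AlgHom.commutes]
      exact sub_self _
    have h4 : m (f - algebraMap ℂ A (m (g • f))) = 0 := hle h3
    rw [map_sub, AlgHom.commutes, sub_eq_zero] at h4
    exact h4.symm
  obtain ⟨a, ha, ha'⟩ := Set.not_subset.1 h2
  have h0 : m a ≠ 0 := ha'
  refine ⟨algebraMap ℂ A (m a)⁻¹ * a, Ideal.mul_mem_left _ _ ha, ?_⟩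
  rw [map_mul, AlgHom.commutes]
  exact inv_mul_cancel₀ h0

variable [Finite G]

/-- A function equal to `1` at the point and to `0` at the other points of its orbit. -/
def separating : A := (exists_separating m G).choose

theorem separating_mem : separating m G ∈ awayIdeal m G := (exists_separating m G).choose_spec.1

theorem apply_separating : m (separating m G) = 1 := (exists_separating m G).choose_spec.2

/-- Functions equal to `1` to order `n` at the point and to `0` to order `n` at the other points of
its orbit. -/
def separatingPow (n : ℕ) : A := 1 - (1 - separating m G ^ n) ^ n

theorem separatingPow_mem (n : ℕ) : separatingPow m G n ∈ awayIdeal m G ^ n := by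
  have h : separating m G ^ n ∣ separatingPow m G n := by
    have := sub_dvd_pow_sub_pow 1 (1 - separating m G ^ n) n
    rwa [one_pow, sub_sub_cancel] at this
  obtain ⟨c, hc⟩ := h
  rw [hc]
  exact Ideal.mul_mem_right _ _ (Ideal.pow_mem_pow (separating_mem m G) n)

theorem one_sub_separatingPow_mem (n : ℕ) : 1 - separatingPow m G n ∈ RingHom.ker m ^ n := by
  rw [separatingPow, sub_sub_cancel]
  refine Ideal.pow_mem_pow ?_ n
  rw [RingHom.mem_ker, map_sub, map_pow, apply_separating, one_pow, map_one, sub_self]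

theorem separatingPow_one : separatingPow m G 1 = separating m G := by
  rw [separatingPow, pow_one, pow_one, sub_sub_cancel]

theorem separatingPow_sub_mem {k n : ℕ} (h : k ≤ n) :
    separatingPow m G n - separatingPow m G k ∈ orbitIdeal G m ^ k := by
  have hco : IsCoprime (RingHom.ker m ^ k) (awayIdeal m G ^ k) := by
    refine IsCoprime.pow ?_
    rw [Ideal.isCoprime_iff_exists]
    refine ⟨1 - separating m G, ?_, separating m G, separating_mem m G, sub_add_cancel _ _⟩
    rw [RingHom.mem_ker, map_sub, apply_separating, map_one, sub_self]
  have h1 : separatingPow m G n - separatingPow m G k ∈ awayIdeal m G ^ k :=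
    sub_mem (Ideal.pow_le_pow_right h (separatingPow_mem m G n)) (separatingPow_mem m G k)
  have h2 : separatingPow m G n - separatingPow m G k ∈ RingHom.ker m ^ k := by
    rw [← sub_sub_sub_cancel_left _ _ (1 : A)]
    exact sub_mem (one_sub_separatingPow_mem m G k)
      (Ideal.pow_le_pow_right h (one_sub_separatingPow_mem m G n))
  have h3 : RingHom.ker m ^ k ⊓ awayIdeal m G ^ k ≤ orbitIdeal G m ^ k := by
    rw [← Ideal.mul_eq_inf_of_isCoprime hco, ← mul_pow]
    exact Ideal.pow_right_mono mul_awayIdeal_le k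
  exact h3 ⟨h2, h1⟩

/-- Extension by zero modulo `n`-th powers. -/
def extendQuot (n : ℕ) : (A ⧸ orbitIdeal (isotropy G m) m ^ n) →ₗ[A] A ⧸ orbitIdeal G m ^ n :=
  (orbitIdeal (isotropy G m) m ^ n).liftQ
    (LinearMap.toSpanSingleton A (A ⧸ orbitIdeal G m ^ n)
      (Ideal.Quotient.mk _ (separatingPow m G n))) (by
    intro a ha
    rw [LinearMap.mem_ker, LinearMap.toSpanSingleton_apply]
    change Ideal.Quotient.mk (orbitIdeal G m ^ n) (a * separatingPow m G n) = 0
    rw [Ideal.Quotient.eq_zero_iff_mem]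
    rw [orbitIdeal_isotropy] at ha
    refine Ideal.pow_right_mono mul_awayIdeal_le n ?_
    rw [mul_pow]
    exact Ideal.mul_mem_mul ha (separatingPow_mem m G n))

theorem extendQuot_mk (n : ℕ) (a : A) : extendQuot m G n (Ideal.Quotient.mk _ a) =
    Ideal.Quotient.mk _ (a * separatingPow m G n) := rfl

theorem exists_extendLocal (c : LocalCompletion m G) : ∃ x : OrbitCompletion G m, ∀ n,
    OrbitCompletion.proj G m n x = extendQuot m G n (OrbitCompletion.proj _ m n c) := by
  refine OrbitCompletion.exists_proj_eq _ fun n => ?_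
  obtain ⟨a, ha⟩ := Ideal.Quotient.mk_surjective (OrbitCompletion.proj _ m (n + 1) c)
  have h1 : OrbitCompletion.proj (isotropy G m) m n c = Ideal.Quotient.mk _ a := by
    refine (OrbitCompletion.factorPow_proj n.le_succ c).symm.trans ?_
    exact congrArg (Ideal.Quotient.factorPow _ _) ha.symm
  rw [← ha, h1, extendQuot_mk, extendQuot_mk]
  change Ideal.Quotient.mk _ _ = _
  rw [Ideal.Quotient.eq, ← mul_sub]
  exact Ideal.mul_mem_left _ _ (separatingPow_sub_mem m G n.le_succ)

/-- Extension by zero from the completion at the point to the completion along the orbit. -/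
def extendLocal : LocalCompletion m G →ₗ[ℂ] OrbitCompletion G m where
  toFun c := (exists_extendLocal m G c).choose
  map_add' c d := OrbitCompletion.ext fun n => by
    rw [map_add, (exists_extendLocal m G _).choose_spec, (exists_extendLocal m G _).choose_spec,
      (exists_extendLocal m G _).choose_spec, map_add, map_add]
  map_smul' a c := OrbitCompletion.ext fun n => by
    rw [RingHom.id_apply, map_smul, (exists_extendLocal m G _).choose_spec,
      (exists_extendLocal m G _).choose_spec, map_smul]
    exact map_smul ((extendQuot m G n).restrictScalars ℂ) a _

variable {m G}

theorem proj_extendLocal {n : ℕ} {c : LocalCompletion m G} {a : A}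
    (h : OrbitCompletion.proj _ m n c = Ideal.Quotient.mk _ a) :
    OrbitCompletion.proj G m n (extendLocal m G c) =
      Ideal.Quotient.mk _ (a * separatingPow m G n) := by
  refine ((exists_extendLocal m G c).choose_spec n).trans ?_
  rw [h, extendQuot_mk]

theorem toLocal_extendLocal (c : LocalCompletion m G) : toLocal m G (extendLocal m G c) = c :=
  OrbitCompletion.ext fun n => by
    obtain ⟨a, ha⟩ := Ideal.Quotient.mk_surjective (OrbitCompletion.proj _ m n c)
    rw [proj_toLocal (proj_extendLocal ha.symm), ← ha, Ideal.Quotient.eq, orbitIdeal_isotropy]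
    have h := Ideal.mul_mem_left _ (-a) (one_sub_separatingPow_mem m G n)
    have e : -a * (1 - separatingPow m G n) = a * separatingPow m G n - a := by ring
    rwa [e] at h

theorem extendLocal_mul (b : OrbitCompletion G m) (c : LocalCompletion m G) :
    extendLocal m G (toLocal m G b * c) = b * extendLocal m G c :=
  OrbitCompletion.ext fun n => by
    obtain ⟨a, ha⟩ := Ideal.Quotient.mk_surjective (OrbitCompletion.proj _ m n c)
    obtain ⟨a', ha'⟩ := Ideal.Quotient.mk_surjective (OrbitCompletion.proj G m n b)
    have h : OrbitCompletion.proj (isotropy G m) m n (toLocal m G b * c) =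
        Ideal.Quotient.mk _ (a' * a) := by
      rw [map_mul, proj_toLocal ha'.symm, ← ha, map_mul]
    rw [proj_extendLocal h, map_mul (OrbitCompletion.proj G m n), ← ha',
      proj_extendLocal ha.symm, ← map_mul, mul_assoc]

theorem evalPoint_smul_extendLocal (c : LocalCompletion m G) {g : G} (hg : g ∉ isotropy G m) :
    OrbitCompletion.evalPoint G m (g • extendLocal m G c) = 0 := by
  obtain ⟨a, ha⟩ := Ideal.Quotient.mk_surjective (OrbitCompletion.proj _ m 1 c)
  change OrbitCompletion.evalQuot G m (OrbitCompletion.proj G m 1 (g • extendLocal m G c)) = 0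
  rw [OrbitCompletion.proj_smul, proj_extendLocal ha.symm, separatingPow_one]
  have h1 : ∀ a, OrbitCompletion.evalQuot G m (OrbitCompletion.quotAct G m g 1
      (Ideal.Quotient.mk _ a)) = m (g • a) := fun _ => rfl
  rw [h1]
  rw [smul_mul', map_mul, separating_mem m G g hg, mul_zero]

theorem continuous_extendLocal : Continuous (extendLocal m G) := by
  rw [OrbitCompletion.continuous_iff]
  intro n
  let _ : TopologicalSpace (A ⧸ orbitIdeal (isotropy G m) m ^ n) := moduleTopology ℂ _
  have : IsModuleTopology ℂ (A ⧸ orbitIdeal (isotropy G m) m ^ n) := ⟨rfl⟩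
  let _ : TopologicalSpace (A ⧸ orbitIdeal G m ^ n) := moduleTopology ℂ _
  have : IsModuleTopology ℂ (A ⧸ orbitIdeal G m ^ n) := ⟨rfl⟩
  have : ContinuousAdd (A ⧸ orbitIdeal G m ^ n) := IsModuleTopology.toContinuousAdd ℂ _
  have : ContinuousSMul ℂ (A ⧸ orbitIdeal G m ^ n) := IsModuleTopology.toContinuousSMul ℂ _
  refine Continuous.congr ?_ fun c => ((exists_extendLocal m G c).choose_spec n).symm
  exact (IsModuleTopology.continuous_of_linearMap ((extendQuot m G n).restrictScalars ℂ)).comp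
    (OrbitCompletion.continuous_proj n)

end Localization

/-! ### The exact structure of Fréchet modules -/

namespace FrechetMod

variable {R : Type u} [Ring R] [Algebra ℂ R] [TopologicalSpace R]

theorem hom_ext {X Y : FrechetMod R} {f g : X ⟶ Y} (h : ∀ x, toCLM f x = toCLM g x) : f = g :=
  ContinuousLinearMap.ext h

/-- A morphism from a continuous linear map. -/
def ofCLM {X Y : FrechetMod R} (f : X.carrier →L[R] Y.carrier) : X ⟶ Y := f

theorem comp_apply {X Y Z : FrechetMod R} (f : X ⟶ Y) (g : Y ⟶ Z) (x : X.carrier) :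
    toCLM (f ≫ g) x = toCLM g (toCLM f x) := rfl

section ClosedRange

variable {W : Type u} [AddCommGroup W] [Module ℂ W] [Module R W] [IsScalarTower ℂ R W]
  {E : Type*} [AddCommGroup E] [Module ℂ E] [UniformSpace E] [IsUniformAddGroup E]
  [ContinuousSMul ℂ E] [LocallyConvexSpace ℝ E] [T0Space E] [CompleteSpace E]
  [(uniformity E).IsCountablyGenerated]

/-- The Fréchet module structure induced by a linear embedding with closed range. -/
abbrev ofClosedRange (e : W →ₗ[ℂ] E) (hinj : Function.Injective e) (hcl : IsClosed (Set.range e))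
    (hact : letI : TopologicalSpace W := .induced e inferInstance
      Continuous fun q : R × W => e (q.1 • q.2)) : FrechetMod R :=
  letI : UniformSpace W := UniformSpace.comap e inferInstance
  have he : IsUniformInducing e := ⟨rfl⟩
  haveI : IsUniformAddGroup W := IsUniformAddGroup.comap e
  haveI : ContinuousSMul ℂ W := he.isInducing.continuousSMul continuous_id (by intros; simp)
  { carrier := W
    continuousSMulR := ⟨he.isInducing.continuous_iff.2 hact⟩
    locallyConvex := LocallyConvexSpace.induced (𝕜 := ℝ) (e.restrictScalars ℝ)
    separated := ⟨fun x y h => hinj (h.map he.uniformContinuous.continuous).eq⟩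
    complete := (completeSpace_iff_isComplete_range he).2 hcl.isComplete
    metrizable := Filter.comap.isCountablyGenerated _ _ }

end ClosedRange

/-- The kernel of a morphism. -/
def kernel {X Y : FrechetMod R} (f : X ⟶ Y) : FrechetMod R :=
  ofClosedRange (R := R) (W := LinearMap.ker (toCLM f).toLinearMap) (E := X.carrier)
    ((LinearMap.ker (toCLM f).toLinearMap).subtype.restrictScalars ℂ) Subtype.val_injective
    (by
      have h : Set.range ((LinearMap.ker (toCLM f).toLinearMap).subtype.restrictScalars ℂ) =
          toCLM f ⁻¹' {0} := Subtype.range_coe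
      rw [h]
      exact isClosed_singleton.preimage (toCLM f).continuous)
    (by
      let _ : TopologicalSpace (LinearMap.ker (toCLM f).toLinearMap) :=
        .induced ((LinearMap.ker (toCLM f).toLinearMap).subtype.restrictScalars ℂ) inferInstance
      have hc : Continuous ((LinearMap.ker (toCLM f).toLinearMap).subtype.restrictScalars ℂ) :=
        continuous_induced_dom
      exact continuous_fst.smul (hc.comp continuous_snd))

/-- The inclusion of the kernel. -/
def kernelι {X Y : FrechetMod R} (f : X ⟶ Y) : kernel f ⟶ X :=
  ofCLM (X := kernel f) ⟨(LinearMap.ker (toCLM f).toLinearMap).subtype, continuous_induced_dom⟩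

theorem kernelι_injective {X Y : FrechetMod R} (f : X ⟶ Y) :
    Function.Injective (toCLM (kernelι f)) := Subtype.val_injective

theorem kernelι_apply {X Y : FrechetMod R} (f : X ⟶ Y) (x : (kernel f).carrier) :
    toCLM f (toCLM (kernelι f) x) = 0 := x.2

/-- A continuous linear map to the kernel. -/
def kernelLift {X Y Z : FrechetMod R} (f : X ⟶ Y) (g : Z.carrier →L[ℂ] X.carrier)
    (h : ∀ z, toCLM f (g z) = 0) : Z.carrier →L[ℂ] (kernel f).carrier where
  toFun z := ⟨g z, h z⟩
  map_add' x y := Subtype.ext (map_add g x y)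
  map_smul' c x := Subtype.ext (map_smul g c x)
  cont := continuous_induced_rng.2 g.continuous

/-- A morphism to the kernel. -/
def kernelHom {X Y Z : FrechetMod R} (f : X ⟶ Y) (g : Z ⟶ X)
    (h : ∀ z, toCLM f (toCLM g z) = 0) : Z ⟶ kernel f :=
  ofCLM (Y := kernel f)
    { toFun z := ⟨toCLM g z, h z⟩
      map_add' x y := Subtype.ext (map_add (toCLM g) x y)
      map_smul' c x := Subtype.ext (map_smul (toCLM g) c x)
      cont := continuous_induced_rng.2 (toCLM g).continuous }

section Pushout

variable {Y E Z Y' : FrechetMod R} (i : Y ⟶ E) (p : E ⟶ Z) (f : Y ⟶ Y')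

/-- The antidiagonal copy of `Y` in `Y' × E`. -/
def pushoutSub : Submodule R (Y'.carrier × E.carrier) :=
  LinearMap.range ((toCLM f).toLinearMap.prod (-(toCLM i).toLinearMap))

variable (s : Z.carrier →L[ℂ] E.carrier) (r : E.carrier →L[ℂ] Y.carrier)

/-- The coordinates on the pushout of a split extension. -/
def pushoutCoordAux : (Y'.carrier × E.carrier) →ₗ[ℂ] Y'.carrier × Z.carrier :=
  (LinearMap.coprod LinearMap.id (((toCLM f).toLinearMap.restrictScalars ℂ) ∘ₗ
    r.toLinearMap)).prod (((toCLM p).toLinearMap.restrictScalars ℂ) ∘ₗ LinearMap.snd ℂ _ _)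

theorem pushoutCoordAux_apply (y : Y'.carrier) (x : E.carrier) :
    pushoutCoordAux p f r (y, x) = (y + toCLM f (r x), toCLM p x) := rfl

theorem continuous_pushoutCoordAux : Continuous (pushoutCoordAux p f r) :=
  (continuous_fst.add ((toCLM f).continuous.comp (r.continuous.comp continuous_snd))).prodMk
    ((toCLM p).continuous.comp continuous_snd)

variable (h1 : ∀ y, r (toCLM i y) = y) (h2 : ∀ z, toCLM p (s z) = z)
  (h3 : ∀ y, toCLM p (toCLM i y) = 0) (h4 : ∀ x, toCLM i (r x) + s (toCLM p x) = x)

include h1 h2 h4 in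
theorem retract_section (z : Z.carrier) : r (s z) = 0 := by
  have h := h4 (s z)
  rw [h2] at h
  have h' : toCLM i (r (s z)) = 0 := by simpa using h
  rw [← h1 (r (s z)), h', map_zero]

include h1 h3 in
theorem pushoutSub_le :
    (pushoutSub i f).restrictScalars ℂ ≤ LinearMap.ker (pushoutCoordAux p f r) := by
  rintro _ ⟨y, rfl⟩
  change ((toCLM f y + toCLM f (r (-toCLM i y)), toCLM p (-toCLM i y)) :
    Y'.carrier × Z.carrier) = 0
  rw [map_neg, h1, map_neg, add_neg_cancel, map_neg, h3, neg_zero]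
  rfl

/-- The coordinates on the pushout of a split extension. -/
def pushoutCoord :
    ((Y'.carrier × E.carrier) ⧸ pushoutSub i f) →ₗ[ℂ] Y'.carrier × Z.carrier :=
  ((pushoutSub i f).restrictScalars ℂ).liftQ (pushoutCoordAux p f r)
    (pushoutSub_le i p f r h1 h3)

theorem pushoutCoord_mk (w : Y'.carrier × E.carrier) :
    pushoutCoord i p f r h1 h3 ((pushoutSub i f).mkQ w) = pushoutCoordAux p f r w := rfl

include h4 in
theorem pushout_eq (x : (Y'.carrier × E.carrier) ⧸ pushoutSub i f) :
    (pushoutSub i f).mkQ ((pushoutCoord i p f r h1 h3 x).1, s (pushoutCoord i p f r h1 h3 x).2) =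
      x := by
  obtain ⟨⟨y, x⟩, rfl⟩ := (pushoutSub i f).mkQ_surjective x
  rw [pushoutCoord_mk, pushoutCoordAux_apply]
  refine (Submodule.Quotient.eq _).2 ⟨r x, ?_⟩
  refine Prod.ext ?_ ?_
  · change toCLM f (r x) = y + toCLM f (r x) - y
    rw [add_sub_cancel_left]
  · change -toCLM i (r x) = s (toCLM p x) - x
    rw [neg_eq_iff_eq_neg, neg_sub]
    exact eq_sub_of_add_eq (h4 x)

/-- The pushout of a split extension. -/
def pushoutObj : FrechetMod R :=
  ofClosedRange (R := R) (W := (Y'.carrier × E.carrier) ⧸ pushoutSub i f)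
    (E := Y'.carrier × Z.carrier) (pushoutCoord i p f r h1 h3)
    (fun x y h => by
      rw [← pushout_eq i p f s r h1 h3 h4 x, ← pushout_eq i p f s r h1 h3 h4 y, h])
    (by
      have h : Set.range (pushoutCoord i p f r h1 h3) = Set.univ := by
        refine Set.eq_univ_of_forall fun q => ⟨(pushoutSub i f).mkQ (q.1, s q.2), ?_⟩
        rw [pushoutCoord_mk, pushoutCoordAux_apply, h2, retract_section i p s r h1 h2 h4,
          map_zero, add_zero]
      rw [h]
      exact isClosed_univ)
    (by
      let _ : TopologicalSpace ((Y'.carrier × E.carrier) ⧸ pushoutSub i f) :=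
        .induced (pushoutCoord i p f r h1 h3) inferInstance
      have hc : Continuous (pushoutCoord i p f r h1 h3) := continuous_induced_dom
      have h : ∀ q : R × ((Y'.carrier × E.carrier) ⧸ pushoutSub i f),
          pushoutCoord i p f r h1 h3 (q.1 • q.2) = pushoutCoordAux p f r
            (q.1 • ((pushoutCoord i p f r h1 h3 q.2).1, s (pushoutCoord i p f r h1 h3 q.2).2)) := by
        intro q
        conv_lhs => rw [← pushout_eq i p f s r h1 h3 h4 q.2, ← map_smul, pushoutCoord_mk]
      refine (continuous_congr h).2 ((continuous_pushoutCoordAux p f r).comp ?_)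
      have hc2 := hc.comp (continuous_snd (X := R))
      exact (continuous_fst.smul (continuous_fst.comp hc2)).prodMk
        (continuous_fst.smul (s.continuous.comp (continuous_snd.comp hc2))))

/-- The map from `Y' × E` to the pushout. -/
def pushoutMk : (Y'.carrier × E.carrier) →L[R] (pushoutObj i p f s r h1 h2 h3 h4).carrier where
  toLinearMap := (pushoutSub i f).mkQ
  cont := continuous_induced_rng.2 (continuous_pushoutCoordAux p f r)

theorem pushoutMk_surjective : Function.Surjective (pushoutMk i p f s r h1 h2 h3 h4) :=
  (pushoutSub i f).mkQ_surjective

theorem pushoutMk_eq (y : Y.carrier) :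
    pushoutMk i p f s r h1 h2 h3 h4 (0, toCLM i y) =
      pushoutMk i p f s r h1 h2 h3 h4 (toCLM f y, 0) := by
  refine (Submodule.Quotient.eq _).2 ⟨-y, Prod.ext ?_ ?_⟩
  · change toCLM f (-y) = 0 - toCLM f y
    rw [map_neg, zero_sub]
  · change -toCLM i (-y) = toCLM i y - 0
    rw [map_neg, neg_neg, sub_zero]

/-- Morphisms out of the pushout. -/
def pushoutDesc {W : FrechetMod R} (l : (Y'.carrier × E.carrier) →L[R] W.carrier)
    (h : ∀ y, l (toCLM f y, -toCLM i y) = 0) :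
    (pushoutObj i p f s r h1 h2 h3 h4).carrier →L[R] W.carrier where
  toLinearMap := (pushoutSub i f).liftQ l.toLinearMap (by rintro _ ⟨y, rfl⟩; exact h y)
  cont := by
    have hc : Continuous (fun x : (pushoutObj i p f s r h1 h2 h3 h4).carrier =>
        pushoutCoord i p f r h1 h3 x) := continuous_induced_dom
    have e : ∀ x : (pushoutObj i p f s r h1 h2 h3 h4).carrier,
        (pushoutSub i f).liftQ l.toLinearMap (by rintro _ ⟨y, rfl⟩; exact h y) x =
        l ((pushoutCoord i p f r h1 h3 x).1, s (pushoutCoord i p f r h1 h3 x).2) := by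
      intro x
      conv_lhs => rw [← pushout_eq i p f s r h1 h3 h4 x]
      rfl
    refine (continuous_congr e).2 (l.continuous.comp ?_)
    exact (continuous_fst.comp hc).prodMk (s.continuous.comp (continuous_snd.comp hc))

/-- The coordinate on the pushout with values in `Y'`. -/
def pushoutRetract : (pushoutObj i p f s r h1 h2 h3 h4).carrier →L[ℂ] Y'.carrier where
  toLinearMap := LinearMap.fst ℂ _ _ ∘ₗ pushoutCoord i p f r h1 h3
  cont := by
    have hc : Continuous (fun x : (pushoutObj i p f s r h1 h2 h3 h4).carrier =>
        pushoutCoord i p f r h1 h3 x) := continuous_induced_dom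
    exact continuous_fst.comp hc

theorem pushoutRetract_mk (w : Y'.carrier × E.carrier) :
    pushoutRetract i p f s r h1 h2 h3 h4 (pushoutMk i p f s r h1 h2 h3 h4 w) =
      w.1 + toCLM f (r w.2) := rfl

end Pushout

theorem surjective_of_isConflation {Y E Z : FrechetMod R} {i : Y ⟶ E} {p : E ⟶ Z}
    (h : HasConflations.IsConflation i p) : Function.Surjective (toCLM p) := by
  obtain ⟨s, r, h1, h2, h3, h4⟩ := h
  exact fun z => ⟨s z, h2 z⟩

instance : ExactLike (FrechetMod R) where
  zero := by
    rintro Y E Z i p ⟨s, r, h1, h2, h3, h4⟩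
    exact hom_ext h3
  mono := by
    rintro Y E Z i p ⟨s, r, h1, h2, h3, h4⟩
    refine ⟨fun {W} a b h => hom_ext fun w => ?_⟩
    rw [← h1 (toCLM a w), ← h1 (toCLM b w), ← comp_apply, ← comp_apply, h]
  epi := by
    rintro Y E Z i p ⟨s, r, h1, h2, h3, h4⟩
    refine ⟨fun {W} a b h => hom_ext fun z => ?_⟩
    rw [← h2 z, ← comp_apply, ← comp_apply, h]
  lift := by
    rintro Y E Z i p ⟨s, r, h1, h2, h3, h4⟩ W f hf
    have e : ∀ w, toCLM i (r (toCLM f w)) = toCLM f w := by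
      intro w
      have h := h4 (toCLM f w)
      rwa [← comp_apply f p, hf, show toCLM (0 : W ⟶ Z) w = 0 from rfl, map_zero, add_zero] at h
    refine ⟨ofCLM
      { toFun w := r (toCLM f w)
        map_add' x y := by rw [map_add, map_add]
        map_smul' c x := by
          rw [RingHom.id_apply, map_smul, ← e x, ← map_smul, h1, e]
        cont := r.continuous.comp (toCLM f).continuous }, hom_ext e⟩
  desc := by
    rintro Y E Z i p ⟨s, r, h1, h2, h3, h4⟩ W f hf
    have e : ∀ x, toCLM f (s (toCLM p x)) = toCLM f x := by
      intro x
      conv_rhs => rw [← h4 x, map_add, ← comp_apply i f, hf]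
      exact (zero_add _).symm
    refine ⟨ofCLM
      { toFun z := toCLM f (s z)
        map_add' x y := by rw [map_add, map_add]
        map_smul' c z := by
          rw [RingHom.id_apply, ← h2 z, ← map_smul, e, map_smul, h2]
        cont := (toCLM f).continuous.comp s.continuous }, hom_ext e⟩
  pushout := by
    rintro Y E Z Y' i p ⟨s, r, h1, h2, h3, h4⟩ f
    let mk := pushoutMk i p f s r h1 h2 h3 h4
    have hmk : Function.Surjective mk := pushoutMk_surjective i p f s r h1 h2 h3 h4
    let inl : Y'.carrier →L[R] (Y'.carrier × E.carrier) := ContinuousLinearMap.inl R _ _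
    let inr : E.carrier →L[R] (Y'.carrier × E.carrier) := ContinuousLinearMap.inr R _ _
    have hsplit : ∀ w : Y'.carrier × E.carrier, mk (inl w.1) + mk (inr w.2) = mk w := by
      intro w
      rw [← map_add]
      exact congrArg mk (Prod.ext (add_zero _) (zero_add _))
    let q : (Y'.carrier × E.carrier) →L[R] Z.carrier :=
      (toCLM p).comp (ContinuousLinearMap.snd R _ _)
    have hq : ∀ y, q (toCLM f y, -toCLM i y) = 0 := fun y => by
      change toCLM p (-toCLM i y) = 0
      rw [map_neg, h3, neg_zero]
    let p' : (pushoutObj i p f s r h1 h2 h3 h4).carrier →L[R] Z.carrier :=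
      pushoutDesc i p f s r h1 h2 h3 h4 q hq
    refine ⟨pushoutObj i p f s r h1 h2 h3 h4, ofCLM (mk.comp inl), ofCLM p', ofCLM (mk.comp inr),
      ⟨⟨((mk.toLinearMap.restrictScalars ℂ) ∘ₗ (inr.toLinearMap.restrictScalars ℂ)) ∘ₗ
          s.toLinearMap, (mk.continuous.comp inr.continuous).comp s.continuous⟩,
        pushoutRetract i p f s r h1 h2 h3 h4, ?_, ?_, ?_, ?_⟩, ?_, ?_, ?_, ?_⟩
    · intro y
      refine (pushoutRetract_mk i p f s r h1 h2 h3 h4 (y, 0)).trans ?_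
      rw [map_zero, map_zero, add_zero]
    · exact fun z => h2 z
    · exact fun y => map_zero (toCLM p)
    · intro x
      obtain ⟨w, rfl⟩ := hmk x
      change mk (inl (w.1 + toCLM f (r w.2))) + mk (inr (s (toCLM p w.2))) = mk w
      rw [← hsplit w, map_add inl, map_add mk, add_assoc]
      congr 1
      have e : mk (inl (toCLM f (r w.2))) = mk (inr (toCLM i (r w.2))) :=
        (pushoutMk_eq i p f s r h1 h2 h3 h4 _).symm
      rw [e, ← map_add, ← map_add, h4]
    · exact hom_ext fun y => pushoutMk_eq i p f s r h1 h2 h3 h4 y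
    · exact hom_ext fun x => rfl
    · intro W a b hab
      refine ⟨ofCLM (pushoutDesc i p f s r h1 h2 h3 h4 ((toCLM a).coprod (toCLM b)) ?_), ?_, ?_⟩
      · intro y
        change toCLM a (toCLM f y) + toCLM b (-toCLM i y) = 0
        rw [map_neg, ← comp_apply, ← comp_apply, hab, add_neg_cancel]
      · refine hom_ext fun y => ?_
        change toCLM a y + toCLM b 0 = toCLM a y
        rw [map_zero, add_zero]
      · refine hom_ext fun y => ?_
        change toCLM a 0 + toCLM b y = toCLM b y
        rw [map_zero, zero_add]
    · intro W c c' ha hb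
      refine hom_ext fun x => ?_
      obtain ⟨w, rfl⟩ := hmk x
      rw [← hsplit w, map_add, map_add]
      exact congrArg₂ (· + ·) (congrArg (fun f => toCLM f w.1) ha)
        (congrArg (fun f => toCLM f w.2) hb)

variable (R) in
/-- A finite system of elements with continuous coordinates. -/
def HasDualBasis (X : FrechetMod R) : Prop :=
  ∃ (n : ℕ) (r : Fin n → X.carrier →ₗ[R] R) (p : Fin n → X.carrier),
    (∀ i, Continuous (r i)) ∧ ∀ x, ∑ i, r i x • p i = x

theorem HasDualBasis.continuous {X Y : FrechetMod R} (h : HasDualBasis R X)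
    (f : X.carrier →ₗ[R] Y.carrier) : Continuous f := by
  obtain ⟨n, r, p, hr, hp⟩ := h
  have e : ∀ x, f x = ∑ i, r i x • f (p i) := by
    intro x
    conv_lhs => rw [← hp x, map_sum]
    simp_rw [map_smul]
  refine (continuous_congr e).2 (continuous_finsetSum _ fun i _ => ?_)
  exact (hr i).smul continuous_const

theorem HasDualBasis.exists_lift {X : FrechetMod R} (h : HasDualBasis R X)
    {E Z : Type*} [AddCommGroup E] [Module R E] [AddCommGroup Z] [Module R Z]
    (p : E →ₗ[R] Z) (hp : Function.Surjective p) (f : X.carrier →ₗ[R] Z) :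
    ∃ g : X.carrier →ₗ[R] E, p ∘ₗ g = f := by
  obtain ⟨n, r, x, -, hx⟩ := h
  choose s hs using hp
  refine ⟨∑ i, (r i).smulRight (s (f (x i))), LinearMap.ext fun y => ?_⟩
  rw [LinearMap.comp_apply, LinearMap.sum_apply, map_sum]
  conv_rhs => rw [← hx y, map_sum]
  refine Finset.sum_congr rfl fun i _ => ?_
  rw [LinearMap.smulRight_apply, map_smul, hs, map_smul]

theorem HasDualBasis.relProjective {X : FrechetMod R} (h : HasDualBasis R X) :
    RelProjective X := by
  intro Y E Z i p hc f
  obtain ⟨g, hg⟩ := h.exists_lift (toCLM p).toLinearMap (surjective_of_isConflation hc)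
    (toCLM f).toLinearMap
  exact ⟨ofCLM ⟨g, h.continuous g⟩, hom_ext fun x => DFunLike.congr_fun hg x⟩

end FrechetMod

/-! ### Resolutions by contractible complexes -/

/-- A complex `⋯ → Q 1 → Q 0` of Fréchet modules with a continuous linear contraction. -/
structure ContractedComplex (R : Type u) [Ring R] [Algebra ℂ R] [TopologicalSpace R] where
  Q : ℕ → FrechetMod R
  d : ∀ k, Q (k + 1) ⟶ Q k
  s : ∀ k, (Q k).carrier →L[ℂ] (Q (k + 1)).carrier
  d_d : ∀ k x, FrechetMod.toCLM (d k) (FrechetMod.toCLM (d (k + 1)) x) = 0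
  d_s_zero : ∀ x, FrechetMod.toCLM (d 0) (s 0 x) = x
  d_s : ∀ k x, FrechetMod.toCLM (d (k + 1)) (s (k + 1) x) + s k (FrechetMod.toCLM (d k) x) = x

namespace ContractedComplex

open FrechetMod

variable {R : Type u} [Ring R] [Algebra ℂ R] [TopologicalSpace R] (D : ContractedComplex R)

theorem d_s_d (k : ℕ) (x : (D.Q (k + 1)).carrier) :
    toCLM (D.d k) (D.s k (toCLM (D.d k) x)) = toCLM (D.d k) x := by
  cases k with
  | zero => exact D.d_s_zero _
  | succ k =>
    have h := D.d_s k (toCLM (D.d (k + 1)) x)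
    rwa [D.d_d, map_zero, add_zero] at h

/-- The syzygies. -/
def Ω : ℕ → FrechetMod R
  | 0 => D.Q 0
  | k + 1 => FrechetMod.kernel (D.d k)

/-- The map to the syzygies. -/
def toΩ : ∀ k, D.Q (k + 1) ⟶ D.Ω k
  | 0 => D.d 0
  | k + 1 => kernelHom (D.d k) (D.d (k + 1)) (D.d_d k)

/-- The resolution of `Q 0`. -/
def resn : Resn (FrechetMod R) where
  Ω := D.Ω
  P k := D.Q (k + 1)
  i k := kernelι (D.d k)
  p := D.toΩ

theorem resn_conf (k : ℕ) : HasConflations.IsConflation (D.resn.i k) (D.resn.p k) := by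
  let r : (D.Q (k + 1)).carrier →L[ℂ] (FrechetMod.kernel (D.d k)).carrier :=
    kernelLift (D.d k) (ContinuousLinearMap.id ℂ _ -
      (D.s k).comp ⟨(toCLM (D.d k)).toLinearMap.restrictScalars ℂ, (toCLM (D.d k)).continuous⟩)
      (fun z => by
        change toCLM (D.d k) (z - D.s k (toCLM (D.d k) z)) = 0
        rw [map_sub, D.d_s_d, sub_self])
  have hr : ∀ x, toCLM (kernelι (D.d k)) (r x) = x - D.s k (toCLM (D.d k) x) := fun x => rfl
  have hri : ∀ y, r (toCLM (kernelι (D.d k)) y) = y := fun y => kernelι_injective _ (by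
    rw [hr, kernelι_apply, map_zero, sub_zero])
  have hsum : ∀ x, toCLM (kernelι (D.d k)) (r x) + D.s k (toCLM (D.d k) x) = x := fun x => by
    rw [hr, sub_add_cancel]
  cases k with
  | zero => exact ⟨D.s 0, r, hri, D.d_s_zero, fun y => y.2, hsum⟩
  | succ k =>
    have hz : ∀ z : (FrechetMod.kernel (D.d k)).carrier,
        toCLM (D.d (k + 1)) (D.s (k + 1) (toCLM (kernelι (D.d k)) z)) =
          toCLM (kernelι (D.d k)) z := fun z => by
      have h := D.d_s k (toCLM (kernelι (D.d k)) z)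
      rwa [kernelι_apply, map_zero, add_zero] at h
    refine ⟨(D.s (k + 1)).comp ⟨(toCLM (kernelι (D.d k))).toLinearMap.restrictScalars ℂ,
      (toCLM (kernelι (D.d k))).continuous⟩, r, hri,
      fun z => kernelι_injective (D.d k) (hz z), fun y => kernelι_injective (D.d k) y.2, hsum⟩

theorem resn_isProjective (h : ∀ k, HasDualBasis R (D.Q (k + 1))) : D.resn.IsProjective :=
  ⟨D.resn_conf, fun k => (h k).relProjective⟩

end ContractedComplex

/-! ### The exact structure of complete bornological modules -/

theorem IsCompleteDisk.prod {E F : Type u} [AddCommGroup E] [Module ℂ E] [AddCommGroup F]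
    [Module ℂ F] {S : Set E} {T : Set F} (hS : IsCompleteDisk S) (hT : IsCompleteDisk T) :
    IsCompleteDisk (S ×ˢ T) where
  nonempty := hS.nonempty.prod hT.nonempty
  balanced := by
    rintro a ha _ ⟨⟨x, y⟩, ⟨hx, hy⟩, rfl⟩
    exact ⟨hS.balanced a ha ⟨x, hx, rfl⟩, hT.balanced a ha ⟨y, hy, rfl⟩⟩
  convex := hS.convex.prod hT.convex
  separated x hx := by
    refine Prod.ext (hS.separated _ fun ε hε => ?_) (hT.separated _ fun ε hε => ?_)
    · obtain ⟨t, ht, rfl⟩ := hx ε hε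
      exact ⟨t.1, ht.1, rfl⟩
    · obtain ⟨t, ht, rfl⟩ := hx ε hε
      exact ⟨t.2, ht.2, rfl⟩
  complete s hs := by
    obtain ⟨x, hx⟩ := hS.complete (fun n => (s n).1) fun ε hε => by
      obtain ⟨N, hN⟩ := hs ε hε
      refine ⟨N, fun j hj k hk => ?_⟩
      obtain ⟨t, ht, e⟩ := hN j hj k hk
      exact ⟨t.1, ht.1, congrArg Prod.fst e⟩
    obtain ⟨y, hy⟩ := hT.complete (fun n => (s n).2) fun ε hε => by
      obtain ⟨N, hN⟩ := hs ε hε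
      refine ⟨N, fun j hj k hk => ?_⟩
      obtain ⟨t, ht, e⟩ := hN j hj k hk
      exact ⟨t.2, ht.2, congrArg Prod.snd e⟩
    refine ⟨(x, y), fun ε hε => ?_⟩
    obtain ⟨N, hN⟩ := hx ε hε
    obtain ⟨N', hN'⟩ := hy ε hε
    refine ⟨max N N', fun j hj => ?_⟩
    obtain ⟨t, ht, e⟩ := hN j (le_of_max_le_left hj)
    obtain ⟨t', ht', e'⟩ := hN' j (le_of_max_le_right hj)
    exact ⟨(t, t'), ⟨ht, ht'⟩, Prod.ext e e'⟩

theorem IsCompleteDisk.preimage {E F : Type u} [AddCommGroup E] [Module ℂ E] [AddCommGroup F]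
    [Module ℂ F] {T : Set F} (hT : IsCompleteDisk T) (e : E ≃ₗ[ℂ] F) :
    IsCompleteDisk (e ⁻¹' T) := by
  have hr : ∀ (ε : ℝ) (x : E), e (ε • x) = ε • e x := fun ε x =>
    (e.toLinearMap.restrictScalars ℝ).map_smul ε x
  have hr' : ∀ (ε : ℝ) (x : F), e.symm (ε • x) = ε • e.symm x := fun ε x =>
    (e.symm.toLinearMap.restrictScalars ℝ).map_smul ε x
  refine ⟨?_, ?_, hT.convex.linear_preimage (e.toLinearMap.restrictScalars ℝ), ?_, ?_⟩
  · obtain ⟨x, hx⟩ := hT.nonempty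
    exact ⟨e.symm x, by simpa using hx⟩
  · rintro a ha _ ⟨x, hx, rfl⟩
    change e (a • x) ∈ T
    rw [map_smul]
    exact hT.balanced a ha ⟨e x, hx, rfl⟩
  · intro x hx
    refine e.map_eq_zero_iff.1 (hT.separated _ fun ε hε => ?_)
    obtain ⟨t, ht, rfl⟩ := hx ε hε
    exact ⟨e t, ht, hr ε t⟩
  · intro s hs
    obtain ⟨x, hx⟩ := hT.complete (fun n => e (s n)) fun ε hε => by
      obtain ⟨N, hN⟩ := hs ε hε
      refine ⟨N, fun j hj k hk => ?_⟩
      obtain ⟨t, ht, h⟩ := hN j hj k hk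
      exact ⟨e t, ht, by rw [← map_sub, h, hr]⟩
    refine ⟨e.symm x, fun ε hε => ?_⟩
    obtain ⟨N, hN⟩ := hx ε hε
    refine ⟨N, fun j hj => ?_⟩
    obtain ⟨t, ht, h⟩ := hN j hj
    refine ⟨e.symm t, by simpa using ht, e.injective ?_⟩
    rw [map_sub, e.apply_symm_apply, h, hr, e.apply_symm_apply]

namespace BornMod

open Bornology

variable {R : Type u} [Ring R] [Algebra ℂ R] [TopologicalSpace R]

/-- Maps that preserve boundedness. -/
def Bdd {X Y : Type*} [Bornology X] [Bornology Y] (f : X → Y) : Prop :=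
  ∀ S : Set X, IsBounded S → IsBounded (f '' S)

theorem Bdd.comp {X Y Z : Type*} [Bornology X] [Bornology Y] [Bornology Z] {g : Y → Z}
    {f : X → Y} (hg : Bdd g) (hf : Bdd f) : Bdd (fun x => g (f x)) := fun S hS => by
  have h := hg _ (hf S hS)
  rwa [← Set.image_comp] at h

theorem Bdd.add {X : Type*} [Bornology X] {Y : BornMod R} {f g : X → Y.carrier}
    (hf : Bdd f) (hg : Bdd g) : Bdd fun x => f x + g x := fun S hS => by
  refine (Y.bounded_add _ _ (hf S hS) (hg S hS)).subset ?_
  rintro _ ⟨x, hx, rfl⟩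
  exact ⟨f x, ⟨x, hx, rfl⟩, g x, ⟨x, hx, rfl⟩, rfl⟩

theorem Bdd.sum {X : Type*} [Bornology X] {Y : BornMod R} {ι : Type*} (s : Finset ι)
    {f : ι → X → Y.carrier} (hf : ∀ i ∈ s, Bdd (f i)) : Bdd fun x => ∑ i ∈ s, f i x := by
  classical
  induction s using Finset.induction_on with
  | empty =>
    intro S _
    refine (isBounded_singleton (x := (0 : Y.carrier))).subset ?_
    rintro _ ⟨x, _, rfl⟩
    exact Finset.sum_empty
  | insert a s ha ih =>
    simp_rw [Finset.sum_insert ha]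
    exact (hf a (Finset.mem_insert_self a s)).add
      (ih fun i hi => hf i (Finset.mem_insert_of_mem hi))

theorem bdd_toLin {X Y : BornMod R} (f : X ⟶ Y) : Bdd (toLin f) :=
  Subtype.property (p := fun f => f ∈ boundedHom X Y) f

/-- A morphism from a bounded linear map. -/
def ofLin {X Y : BornMod R} (f : X.carrier →ₗ[R] Y.carrier) (hf : Bdd f) : X ⟶ Y :=
  (⟨f, hf⟩ : boundedHom X Y)

theorem comp_apply {X Y Z : BornMod R} (f : X ⟶ Y) (g : Y ⟶ Z) (x : X.carrier) :
    toLin (f ≫ g) x = toLin g (toLin f x) := rfl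

theorem isBounded_induced_prod {W X Y : Type*} [Bornology X] [Bornology Y] (c : W → X × Y)
    (S : Set W) : @IsBounded W (Bornology.induced c) S ↔
      IsBounded ((fun x => (c x).1) '' S) ∧ IsBounded ((fun x => (c x).2) '' S) := by
  rw [isBounded_induced, ← isBounded_image_fst_and_snd, ← Set.image_comp, ← Set.image_comp]
  rfl

section Pushout

variable {Y E Z Y' : BornMod R} (i : Y ⟶ E) (p : E ⟶ Z) (f : Y ⟶ Y')

/-- The antidiagonal copy of `Y` in `Y' × E`. -/
def pushoutSub : Submodule R (Y'.carrier × E.carrier) :=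
  LinearMap.range ((toLin f).prod (-(toLin i)))

variable (s : Z.carrier →ₗ[ℂ] E.carrier) (r : E.carrier →ₗ[ℂ] Y.carrier)

/-- The coordinates on the pushout of a split extension. -/
def pushoutCoordAux : (Y'.carrier × E.carrier) →ₗ[ℂ] Y'.carrier × Z.carrier :=
  (LinearMap.coprod LinearMap.id (((toLin f).restrictScalars ℂ) ∘ₗ r)).prod
    (((toLin p).restrictScalars ℂ) ∘ₗ LinearMap.snd ℂ _ _)

theorem pushoutCoordAux_apply (y : Y'.carrier) (x : E.carrier) :
    pushoutCoordAux p f r (y, x) = (y + toLin f (r x), toLin p x) := rfl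

variable (h1 : ∀ y, r (toLin i y) = y) (h2 : ∀ z, toLin p (s z) = z)
  (h3 : ∀ y, toLin p (toLin i y) = 0) (h4 : ∀ x, toLin i (r x) + s (toLin p x) = x)

include h1 h2 h4 in
theorem retract_section (z : Z.carrier) : r (s z) = 0 := by
  have h := h4 (s z)
  rw [h2] at h
  have h' : toLin i (r (s z)) = 0 := by simpa using h
  rw [← h1 (r (s z)), h', map_zero]

include h1 h3 in
theorem pushoutSub_le :
    (pushoutSub i f).restrictScalars ℂ ≤ LinearMap.ker (pushoutCoordAux p f r) := by
  rintro _ ⟨y, rfl⟩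
  change ((toLin f y + toLin f (r (-toLin i y)), toLin p (-toLin i y)) :
    Y'.carrier × Z.carrier) = 0
  rw [map_neg, h1, map_neg, add_neg_cancel, map_neg, h3, neg_zero]
  rfl

include h4 in
theorem pushout_eq (w : Y'.carrier × E.carrier) :
    (pushoutSub i f).mkQ ((pushoutCoordAux p f r w).1, s (pushoutCoordAux p f r w).2) =
      (pushoutSub i f).mkQ w := by
  obtain ⟨y, x⟩ := w
  rw [pushoutCoordAux_apply]
  refine (Submodule.Quotient.eq _).2 ⟨r x, ?_⟩
  refine Prod.ext ?_ ?_
  · change toLin f (r x) = y + toLin f (r x) - y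
    rw [add_sub_cancel_left]
  · change -toLin i (r x) = s (toLin p x) - x
    rw [neg_eq_iff_eq_neg, neg_sub]
    exact eq_sub_of_add_eq (h4 x)

/-- The coordinates on the pushout of a split extension. -/
def pushoutCoord :
    ((Y'.carrier × E.carrier) ⧸ pushoutSub i f) ≃ₗ[ℂ] Y'.carrier × Z.carrier where
  toLinearMap := ((pushoutSub i f).restrictScalars ℂ).liftQ (pushoutCoordAux p f r)
    (pushoutSub_le i p f r h1 h3)
  invFun q := (pushoutSub i f).mkQ (q.1, s q.2)
  left_inv x := by
    obtain ⟨w, rfl⟩ := (pushoutSub i f).mkQ_surjective x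
    exact pushout_eq i p f s r h4 w
  right_inv q := by
    change pushoutCoordAux p f r (q.1, s q.2) = q
    rw [pushoutCoordAux_apply, h2, retract_section i p s r h1 h2 h4, map_zero, add_zero]

theorem pushoutCoord_mk (w : Y'.carrier × E.carrier) :
    pushoutCoord i p f s r h1 h2 h3 h4 ((pushoutSub i f).mkQ w) = pushoutCoordAux p f r w := rfl

theorem pushoutCoord_smul (a : R) (x : (Y'.carrier × E.carrier) ⧸ pushoutSub i f) :
    pushoutCoord i p f s r h1 h2 h3 h4 (a • x) =
      (a • (pushoutCoord i p f s r h1 h2 h3 h4 x).1 +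
        toLin f (r (a • s (pushoutCoord i p f s r h1 h2 h3 h4 x).2)),
        a • (pushoutCoord i p f s r h1 h2 h3 h4 x).2) := by
  obtain ⟨w, rfl⟩ := (pushoutSub i f).mkQ_surjective x
  conv_lhs => rw [← pushout_eq i p f s r h4 w, ← map_smul, pushoutCoord_mk]
  rw [pushoutCoord_mk]
  refine Prod.ext rfl ?_
  change toLin p (a • s _) = _
  rw [map_smul, h2]

variable (hs : Bdd s) (hr : Bdd r)

/-- The pushout of a split extension. -/
def pushoutObj : BornMod R :=
  letI c := pushoutCoord i p f s r h1 h2 h3 h4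
  letI : Bornology ((Y'.carrier × E.carrier) ⧸ pushoutSub i f) := Bornology.induced c
  have hb : ∀ S : Set ((Y'.carrier × E.carrier) ⧸ pushoutSub i f), IsBounded S ↔
      IsBounded ((fun x => (c x).1) '' S) ∧ IsBounded ((fun x => (c x).2) '' S) :=
    isBounded_induced_prod c
  { carrier := (Y'.carrier × E.carrier) ⧸ pushoutSub i f
    bounded_add := fun S T hS hT => by
      rw [hb] at hS hT ⊢
      constructor
      · refine (Y'.bounded_add _ _ hS.1 hT.1).subset ?_
        rintro _ ⟨_, ⟨x, hx, y, hy, rfl⟩, rfl⟩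
        exact ⟨_, ⟨x, hx, rfl⟩, _, ⟨y, hy, rfl⟩, (congrArg Prod.fst (map_add c x y)).symm⟩
      · refine (Z.bounded_add _ _ hS.2 hT.2).subset ?_
        rintro _ ⟨_, ⟨x, hx, y, hy, rfl⟩, rfl⟩
        exact ⟨_, ⟨x, hx, rfl⟩, _, ⟨y, hy, rfl⟩, (congrArg Prod.snd (map_add c x y)).symm⟩
    bounded_smul := fun a S hS => by
      rw [hb] at hS ⊢
      constructor
      · refine (Y'.bounded_smul a _ hS.1).subset ?_
        rintro _ ⟨_, ⟨x, hx, rfl⟩, rfl⟩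
        exact ⟨_, ⟨x, hx, rfl⟩, (congrArg Prod.fst (map_smul c a x)).symm⟩
      · refine (Z.bounded_smul a _ hS.2).subset ?_
        rintro _ ⟨_, ⟨x, hx, rfl⟩, rfl⟩
        exact ⟨_, ⟨x, hx, rfl⟩, (congrArg Prod.snd (map_smul c a x)).symm⟩
    complete := fun S hS => by
      obtain ⟨T, hST, hT, hT'⟩ := Y'.complete _ ((hb S).1 hS).1
      obtain ⟨T', hST', hT1, hT1'⟩ := Z.complete _ ((hb S).1 hS).2
      refine ⟨c ⁻¹' (T ×ˢ T'), fun x hx => ⟨hST ⟨x, hx, rfl⟩, hST' ⟨x, hx, rfl⟩⟩, (hb _).2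
        ⟨hT.subset ?_, hT1.subset ?_⟩, (hT'.prod hT1').preimage c⟩
      · rintro _ ⟨x, hx, rfl⟩; exact hx.1
      · rintro _ ⟨x, hx, rfl⟩; exact hx.2
    bounded_action := fun K S hK hS => by
      rw [hb] at hS ⊢
      constructor
      · refine (Y'.bounded_add _ _ (Y'.bounded_action K _ hK hS.1) (((bdd_toLin f).comp hr) _
          (E.bounded_action K _ hK (hs _ hS.2)))).subset ?_
        rintro _ ⟨_, ⟨a, ha, x, hx, rfl⟩, rfl⟩
        refine ⟨_, ⟨a, ha, _, ⟨x, hx, rfl⟩, rfl⟩, _,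
          ⟨_, ⟨a, ha, _, ⟨_, ⟨x, hx, rfl⟩, rfl⟩, rfl⟩, rfl⟩, ?_⟩
        exact (congrArg Prod.fst (pushoutCoord_smul i p f s r h1 h2 h3 h4 a x)).symm
      · refine (Z.bounded_action K _ hK hS.2).subset ?_
        rintro _ ⟨_, ⟨a, ha, x, hx, rfl⟩, rfl⟩
        exact ⟨a, ha, _, ⟨x, hx, rfl⟩,
          (congrArg Prod.snd (pushoutCoord_smul i p f s r h1 h2 h3 h4 a x)).symm⟩ }

theorem isBounded_pushoutObj
    (S : Set (pushoutObj i p f s r h1 h2 h3 h4 hs hr).carrier) : IsBounded S ↔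
      IsBounded ((fun x => (pushoutCoord i p f s r h1 h2 h3 h4 x).1) '' S) ∧
      IsBounded ((fun x => (pushoutCoord i p f s r h1 h2 h3 h4 x).2) '' S) :=
  isBounded_induced_prod (pushoutCoord i p f s r h1 h2 h3 h4) S

/-- The map from `Y' × E` to the pushout. -/
def pushoutMk : (Y'.carrier × E.carrier) →ₗ[R]
    (pushoutObj i p f s r h1 h2 h3 h4 hs hr).carrier := (pushoutSub i f).mkQ

/-- The coordinates on the pushout. -/
def pushoutFst : (pushoutObj i p f s r h1 h2 h3 h4 hs hr).carrier →ₗ[ℂ] Y'.carrier :=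
  LinearMap.fst ℂ _ _ ∘ₗ (pushoutCoord i p f s r h1 h2 h3 h4).toLinearMap

/-- The coordinates on the pushout. -/
def pushoutSnd : (pushoutObj i p f s r h1 h2 h3 h4 hs hr).carrier →ₗ[ℂ] Z.carrier :=
  LinearMap.snd ℂ _ _ ∘ₗ (pushoutCoord i p f s r h1 h2 h3 h4).toLinearMap

theorem bdd_pushoutFst : Bdd (pushoutFst i p f s r h1 h2 h3 h4 hs hr) := fun S hS =>
  ((isBounded_pushoutObj i p f s r h1 h2 h3 h4 hs hr S).1 hS).1

theorem bdd_pushoutSnd : Bdd (pushoutSnd i p f s r h1 h2 h3 h4 hs hr) := fun S hS =>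
  ((isBounded_pushoutObj i p f s r h1 h2 h3 h4 hs hr S).1 hS).2

theorem bdd_pushoutMk : Bdd (pushoutMk i p f s r h1 h2 h3 h4 hs hr) := fun S hS => by
  rw [← isBounded_image_fst_and_snd] at hS
  refine (isBounded_pushoutObj i p f s r h1 h2 h3 h4 hs hr _).2 ⟨?_, ?_⟩
  · refine (Y'.bounded_add _ _ hS.1 (((bdd_toLin f).comp hr) _ hS.2)).subset ?_
    rintro _ ⟨_, ⟨w, hw, rfl⟩, rfl⟩
    exact ⟨_, ⟨w, hw, rfl⟩, _, ⟨_, ⟨w, hw, rfl⟩, rfl⟩, rfl⟩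
  · refine (bdd_toLin p _ hS.2).subset ?_
    rintro _ ⟨_, ⟨w, hw, rfl⟩, rfl⟩
    exact ⟨_, ⟨w, hw, rfl⟩, rfl⟩

theorem pushoutMk_eq (y : Y.carrier) :
    pushoutMk i p f s r h1 h2 h3 h4 hs hr (0, toLin i y) =
      pushoutMk i p f s r h1 h2 h3 h4 hs hr (toLin f y, 0) := by
  refine (Submodule.Quotient.eq _).2 ⟨-y, Prod.ext ?_ ?_⟩
  · change toLin f (-y) = 0 - toLin f y
    rw [map_neg, zero_sub]
  · change -toLin i (-y) = toLin i y - 0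
    rw [map_neg, neg_neg, sub_zero]

theorem pushoutSub_le_ker {W : BornMod R} (a : Y' ⟶ W) (b : E ⟶ W)
    (h : ∀ y, toLin a (toLin f y) = toLin b (toLin i y)) :
    pushoutSub i f ≤ LinearMap.ker ((toLin a).coprod (toLin b)) := by
  rintro _ ⟨y, rfl⟩
  change toLin a (toLin f y) + toLin b (-toLin i y) = 0
  rw [map_neg, h, add_neg_cancel]

/-- Morphisms out of the pushout. -/
def pushoutDesc {W : BornMod R} (a : Y' ⟶ W) (b : E ⟶ W)
    (h : ∀ y, toLin a (toLin f y) = toLin b (toLin i y)) :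
    pushoutObj i p f s r h1 h2 h3 h4 hs hr ⟶ W :=
  ofLin ((pushoutSub i f).liftQ ((toLin a).coprod (toLin b)) (pushoutSub_le_ker i f a b h)) (by
    have e : ∀ x : (pushoutObj i p f s r h1 h2 h3 h4 hs hr).carrier,
        (pushoutSub i f).liftQ ((toLin a).coprod (toLin b)) (pushoutSub_le_ker i f a b h) x =
        toLin a (pushoutFst i p f s r h1 h2 h3 h4 hs hr x) +
          toLin b (s (pushoutSnd i p f s r h1 h2 h3 h4 hs hr x)) := by
      intro x
      obtain ⟨w, rfl⟩ := (pushoutSub i f).mkQ_surjective x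
      conv_lhs => rw [← pushout_eq i p f s r h4 w]
      rfl
    have hb : Bdd fun x : (pushoutObj i p f s r h1 h2 h3 h4 hs hr).carrier =>
        toLin a (pushoutFst i p f s r h1 h2 h3 h4 hs hr x) +
          toLin b (s (pushoutSnd i p f s r h1 h2 h3 h4 hs hr x)) :=
      ((bdd_toLin a).comp (bdd_pushoutFst i p f s r h1 h2 h3 h4 hs hr)).add
        ((bdd_toLin b).comp (hs.comp (bdd_pushoutSnd i p f s r h1 h2 h3 h4 hs hr)))
    rw [← funext e] at hb
    exact hb)

end Pushout

theorem bdd_inl {X Y : Type*} [Zero Y] [Bornology X] [Bornology Y] :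
    Bdd (fun x : X => (x, (0 : Y))) := fun S hS => by
  refine (hS.prod (isBounded_singleton (x := (0 : Y)))).subset ?_
  rintro _ ⟨x, hx, rfl⟩
  exact ⟨hx, rfl⟩

theorem bdd_inr {X Y : Type*} [Zero X] [Bornology X] [Bornology Y] :
    Bdd (fun y : Y => ((0 : X), y)) := fun S hS => by
  refine ((isBounded_singleton (x := (0 : X))).prod hS).subset ?_
  rintro _ ⟨x, hx, rfl⟩
  exact ⟨rfl, hx⟩

theorem surjective_of_isConflation {Y E Z : BornMod R} {i : Y ⟶ E} {p : E ⟶ Z}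
    (h : HasConflations.IsConflation i p) : Function.Surjective (toLin p) := by
  obtain ⟨s, r, hs, hr, h1, h2, h3, h4⟩ := h
  exact fun z => ⟨s z, h2 z⟩

instance : ExactLike (BornMod R) where
  zero := by
    rintro Y E Z i p ⟨s, r, hs, hr, h1, h2, h3, h4⟩
    exact hom_ext h3
  mono := by
    rintro Y E Z i p ⟨s, r, hs, hr, h1, h2, h3, h4⟩
    refine ⟨fun {W} a b h => hom_ext fun w => ?_⟩
    rw [← h1 (toLin a w), ← h1 (toLin b w), ← comp_apply, ← comp_apply, h]
  epi := by
    rintro Y E Z i p ⟨s, r, hs, hr, h1, h2, h3, h4⟩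
    refine ⟨fun {W} a b h => hom_ext fun z => ?_⟩
    rw [← h2 z, ← comp_apply, ← comp_apply, h]
  lift := by
    rintro Y E Z i p ⟨s, r, hs, hr, h1, h2, h3, h4⟩ W f hf
    have e : ∀ w, toLin i (r (toLin f w)) = toLin f w := by
      intro w
      have h := h4 (toLin f w)
      rwa [← comp_apply f p, hf, show toLin (0 : W ⟶ Z) w = 0 from rfl, map_zero, add_zero] at h
    exact ⟨ofLin
      { toFun w := r (toLin f w)
        map_add' x y := by rw [map_add, map_add]
        map_smul' c x := by
          rw [RingHom.id_apply, map_smul, ← e x, ← map_smul, h1, e] }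
      (Bdd.comp (f := toLin f) hr (bdd_toLin f)), hom_ext e⟩
  desc := by
    rintro Y E Z i p ⟨s, r, hs, hr, h1, h2, h3, h4⟩ W f hf
    have e : ∀ x, toLin f (s (toLin p x)) = toLin f x := by
      intro x
      conv_rhs => rw [← h4 x, map_add, ← comp_apply i f, hf]
      exact (zero_add _).symm
    exact ⟨ofLin
      { toFun z := toLin f (s z)
        map_add' x y := by rw [map_add, map_add]
        map_smul' c z := by
          rw [RingHom.id_apply, ← h2 z, ← map_smul, e, map_smul, h2] }
      ((bdd_toLin f).comp hs), hom_ext e⟩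
  pushout := by
    rintro Y E Z Y' i p ⟨s, r, hs, hr, h1, h2, h3, h4⟩ f
    let mk := pushoutMk i p f s r h1 h2 h3 h4 hs hr
    have hmk : Function.Surjective mk := (pushoutSub i f).mkQ_surjective
    have hbk : Bdd mk := bdd_pushoutMk i p f s r h1 h2 h3 h4 hs hr
    have hsplit : ∀ w : Y'.carrier × E.carrier, mk (w.1, 0) + mk (0, w.2) = mk w := by
      intro w
      rw [← map_add]
      exact congrArg mk (Prod.ext (add_zero _) (zero_add _))
    let i' : Y' ⟶ pushoutObj i p f s r h1 h2 h3 h4 hs hr :=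
      ofLin (mk ∘ₗ LinearMap.inl R _ _) (hbk.comp bdd_inl)
    let t : E ⟶ pushoutObj i p f s r h1 h2 h3 h4 hs hr :=
      ofLin (mk ∘ₗ LinearMap.inr R _ _) (hbk.comp bdd_inr)
    let p' : pushoutObj i p f s r h1 h2 h3 h4 hs hr ⟶ Z :=
      pushoutDesc i p f s r h1 h2 h3 h4 hs hr 0 p fun y => (h3 y).symm
    have hp' : ∀ w, toLin p' (mk w) = toLin p w.2 := fun w => zero_add _
    refine ⟨_, i', p', t,
      ⟨(toLin t).restrictScalars ℂ ∘ₗ s, pushoutFst i p f s r h1 h2 h3 h4 hs hr,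
        (bdd_toLin t).comp hs, bdd_pushoutFst i p f s r h1 h2 h3 h4 hs hr, ?_, ?_, ?_, ?_⟩,
        ?_, ?_, ?_, ?_⟩
    · intro y
      change y + toLin f (r 0) = y
      rw [map_zero, map_zero, add_zero]
    · intro z
      exact (hp' (0, s z)).trans (h2 z)
    · exact fun y => (hp' (y, 0)).trans (map_zero _)
    · intro x
      obtain ⟨w, rfl⟩ := hmk x
      have e0 : toLin t (s (toLin p' (mk w))) = mk (0, s (toLin p w.2)) :=
        congrArg (fun z => mk (0, s z)) (hp' w)
      refine (congrArg (fun z => mk (w.1 + toLin f (r w.2), 0) + z) e0).trans ?_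
      have e1 : ((w.1 + toLin f (r w.2), 0) : Y'.carrier × E.carrier) =
        (w.1, 0) + (toLin f (r w.2), 0) := Prod.ext rfl (add_zero _).symm
      have e : mk (toLin f (r w.2), 0) = mk (0, toLin i (r w.2)) :=
        (pushoutMk_eq i p f s r h1 h2 h3 h4 hs hr _).symm
      rw [e1, map_add, e, add_assoc, ← map_add]
      refine Eq.trans ?_ (hsplit w)
      congr 2
      exact Prod.ext (add_zero _) (h4 w.2)
    · exact hom_ext fun y => pushoutMk_eq i p f s r h1 h2 h3 h4 hs hr y
    · exact hom_ext fun x => hp' (0, x)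
    · intro W a b hab
      refine ⟨pushoutDesc i p f s r h1 h2 h3 h4 hs hr a b fun y => ?_, ?_, ?_⟩
      · rw [← comp_apply, ← comp_apply, hab]
      · refine hom_ext fun y => ?_
        change toLin a y + toLin b 0 = toLin a y
        rw [map_zero, add_zero]
      · refine hom_ext fun y => ?_
        change toLin a 0 + toLin b y = toLin b y
        rw [map_zero, zero_add]
    · intro W c c' ha hb
      refine hom_ext fun x => ?_
      obtain ⟨w, rfl⟩ := hmk x
      rw [← hsplit w, map_add, map_add]
      exact congrArg₂ (· + ·) (congrArg (fun f => toLin f w.1) ha)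
        (congrArg (fun f => toLin f w.2) hb)

end BornMod

/-! ### Fréchet modules with their precompact bornology -/

namespace FrechetMod

open Bornology BornMod

variable {R : Type u} [Ring R] [Algebra ℂ R] [TopologicalSpace R]

theorem isBounded_toBorn {X : FrechetMod R} {S : Set X.toBorn.carrier} :
    IsBounded S ↔ ∃ K : Set X.carrier, IsCompact K ∧ S ⊆ K :=
  isBounded_inCompact_iff (E := X.carrier)

theorem bdd_of_continuous {X Y : FrechetMod R} {f : X.carrier → Y.carrier} (hf : Continuous f) :
    Bdd (X := X.toBorn.carrier) (Y := Y.toBorn.carrier) f := fun S hS => by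
  obtain ⟨K, hK, hSK⟩ := isBounded_toBorn.1 hS
  exact isBounded_toBorn.2 ⟨_, hK.image hf, Set.image_mono hSK⟩

/-- The precompact bornology as a functor. -/
def bornFunctor : FrechetMod R ⥤ BornMod R where
  obj X := X.toBorn
  map {X Y} f := ofLin (X := X.toBorn) (Y := Y.toBorn) (toCLM f).toLinearMap
    (bdd_of_continuous (toCLM f).continuous)

instance : (bornFunctor (R := R)).Additive := ⟨rfl⟩

instance : (bornFunctor (R := R)).Linear ℂ := ⟨fun _ _ => rfl⟩

theorem bornFunctor_conf {Y E Z : FrechetMod R} {i : Y ⟶ E} {p : E ⟶ Z}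
    (h : HasConflations.IsConflation i p) :
    HasConflations.IsConflation (bornFunctor.map i) (bornFunctor.map p) := by
  obtain ⟨s, r, h1, h2, h3, h4⟩ := h
  exact ⟨s.toLinearMap, r.toLinearMap, bdd_of_continuous s.continuous,
    bdd_of_continuous r.continuous, h1, h2, h3, h4⟩

theorem HasDualBasis.bdd {X : FrechetMod R} (h : HasDualBasis R X) {Y : BornMod R}
    (f : X.carrier →ₗ[R] Y.carrier) : Bdd (X := X.toBorn.carrier) f := by
  obtain ⟨n, r, p, hr, hp⟩ := h
  have e : (f : X.toBorn.carrier → Y.carrier) = fun x => ∑ i, r i x • f (p i) := by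
    funext x
    conv_lhs => rw [← hp x, map_sum]
    simp_rw [map_smul]
  rw [e]
  refine Bdd.sum _ fun i _ S hS => ?_
  obtain ⟨K, hK, hSK⟩ := isBounded_toBorn.1 hS
  refine (Y.bounded_action _ _ (hK.image (hr i)) (isBounded_singleton (x := f (p i)))).subset ?_
  rintro _ ⟨x, hx, rfl⟩
  exact ⟨_, ⟨x, hSK hx, rfl⟩, _, rfl, rfl⟩

theorem HasDualBasis.relProjective_born {X : FrechetMod R} (h : HasDualBasis R X) :
    RelProjective X.toBorn := by
  intro Y E Z i p hc f
  obtain ⟨g, hg⟩ := h.exists_lift (toLin p) (BornMod.surjective_of_isConflation hc) (toLin f)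
  exact ⟨ofLin (X := X.toBorn) g (h.bdd g), BornMod.hom_ext fun x => DFunLike.congr_fun hg x⟩

end FrechetMod

/-! ### Projective modules induced from the point -/

section Projective

open CrossedMod OrbitCompletion
open scoped MvPowerSeries.WithPiTopology

variable {G : Type u} [Group G] [Finite G] {A : Type u} [CommRing A] [Algebra ℂ A]
  [MulSemiringAction G A] [SMulCommClass G ℂ A] (m : A →ₐ[ℂ] ℂ)
  {U : Type u} [AddCommGroup U] [Module ℂ U] [FiniteDimensional ℂ U]
  (ρ : Representation ℂ (isotropy G m) U)

/-- The module `U ⊗ C` for the completion `C` at the point. -/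
abbrev localMod : CrossedMod (isotropy G m) (OrbitCompletion G m) where
  carrier := Coef (LocalCompletion m G) U
  ρ := coefRep (LocalCompletion m G) ρ
  act :=
    { toFun := fun b => opMap (LinearMap.mulLeft ℂ (toLocal m G b)) LinearMap.id
      map_one' := LinearMap.ext fun f => LinearMap.ext fun ξ => by
        change toLocal m G 1 * f ξ = f ξ
        rw [map_one, one_mul]
      map_mul' := fun b c => LinearMap.ext fun f => LinearMap.ext fun ξ => by
        change toLocal m G (b * c) * f ξ = toLocal m G b * (toLocal m G c * f ξ)
        rw [map_mul, mul_assoc]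
      map_zero' := LinearMap.ext fun f => LinearMap.ext fun ξ => by
        change toLocal m G 0 * f ξ = 0
        rw [map_zero, zero_mul]
      map_add' := fun b c => LinearMap.ext fun f => LinearMap.ext fun ξ => by
        change toLocal m G (b + c) * f ξ = toLocal m G b * f ξ + toLocal m G c * f ξ
        rw [map_add, add_mul]
      commutes' := fun a => LinearMap.ext fun f => LinearMap.ext fun ξ => by
        change toLocal m G (algebraMap ℂ _ a) * f ξ = a • f ξ
        rw [AlgHom.commutes, Algebra.smul_def] }
  compat h b f := LinearMap.ext fun ξ => by
    change h • (toLocal m G b * f (ξ ∘ₗ ρ h)) = toLocal m G ((h : G) • b) * h • f (ξ ∘ₗ ρ h)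
    rw [smul_mul']
    exact congrArg (· * _) (toLocal_smul h b).symm

theorem localMod_act_apply (b : OrbitCompletion G m) (f : Coef (LocalCompletion m G) U)
    (ξ : Module.Dual ℂ U) : (localMod m ρ).act b f ξ = toLocal m G b * f ξ := rfl

theorem localMod_act_pure (b : OrbitCompletion G m) (c : LocalCompletion m G) (u : U) :
    (localMod m ρ).act b (Coef.pure c u) = Coef.pure (toLocal m G b * c) u :=
  opMap_pure _ _ _ _

variable [IsNoetherianRing A] [hreg : IsRegularLocalRing (Localization.AtPrime (RingHom.ker m))]

/-- The coordinates of an element of the coinduced module as a family of power series. -/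
def coindEmb : Coind (localMod m ρ) →ₗ[ℂ]
    (G → Fin (Module.finrank ℂ U) → (CoordIndex m →₀ ℕ) → ℂ) where
  toFun φ g i := (chart m G).symm (φ g ((Module.finBasis ℂ U).coord i))
  map_add' _ _ := funext fun _ => funext fun _ => map_add (chart m G).symm _ _
  map_smul' _ _ := funext fun _ => funext fun _ => map_smul (chart m G).symm _ _

/-- The family of coefficient functions with given coordinates. -/
def ofCoords (a : G → Fin (Module.finrank ℂ U) → (CoordIndex m →₀ ℕ) → ℂ) (g : G) :
    Coef (LocalCompletion m G) U :=
  ∑ i, Coef.pure (chart m G (show MvPowerSeries (CoordIndex m) ℂ from a g i))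
    (Module.finBasis ℂ U i)

theorem ofCoords_apply (a : G → Fin (Module.finrank ℂ U) → (CoordIndex m →₀ ℕ) → ℂ) (g : G)
    (ξ : Module.Dual ℂ U) : ofCoords m a g ξ = ∑ i, ξ (Module.finBasis ℂ U i) •
      chart m G (show MvPowerSeries (CoordIndex m) ℂ from a g i) := by
  rw [ofCoords, LinearMap.sum_apply]; rfl

theorem ofCoords_coord (a : G → Fin (Module.finrank ℂ U) → (CoordIndex m →₀ ℕ) → ℂ) (g : G)
    (i : Fin (Module.finrank ℂ U)) : ofCoords m a g ((Module.finBasis ℂ U).coord i) =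
      chart m G (show MvPowerSeries (CoordIndex m) ℂ from a g i) := by
  rw [ofCoords_apply, Finset.sum_eq_single i]
  · rw [Module.Basis.coord_apply, Module.Basis.repr_self, Finsupp.single_eq_same, one_smul]
  · intro j _ hj
    rw [Module.Basis.coord_apply, Module.Basis.repr_self, Finsupp.single_eq_of_ne hj.symm,
      zero_smul]
  · intro h; exact absurd (Finset.mem_univ _) h

theorem ofCoords_coindEmb (φ : Coind (localMod m ρ)) (g : G) :
    ofCoords m (coindEmb m ρ φ) g = φ g := by
  have h : ∀ i, chart m G (show MvPowerSeries (CoordIndex m) ℂ from coindEmb m ρ φ g i) =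
      φ g ((Module.finBasis ℂ U).coord i) := fun i => (chart m G).apply_symm_apply _
  rw [ofCoords]
  simp_rw [h]
  exact Coef.sum_pure _ _

theorem coindEmb_injective : Function.Injective (coindEmb m ρ) := fun φ ψ h =>
  Coind.ext fun g => by rw [← ofCoords_coindEmb m ρ φ, h, ofCoords_coindEmb]

theorem continuous_ofCoords (g : G) (ξ : Module.Dual ℂ U) :
    Continuous fun a : G → Fin (Module.finrank ℂ U) → (CoordIndex m →₀ ℕ) → ℂ =>
      ofCoords m a g ξ := by
  have : ContinuousAdd (LocalCompletion m G) := continuousAdd_local m G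
  have : ContinuousSMul ℂ (LocalCompletion m G) := continuousSMul_local m G
  simp_rw [ofCoords_apply]
  refine continuous_finsetSum _ fun i _ => Continuous.fun_const_smul ?_ _
  exact (continuous_chart m G).comp ((continuous_apply i).comp (continuous_apply g))

theorem continuous_coindEmb_iff {Z : Type*} [TopologicalSpace Z] {f : Z → Coind (localMod m ρ)} :
    Continuous (fun z => coindEmb m ρ (f z)) ↔ ∀ g ξ, Continuous fun z => f z g ξ := by
  constructor
  · intro h g ξ
    have e : ∀ z, f z g ξ = ofCoords m (coindEmb m ρ (f z)) g ξ := fun z => by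
      rw [ofCoords_coindEmb]
    exact (continuous_congr e).2 ((continuous_ofCoords m g ξ).comp h)
  · intro h
    refine continuous_pi fun g => continuous_pi fun i => ?_
    exact (continuous_chart_symm m G).comp (h g _)

theorem t2Space_local : T2Space (LocalCompletion m G) := by
  exact Topology.IsEmbedding.t2Space
    ⟨isInducing_chart_symm m G, (chart m G).symm.injective⟩

theorem isClosed_range_coindEmb : IsClosed (Set.range (coindEmb m ρ)) := by
  have : T2Space (LocalCompletion m G) := t2Space_local m
  have h : Set.range (coindEmb m ρ) = ⋂ (g : G) (h : isotropy G m) (ξ : Module.Dual ℂ U),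
      {a | ofCoords m a (g * h) ξ = h⁻¹ • ofCoords m a g (ξ ∘ₗ ρ h⁻¹)} := by
    ext a
    simp only [Set.mem_range, Set.mem_iInter, Set.mem_ofPred_eq]
    constructor
    · rintro ⟨φ, rfl⟩ g h ξ
      rw [ofCoords_coindEmb, ofCoords_coindEmb, φ.apply_mul]
      rfl
    · intro ha
      let φ : Coind (localMod m ρ) := ⟨ofCoords m a, fun g h => LinearMap.ext fun ξ => ha g h ξ⟩
      refine ⟨φ, funext fun g => funext fun i => ?_⟩
      change (chart m G).symm (ofCoords m a g ((Module.finBasis ℂ U).coord i)) = _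
      rw [ofCoords_coord]
      exact (chart m G).symm_apply_apply _
  rw [h]
  refine isClosed_iInter fun g => isClosed_iInter fun h => isClosed_iInter fun ξ => ?_
  exact isClosed_eq (continuous_ofCoords m _ _)
    ((continuous_smul_completion m h⁻¹).comp (continuous_ofCoords m _ _))

/-- The Fréchet module induced from `U ⊗ C`. -/
def projMod : FrechetMod (SkewMonoidAlgebra (OrbitCompletion G m) G) :=
  FrechetMod.ofClosedRange (coindEmb m ρ) (coindEmb_injective m ρ) (isClosed_range_coindEmb m ρ)
    (by
      let _ : TopologicalSpace (Coind (localMod m ρ)) := .induced (coindEmb m ρ) inferInstance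
      have : ContinuousAdd (LocalCompletion m G) := continuousAdd_local m G
      have : ContinuousMul (LocalCompletion m G) := continuousMul_local m G
      let _ := Fintype.ofFinite G
      have hc : ∀ (g : G) (ξ : Module.Dual ℂ U),
          Continuous fun φ : Coind (localMod m ρ) => φ g ξ :=
        (continuous_coindEmb_iff m ρ (f := fun φ => φ)).1 continuous_induced_dom
      rw [continuous_coindEmb_iff]
      intro y ξ
      have e : ∀ q : SkewMonoidAlgebra (OrbitCompletion G m) G × Coind (localMod m ρ),
          (q.1 • q.2) y ξ = ∑ k, toLocal m G (y⁻¹ • q.1.coeff k) * q.2 (k⁻¹ * y) ξ := by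
        intro q
        rw [Coind.crossed_smul_apply, LinearMap.sum_apply]; rfl
      refine (continuous_congr e).2 (continuous_finsetSum _ fun k _ => Continuous.mul ?_ ?_)
      · have hk : Continuous fun r : SkewMonoidAlgebra (OrbitCompletion G m) G => r.coeff k :=
          continuous_iff_le_induced.2 (iInf_le _ k)
        exact continuous_toLocal.comp ((continuous_smul_completion m y⁻¹).comp
          (hk.comp continuous_fst))
      · exact (hc _ _).comp continuous_snd)

/-- The elements of the induced module as functions. -/
def projFun : (projMod m ρ).carrier →ₗ[SkewMonoidAlgebra (OrbitCompletion G m) G]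
    Coind (localMod m ρ) := LinearMap.id

/-- Functions as elements of the induced module. -/
def projOf : Coind (localMod m ρ) →ₗ[SkewMonoidAlgebra (OrbitCompletion G m) G]
    (projMod m ρ).carrier := LinearMap.id

theorem projOf_projFun (φ : (projMod m ρ).carrier) : projOf m ρ (projFun m ρ φ) = φ := rfl

theorem isInducing_coindEmb :
    Topology.IsInducing fun φ : (projMod m ρ).carrier => coindEmb m ρ (projFun m ρ φ) := ⟨rfl⟩

theorem continuous_projMod_iff {Z : Type*} [TopologicalSpace Z] {f : Z → (projMod m ρ).carrier} :
    Continuous f ↔ ∀ g ξ, Continuous fun z => projFun m ρ (f z) g ξ := by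
  rw [(isInducing_coindEmb m ρ).continuous_iff]
  exact continuous_coindEmb_iff m ρ

theorem continuous_projFun (g : G) (ξ : Module.Dual ℂ U) :
    Continuous fun φ : (projMod m ρ).carrier => projFun m ρ φ g ξ :=
  (continuous_projMod_iff m ρ (f := fun φ => φ)).1 continuous_id g ξ

/-- The generator of the induced module given by a vector. -/
def gen (u : U) : (projMod m ρ).carrier :=
  projOf m ρ (Coind.extend (N := localMod m ρ) (Coef.pure (1 : LocalCompletion m G) u))

/-- The coordinate of the induced module given by a linear form. -/
def projCoord (ξ : Module.Dual ℂ U) : (projMod m ρ).carrier →ₗ[SkewMonoidAlgebra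
    (OrbitCompletion G m) G] SkewMonoidAlgebra (OrbitCompletion G m) G :=
  Coind.coord (N := localMod m ρ) (extendLocal m G ∘ₗ LinearMap.applyₗ ξ)
    (fun _ _ => extendLocal_mul _ _) ∘ₗ projFun m ρ

theorem continuous_projCoord (ξ : Module.Dual ℂ U) : Continuous (projCoord m ρ ξ) := by
  refine continuous_iInf_rng.2 fun g => continuous_induced_rng.2 ?_
  have : ContinuousSMul ℂ (LocalCompletion m G) := continuousSMul_local m G
  have e : ∀ φ : (projMod m ρ).carrier, (projCoord m ρ ξ φ).coeff g =
      g • extendLocal m G ((Fintype.card (isotropy G m) : ℂ)⁻¹ • projFun m ρ φ g ξ) := fun φ =>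
    Coind.coeff_coord (N := localMod m ρ) (extendLocal m G ∘ₗ LinearMap.applyₗ ξ)
      (fun _ _ => extendLocal_mul _ _) (projFun m ρ φ) g
  refine (continuous_congr e).2 ((continuous_smul_completion m g).comp
    (continuous_extendLocal.comp ?_))
  exact (continuous_projFun m ρ g ξ).fun_const_smul _

theorem sum_projCoord_smul_gen (φ : (projMod m ρ).carrier) :
    ∑ i, projCoord m ρ ((Module.finBasis ℂ U).coord i) φ • gen m ρ (Module.finBasis ℂ U i) =
      φ := by
  have h := Coind.sum_coord_smul_extend (N := localMod m ρ)
    (fun i => extendLocal m G ∘ₗ LinearMap.applyₗ ((Module.finBasis ℂ U).coord i))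
    (fun i _ _ => extendLocal_mul _ _)
    (fun i => Coef.pure (1 : LocalCompletion m G) (Module.finBasis ℂ U i)) (fun f => by
      refine (Finset.sum_congr rfl fun i _ => ?_).trans (Coef.sum_pure (Module.finBasis ℂ U) f)
      rw [localMod_act_pure, mul_one]
      exact congrArg (fun z => Coef.pure z _) (toLocal_extendLocal _)) (projFun m ρ φ)
  have h' := congrArg (projOf m ρ) h
  rw [map_sum, projOf_projFun] at h'
  refine Eq.trans (Finset.sum_congr rfl fun i _ => ?_) h'
  rw [map_smul]; rfl

theorem projMod_hasDualBasis :
    FrechetMod.HasDualBasis (SkewMonoidAlgebra (OrbitCompletion G m) G) (projMod m ρ) :=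
  ⟨_, fun _ => projCoord m ρ _, fun _ => gen m ρ _, fun _ => continuous_projCoord m ρ _,
    sum_projCoord_smul_gen m ρ⟩

end Projective

/-! ### Koszul resolutions of induced modules -/

section EvalContinuous

variable {C : Type*} [AddCommGroup C] [Module ℂ C] [TopologicalSpace C]
  {U U' U'' : Type*} [AddCommGroup U] [Module ℂ U] [AddCommGroup U'] [Module ℂ U']
  [AddCommGroup U''] [Module ℂ U'']

/-- Linear maps of coefficient spaces that are continuous for pointwise convergence. -/
def EvalContinuous (T : Coef C U →ₗ[ℂ] Coef C U') : Prop :=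
  ∀ (Z : Type u) [TopologicalSpace Z] (f : Z → Coef C U), (∀ ξ, Continuous fun z => f z ξ) →
    ∀ ξ, Continuous fun z => T (f z) ξ

theorem EvalContinuous.opMap {T : C →ₗ[ℂ] C} (hT : Continuous T) (α : U →ₗ[ℂ] U') :
    EvalContinuous.{u} (opMap T α) := fun _ _ _ hf ξ => hT.comp (hf (ξ ∘ₗ α))

theorem EvalContinuous.comp {T : Coef C U' →ₗ[ℂ] Coef C U''} {S : Coef C U →ₗ[ℂ] Coef C U'}
    (hT : EvalContinuous.{u} T) (hS : EvalContinuous.{u} S) : EvalContinuous.{u} (T ∘ₗ S) :=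
  fun Z _ f hf => hT Z (fun z => S (f z)) (hS Z f hf)

theorem EvalContinuous.sum [ContinuousAdd C] {ι : Type*} [Fintype ι]
    {T : ι → Coef C U →ₗ[ℂ] Coef C U'} (hT : ∀ i, EvalContinuous.{u} (T i)) :
    EvalContinuous.{u} (∑ i, T i) := fun Z _ f hf ξ => by
  have e : ∀ z, (∑ i, T i) (f z) ξ = ∑ i, T i (f z) ξ := fun z => by
    rw [LinearMap.sum_apply, LinearMap.sum_apply]
  exact (continuous_congr e).2 (continuous_finsetSum _ fun i _ => hT i Z f hf ξ)

theorem EvalContinuous.smul [ContinuousSMul ℂ C] (c : ℂ) {T : Coef C U →ₗ[ℂ] Coef C U'}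
    (hT : EvalContinuous.{u} T) : EvalContinuous.{u} (c • T) := fun Z _ f hf ξ =>
  (hT Z f hf ξ).fun_const_smul c

end EvalContinuous

section Models

open CrossedMod OrbitCompletion FrechetMod

variable {G : Type u} [Group G] [Finite G] {A : Type u} [CommRing A] [Algebra ℂ A]
  [MulSemiringAction G A] [SMulCommClass G ℂ A] {m : A →ₐ[ℂ] ℂ}
  [IsNoetherianRing A] [hreg : IsRegularLocalRing (Localization.AtPrime (RingHom.ker m))]
  {U U' : Type u} [AddCommGroup U] [Module ℂ U] [FiniteDimensional ℂ U]
  [AddCommGroup U'] [Module ℂ U'] [FiniteDimensional ℂ U']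
  {ρ : Representation ℂ (isotropy G m) U} {ρ' : Representation ℂ (isotropy G m) U'}

variable (ρ ρ') in
/-- Linear maps of coefficient spaces that commute with the action of the isotropy group. -/
def CoefEquivariant (T : Coef (LocalCompletion m G) U →ₗ[ℂ] Coef (LocalCompletion m G) U') :
    Prop := ∀ h, T ∘ₗ coefRep (LocalCompletion m G) ρ h = coefRep (LocalCompletion m G) ρ' h ∘ₗ T

/-- Linear maps of coefficient spaces that are linear over the completion. -/
def CoefLinear (T : Coef (LocalCompletion m G) U →ₗ[ℂ] Coef (LocalCompletion m G) U') : Prop :=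
  ∀ c f, T (opMap (LinearMap.mulLeft ℂ c) LinearMap.id f) =
    opMap (LinearMap.mulLeft ℂ c) LinearMap.id (T f)

theorem CoefLinear.opMap (α : U →ₗ[ℂ] U') :
    CoefLinear (m := m) (G := G) (opMap LinearMap.id α) := fun _ _ => rfl

theorem CoefEquivariant.opMap {α : U →ₗ[ℂ] U'} (h : ∀ g, α ∘ₗ ρ g = ρ' g ∘ₗ α) :
    CoefEquivariant ρ ρ' (opMap LinearMap.id α) := fun g => LinearMap.ext fun f =>
  LinearMap.ext fun ξ => by
    change g • f (ξ ∘ₗ (α ∘ₗ ρ g)) = g • f (ξ ∘ₗ (ρ' g ∘ₗ α))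
    rw [h]

/-- The continuous linear map induced by an equivariant map. -/
def projMapC (T : Coef (LocalCompletion m G) U →ₗ[ℂ] Coef (LocalCompletion m G) U')
    (hT : CoefEquivariant ρ ρ' T) (hc : EvalContinuous.{u} T) :
    (projMod m ρ).carrier →L[ℂ] (projMod m ρ').carrier where
  toLinearMap := ((projOf m ρ').restrictScalars ℂ) ∘ₗ
    Coind.map (N := localMod m ρ) (N' := localMod m ρ') T hT ∘ₗ ((projFun m ρ).restrictScalars ℂ)
  cont := (continuous_projMod_iff m ρ').2 fun g =>
    hc _ (fun φ => projFun m ρ φ g) (continuous_projFun m ρ g)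

/-- The morphism induced by an equivariant homomorphism. -/
def projMap (T : Coef (LocalCompletion m G) U →ₗ[ℂ] Coef (LocalCompletion m G) U')
    (hT : CoefEquivariant ρ ρ' T) (hl : CoefLinear T) : projMod m ρ ⟶ projMod m ρ' :=
  ofCLM ⟨projOf m ρ' ∘ₗ Coind.lmap (N := localMod m ρ) (N' := localMod m ρ') T hT
    (fun b f => hl (toLocal m G b) f) ∘ₗ projFun m ρ, (projMod_hasDualBasis m ρ).continuous _⟩

theorem projMap_apply (T : Coef (LocalCompletion m G) U →ₗ[ℂ] Coef (LocalCompletion m G) U')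
    (hT : CoefEquivariant ρ ρ' T) (hl : CoefLinear T) (φ : (projMod m ρ).carrier) (g : G) :
    projFun m ρ' (toCLM (projMap T hT hl) φ) g = T (projFun m ρ φ g) := rfl

theorem projFun_ext {φ ψ : (projMod m ρ).carrier}
    (h : ∀ g, projFun m ρ φ g = projFun m ρ ψ g) : φ = ψ := Coind.ext h

variable (G m) in
/-- The module `V_m` over the completed crossed product of the isotropy group. -/
abbrev pointMod (V : FinDimRep (isotropy G m)) : CrossedMod (isotropy G m) (OrbitCompletion G m) :=
  charMod (evalPoint G m) (evalPoint_smul G m) V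

theorem comp_coefEval_coefRep {V : FinDimRep (isotropy G m)} (α : U →ₗ[ℂ] V.carrier)
    (hα : ∀ h, α ∘ₗ ρ h = V.ρ h ∘ₗ α) (h : isotropy G m) :
    (α ∘ₗ coefEval (evalPoint (isotropy G m) m).toLinearMap) ∘ₗ
        coefRep (LocalCompletion m G) ρ h =
      V.ρ h ∘ₗ α ∘ₗ coefEval (evalPoint (isotropy G m) m).toLinearMap :=
  LinearMap.ext fun f => by
    have e := coefEval_opMap (evalPoint (isotropy G m) m).toLinearMap
      (evalPoint (isotropy G m) m).toLinearMap
      (DistribMulAction.toModuleEnd ℂ (LocalCompletion m G) h)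
      (LinearMap.ext fun c => evalPoint_smul (isotropy G m) m ⟨h, fun f => h.2 f⟩ c) (ρ h) f
    exact (congrArg α e).trans (LinearMap.congr_fun (hα h) _)

/-- The evaluation at the point, followed by an equivariant map. -/
def evalMap {V : FinDimRep (isotropy G m)} (α : U →ₗ[ℂ] V.carrier)
    (hα : ∀ h, α ∘ₗ ρ h = V.ρ h ∘ₗ α) :
    (projMod m ρ).carrier →ₗ[SkewMonoidAlgebra (OrbitCompletion G m) G] Coind (pointMod G m V) :=
  Coind.lmap (N := localMod m ρ) (N' := pointMod G m V)
    (α ∘ₗ coefEval (evalPoint (isotropy G m) m).toLinearMap)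
    (comp_coefEval_coefRep α hα)
    (fun b f => by
      have e : coefEval (evalPoint (isotropy G m) m).toLinearMap ((localMod m ρ).act b f) =
          evalPoint G m b • coefEval (evalPoint (isotropy G m) m).toLinearMap f :=
        dual_ext fun ξ => by
          rw [map_smul, dual_coefEval, dual_coefEval, localMod_act_apply]
          refine (map_mul (evalPoint (isotropy G m) m) _ _).trans ?_
          rw [evalPoint_toLocal]; rfl
      refine (congrArg α e).trans (map_smul α _ _)) ∘ₗ projFun m ρ

theorem evalMap_apply {V : FinDimRep (isotropy G m)} (α : U →ₗ[ℂ] V.carrier)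
    (hα : ∀ h, α ∘ₗ ρ h = V.ρ h ∘ₗ α) (φ : (projMod m ρ).carrier) (g : G) :
    evalMap α hα φ g = α (coefEval (evalPoint (isotropy G m) m).toLinearMap (projFun m ρ φ g)) :=
  rfl

theorem projMod_hom_ext {X : Type*} [AddCommGroup X]
    [Module (SkewMonoidAlgebra (OrbitCompletion G m) G) X]
    {f f' : (projMod m ρ).carrier →ₗ[SkewMonoidAlgebra (OrbitCompletion G m) G] X}
    (h : ∀ u, f (gen m ρ u) = f' (gen m ρ u)) : f = f' := LinearMap.ext fun φ => by
  rw [← sum_projCoord_smul_gen m ρ φ, map_sum, map_sum]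
  simp_rw [map_smul, h]

theorem single_smul_gen (h : isotropy G m) (u : U) :
    SkewMonoidAlgebra.single (h : G) (1 : OrbitCompletion G m) • gen m ρ u = gen m ρ (ρ h u) := by
  have e := Coind.single_smul_extend (N := localMod m ρ) h (Coef.pure (1 : LocalCompletion m G) u)
  have e2 : coefRep (LocalCompletion m G) ρ h (Coef.pure 1 u) = Coef.pure 1 (ρ h u) :=
    (opMap_pure _ _ _ _).trans (congrArg (fun c => Coef.pure c (ρ h u)) (smul_one h))
  have e3 := congrArg (projOf m ρ) e
  rw [map_smul] at e3
  refine e3.trans (congrArg (fun f => projOf m ρ (Coind.extend f)) e2)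

theorem extendLocal_smul_gen (c : LocalCompletion m G) (u : U) :
    SkewMonoidAlgebra.single (1 : G) (extendLocal m G c) • gen m ρ u =
      projOf m ρ (Coind.extend (N := localMod m ρ) (Coef.pure c u)) := by
  have e := congrArg (projOf m ρ) (Coind.single_one_smul_extend (N := localMod m ρ)
    (extendLocal m G c) (Coef.pure (1 : LocalCompletion m G) u))
  rw [map_smul] at e
  refine e.trans ?_
  rw [localMod_act_pure, toLocal_extendLocal, mul_one]

theorem evalMap_gen {V : FinDimRep (isotropy G m)} (α : U →ₗ[ℂ] V.carrier)
    (hα : ∀ h, α ∘ₗ ρ h = V.ρ h ∘ₗ α) (u : U) :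
    evalMap α hα (gen m ρ u) = Coind.extend (N := pointMod G m V) (α u) := by
  refine (Coind.map_extend (N := localMod m ρ) (N' := pointMod G m V) _
    (comp_coefEval_coefRep α hα) _).trans ?_
  refine congrArg (fun v => Coind.extend (N := pointMod G m V) (α v)) ?_
  refine (coefEval_pure _ _ _).trans ?_
  exact (congrArg (· • u) (map_one (evalPoint (isotropy G m) m))).trans (one_smul _ _)

theorem exists_evalMap {V : FinDimRep (isotropy G m)} (f : (projMod m ρ).carrier →ₗ[SkewMonoidAlgebra
    (OrbitCompletion G m) G] Coind (pointMod G m V)) :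
    ∃ (α : U →ₗ[ℂ] V.carrier) (hα : ∀ h, α ∘ₗ ρ h = V.ρ h ∘ₗ α), f = evalMap α hα := by
  let γ : U →ₗ[ℂ] (projMod m ρ).carrier := ((projOf m ρ).restrictScalars ℂ) ∘ₗ
    Coind.extend (N := localMod m ρ) ∘ₗ Coef.pure 1
  let α : U →ₗ[ℂ] V.carrier :=
    Coind.ev (N := pointMod G m V) 1 ∘ₗ (f.restrictScalars ℂ) ∘ₗ γ
  have hf : ∀ u, f (gen m ρ u) = Coind.extend (N := pointMod G m V) (α u) := by
    intro u
    refine Coind.ext fun g => ?_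
    by_cases hg : g ∈ isotropy G m
    · have h1 := (f (gen m ρ u)).apply_mul 1 ⟨g, hg⟩
      rw [one_mul] at h1
      exact h1.trans (Coind.extend_apply_mem (N := pointMod G m V) (α u) ⟨g, hg⟩).symm
    · rw [Coind.extend_apply_notMem _ hg]
      have h1 : f (gen m ρ u) = SkewMonoidAlgebra.single (1 : G) (extendLocal m G 1) •
          f (gen m ρ u) := by
        rw [← map_smul, extendLocal_smul_gen]; rfl
      rw [h1, Coind.single_smul]
      refine (charMod_act _ _ V _ _).trans ?_
      rw [evalPoint_smul_extendLocal 1 fun h => hg (inv_inv g ▸ (isotropy G m).inv_mem h)]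
      exact zero_smul ℂ _
  have hα : ∀ h, α ∘ₗ ρ h = V.ρ h ∘ₗ α := fun h => LinearMap.ext fun u => by
    have h1 : f (gen m ρ (ρ h u)) = SkewMonoidAlgebra.single (h : G) (1 : OrbitCompletion G m) •
        f (gen m ρ u) := by rw [← map_smul, single_smul_gen]
    rw [hf u, Coind.single_smul_extend] at h1
    exact (congrArg (fun φ : Coind (pointMod G m V) => φ 1) h1).trans
      (Coind.extend_apply_one (N := pointMod G m V) _)
  refine ⟨α, hα, projMod_hom_ext fun u => ?_⟩
  rw [hf, evalMap_gen]

end Models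

section Average

variable {H : Type*} [Group H] [Fintype H] {N₀ N₁ N₂ : Type*} [AddCommGroup N₀] [Module ℂ N₀]
  [AddCommGroup N₁] [Module ℂ N₁] [AddCommGroup N₂] [Module ℂ N₂] {ρ₀ : Representation ℂ H N₀}
  {ρ₁ : Representation ℂ H N₁} {ρ₂ : Representation ℂ H N₂}

theorem average_homotopy {D : N₁ →ₗ[ℂ] N₀} {S : N₀ →ₗ[ℂ] N₁} {E : N₀ →ₗ[ℂ] N₀}
    (hD : ∀ h, D ∘ₗ ρ₁ h = ρ₀ h ∘ₗ D) (hE : average ρ₀ ρ₀ E = E) (h : D ∘ₗ S + E = LinearMap.id) :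
    D ∘ₗ average ρ₀ ρ₁ S + E = LinearMap.id := by
  rw [comp_average _ _ _ _ _ hD, ← hE, ← average_add, h]
  exact average_eq_self _ _ _ fun _ => rfl

theorem average_homotopy_succ {D : N₁ →ₗ[ℂ] N₀} {S : N₀ →ₗ[ℂ] N₁} {D' : N₂ →ₗ[ℂ] N₁}
    {S' : N₁ →ₗ[ℂ] N₂} (hD : ∀ h, D ∘ₗ ρ₁ h = ρ₀ h ∘ₗ D) (hD' : ∀ h, D' ∘ₗ ρ₂ h = ρ₁ h ∘ₗ D')
    (h : D' ∘ₗ S' + S ∘ₗ D = LinearMap.id) :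
    D' ∘ₗ average ρ₁ ρ₂ S' + average ρ₀ ρ₁ S ∘ₗ D = LinearMap.id := by
  rw [comp_average _ _ _ _ _ hD', average_comp _ _ _ _ _ hD, ← average_add, h]
  exact average_eq_self _ _ _ fun _ => rfl

end Average

theorem koszulD_mulLeft {C : Type*} [CommRing C] [Algebra ℂ C] {W : Type u} [AddCommGroup W]
    [Module ℂ W] {κ : Type*} [Fintype κ] [DecidableEq κ] (t : Module.Basis κ ℂ W) (x : W →ₗ[ℂ] C)
    (V : Type u) [AddCommGroup V] [Module ℂ V] (k : ℕ) (c : C) :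
    koszulD t x V k ∘ₗ opMap (LinearMap.mulLeft ℂ c) LinearMap.id =
      opMap (LinearMap.mulLeft ℂ c) LinearMap.id ∘ₗ koszulD t x V k := by
  unfold koszulD
  exact mulSum_comp_opMap _ _ _ (fun _ _ => mul_left_comm _ _ _) _ _ _ _ fun _ => rfl

theorem pure_coefEval {C : Type*} [CommRing C] [Algebra ℂ C] {U : Type*} [AddCommGroup U]
    [Module ℂ U] [FiniteDimensional ℂ U] (ε : C →ₐ[ℂ] ℂ) (f : Coef C U) :
    Coef.pure 1 (coefEval ε.toLinearMap f) =
      opMap (Algebra.linearMap ℂ C ∘ₗ ε.toLinearMap) LinearMap.id f :=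
  LinearMap.ext fun ξ => by
    rw [Coef.pure_apply, dual_coefEval, opMap_apply]
    exact (Algebra.algebraMap_eq_smul_one _).symm

section Resolutions

open CrossedMod OrbitCompletion FrechetMod

variable {G : Type u} [Group G] [Finite G] {A : Type u} [CommRing A] [Algebra ℂ A]
  [MulSemiringAction G A] [SMulCommClass G ℂ A] (m : A →ₐ[ℂ] ℂ)

variable (G) in
/-- Fréchet modules isomorphic to the module induced from a representation. -/
structure IndModel where
  V : FinDimRep (isotropy G m)
  X : FrechetMod (SkewMonoidAlgebra (OrbitCompletion G m) G)
  e : X.carrier ≃ₗ[SkewMonoidAlgebra (OrbitCompletion G m) G] Coind (pointMod G m V)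

variable {m}

instance (V : FinDimRep (isotropy G m)) : FiniteDimensional ℂ (Coind (pointMod G m V)) :=
  inferInstanceAs (FiniteDimensional ℂ (pointMod G m V).coindSub)

instance (M : IndModel G m) : FiniteDimensional ℂ M.X.carrier :=
  Module.Finite.equiv (M.e.restrictScalars ℂ).symm

variable [IsNoetherianRing A] [hreg : IsRegularLocalRing (Localization.AtPrime (RingHom.ker m))]

/-- The representations on `V ⊗ ⋀ᵏ T*`. -/
abbrev extRep (V : FinDimRep (isotropy G m)) (k : ℕ) :
    Representation ℂ (isotropy G m) (V.carrier ⊗[ℂ] ⋀[ℂ]^k (Cotan m)) :=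
  V.ρ.tprod (extPowerRep (cotanRep G m) k)

section Koszul

variable (V : FinDimRep (isotropy G m)) (k : ℕ)

/-- The Koszul differential at the point. -/
abbrev pointD : Coef (LocalCompletion m G) (V.carrier ⊗[ℂ] ⋀[ℂ]^(k + 1) (Cotan m)) →ₗ[ℂ]
    Coef (LocalCompletion m G) (V.carrier ⊗[ℂ] ⋀[ℂ]^k (Cotan m)) :=
  koszulD (cotanBasis m) (formalCoord m G) V.carrier k

theorem pointD_equivariant : CoefEquivariant (extRep V (k + 1)) (extRep V k) (pointD V k) :=
  koszulD_equivariant (cotanBasis m) (formalCoord m G) (cotanRep G m) (formalCoord_cotanRep m G)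
    V.ρ k

theorem pointD_linear : CoefLinear (pointD V k) := fun c f =>
  LinearMap.congr_fun (koszulD_mulLeft (cotanBasis m) (formalCoord m G) V.carrier k c) f

/-- The Koszul differential of the induced modules. -/
def koszulHom : projMod m (extRep V (k + 1)) ⟶ projMod m (extRep V k) :=
  projMap (pointD V k) (pointD_equivariant V k) (pointD_linear V k)

theorem coefEval_pointD (f : Coef (LocalCompletion m G)
    (V.carrier ⊗[ℂ] ⋀[ℂ]^(k + 1) (Cotan m))) :
    coefEval (evalPoint (isotropy G m) m).toLinearMap (pointD V k f) = 0 :=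
  dual_ext fun ξ => by
    rw [dual_coefEval, pointD, koszulD, mulSum, LinearMap.sum_apply, LinearMap.sum_apply, map_sum,
      map_zero]
    refine Finset.sum_eq_zero fun i _ => ?_
    rw [opMap_apply]
    change evalPoint (isotropy G m) m (formalCoord m G _ * _) = 0
    rw [map_mul, evalPoint_formalCoord, zero_mul]

/-- The equivariant contraction of the Koszul complex. -/
def pointS : Coef (LocalCompletion m G) (V.carrier ⊗[ℂ] ⋀[ℂ]^k (Cotan m)) →ₗ[ℂ]
    Coef (LocalCompletion m G) (V.carrier ⊗[ℂ] ⋀[ℂ]^(k + 1) (Cotan m)) :=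
  average (coefRep _ (extRep V k)) (coefRep _ (extRep V (k + 1)))
    (koszulS (cotanBasis m) V.carrier (localEuler m G) k)

theorem pointS_equivariant : CoefEquivariant (extRep V k) (extRep V (k + 1)) (pointS V k) :=
  average_equivariant _ _ _

theorem evalContinuous_coefRep {U : Type u} [AddCommGroup U] [Module ℂ U]
    (ρ : Representation ℂ (isotropy G m) U) (h : isotropy G m) :
    EvalContinuous.{u} (coefRep (LocalCompletion m G) ρ h) :=
  EvalContinuous.opMap (continuous_smul_completion m h) _

theorem pointS_continuous : EvalContinuous.{u} (pointS V k) := by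
  have : ContinuousAdd (LocalCompletion m G) := continuousAdd_local m G
  have : ContinuousSMul ℂ (LocalCompletion m G) := continuousSMul_local m G
  refine EvalContinuous.smul _ (EvalContinuous.sum fun h => (evalContinuous_coefRep _ _).comp
    (EvalContinuous.comp (EvalContinuous.sum fun j => EvalContinuous.opMap ?_ _)
      (evalContinuous_coefRep _ _)))
  exact (continuous_localEuler_D m G j).comp (continuous_localEuler_Q m G k)

theorem pointD_pointS : pointD V (k + 1) ∘ₗ pointS V (k + 1) + pointS V k ∘ₗ pointD V k =
    LinearMap.id :=
  average_homotopy_succ (pointD_equivariant V k) (pointD_equivariant V (k + 1))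
    (koszul_homotopy (cotanBasis m) V.carrier (localEuler m G) k)

/-- The constant coefficient functions. -/
def pointUnit : V.carrier →ₗ[ℂ] Coef (LocalCompletion m G) (V.carrier ⊗[ℂ] ⋀[ℂ]^0 (Cotan m)) :=
  Coef.pure 1 ∘ₗ (evZero (Cotan m) V.carrier).symm.toLinearMap

theorem evZero_comp (h : isotropy G m) :
    (evZero (Cotan m) V.carrier).toLinearMap ∘ₗ extRep V 0 h =
      V.ρ h ∘ₗ (evZero (Cotan m) V.carrier).toLinearMap :=
  LinearMap.ext fun x => evZero_equivariant (cotanRep G m) V.ρ h x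

theorem pointUnit_equivariant (h : isotropy G m) :
    pointUnit V ∘ₗ V.ρ h = coefRep (LocalCompletion m G) (extRep V 0) h ∘ₗ pointUnit V :=
  LinearMap.ext fun v => by
    have e : coefRep (LocalCompletion m G) (extRep V 0) h (pointUnit V v) =
        Coef.pure (h • 1) (extRep V 0 h ((evZero (Cotan m) V.carrier).symm v)) :=
      opMap_pure _ _ _ _
    refine Eq.trans ?_ e.symm
    rw [smul_one]
    change Coef.pure 1 _ = _
    congr 1
    rw [LinearEquiv.coe_coe, LinearEquiv.symm_apply_eq]
    refine Eq.trans ?_ (evZero_equivariant (cotanRep G m) V.ρ h _).symm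
    rw [LinearEquiv.apply_symm_apply]

theorem coefEval_pointUnit (v : V.carrier) :
    evZero (Cotan m) V.carrier (coefEval (evalPoint (isotropy G m) m).toLinearMap
      (pointUnit V v)) = v := by
  have e : coefEval (evalPoint (isotropy G m) m).toLinearMap (pointUnit V v) =
      evalPoint (isotropy G m) m 1 • (evZero (Cotan m) V.carrier).symm v := coefEval_pure _ _ _
  rw [e, map_one, one_smul, LinearEquiv.apply_symm_apply]

theorem pointUnit_evZero (f : Coef (LocalCompletion m G) (V.carrier ⊗[ℂ] ⋀[ℂ]^0 (Cotan m))) :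
    pointUnit V (evZero (Cotan m) V.carrier
      (coefEval (evalPoint (isotropy G m) m).toLinearMap f)) =
    opMap (Algebra.linearMap ℂ (LocalCompletion m G) ∘ₗ
      (evalPoint (isotropy G m) m).toLinearMap) LinearMap.id f :=
  (congrArg (Coef.pure 1) (LinearEquiv.symm_apply_apply _ _)).trans (pure_coefEval _ _)

theorem constant_equivariant {U : Type u} [AddCommGroup U] [Module ℂ U]
    (ρ : Representation ℂ (isotropy G m) U) (h : isotropy G m) :
    opMap (Algebra.linearMap ℂ (LocalCompletion m G) ∘ₗ
        (evalPoint (isotropy G m) m).toLinearMap) LinearMap.id ∘ₗ coefRep _ ρ h =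
      coefRep (LocalCompletion m G) ρ h ∘ₗ opMap (Algebra.linearMap ℂ (LocalCompletion m G) ∘ₗ
        (evalPoint (isotropy G m) m).toLinearMap) LinearMap.id :=
  LinearMap.ext fun f => LinearMap.ext fun ξ => by
    change algebraMap ℂ (LocalCompletion m G) (evalPoint (isotropy G m) m (h • f (ξ ∘ₗ ρ h))) =
      h • algebraMap ℂ (LocalCompletion m G) (evalPoint (isotropy G m) m (f (ξ ∘ₗ ρ h)))
    rw [smul_algebraMap]
    exact congrArg _ (evalPoint_smul (isotropy G m) m ⟨h, fun f => h.2 f⟩ _)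

theorem pointD_pointS_zero
    (f : Coef (LocalCompletion m G) (V.carrier ⊗[ℂ] ⋀[ℂ]^0 (Cotan m))) :
    pointD V 0 (pointS V 0 f) + pointUnit V (evZero (Cotan m) V.carrier
      (coefEval (evalPoint (isotropy G m) m).toLinearMap f)) = f :=
  (congrArg (pointD V 0 (pointS V 0 f) + ·) (pointUnit_evZero V f)).trans
    (LinearMap.congr_fun (average_homotopy (pointD_equivariant V 0)
      (average_eq_self _ _ _ (constant_equivariant (extRep V 0)))
      (koszul_homotopy_zero (cotanBasis m) V.carrier (localEuler m G))) f)

end Koszul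

namespace IndModel

variable (M : IndModel G m)

/-- Morphisms out of an induced module. -/
def homOf {Y : FrechetMod (SkewMonoidAlgebra (OrbitCompletion G m) G)}
    (f : M.X.carrier →ₗ[SkewMonoidAlgebra (OrbitCompletion G m) G] Y.carrier) : M.X ⟶ Y :=
  ofCLM ⟨f, LinearMap.continuous_of_finiteDimensional (f.restrictScalars ℂ)⟩

variable {U : Type u} [AddCommGroup U] [Module ℂ U] [FiniteDimensional ℂ U]
  {ρ : Representation ℂ (isotropy G m) U}

/-- Morphisms from the projective modules to an induced module. -/
def evalHom (α : U →ₗ[ℂ] M.V.carrier) (hα : ∀ h, α ∘ₗ ρ h = M.V.ρ h ∘ₗ α) : projMod m ρ ⟶ M.X :=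
  ofCLM ⟨M.e.symm.toLinearMap ∘ₗ evalMap α hα, (projMod_hasDualBasis m ρ).continuous _⟩

theorem e_evalHom (α : U →ₗ[ℂ] M.V.carrier) (hα : ∀ h, α ∘ₗ ρ h = M.V.ρ h ∘ₗ α)
    (φ : (projMod m ρ).carrier) : M.e (toCLM (M.evalHom α hα) φ) = evalMap α hα φ :=
  M.e.apply_symm_apply _

theorem exists_evalHom (f : projMod m ρ ⟶ M.X) :
    ∃ (α : U →ₗ[ℂ] M.V.carrier) (hα : ∀ h, α ∘ₗ ρ h = M.V.ρ h ∘ₗ α), f = M.evalHom α hα := by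
  obtain ⟨α, hα, h⟩ := exists_evalMap (M.e.toLinearMap ∘ₗ (toCLM f).toLinearMap)
  refine ⟨α, hα, FrechetMod.hom_ext fun φ => M.e.injective ?_⟩
  rw [e_evalHom, ← h]; rfl

theorem evalHom_injective {α β : U →ₗ[ℂ] M.V.carrier} {hα : ∀ h, α ∘ₗ ρ h = M.V.ρ h ∘ₗ α}
    {hβ : ∀ h, β ∘ₗ ρ h = M.V.ρ h ∘ₗ β} (h : M.evalHom α hα = M.evalHom β hβ) : α = β := by
  refine LinearMap.ext fun u => ?_
  have h1 := congrArg (fun f => M.e (toCLM f (gen m ρ u)) 1) h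
  simp only [e_evalHom, evalMap_gen] at h1
  exact (Coind.extend_apply_one (N := pointMod G m M.V) _).symm.trans
    (h1.trans (Coind.extend_apply_one (N := pointMod G m M.V) _))

theorem koszulHom_evalHom (V : FinDimRep (isotropy G m)) (k : ℕ) (f : projMod m (extRep V k) ⟶ M.X) :
    koszulHom V k ≫ f = 0 := by
  obtain ⟨α, hα, rfl⟩ := M.exists_evalHom f
  refine FrechetMod.hom_ext fun φ => M.e.injective ?_
  rw [FrechetMod.comp_apply, e_evalHom]
  refine Eq.trans (Coind.ext fun g => ?_) (map_zero M.e).symm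
  rw [evalMap_apply, koszulHom, projMap_apply, coefEval_pointD]
  exact map_zero α

/-- The terms of the resolution of an induced module. -/
def Q : ℕ → FrechetMod (SkewMonoidAlgebra (OrbitCompletion G m) G)
  | 0 => M.X
  | k + 1 => projMod m (extRep M.V k)

/-- The augmentation of the resolution. -/
def aug : projMod m (extRep M.V 0) ⟶ M.X :=
  M.evalHom (evZero (Cotan m) M.V.carrier).toLinearMap (evZero_comp M.V)

/-- The linear section of the augmentation. -/
def augSection : M.X.carrier →L[ℂ] (projMod m (extRep M.V 0)).carrier where
  toLinearMap := ((projOf m (extRep M.V 0)).restrictScalars ℂ) ∘ₗ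
    Coind.map (N := pointMod G m M.V) (N' := localMod m (extRep M.V 0)) (pointUnit M.V)
      (pointUnit_equivariant M.V) ∘ₗ (M.e.toLinearMap.restrictScalars ℂ)
  cont := LinearMap.continuous_of_finiteDimensional _

theorem projFun_augSection (x : M.X.carrier) (g : G) :
    projFun m (extRep M.V 0) (M.augSection x) g = pointUnit M.V (M.e x g) := rfl

theorem aug_augSection (x : M.X.carrier) : toCLM M.aug (M.augSection x) = x := by
  refine M.e.injective (Coind.ext fun g => ?_)
  rw [aug, e_evalHom, evalMap_apply, projFun_augSection]
  exact coefEval_pointUnit _ _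

theorem e_aug (x : (projMod m (extRep M.V 0)).carrier) (g : G) :
    M.e (toCLM M.aug x) g = evZero (Cotan m) M.V.carrier
      (coefEval (evalPoint (isotropy G m) m).toLinearMap (projFun m (extRep M.V 0) x g)) := by
  rw [aug, e_evalHom, evalMap_apply]; rfl

/-- The contractible Koszul complex of an induced module. -/
def complex : ContractedComplex (SkewMonoidAlgebra (OrbitCompletion G m) G) where
  Q := M.Q
  d
    | 0 => M.aug
    | k + 1 => koszulHom M.V k
  s
    | 0 => M.augSection
    | k + 1 => projMapC (pointS M.V k) (pointS_equivariant M.V k) (pointS_continuous M.V k)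
  d_d
    | 0, x => congrArg (fun f => toCLM f x) (M.koszulHom_evalHom M.V 0 M.aug)
    | k + 1, x => projFun_ext fun g =>
      LinearMap.congr_fun (koszulD_comp (cotanBasis m) (formalCoord m G) M.V.carrier k)
        (projFun m (extRep M.V (k + 2)) x g)
  d_s_zero := M.aug_augSection
  d_s
    | 0, x => projFun_ext fun g =>
      (congrArg (fun v => pointD M.V 0 (pointS M.V 0 (projFun m (extRep M.V 0) x g)) +
        pointUnit M.V v) (M.e_aug x g)).trans
        (pointD_pointS_zero M.V (projFun m (extRep M.V 0) x g))
    | k + 1, x => projFun_ext fun g =>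
      LinearMap.congr_fun (pointD_pointS M.V k) (projFun m (extRep M.V (k + 1)) x g)

theorem complex_isProjective : M.complex.resn.IsProjective :=
  M.complex.resn_isProjective fun _ => projMod_hasDualBasis m _

end IndModel

end Resolutions

namespace Resn

variable {C : Type u} [Category.{v} C] [HasConflations C] [Preadditive C] [ExactLike C]

/-- A chain map of resolutions induces maps of the syzygies. -/
theorem Hom.exists_ofChain {R S : Resn C} (hR : R.IsProjective) (hS : S.IsProjective)
    (t : ∀ k, R.P k ⟶ S.P k)
    (ht : ∀ k, R.p (k + 1) ≫ R.i k ≫ t k = t (k + 1) ≫ S.p (k + 1) ≫ S.i k) :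
    ∃ F : Hom R S, F.t = t := by
  have h0 : ∀ k, R.i k ≫ t k ≫ S.p k = 0 := fun k => by
    have := ExactLike.epi (hR.conf (k + 1))
    rw [← cancel_epi (R.p (k + 1)), ← Category.assoc, ← Category.assoc, Category.assoc (R.p (k + 1)),
      ht, Category.assoc, Category.assoc, ExactLike.zero (hS.conf k), Limits.comp_zero,
      Limits.comp_zero, Limits.comp_zero]
  choose l hl using fun k => ExactLike.desc (hR.conf k) (t k ≫ S.p k) (h0 k)
  refine ⟨⟨l, t, fun k => ?_, hl⟩, rfl⟩
  have := ExactLike.epi (hR.conf (k + 1))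
  rw [← cancel_epi (R.p (k + 1)), ht, ← Category.assoc (R.p (k + 1)), hl, Category.assoc]

end Resn

/-- A chain map from a truncation of a contracted complex. -/
theorem FrechetMod.ContractedComplex.exists_hom {R : Type u} [Ring R] [Algebra ℂ R]
    [TopologicalSpace R] {D D' : ContractedComplex R} (h : D.resn.IsProjective)
    (h' : D'.resn.IsProjective) {p : ℕ} (t : ∀ k, D.Q (p + k + 1) ⟶ D'.Q (k + 1))
    (ht : ∀ k, D.d (p + k + 1) ≫ t k = t (k + 1) ≫ D'.d (k + 1)) :
    ∃ F : Resn.Hom (D.resn.shift p) D'.resn, ∀ k, F.t k = t k := by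
  obtain ⟨F, hF⟩ := Resn.Hom.exists_ofChain (h.shift p) h' t fun k => ht k
  exact ⟨F, fun k => congrFun hF k⟩

section System

open CrossedMod OrbitCompletion FrechetMod

variable {G : Type u} [Group G] [Finite G] {A : Type u} [CommRing A] [Algebra ℂ A]
  [MulSemiringAction G A] [SMulCommClass G ℂ A] {m : A →ₐ[ℂ] ℂ}

theorem actDeg_intertwines {V V' : FinDimRep (isotropy G m)} {p : ℕ} (α : tangentHom m V V' p)
    {k n : ℕ} (h : p + k = n) (g : isotropy G m) :
    actDeg (Cotan m) V.carrier V'.carrier p k n h α.1 ∘ₗ extRep V n g =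
      extRep V' k g ∘ₗ actDeg (Cotan m) V.carrier V'.carrier p k n h α.1 := by
  have e : (V.ρ.linHom V'.ρ).tprod (extPowerRep (cotanRep G m).dual p) g α.1 = α.1 := α.2 g
  exact (actDeg_equivariant (cotanRep G m) V.ρ V'.ρ h α.1 g |>.trans
    (congrArg (fun z => actDeg (Cotan m) V.carrier V'.carrier p k n h z ∘ₗ extRep V n g) e)).symm

variable [IsNoetherianRing A] [hreg : IsRegularLocalRing (Localization.AtPrime (RingHom.ker m))]

theorem actZero_intertwines {V V' : FinDimRep (isotropy G m)} {p : ℕ} (α : tangentHom m V V' p)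
    (g : isotropy G m) :
    actZero (Cotan m) V.carrier V'.carrier p α.1 ∘ₗ extRep V p g =
      V'.ρ g ∘ₗ actZero (Cotan m) V.carrier V'.carrier p α.1 :=
  (mem_invariants_iff_actZero (cotanRep G m) V.ρ V'.ρ α.1).1 α.2 g

/-- The action of an invariant on the terms of Koszul complexes. -/
def actHom {V V' : FinDimRep (isotropy G m)} {p : ℕ} (α : tangentHom m V V' p) (k n : ℕ)
    (h : p + k = n) : projMod m (extRep V n) ⟶ projMod m (extRep V' k) :=
  projMap (opMap LinearMap.id (actDeg (Cotan m) V.carrier V'.carrier p k n h α.1))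
    (CoefEquivariant.opMap (actDeg_intertwines α h)) (CoefLinear.opMap _)

theorem koszulHom_actHom {V V' : FinDimRep (isotropy G m)} {p : ℕ} (α : tangentHom m V V' p)
    (k n : ℕ) (h : p + k = n) (h' : p + (k + 1) = n + 1) :
    koszulHom V n ≫ actHom α k n h = actHom α (k + 1) (n + 1) h' ≫ koszulHom V' k :=
  FrechetMod.hom_ext fun φ => projFun_ext fun g =>
    (LinearMap.congr_fun (koszulD_opMap_actDeg (cotanBasis m) (formalCoord m G) h h' α.1)
      (projFun m (extRep V (n + 1)) φ g)).symm

namespace IndModel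

theorem projMap_evalHom (M : IndModel G m) {U U' : Type u} [AddCommGroup U] [Module ℂ U]
    [FiniteDimensional ℂ U] [AddCommGroup U'] [Module ℂ U'] [FiniteDimensional ℂ U']
    {ρ : Representation ℂ (isotropy G m) U} {ρ' : Representation ℂ (isotropy G m) U'}
    {α : U →ₗ[ℂ] U'} (hα : CoefEquivariant ρ ρ' (opMap LinearMap.id α))
    (hl : CoefLinear (opMap LinearMap.id α)) (β : U' →ₗ[ℂ] M.V.carrier)
    (hβ : ∀ h, β ∘ₗ ρ' h = M.V.ρ h ∘ₗ β) (γ : U →ₗ[ℂ] M.V.carrier)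
    (hγ : ∀ h, γ ∘ₗ ρ h = M.V.ρ h ∘ₗ γ) (e : γ = β ∘ₗ α) :
    projMap _ hα hl ≫ M.evalHom β hβ = M.evalHom γ hγ :=
  FrechetMod.hom_ext fun φ => M.e.injective (by
    rw [FrechetMod.comp_apply, e_evalHom, e_evalHom]
    refine Coind.ext fun g => ?_
    rw [evalMap_apply, evalMap_apply, projMap_apply, e]
    exact congrArg β (coefEval_opMap _ _ _ (LinearMap.comp_id _) α _))

variable (M M' : IndModel G m)

/-- The morphism from a term of the resolution given by an invariant. -/
def evalAct {V : FinDimRep (isotropy G m)} {M' : IndModel G m} {n : ℕ}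
    (α : tangentHom m V M'.V n) : projMod m (extRep V n) ⟶ M'.X :=
  M'.evalHom (actZero (Cotan m) V.carrier M'.V.carrier n α.1) (actZero_intertwines α)

section Linear

variable {V : FinDimRep (isotropy G m)} {n : ℕ}

theorem e_evalAct (α : tangentHom m V M'.V n) (φ : (projMod m (extRep V n)).carrier) (g : G) :
    M'.e (toCLM (evalAct α) φ) g = actZero (Cotan m) V.carrier M'.V.carrier n α.1
      (coefEval (evalPoint (isotropy G m) m).toLinearMap (projFun m (extRep V n) φ g)) := by
  rw [evalAct, e_evalHom, evalMap_apply]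

theorem evalAct_add (α β : tangentHom m V M'.V n) :
    evalAct (α + β) = evalAct α + evalAct β :=
  FrechetMod.hom_ext fun φ => M'.e.injective (Coind.ext fun g =>
    (e_evalAct M' (α + β) φ g).trans (by
      change _ = M'.e (toCLM (evalAct α) φ + toCLM (evalAct β) φ) g
      rw [map_add]
      refine Eq.trans ?_ (congrArg₂ (· + ·) (e_evalAct M' α φ g) (e_evalAct M' β φ g)).symm
      exact LinearMap.congr_fun (map_add (actZero (Cotan m) V.carrier M'.V.carrier n) α.1 β.1) _))

theorem evalAct_smul (c : ℂ) (α : tangentHom m V M'.V n) :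
    evalAct (c • α) = c • evalAct α :=
  FrechetMod.hom_ext fun φ => M'.e.injective (Coind.ext fun g =>
    (e_evalAct M' (c • α) φ g).trans (by
      change _ = (M'.e.toLinearMap.restrictScalars ℂ) (c • toCLM (evalAct α) φ) g
      rw [map_smul]
      refine Eq.trans ?_ (congrArg (c • ·) (e_evalAct M' α φ g)).symm
      exact LinearMap.congr_fun (map_smul (actZero (Cotan m) V.carrier M'.V.carrier n) c α.1) _))

end Linear

section Syzygies

variable {M M'}

theorem exists_lift {p : ℕ} (α : tangentHom m M.V M'.V p) :
    ∃ F : Resn.Hom (M.complex.resn.shift p) M'.complex.resn,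
      ∀ k, F.t k = actHom α k (p + k) rfl :=
  ContractedComplex.exists_hom M.complex_isProjective M'.complex_isProjective
    (fun k => actHom α k (p + k) rfl) (fun k => koszulHom_actHom α k (p + k) rfl rfl)

/-- The lift of an invariant to the resolutions. -/
def liftHom {p : ℕ} (α : tangentHom m M.V M'.V p) :
    Resn.Hom (M.complex.resn.shift p) M'.complex.resn := (exists_lift α).choose

theorem liftHom_t {p : ℕ} (α : tangentHom m M.V M'.V p) (k : ℕ) :
    (liftHom α).t k = actHom α k (p + k) rfl := (exists_lift α).choose_spec k

/-- The morphism from a syzygy given by an invariant. -/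
def syzygyFun {n : ℕ} (α : tangentHom m M.V M'.V n) : M.complex.resn.Ω n ⟶ M'.X :=
  (liftHom α).l 0

theorem p_syzygyFun {p : ℕ} (α : tangentHom m M.V M'.V p) :
    M.complex.resn.p p ≫ syzygyFun α = evalAct α :=
  ((liftHom α).comm_p 0).trans ((congrArg (· ≫ M'.aug) (liftHom_t α 0)).trans
    (projMap_evalHom M' _ _ _ _ _ _ rfl))

variable (M) in
theorem epi_p (n : ℕ) : Epi (M.complex.resn.p n) :=
  ExactLike.epi (M.complex_isProjective.conf n)

theorem minimal {k : ℕ} (f : M.complex.resn.P k ⟶ M'.X) : M.complex.resn.i k ≫ f = 0 := by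
  have := M.epi_p (k + 1)
  rw [← cancel_epi (M.complex.resn.p (k + 1)), Limits.comp_zero]
  exact M'.koszulHom_evalHom M.V k f

theorem ext_p {n : ℕ} {f g : M.complex.resn.Ω n ⟶ M'.X}
    (h : M.complex.resn.p n ≫ f = M.complex.resn.p n ≫ g) : f = g := by
  have := M.epi_p n
  exact (cancel_epi _).1 h

end Syzygies

/-- The morphisms from a syzygy to an induced module given by invariants. -/
def syzygyMap (n : ℕ) : tangentHom m M.V M'.V n →ₗ[ℂ] (M.complex.resn.Ω n ⟶ M'.X) where
  toFun α := syzygyFun α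
  map_add' α β := ext_p ((p_syzygyFun _).trans (((evalAct_add M' α β).trans
      (congrArg₂ (· + ·) (p_syzygyFun α).symm (p_syzygyFun β).symm)).trans
      (Preadditive.comp_add _ _ _ _ _ _).symm))
  map_smul' c α := ext_p ((p_syzygyFun _).trans (((evalAct_smul M' c α).trans
      (congrArg (c • ·) (p_syzygyFun α).symm)).trans (Linear.comp_smul _ _ _ _ _ _).symm))

theorem evalAct_injective {V : FinDimRep (isotropy G m)} {M' : IndModel G m} {n : ℕ} {α β : tangentHom m V M'.V n}
    (h : evalAct α = evalAct β) : α = β :=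
  Subtype.ext ((actZero_bijective n).1 (M'.evalHom_injective h))

theorem syzygyMap_bijective (n : ℕ) : Function.Bijective (syzygyMap M M' n) := by
  refine ⟨fun α β h => evalAct_injective ?_, fun f => ?_⟩
  · exact (p_syzygyFun α).symm.trans ((congrArg (M.complex.resn.p n ≫ ·) h).trans (p_syzygyFun β))
  · obtain ⟨γ, hγ, h⟩ := M'.exists_evalHom (M.complex.resn.p n ≫ f : projMod m (extRep M.V n) ⟶ M'.X)
    obtain ⟨x, hx⟩ := (actZero_bijective (W := Cotan m) n).2 γ
    subst hx
    refine ⟨⟨x, (mem_invariants_iff_actZero (cotanRep G m) M.V.ρ M'.V.ρ x).2 hγ⟩, ext_p ?_⟩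
    exact (p_syzygyFun _).trans h.symm

variable (G m) in
/-- The minimal resolutions of the induced modules. -/
def system : MinimalSystem (FrechetMod (SkewMonoidAlgebra (OrbitCompletion G m) G)) (IndModel G m)
    (fun M M' n => tangentHom m M.V M'.V n) where
  R M := M.complex.resn
  φ {M M' n} := LinearEquiv.ofBijective (syzygyMap M M' n) (syzygyMap_bijective M M' n)
  lift α := liftHom α
  lift_zero _ := rfl
  minimal f := minimal f

theorem system_isProjective (M : IndModel G m) : ((system G m).R M).IsProjective :=
  M.complex_isProjective

theorem p_φ {M M' : IndModel G m} {n : ℕ} (α : tangentHom m M.V M'.V n) :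
    M.complex.resn.p n ≫ (system G m).φ (i := M) (j := M') α = evalAct α := p_syzygyFun α

theorem gradedMul_mem {V V' V'' : FinDimRep (isotropy G m)} {p q n : ℕ} (h : p + q = n)
    (α : tangentHom m V V' p) (β : tangentHom m V' V'' q) :
    gradedMul (Tan m) V.carrier V'.carrier V''.carrier q p n h β.1 α.1 ∈ tangentHom m V V'' n := by
  refine (mem_invariants_iff_actZero (cotanRep G m) V.ρ V''.ρ _).2 fun g => ?_
  subst h
  have e : actZero (Cotan m) V.carrier V''.carrier (p + q) (gradedMul (Tan m) V.carrier V'.carrier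
      V''.carrier q p (p + q) rfl β.1 α.1) = actZero (Cotan m) V'.carrier V''.carrier q β.1 ∘ₗ
      actDeg (Cotan m) V.carrier V'.carrier p q (p + q) rfl α.1 :=
    congrArg ((evZero (Cotan m) V''.carrier).toLinearMap ∘ₗ ·)
      (actDeg_gradedMul rfl rfl rfl rfl β.1 α.1)
  rw [e, LinearMap.comp_assoc]
  refine (congrArg (actZero (Cotan m) V'.carrier V''.carrier q β.1 ∘ₗ ·)
    (actDeg_intertwines α rfl g)).trans ?_
  exact congrArg (· ∘ₗ actDeg (Cotan m) V.carrier V'.carrier p q (p + q) rfl α.1)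
    (actZero_intertwines β g)

theorem system_mul {M M' M'' : IndModel G m} {p q n : ℕ} (h : p + q = n)
    (α : tangentHom m M.V M'.V p) (β : tangentHom m M'.V M''.V q) :
    (system G m).mul (i := M) (j := M') (k := M'') h α β =
      ⟨gradedMul (Tan m) _ _ _ q p n h β.1 α.1, gradedMul_mem h α β⟩ := by
  subst h
  refine ((system G m).φ (i := M) (j := M'')).symm_apply_eq.2 (ext_p ?_)
  refine Eq.trans ?_ (p_φ _).symm
  change M.complex.resn.p (p + q) ≫ (liftHom α).l q ≫ (system G m).φ (i := M') (j := M'') β = _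
  refine (Category.assoc (M.complex.resn.p (p + q)) ((liftHom α).l q :) _).symm.trans
    ((congrArg (· ≫ (system G m).φ (i := M') (j := M'') β) ((liftHom α).comm_p q)).trans
    ((Category.assoc _ _ _).trans ?_))
  refine (congrArg₂ (· ≫ ·) (liftHom_t α q) (p_φ β)).trans ?_
  exact projMap_evalHom M'' _ _ _ _ _ _ (congrArg ((evZero (Cotan m) M''.V.carrier).toLinearMap ∘ₗ ·)
      (actDeg_gradedMul rfl rfl rfl rfl β.1 α.1))

section Sum

variable (M : IndModel G m)

/-- The representation `V ⊕ V`. -/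
def double (V : FinDimRep (isotropy G m)) : FinDimRep (isotropy G m) where
  carrier := V.carrier × V.carrier
  ρ := V.ρ.prod V.ρ

/-- The induced module of `V ⊕ V`. -/
def doubleEquiv (V : FinDimRep (isotropy G m)) :
    (Coind (pointMod G m V) × Coind (pointMod G m V)) ≃ₗ[SkewMonoidAlgebra (OrbitCompletion G m) G]
      Coind (pointMod G m (double V)) where
  toLinearMap := (Coind.lmap (N := pointMod G m V) (N' := pointMod G m (double V))
      (LinearMap.inl ℂ _ _) (fun _ => LinearMap.ext fun _ =>
        Prod.ext rfl (map_zero (V.ρ _)).symm) (fun _ _ => Prod.ext rfl (smul_zero _).symm)).coprod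
    (Coind.lmap (N := pointMod G m V) (N' := pointMod G m (double V))
      (LinearMap.inr ℂ _ _) (fun _ => LinearMap.ext fun _ =>
        Prod.ext (map_zero (V.ρ _)).symm rfl) (fun _ _ => Prod.ext (smul_zero _).symm rfl))
  invFun := (Coind.lmap (N := pointMod G m (double V)) (N' := pointMod G m V)
      (LinearMap.fst ℂ _ _) (fun _ => rfl) (fun _ _ => rfl)).prod
    (Coind.lmap (N := pointMod G m (double V)) (N' := pointMod G m V)
      (LinearMap.snd ℂ _ _) (fun _ => rfl) (fun _ _ => rfl))
  left_inv x := Prod.ext (Coind.ext fun g => add_zero (x.1 g)) (Coind.ext fun g => zero_add (x.2 g))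
  right_inv x := Coind.ext fun g => Prod.ext (add_zero (x g).1) (zero_add (x g).2)

/-- The direct sum of two copies of an induced module. -/
def sum : IndModel G m where
  V := double M.V
  X := { carrier := M.X.carrier × M.X.carrier }
  e := (LinearEquiv.prodCongr M.e M.e).trans (doubleEquiv M.V)

/-- The direct sum of two copies of an induced module is a biproduct. -/
def sumBicone : Limits.BinaryBicone M.X M.X where
  pt := M.sum.X
  fst := ofCLM (ContinuousLinearMap.fst _ _ _)
  snd := ofCLM (ContinuousLinearMap.snd _ _ _)
  inl := ofCLM (ContinuousLinearMap.inl _ _ _)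
  inr := ofCLM (ContinuousLinearMap.inr _ _ _)
  inl_fst := rfl
  inl_snd := rfl
  inr_fst := rfl
  inr_snd := rfl

theorem sumBicone_total : M.sumBicone.fst ≫ M.sumBicone.inl + M.sumBicone.snd ≫ M.sumBicone.inr =
    𝟙 M.sumBicone.pt :=
  FrechetMod.hom_ext fun x => Prod.ext (add_zero x.1) (zero_add x.2)

theorem exists_sum (M : IndModel G m) : ∃ (M' : IndModel G m) (b : Limits.BinaryBicone M.X M.X)
    (_ : b.IsBilimit), b.pt = M'.X :=
  ⟨M.sum, M.sumBicone, Limits.isBinaryBilimitOfTotal _ M.sumBicone_total, rfl⟩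

end Sum

variable (G m) in
/-- The induced module of a representation. -/
def ofRep (V : FinDimRep (isotropy G m)) : IndModel G m where
  V := V
  X := indFrechet m V
  e := (exists_indRep_equiv (evalPoint G m) (evalPoint_smul G m) V).choose

variable (G m) in
/-- The module induced from the point. -/
def ofPoint : IndModel G m where
  V := regularRep (isotropy G m)
  X := indCharFrechet G m
  e := (exists_indRegular_equiv (evalPoint G m) (evalPoint_smul G m)).some.symm.trans
    (exists_indRep_equiv (evalPoint G m) (evalPoint_smul G m) (regularRep (isotropy G m))).choose

end IndModel

end System

/-! ### Transport of minimal systems along functors -/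

section Transport

universe v₁ u₁

variable {C : Type u} [Category.{v} C] {C' : Type u₁} [Category.{v₁} C']

/-- The image of a resolution under a functor. -/
def Resn.mapF (U : C ⥤ C') (R : Resn C) : Resn C' where
  Ω k := U.obj (R.Ω k)
  P k := U.obj (R.P k)
  i k := U.map (R.i k)
  p k := U.map (R.p k)

/-- The image of a morphism of resolutions under a functor. -/
def Resn.Hom.mapF (U : C ⥤ C') {R S : Resn C} (F : Resn.Hom R S) :
    Resn.Hom (R.mapF U) (S.mapF U) where
  l k := U.map (F.l k)
  t k := U.map (F.t k)
  comm_i k := by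
    change U.map (R.i k) ≫ U.map (F.t k) = U.map (F.l (k + 1)) ≫ U.map (S.i k)
    rw [← U.map_comp, F.comm_i, U.map_comp]
  comm_p k := by
    change U.map (R.p k) ≫ U.map (F.l k) = U.map (F.t k) ≫ U.map (S.p k)
    rw [← U.map_comp, F.comm_p, U.map_comp]

namespace MinimalSystem

variable [Preadditive C] [Linear ℂ C] [Preadditive C'] [Linear ℂ C']
  {I : Type*} {T : I → I → ℕ → Type w} [∀ i j n, AddCommGroup (T i j n)]
  [∀ i j n, Module ℂ (T i j n)] (D : MinimalSystem C I T) [HasConflations C] [ExactLike C]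
  (hD : ∀ i, (D.R i).IsProjective) (U : C ⥤ C') [U.Additive] [U.Linear ℂ] [U.Faithful]
  (hU : ∀ i j k (f : U.obj ((D.R i).P k) ⟶ U.obj ((D.R j).Ω 0)), ∃ f', U.map f' = f)
  (hp : ∀ i k, Epi (U.map ((D.R i).p k)))

include hD hU hp in
theorem map_surjective {i j : I} {n : ℕ} (f : U.obj ((D.R i).Ω n) ⟶ U.obj ((D.R j).Ω 0)) :
    ∃ f', U.map f' = f := by
  obtain ⟨f', hf⟩ := hU _ _ _ (U.map ((D.R i).p n) ≫ f)
  obtain ⟨g, rfl⟩ := ExactLike.desc ((hD i).conf n) f' (D.minimal f')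
  have := hp i n
  exact ⟨g, by rwa [U.map_comp, cancel_epi] at hf⟩

/-- The image of a minimal system under a functor. -/
def mapF : MinimalSystem C' I T where
  R i := (D.R i).mapF U
  φ {i j n} := D.φ.trans (LinearEquiv.ofBijective (U.mapLinearMap ℂ)
    ⟨U.map_injective, D.map_surjective hD U hU hp⟩)
  lift α := (D.lift α).mapF U
  lift_zero α := congrArg U.map (D.lift_zero α)
  minimal {i j k} f := by
    obtain ⟨f', rfl⟩ := hU _ _ _ f
    change U.map ((D.R i).i k) ≫ U.map f' = 0
    rw [← U.map_comp, D.minimal, U.map_zero]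

theorem mul_mapF {i j k : I} {p q n : ℕ} (h : p + q = n) (α : T i j p) (β : T j k q) :
    (D.mapF hD U hU hp).mul (i := i) (j := j) (k := k) h α β = D.mul h α β := by
  subst h
  refine (D.mapF hD U hU hp).φ.symm_apply_eq.2 ?_
  refine (U.map_comp _ _).symm.trans (congrArg U.map ?_)
  exact (D.φ.apply_symm_apply _).symm

end MinimalSystem

end Transport

/-! ### The systems of bornological modules and of abstract modules -/

section Functors

open FrechetMod

variable {R : Type u} [Ring R] [Algebra ℂ R] [TopologicalSpace R]

instance : (bornFunctor (R := R)).Faithful where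
  map_injective h := FrechetMod.hom_ext fun x => congrArg (fun f => BornMod.toLin f x) h

/-- The underlying module of a Fréchet module, restricted along a homomorphism. -/
def FrechetMod.moduleFunctor {S : Type u} [Ring S] [Algebra ℂ S] (j : S →ₐ[ℂ] R) :
    FrechetMod R ⥤ ModuleCat.{u} S where
  obj X := (ModuleCat.restrictScalars j.toRingHom).obj (ModuleCat.of R X.carrier)
  map f := (ModuleCat.restrictScalars j.toRingHom).map (ModuleCat.ofHom (toCLM f).toLinearMap)

variable {S : Type u} [Ring S] [Algebra ℂ S] (j : S →ₐ[ℂ] R)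

instance : (moduleFunctor j).Additive := ⟨rfl⟩

instance : (moduleFunctor j).Linear ℂ where
  map_smul {X Y} f c := by
    refine ModuleCat.hom_ext (LinearMap.ext fun x => ?_)
    change c • toCLM f x = j (algebraMap ℂ S c) • toCLM f x
    rw [AlgHom.commutes, algebraMap_smul]

instance : (moduleFunctor j).Faithful where
  map_injective h := FrechetMod.hom_ext fun x => congrArg (fun f => f.hom x) h

theorem FrechetMod.moduleFunctor_comp {Y E Z : FrechetMod R} {i : Y ⟶ E} {p : E ⟶ Z}
    (h : HasConflations.IsConflation i p) :
    (moduleFunctor j).map i ≫ (moduleFunctor j).map p = 0 := by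
  rw [← Functor.map_comp, ExactLike.zero h, Functor.map_zero]

theorem FrechetMod.moduleFunctor_shortExact {Y E Z : FrechetMod R} {i : Y ⟶ E} {p : E ⟶ Z}
    (h : HasConflations.IsConflation i p) :
    (ShortComplex.mk _ _ (moduleFunctor_comp j h)).ShortExact := by
  obtain ⟨s, r, h1, h2, h3, h4⟩ := h
  refine ModuleCat.shortComplex_shortExact _ ?_ ?_ ?_
  · refine fun x => ⟨fun hx => ⟨r x, ?_⟩, ?_⟩
    · have hx : toCLM p x = 0 := hx
      have := h4 x
      rwa [hx, map_zero, add_zero] at this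
    · rintro ⟨y, rfl⟩
      exact h3 y
  · exact Function.LeftInverse.injective (g := r) h1
  · exact Function.RightInverse.surjective (g := s) h2

theorem FrechetMod.moduleFunctor_epi {E Z : FrechetMod R} {p : E ⟶ Z}
    (h : Function.Surjective (toCLM p)) : Epi ((moduleFunctor j).map p) :=
  (ModuleCat.epi_iff_surjective _).2 h

/-- The underlying function of a homomorphism of restricted modules. -/
def FrechetMod.moduleFun {X Y : FrechetMod R}
    (f : (moduleFunctor j).obj X ⟶ (moduleFunctor j).obj Y) : X.carrier → Y.carrier :=
  fun x => f.hom x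

theorem FrechetMod.moduleFun_smul {X Y : FrechetMod R}
    (f : (moduleFunctor j).obj X ⟶ (moduleFunctor j).obj Y) (s : S) (x : X.carrier) :
    moduleFun j f (j s • x) = j s • moduleFun j f x := f.hom.map_smul s x

theorem FrechetMod.moduleFun_add {X Y : FrechetMod R}
    (f : (moduleFunctor j).obj X ⟶ (moduleFunctor j).obj Y) (x y : X.carrier) :
    moduleFun j f (x + y) = moduleFun j f x + moduleFun j f y := map_add f.hom x y

/-- A homomorphism of the restricted modules that is linear is the image of a morphism. -/
theorem FrechetMod.HasDualBasis.exists_moduleFunctor_map {X Y : FrechetMod R}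
    (hX : HasDualBasis R X) (f : (moduleFunctor j).obj X ⟶ (moduleFunctor j).obj Y)
    (hf : ∀ (r : R) (x : X.carrier), moduleFun j f (r • x) = r • moduleFun j f x) : ∃ f', (moduleFunctor j).map f' = f := by
  let g : X.carrier →ₗ[R] Y.carrier :=
    { toFun := moduleFun j f, map_add' := moduleFun_add j f, map_smul' := hf }
  exact ⟨ofCLM ⟨g, hX.continuous g⟩, rfl⟩

theorem FrechetMod.HasDualBasis.projective {X : FrechetMod R} (hX : HasDualBasis R X) :
    Projective ((moduleFunctor (AlgHom.id ℂ R)).obj X) where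
  factors {E Z} f e _ := by
    let g : X.carrier →ₗ[R] Z :=
      { toFun := fun x => f.hom x, map_add' := fun x y => map_add f.hom x y
        map_smul' := fun r x => f.hom.map_smul r x }
    obtain ⟨l, hl⟩ := hX.exists_lift e.hom ((ModuleCat.epi_iff_surjective e).1 inferInstance) g
    let l' : (moduleFunctor (AlgHom.id ℂ R)).obj X →ₗ[R] E :=
      { toFun := fun x => l x, map_add' := fun x y => map_add l x y
        map_smul' := fun r x => l.map_smul r x }
    exact ⟨ModuleCat.ofHom l', ModuleCat.hom_ext (LinearMap.ext fun x => LinearMap.congr_fun hl x)⟩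

/-- A bounded homomorphism out of a projective module is the image of a morphism. -/
theorem FrechetMod.HasDualBasis.exists_bornFunctor_map {X Y : FrechetMod R}
    (hX : HasDualBasis R X) (f : bornFunctor.obj X ⟶ bornFunctor.obj Y) :
    ∃ f', bornFunctor.map f' = f :=
  ⟨ofCLM ⟨BornMod.toLin (X := X.toBorn) (Y := Y.toBorn) f, hX.continuous _⟩, rfl⟩

end Functors

section Systems

open CrossedMod OrbitCompletion FrechetMod

variable {G : Type u} [Group G] [Finite G] {A : Type u} [CommRing A] [Algebra ℂ A]
  [MulSemiringAction G A] [SMulCommClass G ℂ A] {m : A →ₐ[ℂ] ℂ}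
  [IsNoetherianRing A] [hreg : IsRegularLocalRing (Localization.AtPrime (RingHom.ker m))]

namespace IndModel

theorem hasDualBasis (M : IndModel G m) (k : ℕ) :
    HasDualBasis (SkewMonoidAlgebra (OrbitCompletion G m) G) (((system G m).R M).P k) :=
  projMod_hasDualBasis m _

theorem surjective_p (M : IndModel G m) (k : ℕ) :
    Function.Surjective (toCLM (((system G m).R M).p k)) :=
  surjective_of_isConflation ((system_isProjective M).conf k)

theorem born_epi (M : IndModel G m) (k : ℕ) :
    Epi (bornFunctor.map (((system G m).R M).p k)) :=
  ExactLike.epi (bornFunctor_conf ((system_isProjective M).conf k))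

theorem born_full (M M' : IndModel G m) (k : ℕ) (f : bornFunctor.obj (((system G m).R M).P k) ⟶
    bornFunctor.obj (((system G m).R M').Ω 0)) : ∃ f', bornFunctor.map f' = f :=
  (hasDualBasis M k).exists_bornFunctor_map f

variable (G m) in
/-- The minimal resolutions of the induced modules in the category of bornological modules. -/
def bornSystem : MinimalSystem (BornMod (SkewMonoidAlgebra (OrbitCompletion G m) G)) (IndModel G m)
    (fun M M' n => tangentHom m M.V M'.V n) :=
  (system G m).mapF system_isProjective bornFunctor born_full born_epi

theorem bornSystem_isProjective (M : IndModel G m) : ((bornSystem G m).R M).IsProjective where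
  conf k := bornFunctor_conf ((system_isProjective M).conf k)
  proj k := (hasDualBasis M k).relProjective_born

theorem bornSystem_mul {M M' M'' : IndModel G m} {p q n : ℕ} (h : p + q = n)
    (α : tangentHom m M.V M'.V p) (β : tangentHom m M'.V M''.V q) :
    (bornSystem G m).mul (i := M) (j := M') (k := M'') h α β =
      ⟨gradedMul (Tan m) _ _ _ q p n h β.1 α.1, gradedMul_mem h α β⟩ :=
  ((system G m).mul_mapF system_isProjective bornFunctor born_full born_epi h α β).trans
    (system_mul h α β)

section Modules

variable {S : Type u} [Ring S] [Algebra ℂ S]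
  (j : S →ₐ[ℂ] SkewMonoidAlgebra (OrbitCompletion G m) G)

/-- Homomorphisms from the projective modules to the induced modules are linear over the completed
crossed product if they are linear over `S`. -/
def LinearOver : Prop := ∀ (M M' : IndModel G m) (k : ℕ)
  (f : (moduleFunctor j).obj (((system G m).R M).P k) ⟶ (moduleFunctor j).obj M'.X)
  (r : SkewMonoidAlgebra (OrbitCompletion G m) G) (x : (((system G m).R M).P k).carrier),
  moduleFun j f (r • x) = r • moduleFun j f x

theorem module_epi (M : IndModel G m) (k : ℕ) :
    Epi ((moduleFunctor j).map (((system G m).R M).p k)) :=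
  moduleFunctor_epi j (surjective_p M k)

variable (hj : LinearOver j)

include hj in
theorem module_full (M M' : IndModel G m) (k : ℕ)
    (f : (moduleFunctor j).obj (((system G m).R M).P k) ⟶
      (moduleFunctor j).obj (((system G m).R M').Ω 0)) : ∃ f', (moduleFunctor j).map f' = f :=
  (hasDualBasis M k).exists_moduleFunctor_map j f (hj M M' k f)

/-- The minimal resolutions of the induced modules in the category of abstract modules. -/
def moduleSystem : MinimalSystem (ModuleCat.{u} S) (IndModel G m)
    (fun M M' n => tangentHom m M.V M'.V n) :=
  (system G m).mapF system_isProjective (moduleFunctor j) (module_full j hj)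
    (module_epi j)

theorem moduleSystem_isExact (M : IndModel G m) : ((moduleSystem j hj).R M).IsExact where
  zero k := moduleFunctor_comp j ((system_isProjective M).conf k)
  exact k := moduleFunctor_shortExact j ((system_isProjective M).conf k)

theorem moduleSystem_mul {M M' M'' : IndModel G m} {p q n : ℕ} (h : p + q = n)
    (α : tangentHom m M.V M'.V p) (β : tangentHom m M'.V M''.V q) :
    (moduleSystem j hj).mul (i := M) (j := M') (k := M'') h α β =
      ⟨gradedMul (Tan m) _ _ _ q p n h β.1 α.1, gradedMul_mem h α β⟩ :=
  ((system G m).mul_mapF system_isProjective (moduleFunctor j) (module_full j hj) (module_epi j)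
    h α β).trans (system_mul h α β)

end Modules

variable (G m) in
theorem linearOver_id :
    LinearOver (AlgHom.id ℂ (SkewMonoidAlgebra (OrbitCompletion G m) G)) :=
  fun _ _ _ f r x => moduleFun_smul (AlgHom.id ℂ _) f r x

end IndModel

end Systems

/-! ### Endomorphisms of the regular representation -/

section Entries

variable {H : Type*} [Fintype H] {V : Type*} [AddCommGroup V] [Module ℂ V]
  (b : Module.Basis H ℂ V) {Λ Λ' Λ'' : Type*} [AddCommGroup Λ] [Module ℂ Λ] [AddCommGroup Λ']
  [Module ℂ Λ'] [AddCommGroup Λ''] [Module ℂ Λ'']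

/-- The matrix entries of an element of `End V ⊗ Λ`. -/
def matrixEntry (y x : H) : (V →ₗ[ℂ] V) ⊗[ℂ] Λ →ₗ[ℂ] Λ :=
  TensorProduct.lift ((LinearMap.lsmul ℂ Λ) ∘ₗ b.coord y ∘ₗ LinearMap.applyₗ (b x))

theorem matrixEntry_tmul (y x : H) (f : V →ₗ[ℂ] V) (l : Λ) :
    matrixEntry b y x (f ⊗ₜ l) = b.coord y (f (b x)) • l := rfl

/-- The element of `End V ⊗ Λ` with a single nonzero matrix entry. -/
def matrixUnit (y x : H) : Λ →ₗ[ℂ] (V →ₗ[ℂ] V) ⊗[ℂ] Λ :=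
  TensorProduct.mk ℂ _ _ ((b.coord x).smulRight (b y))

theorem sum_matrixUnit (θ : (V →ₗ[ℂ] V) ⊗[ℂ] Λ) :
    ∑ y, ∑ x, matrixUnit b y x (matrixEntry b y x θ) = θ := by
  induction θ with
  | zero => simp
  | add θ θ' h h' => simp only [map_add, Finset.sum_add_distrib, h, h']
  | tmul f l =>
    have e : ∑ y, ∑ x, b.coord y (f (b x)) • (b.coord x).smulRight (b y) = f := by
      classical
      refine b.ext fun x => ?_
      simp only [LinearMap.sum_apply, LinearMap.smul_apply, LinearMap.smulRight_apply,
        Module.Basis.coord_apply, Module.Basis.repr_self]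
      conv_rhs => rw [← b.sum_repr (f (b x))]
      refine Finset.sum_congr rfl fun y _ => ?_
      rw [Finset.sum_eq_single x (fun z _ hz => by
        rw [Finsupp.single_eq_of_ne hz, zero_smul, smul_zero]) (fun h => absurd (Finset.mem_univ _) h),
        Finsupp.single_eq_same, one_smul]
    conv_rhs => rw [← e]
    simp only [TensorProduct.sum_tmul, matrixEntry_tmul, map_smul]
    rfl

theorem matrixEntry_ext {θ θ' : (V →ₗ[ℂ] V) ⊗[ℂ] Λ}
    (h : ∀ y x, matrixEntry b y x θ = matrixEntry b y x θ') : θ = θ' := by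
  rw [← sum_matrixUnit b θ, ← sum_matrixUnit b θ']
  simp only [h]

theorem exists_matrixEntry (c : H → H → Λ) : ∃ θ, ∀ y x, matrixEntry b y x θ = c y x := by
  classical
  refine ⟨∑ y, ∑ x, matrixUnit b y x (c y x), fun y x => ?_⟩
  have e : ∀ y' x', matrixEntry b y x (matrixUnit b y' x' (c y' x')) =
      if x' = x then if y' = y then c y' x' else 0 else 0 := fun y' x' => by
    refine (matrixEntry_tmul b y x _ _).trans ?_
    rw [LinearMap.smulRight_apply, map_smul, Module.Basis.coord_apply, Module.Basis.repr_self,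
      Module.Basis.coord_apply, Module.Basis.repr_self, Finsupp.single_apply, Finsupp.single_apply]
    split_ifs with h1 h2 h3 <;> simp_all
  simp only [map_sum, e]
  simp

theorem matrixEntry_map₂ (μ : Λ →ₗ[ℂ] Λ' →ₗ[ℂ] Λ'') (y x : H) (θ : (V →ₗ[ℂ] V) ⊗[ℂ] Λ)
    (θ' : (V →ₗ[ℂ] V) ⊗[ℂ] Λ') :
    matrixEntry b y x (TensorProduct.map₂ (LinearMap.llcomp ℂ V V V) μ θ θ') =
      ∑ z, μ (matrixEntry b y z θ) (matrixEntry b z x θ') := by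
  induction θ with
  | zero => simp
  | add θ₁ θ₂ h h' => simp only [map_add, LinearMap.add_apply, Finset.sum_add_distrib, h, h']
  | tmul f l =>
    induction θ' with
    | zero => simp
    | add θ₁ θ₂ h h' => simp only [map_add, Finset.sum_add_distrib, h, h']
    | tmul g l' =>
      refine (matrixEntry_tmul b y x (f ∘ₗ g) (μ l l')).trans ?_
      simp only [matrixEntry_tmul, map_smul, LinearMap.smul_apply, smul_smul]
      rw [← Finset.sum_smul]
      congr 1
      rw [LinearMap.comp_apply]
      conv_lhs => rw [← b.sum_repr (g (b x))]
      simp only [map_sum, map_smul, smul_eq_mul]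
      rfl

theorem matrixEntry_equivariant [Group H] {ρ : Representation ℂ H V}
    (hρ : ∀ h k, ρ h (b k) = b (h * k)) (τ : Representation ℂ H Λ) (h y x : H)
    (θ : (V →ₗ[ℂ] V) ⊗[ℂ] Λ) :
    matrixEntry b (h * y) (h * x) ((ρ.linHom ρ).tprod τ h θ) = τ h (matrixEntry b y x θ) := by
  induction θ with
  | zero => simp
  | add θ₁ θ₂ h h' => simp only [map_add, h, h']
  | tmul f l =>
    refine (matrixEntry_tmul b _ _ (ρ h ∘ₗ f ∘ₗ ρ h⁻¹) (τ h l)).trans ?_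
    have e : b.coord (h * y) ∘ₗ ρ h = b.coord y := by
      classical
      refine b.ext fun k => ?_
      rw [LinearMap.comp_apply, hρ, Module.Basis.coord_apply, Module.Basis.repr_self,
        Module.Basis.coord_apply, Module.Basis.repr_self, Finsupp.single_apply, Finsupp.single_apply]
      simp
    rw [matrixEntry_tmul, map_smul, LinearMap.comp_apply, LinearMap.comp_apply, hρ,
      inv_mul_cancel_left]
    exact congrArg (· • _) (LinearMap.congr_fun e _)

theorem mem_invariants_iff_matrixEntry [Group H] {ρ : Representation ℂ H V}
    (hρ : ∀ h k, ρ h (b k) = b (h * k)) (τ : Representation ℂ H Λ) (θ : (V →ₗ[ℂ] V) ⊗[ℂ] Λ) :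
    θ ∈ ((ρ.linHom ρ).tprod τ).invariants ↔
      ∀ y x, matrixEntry b y x θ = τ y (matrixEntry b 1 (y⁻¹ * x) θ) := by
  rw [Representation.mem_invariants]
  constructor
  · intro h y x
    rw [← matrixEntry_equivariant b hρ, h, mul_one, mul_inv_cancel_left]
  · refine fun h g => matrixEntry_ext b fun y x => ?_
    have e := matrixEntry_equivariant b hρ τ g (g⁻¹ * y) (g⁻¹ * x) θ
    rw [mul_inv_cancel_left, mul_inv_cancel_left] at e
    rw [e, h, h y x, ← Module.End.mul_apply, ← map_mul]
    congr 2
    · rw [mul_inv_cancel_left]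
    · group

end Entries

theorem coeff_mul_fintype {k G : Type*} [Ring k] [Group G] [Fintype G] [MulSemiringAction G k]
    (f g : SkewMonoidAlgebra k G) (x : G) :
    (f * g).coeff x = ∑ z, f.coeff z * z • g.coeff (z⁻¹ * x) := by
  classical
  rw [SkewMonoidAlgebra.coeff_mul, SkewMonoidAlgebra.sum_def, Finsupp.sum_fintype _ _ fun z => ?_]
  · refine Finset.sum_congr rfl fun z _ => ?_
    rw [SkewMonoidAlgebra.sum_def, Finsupp.sum_fintype _ _ fun w => by simp,
      Finset.sum_eq_single (z⁻¹ * x)]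
    · rw [if_pos (mul_inv_cancel_left z x)]
    · rintro w - hw
      exact if_neg fun h => hw (by rw [← h, inv_mul_cancel_left])
    · exact fun h => absurd (Finset.mem_univ _) h
  · rw [SkewMonoidAlgebra.sum_def]; simp

section Crossed

open CrossedMod OrbitCompletion FrechetMod

variable {G : Type u} [Group G] [Finite G] {A : Type u} [CommRing A] [Algebra ℂ A]
  [MulSemiringAction G A] [SMulCommClass G ℂ A] {m : A →ₐ[ℂ] ℂ}

variable (G m) in
/-- The coefficients of the elements of `⋀ T_m M ⋊ G_m` of a given degree. -/
def crossedCoeffs (n : ℕ) : extCrossedDegree G m n ≃ₗ[ℂ] (isotropy G m → ⋀[ℂ]^n (Tan m)) where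
  toFun z h := ⟨z.1.coeff h, z.2 h⟩
  invFun c := ⟨⟨Finsupp.equivFunOnFinite.symm fun h => (c h).1⟩, fun h => (c h).2⟩
  left_inv _ := Subtype.ext (SkewMonoidAlgebra.coeff_injective (Finsupp.ext fun _ => rfl))
  right_inv _ := rfl
  map_add' z w := funext fun h =>
    Subtype.ext (DFunLike.congr_fun (SkewMonoidAlgebra.coeff_add z.1 w.1) h)
  map_smul' a z := funext fun h =>
    Subtype.ext (DFunLike.congr_fun (SkewMonoidAlgebra.coeff_smul a z.1) h)

/-- The first row of an invariant endomorphism of the regular representation. -/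
def firstRow (n : ℕ) :
    tangentHom m (regularRep (isotropy G m)) (regularRep (isotropy G m)) n →ₗ[ℂ]
      (isotropy G m → ⋀[ℂ]^n (Tan m)) :=
  LinearMap.pi fun h => matrixEntry (regularBasis (isotropy G m)) 1 h ∘ₗ Submodule.subtype _

theorem matrixEntry_tangentHom {n : ℕ}
    (θ : tangentHom m (regularRep (isotropy G m)) (regularRep (isotropy G m)) n)
    (y x : isotropy G m) : matrixEntry (regularBasis (isotropy G m)) y x θ.1 =
      extPowerRep (tanRep G m) n y (matrixEntry (regularBasis (isotropy G m)) 1 (y⁻¹ * x) θ.1) :=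
  have := Fintype.ofFinite (isotropy G m)
  (mem_invariants_iff_matrixEntry (regularBasis (isotropy G m)) (regularRep_basis (H := isotropy G m)) _ θ.1).1 θ.2 y x

theorem firstRow_bijective (n : ℕ) : Function.Bijective (firstRow (G := G) (m := m) n) := by
  have := Fintype.ofFinite (isotropy G m)
  constructor
  · refine fun θ θ' h => Subtype.ext (matrixEntry_ext (regularBasis (isotropy G m)) fun y x => ?_)
    rw [matrixEntry_tangentHom, matrixEntry_tangentHom θ']
    exact congrArg _ (congrFun h (y⁻¹ * x))
  · intro c
    obtain ⟨θ, hθ⟩ := exists_matrixEntry (regularBasis (isotropy G m))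
      fun y x => extPowerRep (tanRep G m) n y (c (y⁻¹ * x))
    have h1 : ∀ x, matrixEntry (regularBasis (isotropy G m)) 1 x θ = c x := fun x => by
      rw [hθ, map_one, inv_one, one_mul]; rfl
    refine ⟨⟨θ, (mem_invariants_iff_matrixEntry (regularBasis (isotropy G m))
      (regularRep_basis (H := isotropy G m)) (extPowerRep (tanRep G m) n) θ).2 fun y x => ?_⟩, funext h1⟩
    rw [hθ, h1]

variable (G m) in
/-- `(End ℂ[G_m] ⊗ ⋀ⁿ T_m M)^{G_m}` is the degree `n` part of `⋀ T_m M ⋊ G_m`. -/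
def crossedEquiv (n : ℕ) :
    tangentHom m (regularRep (isotropy G m)) (regularRep (isotropy G m)) n ≃ₗ[ℂ]
      extCrossedDegree G m n :=
  (LinearEquiv.ofBijective (firstRow n) (firstRow_bijective n)).trans (crossedCoeffs G m n).symm

theorem crossedEquiv_coeff {n : ℕ}
    (θ : tangentHom m (regularRep (isotropy G m)) (regularRep (isotropy G m)) n) (h : isotropy G m) :
    (crossedEquiv G m n θ).1.coeff h = (firstRow n θ h).1 := rfl

variable [IsNoetherianRing A] [hreg : IsRegularLocalRing (Localization.AtPrime (RingHom.ker m))]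

theorem crossedEquiv_gradedMul {p q n : ℕ} (h : p + q = n)
    (γ : tangentHom m (regularRep (isotropy G m)) (regularRep (isotropy G m)) n)
    (β : tangentHom m (regularRep (isotropy G m)) (regularRep (isotropy G m)) q)
    (α : tangentHom m (regularRep (isotropy G m)) (regularRep (isotropy G m)) p) :
    (crossedEquiv G m n γ).1 = (crossedEquiv G m q β).1 * (crossedEquiv G m p α).1 ↔
      γ.1 = gradedMul (Tan m) _ _ _ q p n h β.1 α.1 := by
  have := Fintype.ofFinite (isotropy G m)
  let b := regularBasis (isotropy G m)
  let δ : tangentHom m (regularRep (isotropy G m)) (regularRep (isotropy G m)) n :=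
    ⟨gradedMul (Tan m) _ _ _ q p n h β.1 α.1, IndModel.gradedMul_mem h α β⟩
  have hδ : (crossedEquiv G m n δ).1 = (crossedEquiv G m q β).1 * (crossedEquiv G m p α).1 := by
    refine SkewMonoidAlgebra.coeff_injective (Finsupp.ext fun x => ?_)
    rw [coeff_mul_fintype]
    refine (congrArg Subtype.val (matrixEntry_map₂ b (mulDeg (Tan m) q p n h) 1 x β.1 α.1)).trans ?_
    refine (map_sum (⋀[ℂ]^n (Tan m)).subtype _ _).trans (Finset.sum_congr rfl fun z _ => ?_)
    refine (coe_mulDeg _ h _ _).trans ?_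
    rw [matrixEntry_tangentHom α z x]
    exact congrArg (_ * ·) (coe_extPowerRep (tanRep G m) z _)
  rw [← hδ]
  exact ⟨fun e => congrArg Subtype.val ((crossedEquiv G m n).injective (Subtype.ext e)),
    fun e => congrArg (fun w => (crossedEquiv G m n w).1) (Subtype.ext (a2 := δ) e)⟩

variable (m) in
/-- The identity in degree zero. -/
def tangentOne (V : FinDimRep (isotropy G m)) : tangentHom m V V 0 :=
  ⟨LinearMap.id ⊗ₜ ⟨1, SetLike.GradedOne.one_mem⟩, fun g => by
    refine congrArg₂ (· ⊗ₜ[ℂ] ·) ?_ (Subtype.ext ?_)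
    · refine LinearMap.ext fun v => ?_
      change V.ρ g (V.ρ g⁻¹ v) = v
      rw [← Module.End.mul_apply, ← map_mul, mul_inv_cancel, map_one]; rfl
    · exact (coe_extPowerRep _ _ _).trans (map_one _)⟩

theorem crossedEquiv_one : (crossedEquiv G m 0 (tangentOne m _)).1 = 1 := by
  classical
  refine SkewMonoidAlgebra.coeff_injective (Finsupp.ext fun x => ?_)
  have e : (firstRow 0 (tangentOne m (regularRep (isotropy G m))) x) =
      (regularBasis (isotropy G m)).coord 1 ((regularBasis (isotropy G m)) x) •
        ⟨1, SetLike.GradedOne.one_mem⟩ := rfl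
  rw [crossedEquiv_coeff, e, SkewMonoidAlgebra.one_def, SkewMonoidAlgebra.coeff_single,
    Module.Basis.coord_apply, Module.Basis.repr_self, Finsupp.single_apply, Finsupp.single_apply]
  by_cases h : x = 1
  · rw [if_pos h, if_pos h.symm, one_smul]
  · rw [if_neg h, if_neg (Ne.symm h), zero_smul]; rfl

namespace IndModel

theorem actZero_one (V : FinDimRep (isotropy G m)) :
    actZero (Cotan m) V.carrier V.carrier 0 (tangentOne m V).1 =
      (evZero (Cotan m) V.carrier).toLinearMap := by
  have e : contrDeg (Cotan m) 0 0 0 rfl ⟨1, SetLike.GradedOne.one_mem⟩ = LinearMap.id :=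
    LinearMap.ext fun x => Subtype.ext (by rw [coe_contrDeg, map_one]; rfl)
  have e' : actDeg (Cotan m) V.carrier V.carrier 0 0 0 rfl (tangentOne m V).1 = LinearMap.id :=
    (congrArg (TensorProduct.map LinearMap.id) e).trans TensorProduct.map_id
  exact congrArg ((evZero (Cotan m) V.carrier).toLinearMap ∘ₗ ·) e'

theorem system_φ_one (M : IndModel G m) :
    (system G m).φ (i := M) (j := M) (tangentOne m M.V) = 𝟙 M.X := by
  refine ext_p ((p_φ _).trans ?_)
  refine Eq.trans ?_ (Category.comp_id (M.complex.resn.p 0)).symm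
  exact FrechetMod.hom_ext fun φ => M.e.injective (Coind.ext fun g =>
    (e_evalAct M _ φ g).trans ((LinearMap.congr_fun (actZero_one M.V) _).trans
      (M.e_aug φ g).symm))

end IndModel

end Crossed

/-! ### The assertions about Ext from minimal systems -/

theorem IsLinearOnExt.trans {C : Type (u + 1)} [Category.{u} C] [Preadditive C] [Linear ℂ C]
    [HasConflations C] {X Y : C} {n : ℕ} {W W' : Type u} [AddCommGroup W] [Module ℂ W]
    [AddCommGroup W'] [Module ℂ W'] {f : YExt X Y n ≃ W} (h : IsLinearOnExt f) (e : W ≃ₗ[ℂ] W') :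
    IsLinearOnExt (f.trans e.toEquiv) := by
  refine ⟨fun x y z => (h.1 x y z).trans ?_, fun c x z => (h.2 c x z).trans ?_⟩
  · rw [← e.injective.eq_iff, map_add]; rfl
  · rw [← e.injective.eq_iff, map_smul]; rfl

section TransportExt

open Abelian

variable {C : Type u} [Category.{v} C] [Abelian C] [HasExt.{w} C] [Linear ℂ C]

/-- Isomorphic objects have isomorphic Ext-groups. -/
def extIso {X Y X' Y' : C} (e : X ≅ X') (e' : Y ≅ Y') (n : ℕ) :
    Ext.{w} X Y n ≃ₗ[ℂ] Ext.{w} X' Y' n where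
  toFun α := (Ext.mk₀ e.inv).comp (α.comp (Ext.mk₀ e'.hom) (add_zero n)) (zero_add n)
  invFun α := (Ext.mk₀ e.hom).comp (α.comp (Ext.mk₀ e'.inv) (add_zero n)) (zero_add n)
  left_inv α := by
    beta_reduce
    rw [Ext.comp_assoc_of_third_deg_zero, Ext.comp_assoc_of_third_deg_zero, Ext.mk₀_comp_mk₀,
      ← Ext.comp_assoc_of_second_deg_zero, Ext.mk₀_comp_mk₀, e.hom_inv_id, e'.hom_inv_id,
      Ext.mk₀_id_comp, Ext.comp_mk₀_id]
  right_inv α := by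
    beta_reduce
    rw [Ext.comp_assoc_of_third_deg_zero, Ext.comp_assoc_of_third_deg_zero, Ext.mk₀_comp_mk₀,
      ← Ext.comp_assoc_of_second_deg_zero, Ext.mk₀_comp_mk₀, e.inv_hom_id, e'.inv_hom_id,
      Ext.mk₀_id_comp, Ext.comp_mk₀_id]
  map_add' α β := by rw [Ext.add_comp, Ext.comp_add]
  map_smul' c α := by rw [Ext.smul_comp, Ext.comp_smul]; rfl

theorem extIso_comp {X Y Z X' Y' Z' : C} (e : X ≅ X') (e' : Y ≅ Y') (e'' : Z ≅ Z') {p q n : ℕ}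
    (h : p + q = n) (α : Ext.{w} X Y p) (β : Ext.{w} Y Z q) :
    extIso e e'' n (α.comp β h) = (extIso e e' p α).comp (extIso e' e'' q β) h := by
  change (Ext.mk₀ e.inv).comp ((α.comp β h).comp (Ext.mk₀ e''.hom) (add_zero n)) (zero_add n) =
    ((Ext.mk₀ e.inv).comp (α.comp (Ext.mk₀ e'.hom) (add_zero p)) (zero_add p)).comp
      ((Ext.mk₀ e'.inv).comp (β.comp (Ext.mk₀ e''.hom) (add_zero q)) (zero_add q)) h
  rw [Ext.comp_assoc (Ext.mk₀ e.inv) _ _ (zero_add p) h (by omega),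
    Ext.comp_assoc_of_second_deg_zero, ← Ext.comp_assoc (Ext.mk₀ e'.hom) (Ext.mk₀ e'.inv) _
      (add_zero 0) (zero_add q) (by omega), Ext.mk₀_comp_mk₀, e'.hom_inv_id, Ext.mk₀_id_comp,
    Ext.comp_assoc_of_third_deg_zero]

theorem extIso_id {X X' : C} (e : X ≅ X') :
    extIso e e 0 (Ext.mk₀ (𝟙 X)) = (Ext.mk₀ (𝟙 X') : Ext.{w} X' X' 0) := by
  change (Ext.mk₀ e.inv).comp ((Ext.mk₀ (𝟙 X)).comp (Ext.mk₀ e.hom) (add_zero 0)) (zero_add 0) = _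
  rw [Ext.mk₀_comp_mk₀, Ext.mk₀_comp_mk₀, Category.id_comp, e.inv_hom_id]

end TransportExt

section Assertions

open IndModel

variable {G : Type u} [Group G] [Finite G] {A : Type u} [CommRing A] [Algebra ℂ A]
  [MulSemiringAction G A] [SMulCommClass G ℂ A] {m : A →ₐ[ℂ] ℂ}
  [IsNoetherianRing A] [hreg : IsRegularLocalRing (Localization.AtPrime (RingHom.ker m))]

/-- The product of invariants. -/
def tangentMul {V V' V'' : FinDimRep (isotropy G m)} {p q n : ℕ} (h : p + q = n)
    (β : tangentHom m V' V'' q) (α : tangentHom m V V' p) : tangentHom m V V'' n :=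
  ⟨gradedMul (Tan m) _ _ _ q p n h β.1 α.1, gradedMul_mem h α β⟩

theorem toTotal_eq_iff {V V' V'' : FinDimRep (isotropy G m)} {p q n : ℕ} (h : p + q = n)
    (γ : tangentHom m V V'' n) (β : tangentHom m V' V'' q) (α : tangentHom m V V' p) :
    toTotal m γ = wedgeProduct m (toTotal m β) (toTotal m α) ↔ γ = tangentMul h β α :=
  (toTotal_eq_wedgeProduct_iff m h γ β α).trans
    (Subtype.ext_iff (a1 := γ) (a2 := tangentMul h β α)).symm

theorem crossedEquiv_eq_iff {p q n : ℕ} (h : p + q = n)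
    (γ : tangentHom m (regularRep (isotropy G m)) (regularRep (isotropy G m)) n)
    (β : tangentHom m (regularRep (isotropy G m)) (regularRep (isotropy G m)) q)
    (α : tangentHom m (regularRep (isotropy G m)) (regularRep (isotropy G m)) p) :
    (crossedEquiv G m n γ).1 = (crossedEquiv G m q β).1 * (crossedEquiv G m p α).1 ↔
      γ = tangentMul h β α :=
  (crossedEquiv_gradedMul h γ β α).trans (Subtype.ext_iff (a1 := γ) (a2 := tangentMul h β α)).symm

/-- The product of a minimal system is the product of invariants. -/
def HasGradedMul {C : Type (u + 1)} [Category.{u} C] [Preadditive C] [Linear ℂ C]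
    (D : MinimalSystem C (IndModel G m) (fun M M' n => tangentHom m M.V M'.V n)) : Prop :=
  (∀ M, D.φ (i := M) (j := M) (tangentOne m M.V) = 𝟙 _) ∧
  ∀ (M M' M'' : IndModel G m) (p q n : ℕ) (h : p + q = n) (α : tangentHom m M.V M'.V p)
    (β : tangentHom m M'.V M''.V q), D.mul (i := M) (j := M') (k := M'') h α β =
      tangentMul h β α

theorem exactExtAssertion {C : Type (u + 1)} [Category.{u} C] [Preadditive C] [Linear ℂ C]
    [HasConflations C] [ExactLike C]
    (D : MinimalSystem C (IndModel G m) (fun M M' n => tangentHom m M.V M'.V n))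
    (hD : ∀ M, (D.R M).IsProjective) (hmul : HasGradedMul D)
    (hsum : ∀ M, ∃ M', ∃ b : Limits.BinaryBicone ((D.R M).Ω 0) ((D.R M).Ω 0),
      ∃ (_ : b.IsBilimit), b.pt = (D.R M').Ω 0)
    (hiso : Nonempty ((D.R (ofRep G m (regularRep (isotropy G m)))).Ω 0 ≅
      (D.R (ofPoint G m)).Ω 0)) :
    ExactExtAssertion m C (fun V => (D.R (ofRep G m V)).Ω 0) ((D.R (ofPoint G m)).Ω 0) := by
  have hlin : ∀ M M' n, IsLinearOnExt (D.equivYExt hD M M' n) := fun M M' n =>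
    ⟨D.equivYExt_baer hD hsum, D.equivYExt_smul hD⟩
  have hprod : ∀ (M M' M'' : IndModel G m) (p q : ℕ) (α : YExt ((D.R M).Ω 0) ((D.R M').Ω 0) p)
      (β : YExt ((D.R M').Ω 0) ((D.R M'').Ω 0) q) (γ : YExt ((D.R M).Ω 0) ((D.R M'').Ω 0) (q + p)),
      IsProduct β α γ ↔ D.equivYExt hD M M'' (q + p) γ = tangentMul (V := M.V) (V' := M'.V)
        (V'' := M''.V) (add_comm p q) (D.equivYExt hD M' M'' q β) (D.equivYExt hD M M' p α) :=
    fun M M' M'' p q α β γ => (D.equivYExt_product hD (add_comm p q) α β γ).trans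
      (Eq.congr_right (hmul.2 M M' M'' p q _ _ _ _))
  refine ⟨fun V V' n => ⟨(D.equivYExt hD (ofRep G m V) (ofRep G m V') n).trans
    (tangentCotangent m V V' n).toEquiv, (hlin (ofRep G m V) (ofRep G m V') n).trans
      (tangentCotangent m V V' n)⟩,
    ⟨fun V V' n => D.equivYExt hD (ofRep G m V) (ofRep G m V') n,
      fun V V' n => hlin (ofRep G m V) (ofRep G m V') n, fun V V' V'' p q α β γ =>
        (hprod (ofRep G m V) (ofRep G m V') (ofRep G m V'') p q α β γ).trans
          (toTotal_eq_iff (add_comm p q) _ _ _).symm⟩, hiso,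
    ⟨fun n => (D.equivYExt hD (ofPoint G m) (ofPoint G m) n).trans (crossedEquiv G m n).toEquiv,
      fun n => (hlin (ofPoint G m) (ofPoint G m) n).trans (crossedEquiv G m n), ?_,
      fun p q α β γ => (hprod (ofPoint G m) (ofPoint G m) (ofPoint G m) p q α β γ).trans
        (crossedEquiv_eq_iff (add_comm p q) _ _ _).symm⟩⟩
  refine Eq.trans ?_ crossedEquiv_one
  exact congrArg (fun z => (crossedEquiv G m 0 z).1) (D.φ.injective
    ((D.equivYExt_hom hD (𝟙 _)).trans (hmul.1 (ofPoint G m)).symm))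

theorem moduleExtAssertion {S : Type u} [Ring S] [Algebra ℂ S]
    (D : MinimalSystem (ModuleCat.{u} S) (IndModel G m) (fun M M' n => tangentHom m M.V M'.V n))
    (hD : ∀ M, (D.R M).IsExact)
    (hac : ∀ i j k n (e : Abelian.Ext.{u} ((D.R i).P k) ((D.R j).Ω 0) (n + 1)), e = 0)
    (hmul : HasGradedMul D) (ind : FinDimRep (isotropy G m) → ModuleCat.{u} S)
    (indPt : ModuleCat.{u} S) (e : ∀ V, ind V ≅ (D.R (ofRep G m V)).Ω 0)
    (ePt : indPt ≅ (D.R (ofPoint G m)).Ω 0)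
    (hiso : Nonempty (ind (regularRep (isotropy G m)) ≅ indPt)) :
    ModuleExtAssertion m S ind indPt := by
  have hprod : ∀ (M M' M'' : IndModel G m) (p q n : ℕ) (h : p + q = n)
      (α : Abelian.Ext ((D.R M).Ω 0) ((D.R M').Ω 0) p)
      (β : Abelian.Ext ((D.R M').Ω 0) ((D.R M'').Ω 0) q),
      D.equivExt hD hac M M'' n (α.comp β h) = tangentMul (V := M.V) (V' := M'.V)
        (V'' := M''.V) h (D.equivExt hD hac M' M'' q β) (D.equivExt hD hac M M' p α) :=
    fun M M' M'' p q n h α β => (D.equivExt_comp hD hac h α β).trans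
      (hmul.2 M M' M'' p q _ _ _ _)
  let Φ : ∀ V V' n, Abelian.Ext (ind V) (ind V') n ≃ₗ[ℂ] tangentHom m V V' n := fun V V' n =>
    (extIso (e V) (e V') n).trans (D.equivExt hD hac (ofRep G m V) (ofRep G m V') n)
  refine ⟨fun V V' n => ⟨(Φ V V' n).trans (tangentCotangent m V V' n)⟩, ⟨Φ,
    fun V V' V'' p q n h α β => (toTotal_eq_iff h _ _ _).2 ?_⟩, hiso,
    ⟨fun n => (extIso ePt ePt n).trans ((D.equivExt hD hac (ofPoint G m) (ofPoint G m) n).trans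
      (crossedEquiv G m n)), ?_,
      fun p q n h α β => (crossedEquiv_eq_iff h _ _ _).2 ?_⟩⟩
  · exact (congrArg (fun z => (D.equivExt hD hac (ofRep G m V) (ofRep G m V'') n z))
      (extIso_comp (e V) (e V') (e V'') h α β)).trans
      (hprod (ofRep G m V) (ofRep G m V') (ofRep G m V'') p q n h _ _)
  · refine Eq.trans ?_ crossedEquiv_one
    refine congrArg (fun z => (crossedEquiv G m 0 z).1) (D.φ.injective ?_)
    refine (congrArg (fun z => D.φ (D.equivExt hD hac _ _ 0 z)) (extIso_id ePt)).trans ?_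
    exact (D.equivExt_mk₀ hD hac (𝟙 _)).trans (hmul.1 (ofPoint G m)).symm
  · exact (congrArg (fun z => (D.equivExt hD hac (ofPoint G m) (ofPoint G m) n z))
      (extIso_comp ePt ePt ePt h α β)).trans
      (hprod (ofPoint G m) (ofPoint G m) (ofPoint G m) p q n h _ _)

end Assertions

/-! ### Kernels of maps onto flat modules -/

section Flat

variable {A : Type*} [CommRing A] {F Q : Type*} [AddCommGroup F] [Module A F] [AddCommGroup Q]
  [Module A Q] {π : F →ₗ[A] Q} (hπ : Function.Surjective π)

include hπ in
theorem exists_factor_ker [Module.Flat A Q] {L N : Type*} [AddCommGroup L] [Module A L]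
    [Module.Finite A L] [AddCommGroup N] [Module A N] [Module.Free A N] [Module.Finite A N]
    {f : L →ₗ[A] N} {y : N →ₗ[A] F} (h : (π ∘ₗ y) ∘ₗ f = 0) :
    ∃ z : N →ₗ[A] LinearMap.ker π, ∀ x, (z (f x) : F) = y (f x) := by
  obtain ⟨k, a, t, h1, h2⟩ := Module.Flat.exists_factorization_of_comp_eq_zero_of_free h
  obtain ⟨l, hl⟩ := Module.projective_lifting_property π t hπ
  refine ⟨(y - l ∘ₗ a).codRestrict _ fun x => ?_, fun x => ?_⟩
  · have e1 : π (y x) = t (a x) := LinearMap.congr_fun h1 x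
    have e2 : π (l (a x)) = t (a x) := LinearMap.congr_fun hl (a x)
    rw [LinearMap.mem_ker, LinearMap.sub_apply, map_sub, e1, LinearMap.comp_apply, e2, sub_self]
  · have e : a (f x) = 0 := LinearMap.congr_fun h2 x
    rw [LinearMap.codRestrict_apply, LinearMap.sub_apply, LinearMap.comp_apply, e, map_zero,
      sub_zero]

include hπ in
theorem flat_ker [Module.Flat A F] [Module.Flat A Q] : Module.Flat A (LinearMap.ker π) := by
  refine Module.Flat.of_forall_exists_factorization fun {l f x} h => ?_
  obtain ⟨k, a, y, h1, h2⟩ := Module.Flat.exists_factorization_of_apply_eq_zero_of_free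
    (x := (LinearMap.ker π).subtype ∘ₗ x) (f := f) (by rw [LinearMap.comp_apply, h, map_zero])
  have hy : ∀ u, ((x u : LinearMap.ker π) : F) = y (a u) := LinearMap.congr_fun h1
  obtain ⟨z, hz⟩ := exists_factor_ker hπ (f := a) (y := y) (LinearMap.ext fun u => by
    rw [LinearMap.comp_apply, LinearMap.comp_apply, ← hy]
    exact (x u).2)
  exact ⟨k, a, z, LinearMap.ext fun u => Subtype.ext ((hy u).trans (hz u).symm), h2⟩

include hπ in
theorem ker_inf_smul_top_le [Module.Flat A Q] (J : Ideal A) :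
    LinearMap.ker π ⊓ J • ⊤ ≤ J • LinearMap.ker π := by
  classical
  rintro x ⟨hx, hxJ⟩
  have h : x ∈ J • Submodule.span A (Set.range (id : F → F)) := by
    rwa [Set.range_id, Submodule.span_univ]
  obtain ⟨c, hc, rfl⟩ := (Submodule.mem_ideal_smul_span_iff_exists_sum J id x).1 h
  let b : c.support → A := fun i => c i
  have e : Fintype.linearCombination A (fun i : c.support => (i : F)) b =
      c.sum fun i a => a • id i := by
    rw [Fintype.linearCombination_apply, Finsupp.sum]
    exact Finset.sum_coe_sort c.support fun i => c i • i
  obtain ⟨z, hz⟩ := exists_factor_ker hπ (f := LinearMap.toSpanSingleton A (c.support → A) b)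
    (y := Fintype.linearCombination A fun i : c.support => (i : F)) (LinearMap.ext_ring (by
      rw [LinearMap.comp_apply, LinearMap.toSpanSingleton_apply, one_smul, LinearMap.comp_apply, e]
      exact hx))
  have h2 := hz 1
  rw [LinearMap.toSpanSingleton_apply, one_smul, e] at h2
  rw [← h2, pi_eq_sum_univ' b, map_sum, AddSubmonoidClass.coe_finsetSum]
  refine Submodule.sum_mem _ fun i _ => ?_
  rw [map_smul]
  exact Submodule.smul_mem_smul (hc i) (z _).2

end Flat

/-! ### Extension of equivariant maps into modules supported on an orbit -/

theorem exists_extension_of_ker_le {E F X : Type*} [AddCommGroup E] [Module ℂ E] [AddCommGroup F]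
    [Module ℂ F] [AddCommGroup X] [Module ℂ X] (i : E →ₗ[ℂ] F) (f : E →ₗ[ℂ] X)
    (h : LinearMap.ker i ≤ LinearMap.ker f) : ∃ l : F →ₗ[ℂ] X, l ∘ₗ i = f := by
  obtain ⟨r, hr⟩ := LinearMap.exists_leftInverse_of_injective
    ((LinearMap.ker i).liftQ i le_rfl) (Submodule.ker_liftQ_eq_bot' _ _ rfl)
  refine ⟨(LinearMap.ker i).liftQ f h ∘ₗ r, LinearMap.ext fun x => ?_⟩
  have := LinearMap.congr_fun hr (Submodule.Quotient.mk x)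
  rw [LinearMap.comp_apply, Submodule.liftQ_apply] at this
  rw [LinearMap.comp_apply, LinearMap.comp_apply, this]
  rfl

section Extension

variable {G : Type u} [Group G] [Finite G] {A : Type u} [CommRing A] [Algebra ℂ A]
  [MulSemiringAction G A] [SMulCommClass G ℂ A] (m : A →ₐ[ℂ] ℂ)

/-- The module is killed by the functions which vanish on the orbit. -/
def KilledByOrbit (X : Type u) [AddCommGroup X] [Module (SkewMonoidAlgebra A G) X] : Prop :=
  ∀ b ∈ orbitIdeal G m, ∀ x : X, (SkewMonoidAlgebra.single (1 : G) b : SkewMonoidAlgebra A G) • x = 0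

theorem single_sub_single (g : G) (a b : A) :
    (SkewMonoidAlgebra.single g (a - b) : SkewMonoidAlgebra A G) =
      SkewMonoidAlgebra.single g a - SkewMonoidAlgebra.single g b :=
  map_sub (SkewMonoidAlgebra.singleAddHom g) a b

theorem single_mul_single' (g k : G) (a b : A) :
    (SkewMonoidAlgebra.single g a : SkewMonoidAlgebra A G) * SkewMonoidAlgebra.single k b =
      SkewMonoidAlgebra.single (g * k) (a * g • b) := SkewMonoidAlgebra.single_mul_single

variable {m} {X F : Type u} [AddCommGroup X] [Module (SkewMonoidAlgebra A G) X]
  [AddCommGroup F] [Module (SkewMonoidAlgebra A G) F]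

theorem KilledByOrbit.single_smul (hX : KilledByOrbit (G := G) m X) {b : A}
    (hb : b ∈ orbitIdeal G m) (k : G) (x : X) :
    (SkewMonoidAlgebra.single k b : SkewMonoidAlgebra A G) • x = 0 := by
  have := hX b hb ((SkewMonoidAlgebra.single k (1 : A) : SkewMonoidAlgebra A G) • x)
  rwa [smul_smul, single_mul_single', one_mul, smul_one, mul_one] at this

variable [Module ℂ X] [IsScalarTower ℂ (SkewMonoidAlgebra A G) X] [Module ℂ F]
  [IsScalarTower ℂ (SkewMonoidAlgebra A G) F]

/-- The summands of the average of a linear map. -/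
def averageTerm (h : F →ₗ[ℂ] X) (g : G) (x : F) : X :=
  (SkewMonoidAlgebra.single g (g • separating m G) : SkewMonoidAlgebra A G) •
    h ((SkewMonoidAlgebra.single g⁻¹ (separating m G) : SkewMonoidAlgebra A G) • x)

theorem separating_mul_sub_mem (b : A) :
    b * separating m G - algebraMap ℂ A (m b) * separating m G ∈ orbitIdeal G m := by
  rw [← sub_mul]
  refine mul_awayIdeal_le (Ideal.mul_mem_mul ?_ (separating_mem m G))
  rw [RingHom.mem_ker, map_sub, AlgHom.commutes]
  exact sub_self _

theorem smul_orbitIdeal {b : A} (hb : b ∈ orbitIdeal G m) (g : G) : g • b ∈ orbitIdeal G m :=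
  fun k => by rw [smul_smul]; exact hb (k * g)

theorem single_algebraMap_mul (k : G) (c : ℂ) (b : A) :
    (SkewMonoidAlgebra.single k (algebraMap ℂ A c * b) : SkewMonoidAlgebra A G) =
      c • SkewMonoidAlgebra.single k b := by
  rw [← Algebra.smul_def, SkewMonoidAlgebra.smul_single]

theorem averageTerm_single_smul (hX : KilledByOrbit (G := G) m X) {h : F →ₗ[ℂ] X}
    (hh : ∀ b ∈ orbitIdeal G m, ∀ x : F,
      h ((SkewMonoidAlgebra.single (1 : G) b : SkewMonoidAlgebra A G) • x) = 0)
    (k g : G) (b : A) (x : F) :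
    averageTerm (m := m) h (k * g) ((SkewMonoidAlgebra.single k b : SkewMonoidAlgebra A G) • x) =
      (SkewMonoidAlgebra.single k b : SkewMonoidAlgebra A G) • averageTerm (m := m) h g x := by
  set a := separating m G with ha
  set c := (k * g)⁻¹ • b with hc
  have h1 : h ((SkewMonoidAlgebra.single (k * g)⁻¹ a : SkewMonoidAlgebra A G) •
      (SkewMonoidAlgebra.single k b : SkewMonoidAlgebra A G) • x) =
      m c • h ((SkewMonoidAlgebra.single g⁻¹ a : SkewMonoidAlgebra A G) • x) := by
    have e : (k * g)⁻¹ * k = g⁻¹ := by rw [mul_inv_rev, inv_mul_cancel_right]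
    rw [smul_smul, single_mul_single', ← hc, e, mul_comm a c, ← map_smul, ← smul_assoc,
      ← single_algebraMap_mul, ← sub_eq_zero, ← map_sub, ← sub_smul,
      ← single_sub_single]
    have := hh _ (separating_mul_sub_mem (m := m) (G := G) c)
      ((SkewMonoidAlgebra.single g⁻¹ (1 : A) : SkewMonoidAlgebra A G) • x)
    rwa [smul_smul, single_mul_single', one_mul, smul_one, mul_one] at this
  have h2 : ∀ y : X, (SkewMonoidAlgebra.single k b : SkewMonoidAlgebra A G) •
      (SkewMonoidAlgebra.single g (g • a) : SkewMonoidAlgebra A G) • y =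
      m c • (SkewMonoidAlgebra.single (k * g) ((k * g) • a) : SkewMonoidAlgebra A G) • y := by
    intro y
    have e : b * k • g • a = (k * g) • (c * a) := by
      rw [smul_mul', hc, smul_inv_smul, smul_smul]
    rw [smul_smul, single_mul_single', e, ← smul_assoc, ← single_algebraMap_mul, ← sub_eq_zero,
      ← sub_smul, ← single_sub_single]
    refine hX.single_smul ?_ _ _
    have e' : algebraMap ℂ A (m c) * (k * g) • a = (k * g) • (algebraMap ℂ A (m c) * a) := by
      rw [smul_mul', smul_algebraMap]
    rw [e', ← smul_sub]
    exact smul_orbitIdeal (separating_mul_sub_mem c) _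
  change (SkewMonoidAlgebra.single (k * g) ((k * g) • a) : SkewMonoidAlgebra A G) • h _ = _
  rw [h1]
  exact (smul_comm _ _ _).trans (h2 _).symm

theorem averageTerm_add (h : F →ₗ[ℂ] X) (g : G) (x y : F) :
    averageTerm (m := m) h g (x + y) = averageTerm (m := m) h g x + averageTerm (m := m) h g y := by
  simp only [averageTerm, smul_add, map_add]

theorem sum_separating_sub_mem [Fintype G] [Fintype (isotropy G m)] :
    ∑ g : G, (g • separating m G) * (g • separating m G) -
      algebraMap ℂ A (Fintype.card (isotropy G m)) ∈ orbitIdeal G m := by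
  classical
  intro k
  have h : ∀ g : G, m (k • ((g • separating m G) * (g • separating m G))) =
      if k * g ∈ isotropy G m then 1 else 0 := by
    intro g
    rw [smul_mul', smul_smul, map_mul]
    split_ifs with hg
    · rw [hg, apply_separating, one_mul]
    · rw [separating_mem m G _ hg, zero_mul]
  rw [smul_sub, map_sub, Finset.smul_sum, map_sum, Finset.sum_congr rfl fun g _ => h g,
    smul_algebraMap, AlgHom.commutes, sub_eq_zero]
  refine (Equiv.sum_comp (Equiv.mulLeft k)
    (fun g => if g ∈ isotropy G m then (1 : ℂ) else 0)).trans ?_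
  rw [Finset.sum_boole, ← Fintype.card_subtype]
  exact congrArg Nat.cast (Fintype.card_congr (Equiv.refl _))

theorem exists_crossed_extension (hX : KilledByOrbit (G := G) m X)
    {K : Submodule (SkewMonoidAlgebra A G) F} (f : K →ₗ[SkewMonoidAlgebra A G] X) {h : F →ₗ[ℂ] X}
    (hh : ∀ b ∈ orbitIdeal G m, ∀ x : F,
      h ((SkewMonoidAlgebra.single (1 : G) b : SkewMonoidAlgebra A G) • x) = 0)
    (hf : ∀ x : K, h x = f x) :
    ∃ l : F →ₗ[SkewMonoidAlgebra A G] X, ∀ x : K, l x = f x := by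
  have := Fintype.ofFinite G
  have := Fintype.ofFinite (isotropy G m)
  have hcard : (Fintype.card (isotropy G m) : ℂ) ≠ 0 := Nat.cast_ne_zero.2 Fintype.card_ne_zero
  let s : F → X := fun x => ∑ g : G, averageTerm (m := m) h g x
  have sadd : ∀ x y, s (x + y) = s x + s y := fun x y => by
    simp only [s, averageTerm_add, Finset.sum_add_distrib]
  have ssmul : ∀ (r : SkewMonoidAlgebra A G) x, s (r • x) = r • s x := by
    intro r x
    induction r with
    | single k b =>
      change ∑ g : G, averageTerm (m := m) h g _ = _
      refine (Equiv.sum_comp (Equiv.mulLeft k) _).symm.trans ?_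
      exact (Finset.sum_congr rfl fun g _ => averageTerm_single_smul hX hh k g b x).trans
        (Finset.smul_sum).symm
    | add r r' hr hr' => rw [add_smul, sadd, hr, hr', add_smul]
  have sK : ∀ x : K, s x = (Fintype.card (isotropy G m) : ℂ) • f x := by
    intro x
    have e : ∀ g : G, averageTerm (m := m) h g (x : F) = (SkewMonoidAlgebra.single (1 : G)
        ((g • separating m G) * (g • separating m G)) : SkewMonoidAlgebra A G) • f x := by
      intro g
      have e1 := hf ((SkewMonoidAlgebra.single g⁻¹ (separating m G) : SkewMonoidAlgebra A G) • x)
      rw [map_smul] at e1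
      change (_ : SkewMonoidAlgebra A G) • h _ = _
      refine (congrArg _ e1).trans ?_
      rw [smul_smul, single_mul_single', mul_inv_cancel]
    change ∑ g : G, averageTerm (m := m) h g (x : F) = _
    rw [Finset.sum_congr rfl fun g _ => e g, ← Finset.sum_smul]
    have e2 : ∀ c : ℂ, c • f x = (SkewMonoidAlgebra.single (1 : G) (algebraMap ℂ A c) :
        SkewMonoidAlgebra A G) • f x := by
      intro c
      have := single_algebraMap_mul (G := G) 1 c (1 : A)
      rw [mul_one] at this
      rw [this, smul_assoc]
      exact congrArg _ (one_smul _ _).symm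
    rw [e2, ← sub_eq_zero, ← sub_smul]
    have e3 := hX _ (sum_separating_sub_mem (m := m) (G := G)) (f x)
    rw [single_sub_single] at e3
    rw [← e3]
    congr 2
    exact (map_sum (SkewMonoidAlgebra.singleAddHom (1 : G)) _ _).symm
  let l : F →ₗ[SkewMonoidAlgebra A G] X :=
    { toFun := s, map_add' := sadd, map_smul' := ssmul }
  refine ⟨(Fintype.card (isotropy G m) : ℂ)⁻¹ • l, fun x => ?_⟩
  change (Fintype.card (isotropy G m) : ℂ)⁻¹ • s x = f x
  rw [sK, smul_smul, inv_mul_cancel₀ hcard, one_smul]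

end Extension

/-! ### Modules which are flat over the coefficients -/

theorem flat_finsupp (A : Type*) [CommRing A] (M : Type*) [AddCommGroup M] [Module A M]
    [Module.Flat A M] (ι : Type*) : Module.Flat A (ι →₀ M) := by
  classical
  exact Module.Flat.of_linearEquiv (finsuppLequivDFinsupp A)

section FlatAlong

variable {A : Type u} [CommRing A] {R : Type u} [Ring R] (φ : A →+* R)

/-- Flatness of an `R`-module over a commutative ring which maps to `R`. -/
def FlatAlong (Q : Type u) [AddCommGroup Q] [Module R Q] : Prop :=
  @Module.Flat A Q _ _ (Module.compHom Q φ)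

variable {φ}

theorem FlatAlong.finsupp (h : FlatAlong φ R) (ι : Type u) : FlatAlong φ (ι →₀ R) := by
  let _ : Module A R := Module.compHom R φ
  have : Module.Flat A R := h
  exact flat_finsupp A R ι

theorem FlatAlong.of_dualBasis (h : FlatAlong φ R) {Q : Type u} [AddCommGroup Q] [Module R Q]
    {n : ℕ} (r : Fin n → Q →ₗ[R] R) (p : Fin n → Q) (hrp : ∀ x, ∑ i, r i x • p i = x) :
    FlatAlong φ Q := by
  let _ : Module A R := Module.compHom R φ
  let _ : Module A Q := Module.compHom Q φ
  have : Module.Flat A R := h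
  let i : Q →ₗ[A] (Fin n → R) :=
    { toFun := fun x k => r k x
      map_add' := fun x y => funext fun k => map_add (r k) x y
      map_smul' := fun a x => funext fun k => (r k).map_smul (φ a) x }
  let q : (Fin n → R) →ₗ[A] Q :=
    { toFun := fun y => ∑ k, y k • p k
      map_add' := fun x y => by simp only [Pi.add_apply, add_smul, Finset.sum_add_distrib]
      map_smul' := fun a y =>
        (Finset.sum_congr rfl fun k _ => mul_smul (φ a) (y k) (p k)).trans Finset.smul_sum.symm }
  have := flat_finsupp A R (Fin n)
  have : Module.Flat A (Fin n → R) :=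
    Module.Flat.of_linearEquiv (Finsupp.linearEquivFunOnFinite A R (Fin n)).symm
  exact Module.Flat.of_retract i q (LinearMap.ext hrp)

theorem FlatAlong.ker {F Q : Type u} [AddCommGroup F] [Module R F] [AddCommGroup Q] [Module R Q]
    {π : F →ₗ[R] Q} (hπ : Function.Surjective π) (hF : FlatAlong φ F) (hQ : FlatAlong φ Q) :
    FlatAlong φ (LinearMap.ker π) := by
  let _ : Module A F := Module.compHom F φ
  let _ : Module A Q := Module.compHom Q φ
  have : Module.Flat A F := hF
  have : Module.Flat A Q := hQ
  let π' : F →ₗ[A] Q := { π with map_smul' := fun a x => π.map_smul (φ a) x }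
  exact flat_ker (π := π') hπ

theorem flatAlong_crossed {G : Type u} [Group G] {B : Type u} [CommRing B]
    [MulSemiringAction G B] (θ : A →+* B) (hθ : θ.Flat) {φ : A →+* SkewMonoidAlgebra B G}
    (hφ : ∀ a, φ a = SkewMonoidAlgebra.single 1 (θ a)) : FlatAlong φ (SkewMonoidAlgebra B G) := by
  let _ : Module A B := Module.compHom B θ
  let _ : Module A (SkewMonoidAlgebra B G) := Module.compHom _ φ
  have : Module.Flat A B := hθ
  let e : SkewMonoidAlgebra B G ≃ₗ[A] G →₀ B :=
    { SkewMonoidAlgebra.coeffAddEquiv with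
      map_smul' := fun a r => by
        change (φ a * r).coeff = a • r.coeff
        rw [hφ]
        induction r with
        | single g b =>
          rw [SkewMonoidAlgebra.single_mul_single, one_mul, one_smul,
            SkewMonoidAlgebra.coeff_single, SkewMonoidAlgebra.coeff_single, Finsupp.smul_single]
          rfl
        | add r s hr hs =>
          rw [mul_add, SkewMonoidAlgebra.coeff_add, hr, hs, SkewMonoidAlgebra.coeff_add, smul_add] }
  have := flat_finsupp A B G
  exact Module.Flat.of_linearEquiv e

end FlatAlong

section Vanishing

variable {G : Type u} [Group G] [Finite G] {A : Type u} [CommRing A] [Algebra ℂ A]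
  [MulSemiringAction G A] [SMulCommClass G ℂ A] {m : A →ₐ[ℂ] ℂ}

theorem exists_extension_of_flat {F Q X : Type u} [AddCommGroup F] [Module A F] [Module ℂ F]
    [IsScalarTower ℂ A F] [Module (SkewMonoidAlgebra A G) F]
    [IsScalarTower ℂ (SkewMonoidAlgebra A G) F] [AddCommGroup Q] [Module A Q]
    [Module (SkewMonoidAlgebra A G) Q] [AddCommGroup X] [Module ℂ X]
    [Module (SkewMonoidAlgebra A G) X] [IsScalarTower ℂ (SkewMonoidAlgebra A G) X]
    (hF : ∀ (a : A) (x : F), a • x = coeffInclusion G A a • x)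
    (hQ : ∀ (a : A) (x : Q), a • x = coeffInclusion G A a • x) [Module.Flat A Q]
    {π : F →ₗ[SkewMonoidAlgebra A G] Q} (hπ : Function.Surjective π)
    (hX : KilledByOrbit (G := G) m X) (f : LinearMap.ker π →ₗ[SkewMonoidAlgebra A G] X) :
    ∃ l : F →ₗ[SkewMonoidAlgebra A G] X, ∀ x : LinearMap.ker π, l x = f x := by
  obtain ⟨π', h'⟩ : ∃ π' : F →ₗ[A] Q, ∀ x, π' x = π x :=
    ⟨{ π with map_smul' := fun a x =>
        (congrArg π (hF a x)).trans ((π.map_smul _ x).trans (hQ a (π x)).symm) }, fun _ => rfl⟩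
  have hπ' : Function.Surjective π' := fun y => by
    obtain ⟨x, rfl⟩ := hπ y
    exact ⟨x, h' x⟩
  have hmem : ∀ x, x ∈ LinearMap.ker π' ↔ x ∈ LinearMap.ker π := fun x => by
    rw [LinearMap.mem_ker, LinearMap.mem_ker, h']
  obtain ⟨JF, hJF⟩ : ∃ JF : Submodule ℂ F, ∀ x, x ∈ JF ↔ x ∈ orbitIdeal G m • (⊤ : Submodule A F) :=
    ⟨(orbitIdeal G m • (⊤ : Submodule A F)).restrictScalars ℂ, fun _ => Iff.rfl⟩
  have hi : LinearMap.ker (JF.mkQ ∘ₗ ((LinearMap.ker π).subtype.restrictScalars ℂ)) ≤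
      LinearMap.ker (f.restrictScalars ℂ) := by
    intro x hx
    have h1 : (x : F) ∈ JF := (Submodule.Quotient.mk_eq_zero JF).1 hx
    have h2 : (x : F) ∈ orbitIdeal G m • LinearMap.ker π' :=
      ker_inf_smul_top_le hπ' (orbitIdeal G m) ⟨(hmem _).2 x.2, (hJF _).1 h1⟩
    have h3 : ∃ hx' : (x : F) ∈ LinearMap.ker π, f ⟨x, hx'⟩ = 0 := by
      refine Submodule.smul_induction_on h2 (fun b hb y hy => ?_) fun y z hy hz => ?_
      · have hy' : y ∈ LinearMap.ker π := (hmem y).1 hy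
        have e : b • y = ((coeffInclusion G A b • ⟨y, hy'⟩ : LinearMap.ker π) : F) := hF b y
        rw [e]
        exact ⟨Subtype.property _, (f.map_smul (coeffInclusion G A b) ⟨y, hy'⟩).trans (hX b hb _)⟩
      · obtain ⟨hy, hy'⟩ := hy
        obtain ⟨hz, hz'⟩ := hz
        refine ⟨add_mem hy hz, (map_add f ⟨y, hy⟩ ⟨z, hz⟩).trans ?_⟩
        rw [hy', hz', add_zero]
    exact h3.2
  obtain ⟨l, hl⟩ := exists_extension_of_ker_le _ (f.restrictScalars ℂ) hi
  refine exists_crossed_extension hX f (h := l ∘ₗ JF.mkQ) (fun b hb x => ?_)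
    (LinearMap.congr_fun hl)
  have h : coeffInclusion G A b • x ∈ JF := by
    rw [hJF, ← hF]
    exact Submodule.smul_mem_smul hb Submodule.mem_top
  exact (congrArg l ((Submodule.Quotient.mk_eq_zero JF).2 h)).trans (map_zero l)

theorem exists_extension_of_flatAlong {F Q X : Type u} [AddCommGroup F]
    [Module (SkewMonoidAlgebra A G) F] [AddCommGroup Q] [Module (SkewMonoidAlgebra A G) Q]
    [AddCommGroup X] [Module (SkewMonoidAlgebra A G) X] {π : F →ₗ[SkewMonoidAlgebra A G] Q}
    (hπ : Function.Surjective π) (hQ : FlatAlong (coeffInclusion G A).toRingHom Q)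
    (hX : KilledByOrbit (G := G) m X) (f : LinearMap.ker π →ₗ[SkewMonoidAlgebra A G] X) :
    ∃ l : F →ₗ[SkewMonoidAlgebra A G] X, ∀ x : LinearMap.ker π, l x = f x := by
  let _ : Module ℂ F := Module.compHom F (algebraMap ℂ (SkewMonoidAlgebra A G))
  let _ : Module ℂ X := Module.compHom X (algebraMap ℂ (SkewMonoidAlgebra A G))
  have : IsScalarTower ℂ (SkewMonoidAlgebra A G) F := ⟨fun c r x => by
    rw [Algebra.smul_def, mul_smul]; rfl⟩
  have : IsScalarTower ℂ (SkewMonoidAlgebra A G) X := ⟨fun c r x => by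
    rw [Algebra.smul_def, mul_smul]; rfl⟩
  let _ : Module A F := Module.compHom F (coeffInclusion G A).toRingHom
  let _ : Module A Q := Module.compHom Q (coeffInclusion G A).toRingHom
  have : IsScalarTower ℂ A F := ⟨fun c a x => by
    change coeffInclusion G A (c • a) • x = c • coeffInclusion G A a • x
    rw [map_smul, smul_assoc]⟩
  have : Module.Flat A Q := hQ
  exact exists_extension_of_flat (fun _ _ => rfl) (fun _ _ => rfl) hπ hX f

theorem exists_free_cover {X : ModuleCat.{u} (SkewMonoidAlgebra A G)}
    (hX : KilledByOrbit (G := G) m X) (Q : ModuleCat.{u} (SkewMonoidAlgebra A G))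
    (hQ : FlatAlong (coeffInclusion G A).toRingHom Q) :
    ∃ (K F : ModuleCat.{u} (SkewMonoidAlgebra A G)) (i : K ⟶ F) (p : F ⟶ Q) (w : i ≫ p = 0),
      (ShortComplex.mk i p w).ShortExact ∧ Projective F ∧
      FlatAlong (coeffInclusion G A).toRingHom K ∧ ∀ f : K ⟶ X, ∃ l : F ⟶ X, i ≫ l = f := by
  have hS : FlatAlong (coeffInclusion G A).toRingHom (SkewMonoidAlgebra A G) :=
    flatAlong_crossed (RingHom.id A) (RingHom.Flat.id A) fun _ => rfl
  obtain ⟨π, hπ⟩ : ∃ π : (Q →₀ SkewMonoidAlgebra A G) →ₗ[SkewMonoidAlgebra A G] Q,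
      Function.Surjective π := ⟨_, Finsupp.linearCombination_id_surjective _ _⟩
  refine ⟨ModuleCat.of _ (LinearMap.ker π), ModuleCat.of _ (Q →₀ SkewMonoidAlgebra A G),
    ModuleCat.ofHom (LinearMap.ker π).subtype, ModuleCat.ofHom π,
    ModuleCat.hom_ext (LinearMap.comp_ker_subtype π),
    ModuleCat.shortComplex_shortExact _ (LinearMap.exact_subtype_ker_map π)
      Subtype.val_injective hπ,
    ModuleCat.projective_of_free Finsupp.basisSingleOne,
    FlatAlong.ker hπ (hS.finsupp Q) hQ, fun f => ?_⟩
  obtain ⟨l, hl⟩ := exists_extension_of_flatAlong hπ hQ hX f.hom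
  exact ⟨ModuleCat.ofHom l, ModuleCat.hom_ext (LinearMap.ext hl)⟩

theorem ext_eq_zero_of_flatAlong {X : ModuleCat.{u} (SkewMonoidAlgebra A G)}
    (hX : KilledByOrbit (G := G) m X) (n : ℕ) (Q : ModuleCat.{u} (SkewMonoidAlgebra A G))
    (hQ : FlatAlong (coeffInclusion G A).toRingHom Q) (e : Abelian.Ext Q X (n + 1)) : e = 0 := by
  induction n generalizing Q with
  | zero =>
    obtain ⟨K, F, i, p, w, hT, hP, -, hext⟩ := exists_free_cover hX Q hQ
    obtain ⟨x, rfl⟩ := Abelian.Ext.contravariant_sequence_exact₃ hT X e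
      (Abelian.Ext.eq_zero_of_projective _) (n₀ := 0) rfl
    obtain ⟨f, rfl⟩ := (Abelian.Ext.mk₀_bijective _ _).2 x
    obtain ⟨l, rfl⟩ := hext f
    rw [← Abelian.Ext.mk₀_comp_mk₀]
    exact hT.extClass_comp_assoc (Abelian.Ext.mk₀ l)
  | succ n ih =>
    obtain ⟨K, F, i, p, w, hT, hP, hK, -⟩ := exists_free_cover hX Q hQ
    obtain ⟨x, rfl⟩ := Abelian.Ext.contravariant_sequence_exact₃ hT X e
      (Abelian.Ext.eq_zero_of_projective _) (n₀ := n + 1) (by omega)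
    rw [ih K hK x, Abelian.Ext.comp_zero]

end Vanishing

/-! ### The crossed product and its completion -/

section Completion

open OrbitCompletion CrossedMod FrechetMod

variable {G : Type u} [Group G] [Finite G] {A : Type u} [CommRing A] [Algebra ℂ A]
  [MulSemiringAction G A] [SMulCommClass G ℂ A] (m : A →ₐ[ℂ] ℂ)

variable (G) in
/-- The map from the crossed product to its completion. -/
def crossedCompletion : SkewMonoidAlgebra A G →ₐ[ℂ] SkewMonoidAlgebra (OrbitCompletion G m) G :=
  SkewMonoidAlgebra.liftNCAlgHom ((coeffInclusion G (OrbitCompletion G m)).comp (of G m))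
    (SkewMonoidAlgebra.of (OrbitCompletion G m) G) (by
      intro a g
      change SkewMonoidAlgebra.single 1 (of G m (g • a)) * SkewMonoidAlgebra.single g 1 =
        SkewMonoidAlgebra.single g 1 * SkewMonoidAlgebra.single 1 (of G m a)
      rw [single_mul_single', single_mul_single', one_mul, mul_one, one_mul, one_smul, mul_one,
        smul_of])

theorem crossedCompletion_single (g : G) (a : A) :
    crossedCompletion G m (SkewMonoidAlgebra.single g a) = SkewMonoidAlgebra.single g (of G m a) := by
  have h : crossedCompletion G m (SkewMonoidAlgebra.single g a) =
      SkewMonoidAlgebra.single 1 (of G m a) * SkewMonoidAlgebra.single g 1 :=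
    SkewMonoidAlgebra.liftNC_single _ _ _ _
  rw [h, single_mul_single', one_mul, one_smul, mul_one]

variable [IsNoetherianRing A]

theorem exists_sub_of_mem (b : OrbitCompletion G m) : ∃ a : A,
    b - of G m a ∈ (orbitIdeal G m).map (of G m : A →+* OrbitCompletion G m) := by
  obtain ⟨a, ha⟩ := Ideal.Quotient.mk_surjective (AdicCompletion.evalOneₐ (orbitIdeal G m) b)
  refine ⟨a, ?_⟩
  have h1 : b - of G m a ∈ RingHom.ker (AdicCompletion.evalOneₐ (orbitIdeal G m)).toRingHom := by
    refine (map_sub (AdicCompletion.evalOneₐ (orbitIdeal G m)) b (of G m a)).trans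
      (sub_eq_zero.2 (ha.symm.trans ?_))
    exact ((AdicCompletion.evalOneₐ (orbitIdeal G m)).commutes a).symm
  exact (AdicCompletion.ker_evalOneₐ_eq_map (orbitIdeal G m) (IsNoetherian.noetherian _)).le h1

theorem map_smul_of_map_single_of_smul {P Y : Type u} [AddCommGroup P]
    [Module (SkewMonoidAlgebra (OrbitCompletion G m) G) P] [AddCommGroup Y]
    [Module (SkewMonoidAlgebra (OrbitCompletion G m) G) Y]
    (hY : ∀ {a : A}, a ∈ orbitIdeal G m → ∀ y : Y,
      (SkewMonoidAlgebra.single 1 (of G m a) : SkewMonoidAlgebra (OrbitCompletion G m) G) • y = 0)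
    (f : P →+ Y) (hf : ∀ (g : G) (a : A) (y : P),
      f ((SkewMonoidAlgebra.single g (of G m a) : SkewMonoidAlgebra (OrbitCompletion G m) G) • y) =
      (SkewMonoidAlgebra.single g (of G m a) : SkewMonoidAlgebra (OrbitCompletion G m) G) • f y)
    (r : SkewMonoidAlgebra (OrbitCompletion G m) G) (x : P) : f (r • x) = r • f x := by
  have hJ : ∀ z ∈ (orbitIdeal G m).map (of G m : A →+* OrbitCompletion G m),
      (∀ y, f ((SkewMonoidAlgebra.single 1 z : SkewMonoidAlgebra (OrbitCompletion G m) G) • y) =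
        0) ∧ ∀ y : Y,
        (SkewMonoidAlgebra.single 1 z : SkewMonoidAlgebra (OrbitCompletion G m) G) • y = 0 := by
    intro z hz
    induction hz using Submodule.span_induction with
    | mem z hz =>
      obtain ⟨a, ha, rfl⟩ := hz
      exact ⟨fun y => (hf 1 a y).trans (hY ha _), hY ha⟩
    | zero =>
      rw [SkewMonoidAlgebra.single_zero]
      exact ⟨fun y => by rw [zero_smul, map_zero], fun y => zero_smul _ y⟩
    | add z w _ _ hz hw =>
      rw [SkewMonoidAlgebra.single_add]
      exact ⟨fun y => by rw [add_smul, map_add, hz.1, hw.1, add_zero],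
        fun y => by rw [add_smul, hz.2, hw.2, add_zero]⟩
    | smul c z _ hz =>
      have e : (SkewMonoidAlgebra.single 1 (c • z) : SkewMonoidAlgebra (OrbitCompletion G m) G) =
          SkewMonoidAlgebra.single 1 z * SkewMonoidAlgebra.single 1 c := by
        rw [single_mul_single', one_mul, one_smul, smul_eq_mul, mul_comm]
      exact ⟨fun y => by rw [e, mul_smul, hz.1], fun y => by rw [e, mul_smul, hz.2]⟩
  induction r with
  | single g b =>
    obtain ⟨a, ha⟩ := exists_sub_of_mem m b
    have e : (SkewMonoidAlgebra.single g b : SkewMonoidAlgebra (OrbitCompletion G m) G) =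
        SkewMonoidAlgebra.single g (of G m a) +
          SkewMonoidAlgebra.single 1 (b - of G m a) * SkewMonoidAlgebra.single g 1 := by
      rw [single_mul_single', one_mul, one_smul, mul_one, ← SkewMonoidAlgebra.single_add,
        add_sub_cancel]
    rw [e, add_smul, add_smul, map_add, hf, mul_smul, mul_smul, (hJ _ ha).1, (hJ _ ha).2]
  | add r s hr hs => rw [add_smul, map_add, hr, hs, add_smul]

theorem flatAlong_completion : FlatAlong ((crossedCompletion G m).toRingHom.comp
    (coeffInclusion G A).toRingHom) (SkewMonoidAlgebra (OrbitCompletion G m) G) :=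
  flatAlong_crossed (of G m : A →+* OrbitCompletion G m)
    (AdicCompletion.flat_of_isNoetherian (R := A) (orbitIdeal G m))
    fun a => crossedCompletion_single m 1 a

variable {m}

theorem single_of_smul (M : IndModel G m) {a : A} (ha : a ∈ orbitIdeal G m) (x : M.X.carrier) :
    (SkewMonoidAlgebra.single 1 (of G m a) : SkewMonoidAlgebra (OrbitCompletion G m) G) • x = 0 := by
  refine M.e.injective ?_
  rw [map_smul, map_zero]
  refine Coind.ext fun y => (Coind.single_smul (N := pointMod G m M.V) _ _ _ _).trans ?_
  have h : m (y⁻¹ • a) = 0 := ha y⁻¹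
  have h' : evalPoint G m (y⁻¹ • of G m a) = 0 := by rw [smul_of, evalPoint_of, h]
  exact (charMod_act _ _ _ _ _).trans ((congrArg (· • _) h').trans (zero_smul ℂ _))

theorem killedByOrbit (M : IndModel G m) :
    KilledByOrbit (G := G) m ((moduleFunctor (crossedCompletion G m)).obj M.X) := by
  intro a ha x
  change crossedCompletion G m (SkewMonoidAlgebra.single 1 a) • (show M.X.carrier from x) = 0
  rw [crossedCompletion_single]
  exact single_of_smul M ha x

variable [hreg : IsRegularLocalRing (Localization.AtPrime (RingHom.ker m))]

theorem linearOver_crossedCompletion : IndModel.LinearOver (crossedCompletion G m) :=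
  fun M M' k f => map_smul_of_map_single_of_smul m
    (P := (((IndModel.system G m).R M).P k).carrier) (Y := M'.X.carrier) (single_of_smul M')
    (AddMonoidHom.mk' (moduleFun (crossedCompletion G m) f) (moduleFun_add _ f))
    (fun g a y => (congrArg (fun r => moduleFun (crossedCompletion G m) f (r • y))
      (crossedCompletion_single m g a).symm).trans ((moduleFun_smul _ f _ y).trans
        (congrArg (· • moduleFun (crossedCompletion G m) f y) (crossedCompletion_single m g a))))

theorem ext_term_eq_zero (M M' : IndModel G m) (k n : ℕ)
    (e : Abelian.Ext.{u} ((moduleFunctor (crossedCompletion G m)).obj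
      (((IndModel.system G m).R M).P k)) ((moduleFunctor (crossedCompletion G m)).obj M'.X)
      (n + 1)) : e = 0 := by
  refine ext_eq_zero_of_flatAlong (m := m) (killedByOrbit M') n _ ?_ e
  obtain ⟨l, r, p, -, h⟩ := IndModel.hasDualBasis M k
  exact (flatAlong_completion m).of_dualBasis r p h

theorem ext_term_eq_zero_id (M M' : IndModel G m) (k n : ℕ)
    (e : Abelian.Ext.{u} ((moduleFunctor (AlgHom.id ℂ _)).obj (((IndModel.system G m).R M).P k))
      ((moduleFunctor (AlgHom.id ℂ _)).obj M'.X) (n + 1)) : e = 0 :=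
  have := HasDualBasis.projective (IndModel.hasDualBasis M k)
  Abelian.Ext.eq_zero_of_projective e

end Completion

/-! ### The four categories of modules -/

section Comparison

open OrbitCompletion CrossedMod FrechetMod IndModel

variable {G : Type u} [Group G] [Finite G] {A : Type u} [CommRing A] [Algebra ℂ A]
  [MulSemiringAction G A] [SMulCommClass G ℂ A] {m : A →ₐ[ℂ] ℂ}

theorem coe_isotropy_smul (h : isotropy G m) (b : A) : m (h • b) = m b := h.2 b

/-- Coinduced modules over the crossed product and over its completion. -/
def coindCompletion (V : FinDimRep (isotropy G m)) :
    Coind (charMod m (coe_isotropy_smul (G := G)) V) ≃+ Coind (pointMod G m V) where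
  toFun φ := ⟨φ.1, φ.2⟩
  invFun φ := ⟨φ.1, φ.2⟩
  left_inv _ := rfl
  right_inv _ := rfl
  map_add' _ _ := rfl

theorem coindCompletion_smul (V : FinDimRep (isotropy G m)) (r : SkewMonoidAlgebra A G)
    (φ : Coind (charMod m (coe_isotropy_smul (G := G)) V)) :
    coindCompletion V (r • φ) = crossedCompletion G m r • coindCompletion V φ := by
  induction r with
  | single g a =>
    rw [crossedCompletion_single]
    refine Coind.ext fun y => (Coind.single_smul (N := charMod m _ V) g a φ y).trans
      (Eq.trans ?_ (Coind.single_smul (N := pointMod G m V) g (of G m a) _ y).symm)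
    have h : evalPoint G m (y⁻¹ • of G m a) = m (y⁻¹ • a) := by rw [smul_of, evalPoint_of]
    exact (congrArg (· • (φ (g⁻¹ * y) : V.carrier)) h).symm
  | add r s hr hs => rw [add_smul, map_add, hr, hs, map_add, add_smul]

/-- An induced module over the crossed product as the restriction of a Fréchet module. -/
def restrictIso (M : IndModel G m) {X : Type u} [AddCommGroup X] [Module (SkewMonoidAlgebra A G) X]
    (e : X ≃ₗ[SkewMonoidAlgebra A G] Coind (charMod m (coe_isotropy_smul (G := G)) M.V)) :
    ModuleCat.of (SkewMonoidAlgebra A G) X ≅ (moduleFunctor (crossedCompletion G m)).obj M.X :=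
  let f : X ≃+ M.X.carrier :=
    (e.toAddEquiv.trans (coindCompletion M.V)).trans M.e.symm.toAddEquiv
  let l : X ≃ₗ[SkewMonoidAlgebra A G] (moduleFunctor (crossedCompletion G m)).obj M.X :=
    { f with
      map_smul' := fun r x => (congrArg (fun z => M.e.symm (coindCompletion M.V z))
        (e.map_smul r x)).trans ((congrArg M.e.symm (coindCompletion_smul M.V r (e x))).trans
          (M.e.symm.map_smul (crossedCompletion G m r) (coindCompletion M.V (e x)))) }
  LinearEquiv.toModuleIso l

/-- A Fréchet module as an abstract module. -/
def forgetIso {R : Type u} [Ring R] [Algebra ℂ R] [TopologicalSpace R] (X : FrechetMod R) :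
    ModuleCat.of R X.carrier ≅ (moduleFunctor (AlgHom.id ℂ R)).obj X :=
  let l : X.carrier ≃ₗ[R] (moduleFunctor (AlgHom.id ℂ R)).obj X :=
    { AddEquiv.refl X.carrier with map_smul' := fun _ _ => rfl }
  LinearEquiv.toModuleIso l

/-- Isomorphic induced modules are isomorphic as Fréchet modules. -/
def isoOf (M M' : IndModel G m)
    (e : M.X.carrier ≃ₗ[SkewMonoidAlgebra (OrbitCompletion G m) G] M'.X.carrier) : M.X ≅ M'.X where
  hom := M.homOf e.toLinearMap
  inv := M'.homOf e.symm.toLinearMap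
  hom_inv_id := FrechetMod.hom_ext e.symm_apply_apply
  inv_hom_id := FrechetMod.hom_ext e.apply_symm_apply

variable [IsNoetherianRing A] [hreg : IsRegularLocalRing (Localization.AtPrime (RingHom.ker m))]

theorem hasGradedMul_system : HasGradedMul (system G m) :=
  ⟨system_φ_one, fun _ _ _ _ _ _ h α β => system_mul h α β⟩

theorem hasGradedMul_bornSystem : HasGradedMul (bornSystem G m) :=
  ⟨fun M => (congrArg bornFunctor.map (system_φ_one M)).trans (bornFunctor.map_id M.X),
    fun _ _ _ _ _ _ h α β => bornSystem_mul h α β⟩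

theorem hasGradedMul_moduleSystem {S : Type u} [Ring S] [Algebra ℂ S]
    (j : S →ₐ[ℂ] SkewMonoidAlgebra (OrbitCompletion G m) G) (hj : LinearOver j) :
    HasGradedMul (moduleSystem j hj) :=
  ⟨fun M => (congrArg (moduleFunctor j).map (system_φ_one M)).trans ((moduleFunctor j).map_id M.X),
    fun _ _ _ _ _ _ h α β => moduleSystem_mul j hj h α β⟩

theorem exists_born_sum (M : IndModel G m) : ∃ M' : IndModel G m,
    ∃ b : Limits.BinaryBicone (bornFunctor.obj M.X) (bornFunctor.obj M.X),
      ∃ (_ : b.IsBilimit), b.pt = bornFunctor.obj M'.X := by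
  let b : Limits.BinaryBicone (bornFunctor.obj M.X) (bornFunctor.obj M.X) :=
    { pt := bornFunctor.obj M.sum.X
      fst := bornFunctor.map M.sumBicone.fst
      snd := bornFunctor.map M.sumBicone.snd
      inl := bornFunctor.map M.sumBicone.inl
      inr := bornFunctor.map M.sumBicone.inr
      inl_fst := rfl
      inl_snd := rfl
      inr_fst := rfl
      inr_snd := rfl }
  exact ⟨M.sum, b, Limits.isBinaryBilimitOfTotal b (congrArg bornFunctor.map M.sumBicone_total),
    rfl⟩

variable (G m)

theorem frechet_regular_iso :
    Nonempty ((ofRep G m (regularRep (isotropy G m))).X ≅ (ofPoint G m).X) :=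
  (exists_indRegular_equiv (evalPoint G m) (evalPoint_smul G m)).map fun e =>
    isoOf (ofRep G m (regularRep (isotropy G m))) (ofPoint G m) e

theorem frechet_extAssertion :
    ExactExtAssertion (G := G) m (FrechetMod (SkewMonoidAlgebra (OrbitCompletion G m) G))
      (indFrechet m) (indCharFrechet G m) :=
  exactExtAssertion (system G m) system_isProjective hasGradedMul_system exists_sum
    (frechet_regular_iso G m)

theorem born_extAssertion :
    ExactExtAssertion (G := G) m (BornMod (SkewMonoidAlgebra (OrbitCompletion G m) G))
      (fun V => (indFrechet m V).toBorn) (indCharFrechet G m).toBorn :=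
  exactExtAssertion (bornSystem G m) bornSystem_isProjective hasGradedMul_bornSystem exists_born_sum
    ((frechet_regular_iso G m).map bornFunctor.mapIso)

theorem formal_extAssertion :
    ModuleExtAssertion (G := G) m (SkewMonoidAlgebra (OrbitCompletion G m) G)
      (fun V => ModuleCat.of _ (IndFormal m V)) (ModuleCat.of _ (IndCharFormal G m)) := by
  have e : ∀ V, ModuleCat.of (SkewMonoidAlgebra (OrbitCompletion G m) G) (IndFormal m V) ≅
      (moduleFunctor (AlgHom.id ℂ (SkewMonoidAlgebra (OrbitCompletion G m) G))).obj (indFrechet m V) := fun V => forgetIso (indFrechet m V)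
  have ePt : ModuleCat.of (SkewMonoidAlgebra (OrbitCompletion G m) G) (IndCharFormal G m) ≅
      (moduleFunctor (AlgHom.id ℂ (SkewMonoidAlgebra (OrbitCompletion G m) G))).obj (indCharFrechet G m) := forgetIso (indCharFrechet G m)
  have hiso : Nonempty (ModuleCat.of (SkewMonoidAlgebra (OrbitCompletion G m) G)
      (IndFormal m (regularRep (isotropy G m))) ≅ ModuleCat.of _ (IndCharFormal G m)) :=
    (exists_indRegular_equiv (evalPoint G m) (evalPoint_smul G m)).map LinearEquiv.toModuleIso
  have hD := moduleSystem_isExact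
    (AlgHom.id ℂ (SkewMonoidAlgebra (OrbitCompletion G m) G)) (linearOver_id G m)
  have hmul := hasGradedMul_moduleSystem
    (AlgHom.id ℂ (SkewMonoidAlgebra (OrbitCompletion G m) G)) (linearOver_id G m)
  exact moduleExtAssertion (moduleSystem (AlgHom.id ℂ (SkewMonoidAlgebra (OrbitCompletion G m) G)) (linearOver_id G m))
    hD ext_term_eq_zero_id hmul
    (fun V => ModuleCat.of _ (IndFormal m V)) (ModuleCat.of _ (IndCharFormal G m))
    e ePt hiso

theorem crossed_extAssertion :
    ModuleExtAssertion (G := G) m (SkewMonoidAlgebra A G)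
      (fun V => ModuleCat.of _ (IndAlg G m V)) (ModuleCat.of _ (IndChar G m)) :=
  moduleExtAssertion (moduleSystem (crossedCompletion G m) linearOver_crossedCompletion)
    (moduleSystem_isExact _ _) ext_term_eq_zero (hasGradedMul_moduleSystem _ _)
    (fun V => ModuleCat.of _ (IndAlg G m V)) (ModuleCat.of _ (IndChar G m))
    (fun V => restrictIso (ofRep G m V)
      (exists_indRep_equiv m (coe_isotropy_smul (G := G)) V).choose)
    (restrictIso (ofPoint G m)
      ((exists_indRegular_equiv m (coe_isotropy_smul (G := G))).some.symm.trans
        (exists_indRep_equiv m (coe_isotropy_smul (G := G)) (regularRep (isotropy G m))).choose))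
    ((exists_indRegular_equiv m (coe_isotropy_smul (G := G))).map LinearEquiv.toModuleIso)

end Comparison

end YonedaCrossed

end

open YonedaCrossed

theorem theorem3p3 {G A : Type u} [Group G] [Finite G] [CommRing A] [Algebra ℂ A]
    [Algebra.FiniteType ℂ A]
    [MulSemiringAction G A] [SMulCommClass G ℂ A]
    (nonsingular : ∀ (P : Ideal A) [P.IsMaximal], IsRegularLocalRing (Localization.AtPrime P))
    (m : A →ₐ[ℂ] ℂ) :
    (∀ (V V' : FinDimRep (isotropy G m)) (n : ℕ),
      Nonempty (cotangentHom m V V' n ≃ₗ[ℂ] tangentHom m V V' n)) ∧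
    ModuleExtAssertion (G := G) m (SkewMonoidAlgebra A G)
      (fun V => ModuleCat.of _ (IndAlg G m V)) (ModuleCat.of _ (IndChar G m)) ∧
    ModuleExtAssertion (G := G) m (SkewMonoidAlgebra (OrbitCompletion G m) G)
      (fun V => ModuleCat.of _ (IndFormal m V)) (ModuleCat.of _ (IndCharFormal G m)) ∧
    ExactExtAssertion (G := G) m (FrechetMod (SkewMonoidAlgebra (OrbitCompletion G m) G))
      (indFrechet m) (indCharFrechet G m) ∧
    ExactExtAssertion (G := G) m (BornMod (SkewMonoidAlgebra (OrbitCompletion G m) G))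
      (fun V => (indFrechet m V).toBorn) (indCharFrechet G m).toBorn := by
  have : IsNoetherianRing A := Algebra.FiniteType.isNoetherianRing ℂ A
  have : IsRegularLocalRing (Localization.AtPrime (RingHom.ker m)) := nonsingular (RingHom.ker m)
  exact ⟨fun V V' n => ⟨(tangentCotangent m V V' n).symm⟩, crossed_extAssertion G m,
    formal_extAssertion G m, frechet_extAssertion G m, born_extAssertion G m⟩
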